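/- Let $G$ be a locally compact (Hausdorff) group and $K<G$ a compact open subgroup; for $g\in G$ let $\chi_{gK}\in L^\infty(G/K)=\ell^\infty(G/K)$ be the indicator function of the point $gK$. Let $\mathcal C_f(K<G)$ be the following category. Its objects are the finite-rank $L^\infty(G/K)$-$G$-$L^\infty(G/K)$-modules: Hilbert spaces $\mathcal H$ with a strongly continuous unitary representation $\pi_{\mathcal H}$ of $G$ and commuting normal unital left and right $*$-actions of $L^\infty(G/K)$ such that $\pi_{\mathcal H}(g)(f_1\cdot\xi\cdot f_2)=(gf_1)\cdot\pi_{\mathcal H}(g)\xi\cdot(gf_2)$, where $G$ acts on $L^\infty(G/K)$ by left translation, and such that $\chi_K\cdot\mathcal H$ is finite-dimensional. Its morphisms are the bounded operators that intertwine all these structures. It is a monoidal category with the tensor product $$\mathcal H\otimes_{L^\infty(G/K)}\mathcal K=\{\xi\in\mathcal H\otimes\mathcal K\mid \xi(\chi_{gK}\otimes1)=(1\otimes\chi_{gK})\xi\ \text{ for all } gK\in G/K\},$$ carrying the representation $\pi_{\mathcal H}\otimes\pi_{\mathcal K}$, the left action of $\mathcal H$ and the right action of $\mathcal K$, with unit object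 $L^2(G/K)$ and the natural associativity and unit isomorphisms. Let $\mathbf F$ be the functor from $\mathcal C_f(K<G)$ to the category $\mathrm{Hilb}_f$ of finite-dimensional Hilbert spaces that sends $\mathcal H$ to $\chi_K\cdot\mathcal H$ and acts on morphisms by restriction. Let $\Gamma<G$ be a subgroup such that $G=\Gamma K$ and $\Gamma\cap K=\{e\}$. Then the following holds. 1. The maps $$\chi_K\cdot(\mathcal H\otimes_{L^\infty(G/K)}\mathcal K)\to(\chi_K\cdot\mathcal H)\otimes(\chi_K\cdot\mathcal K):\ \xi\mapsto\sum_{\gamma\in\Gamma}(1\otimes\pi_{\mathcal K}(\gamma)^*\chi_{\gamma K})\,\xi$$ are well defined and unitary, and they are the tensor structure maps of a monoidal structure on $\mathbf F$. With this structure $\mathbf F$ is a fiber functor, i.e. a faithful, linear, adjoint-preserving monoidal functor to $\mathrm{Hilb}_f$ whose structure maps (the above ones and $\mathbf F(L^2(G/K))\to\mathbb C$) are unitary. 2. $\mathbf F$ is dimension-preserving: every $\mathcal H\in\mathcal C_f(K<G)$ has a conjugate object $\overline{\mathcal H}$ with morphisms $s:L^2(G/K)\to\mathcal H\otimes_{L^\infty(G/K)}\overline{\mathcal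 H}$ and $t:L^2(G/K)\to\overline{\mathcal H}\otimes_{L^\infty(G/K)}\mathcal H$ satisfying $(t^*\otimes1)(1\otimes s)=1$, $(s^*\otimes1)(1\otimes t)=1$ and $s^*(T\otimes1)s=t^*(1\otimes T)t$ for all endomorphisms $T$ of $\mathcal H$, and for every such choice the categorical dimension $d(\mathcal H)=s^*s$ equals $\dim(\chi_K\cdot\mathcal H)$. 3. The compact quantum group associated to the fiber functor $\mathbf F$ by Tannaka–Krein duality is of Kac type, and it is the bicrossed product of the matched pair $G=\Gamma K$. Explicitly: let $\mathbb H$ be the bicrossed product, whose $C^*$-algebra is the (reduced) crossed product of $C(\Gamma\backslash G)=C(K)$ by the action of $\Gamma$ by right translations, realized on $\ell^2(G)$ as the $C^*$-algebra generated by the operators $\delta_{\gamma k}\mapsto f(k)\,\delta_{\gamma k}$ ($f\in C(K)$, $\gamma\in\Gamma$, $k\in K$) and $v_s:\delta_g\mapsto\delta_{gs^{-1}}$ ($s\in\Gamma$), with comultiplication given by $\Delta(f)(k,k')=f(kk')$ for $f\in C(K)$, and $$\Delta(v_s)=\sum_{r\in\Gamma}v_r\otimes 1_{\{k\in K\,:\,ks\in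 rK\}}\,v_s\qquad(s\in\Gamma).$$ Then $\mathbb H$ is a compact quantum group whose Haar state is a trace, and there are finite-dimensional unitary representations $u_{\mathcal H}$ of $\mathbb H$ on $\mathbf F(\mathcal H)$, $\mathcal H\in\mathcal C_f(K<G)$, such that: the intertwiners from $u_{\mathcal H}$ to $u_{\mathcal K}$ are precisely the maps $\mathbf F(T)$ with $T:\mathcal H\to\mathcal K$ a morphism; the structure maps in 1 intertwine $u_{\mathcal H\otimes\mathcal K}$ with the tensor product representation of $u_{\mathcal H}$ and $u_{\mathcal K}$, and the representation $u_{L^2(G/K)}$ on $\mathbf F(L^2(G/K))$ is trivial; and every finite-dimensional unitary representation of $\mathbb H$ is unitarily equivalent to some $u_{\mathcal H}$. -/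

import Mathlib

open CategoryTheory MonoidalCategory
open scoped TensorProduct ENNReal

universe u

noncomputable section

section HilbertTensor

variable {E F E' F' : Type*}
  [NormedAddCommGroup E] [InnerProductSpace ℂ E] [NormedAddCommGroup F] [InnerProductSpace ℂ F]
  [NormedAddCommGroup E'] [InnerProductSpace ℂ E'] [NormedAddCommGroup F'] [InnerProductSpace ℂ F']

/-- The Hilbert space tensor product: the completion of the algebraic tensor product with respect
to the inner product `⟪x ⊗ y, x' ⊗ y'⟫ = ⟪x, x'⟫ ⟪y, y'⟫`. -/
def HTensor (E F : Type*) [NormedAddCommGroup E] [InnerProductSpace ℂ E]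
    [NormedAddCommGroup F] [InnerProductSpace ℂ F] : Type _ :=
  UniformSpace.Completion (E ⊗[ℂ] F)

namespace HTensor

instance : NormedAddCommGroup (HTensor E F) :=
  inferInstanceAs (NormedAddCommGroup (UniformSpace.Completion (E ⊗[ℂ] F)))
instance : InnerProductSpace ℂ (HTensor E F) :=
  inferInstanceAs (InnerProductSpace ℂ (UniformSpace.Completion (E ⊗[ℂ] F)))
instance : CompleteSpace (HTensor E F) :=
  inferInstanceAs (CompleteSpace (UniformSpace.Completion (E ⊗[ℂ] F)))

/-- The isometric inclusion of the algebraic tensor product. -/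
def incl (E F : Type*) [NormedAddCommGroup E] [InnerProductSpace ℂ E]
    [NormedAddCommGroup F] [InnerProductSpace ℂ F] : E ⊗[ℂ] F →ₗᵢ[ℂ] HTensor E F :=
  (UniformSpace.Completion.toComplₗᵢ : E ⊗[ℂ] F →ₗᵢ[ℂ] UniformSpace.Completion (E ⊗[ℂ] F))

/-- Elementary tensors in the Hilbert space tensor product. -/
def tmul (x : E) (y : F) : HTensor E F := incl E F (x ⊗ₜ[ℂ] y)

lemma denseRange_incl : DenseRange (incl E F) := UniformSpace.Completion.denseRange_coe

lemma inner_tmul (x x' : E) (y y' : F) :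
    inner ℂ (tmul x y) (tmul x' y') = inner ℂ x x' * inner ℂ y y' := by
  simp only [tmul, LinearIsometry.inner_map_map, TensorProduct.inner_tmul]

lemma norm_tmul (x : E) (y : F) : ‖tmul x y‖ = ‖x‖ * ‖y‖ := by
  simp only [tmul, LinearIsometry.norm_map, TensorProduct.norm_tmul]

/-- The tensor product `S ⊗ T` of two bounded operators. -/
def map (S : E →L[ℂ] E') (T : F →L[ℂ] F') : HTensor E F →L[ℂ] HTensor E' F' :=
  ((incl E' F').toLinearMap ∘ₗ (TensorProduct.mapL S T).toLinearMap).extendOfNorm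
    (incl E F).toLinearMap

lemma map_incl (S : E →L[ℂ] E') (T : F →L[ℂ] F') (v : E ⊗[ℂ] F) :
    map S T (incl E F v) = incl E' F' (TensorProduct.mapL S T v) := by
  refine LinearMap.extendOfNorm_eq (e := (incl E F).toLinearMap)
    (f := (incl E' F').toLinearMap ∘ₗ (TensorProduct.mapL S T).toLinearMap)
    denseRange_incl ⟨‖TensorProduct.mapL S T‖, fun x => ?_⟩ v
  have := (TensorProduct.mapL S T).le_opNorm x
  exact (((incl E' F').norm_map _).le.trans this).trans_eq
    (congrArg _ ((incl E F).norm_map x).symm)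

@[simp] lemma map_tmul (S : E →L[ℂ] E') (T : F →L[ℂ] F') (x : E) (y : F) :
    map S T (tmul x y) = tmul (S x) (T y) := by
  rw [tmul, map_incl, TensorProduct.mapL_tmul]; rfl

lemma ext_clm {W : Type*} [NormedAddCommGroup W] [InnerProductSpace ℂ W]
    {A B : HTensor E F →L[ℂ] W} (h : ∀ x y, A (tmul x y) = B (tmul x y)) : A = B := by
  have h1 : A.toLinearMap ∘ₗ (incl E F).toLinearMap = B.toLinearMap ∘ₗ (incl E F).toLinearMap :=
    TensorProduct.ext' h
  ext w
  exact denseRange_incl.induction_on (p := fun w => A w = B w) w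
    (isClosed_eq A.continuous B.continuous) (fun v => LinearMap.congr_fun h1 v)

lemma ext_inner {v w : HTensor E F} (h : ∀ x y, inner ℂ v (tmul x y) = inner ℂ w (tmul x y)) :
    v = w := by
  have : innerSL ℂ v = innerSL ℂ w := ext_clm h
  exact innerSL_inj.1 this

lemma map_comp {E'' F'' : Type*} [NormedAddCommGroup E''] [InnerProductSpace ℂ E'']
    [NormedAddCommGroup F''] [InnerProductSpace ℂ F'']
    (S : E →L[ℂ] E') (T : F →L[ℂ] F') (S' : E' →L[ℂ] E'') (T' : F' →L[ℂ] F'') :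
    map (S' ∘L S) (T' ∘L T) = map S' T' ∘L map S T := ext_clm (by simp)

lemma map_map {E'' F'' : Type*} [NormedAddCommGroup E''] [InnerProductSpace ℂ E'']
    [NormedAddCommGroup F''] [InnerProductSpace ℂ F'']
    (S : E →L[ℂ] E') (T : F →L[ℂ] F') (S' : E' →L[ℂ] E'') (T' : F' →L[ℂ] F'') (w : HTensor E F) :
    map S' T' (map S T w) = map (S' ∘L S) (T' ∘L T) w := by rw [map_comp]; rfl

lemma tmul_add_left (x x' : E) (y : F) : tmul (x + x') y = tmul x y + tmul x' y := by
  simp [tmul, TensorProduct.add_tmul, map_add]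
lemma tmul_add_right (x : E) (y y' : F) : tmul x (y + y') = tmul x y + tmul x y' := by
  simp [tmul, TensorProduct.tmul_add, map_add]
lemma tmul_smul_left (c : ℂ) (x : E) (y : F) : tmul (c • x) y = c • tmul x y := by
  simp only [tmul, ← TensorProduct.smul_tmul', map_smul]
lemma tmul_smul_right (c : ℂ) (x : E) (y : F) : tmul x (c • y) = c • tmul x y := by
  simp only [tmul, TensorProduct.tmul_smul, map_smul]
lemma tmul_zero_left (y : F) : tmul (0 : E) y = 0 := by simp [tmul]
lemma tmul_zero_right (x : E) : tmul x (0 : F) = 0 := by simp [tmul]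

lemma map_adjoint [CompleteSpace E] [CompleteSpace E'] [CompleteSpace F] [CompleteSpace F']
    (S : E →L[ℂ] E') (T : F →L[ℂ] F') : (map S T).adjoint = map S.adjoint T.adjoint := by
  refine ext_clm fun x y => ext_inner fun x' y' => ?_
  rw [ContinuousLinearMap.adjoint_inner_left, map_tmul, map_tmul, inner_tmul, inner_tmul,
    ContinuousLinearMap.adjoint_inner_left, ContinuousLinearMap.adjoint_inner_left]

lemma continuous_tmul : Continuous fun z : E × F => tmul z.1 z.2 :=
  (incl E F).continuous.comp TensorProduct.continuous_tmul

lemma hasSum_tmul_left {ι : Type*} {f : ι → E} {a : E} (h : HasSum f a) (y : F) :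
    HasSum (fun i => tmul (f i) y) (tmul a y) :=
  h.mapL ((incl E F).toContinuousLinearMap ∘L (TensorProduct.mkL ℂ E F).flip y)

lemma hasSum_tmul_right {ι : Type*} {f : ι → F} {a : F} (h : HasSum f a) (x : E) :
    HasSum (fun i => tmul x (f i)) (tmul x a) :=
  h.mapL ((incl E F).toContinuousLinearMap ∘L TensorProduct.mkL ℂ E F x)

/-- `S ↦ S ⊗ 1` as a `*`-homomorphism. -/
def ampL (E F : Type*) [NormedAddCommGroup E] [InnerProductSpace ℂ E] [CompleteSpace E]
    [NormedAddCommGroup F] [InnerProductSpace ℂ F] [CompleteSpace F] :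
    (E →L[ℂ] E) →⋆ₐ[ℂ] (HTensor E F →L[ℂ] HTensor E F) where
  toFun S := map S 1
  map_one' := ext_clm (by simp)
  map_mul' S T := ext_clm (by simp)
  map_zero' := ext_clm (by simp [tmul_zero_left])
  map_add' S T := ext_clm (by simp [tmul_add_left])
  commutes' c := ext_clm (by simp [tmul_smul_left, Algebra.algebraMap_eq_smul_one])
  map_star' S := by
    simp only [ContinuousLinearMap.star_eq_adjoint, map_adjoint]
    rw [← ContinuousLinearMap.star_eq_adjoint (1 : F →L[ℂ] F), star_one]

/-- `T ↦ 1 ⊗ T` as a `*`-homomorphism. -/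
def ampR (E F : Type*) [NormedAddCommGroup E] [InnerProductSpace ℂ E] [CompleteSpace E]
    [NormedAddCommGroup F] [InnerProductSpace ℂ F] [CompleteSpace F] :
    (F →L[ℂ] F) →⋆ₐ[ℂ] (HTensor E F →L[ℂ] HTensor E F) where
  toFun T := map 1 T
  map_one' := ext_clm (by simp)
  map_mul' S T := ext_clm (by simp)
  map_zero' := ext_clm (by simp [tmul_zero_right])
  map_add' S T := ext_clm (by simp [tmul_add_right])
  commutes' c := ext_clm (by simp [tmul_smul_right, Algebra.algebraMap_eq_smul_one])
  map_star' S := by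
    simp only [ContinuousLinearMap.star_eq_adjoint, map_adjoint]
    rw [← ContinuousLinearMap.star_eq_adjoint (1 : E →L[ℂ] E), star_one]

@[simp] lemma ampL_apply [CompleteSpace E] [CompleteSpace F] (S : E →L[ℂ] E) :
    ampL E F S = map S 1 := rfl
@[simp] lemma ampR_apply [CompleteSpace E] [CompleteSpace F] (S : F →L[ℂ] F) :
    ampR E F S = map 1 S := rfl

end HTensor

end HilbertTensor

section Reps

/-- Two linear maps from the same space with dense ranges and the same Gram form induce a unitary. -/
def isoOfInner {V E F : Type*} [AddCommGroup V] [Module ℂ V]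
    [NormedAddCommGroup E] [InnerProductSpace ℂ E] [CompleteSpace E]
    [NormedAddCommGroup F] [InnerProductSpace ℂ F] [CompleteSpace F]
    (e : V →ₗ[ℂ] E) (f : V →ₗ[ℂ] F) (he : DenseRange e) (hf : DenseRange f)
    (h : ∀ v, ‖e v‖ = ‖f v‖) : E ≃ₗᵢ[ℂ] F :=
  (LinearEquiv.refl ℂ V).extendOfIsometry e f he hf (fun v => (h v).symm)

lemma isoOfInner_apply {V E F : Type*} [AddCommGroup V] [Module ℂ V]
    [NormedAddCommGroup E] [InnerProductSpace ℂ E] [CompleteSpace E]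
    [NormedAddCommGroup F] [InnerProductSpace ℂ F] [CompleteSpace F]
    (e : V →ₗ[ℂ] E) (f : V →ₗ[ℂ] F) (he : DenseRange e) (hf : DenseRange f)
    (h : ∀ v, ‖e v‖ = ‖f v‖) (v : V) : isoOfInner e f he hf h (e v) = f v :=
  LinearEquiv.extendOfIsometry_eq (LinearEquiv.refl ℂ V) e f he hf (fun v => (h v).symm) v

variable {W : Type*} [NormedAddCommGroup W] [InnerProductSpace ℂ W] [CompleteSpace W]

/-- Restriction of a `*`-representation to an invariant closed subspace. -/
def restrictRep {A : Type*} [Ring A] [StarRing A] [Algebra ℂ A]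
    (φ : A →⋆ₐ[ℂ] (W →L[ℂ] W)) (T : Submodule ℂ W) [CompleteSpace T]
    (h : ∀ a, ∀ w ∈ T, φ a w ∈ T) : A →⋆ₐ[ℂ] (T →L[ℂ] T) where
  toFun a := (φ a).restrict (h a)
  map_one' := by ext; simp
  map_mul' a b := by ext; simp
  map_zero' := by ext; simp
  map_add' a b := by ext; simp
  commutes' c := by ext; simp [Algebra.algebraMap_eq_smul_one]
  map_star' a := by
    rw [ContinuousLinearMap.star_eq_adjoint]
    refine (ContinuousLinearMap.eq_adjoint_iff _ _).2 fun x y => ?_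
    simp only [Submodule.coe_inner, ContinuousLinearMap.restrict_apply, map_star,
      ContinuousLinearMap.star_eq_adjoint, ContinuousLinearMap.adjoint_inner_left]

@[simp] lemma restrictRep_apply {A : Type*} [Ring A] [StarRing A] [Algebra ℂ A]
    (φ : A →⋆ₐ[ℂ] (W →L[ℂ] W)) (T : Submodule ℂ W) [CompleteSpace T]
    (h : ∀ a, ∀ w ∈ T, φ a w ∈ T) (a : A) (w : T) :
    (restrictRep φ T h a w : W) = φ a w := rfl

/-- The algebra `ℓ^∞(X)` of bounded functions on a (discrete) set. -/
abbrev LInf (X : Type*) : Type _ := lp (fun _ : X => ℂ) ∞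

/-- The Hilbert space `ℓ²(X)`. -/
abbrev L2 (X : Type*) : Type _ := lp (fun _ : X => ℂ) 2

open scoped Classical in
/-- The indicator function of a point as an element of `ℓ^∞(X)`. -/
def LInf.chi {X : Type*} (x : X) : LInf X := lp.single ∞ x 1

open scoped Classical in
/-- The canonical basis vector of `ℓ²(X)`. -/
def L2.delta {X : Type*} (x : X) : L2 X := lp.single 2 x 1

variable {X : Type*}

lemma LInf.ext {f g : LInf X} (h : ∀ x, f x = g x) : f = g := lp.ext (funext h)

lemma LInf.chi_apply [DecidableEq X] (x y : X) : LInf.chi x y = if y = x then 1 else 0 := by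
  obtain rfl : ‹DecidableEq X› = fun a b => Classical.propDecidable (a = b) := Subsingleton.elim _ _
  exact @Pi.single_apply X (fun a b => Classical.propDecidable (a = b)) ℂ _ x 1 y

lemma LInf.mul_chi (f : LInf X) (x : X) : f * chi x = f x • chi x := by
  classical
  refine LInf.ext fun y => ?_
  simp only [lp.infty_coeFn_mul, Pi.mul_apply, lp.coeFn_smul, Pi.smul_apply, chi_apply, smul_eq_mul]
  split_ifs with h
  · rw [h]
  · simp

lemma LInf.chi_mul_chi [DecidableEq X] (x y : X) :
    (chi x * chi y : LInf X) = if x = y then chi x else 0 := by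
  rw [LInf.mul_chi, LInf.chi_apply]
  split_ifs with h h' h'
  · rw [one_smul, h]
  · exact absurd h.symm h'
  · exact absurd h'.symm h
  · rw [zero_smul]

lemma LInf.star_chi (x : X) : star (chi x : LInf X) = chi x := by
  classical
  refine LInf.ext fun y => ?_
  rw [lp.star_apply, LInf.chi_apply]
  split_ifs <;> simp

/-- A unital `*`-representation of `ℓ^∞(X)` is normal if the minimal projections `χ_x` sum up to
the identity in the strong topology. -/
def IsNormalRep (σ : LInf X →⋆ₐ[ℂ] (W →L[ℂ] W)) : Prop :=
  ∀ w, HasSum (fun x => σ (LInf.chi x) w) w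

section
variable (σ : LInf X →⋆ₐ[ℂ] (W →L[ℂ] W))

lemma rep_inner (f : LInf X) (v w : W) : inner ℂ (σ f v) w = inner ℂ v (σ (star f) w) := by
  rw [map_star, ContinuousLinearMap.star_eq_adjoint, ContinuousLinearMap.adjoint_inner_right]

lemma rep_chi_inner (x : X) (v w : W) :
    inner ℂ (σ (LInf.chi x) v) w = inner ℂ v (σ (LInf.chi x) w) := by
  rw [rep_inner, LInf.star_chi]

lemma rep_mul_apply (f g : LInf X) (w : W) : σ f (σ g w) = σ (f * g) w := by
  rw [map_mul]; rfl

lemma rep_apply_chi (f : LInf X) (x : X) (w : W) :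
    σ f (σ (LInf.chi x) w) = f x • σ (LInf.chi x) w := by
  rw [rep_mul_apply, LInf.mul_chi, map_smul]; rfl

lemma rep_chi_apply (f : LInf X) (x : X) (w : W) :
    σ (LInf.chi x) (σ f w) = f x • σ (LInf.chi x) w := by
  rw [rep_mul_apply, mul_comm, LInf.mul_chi, map_smul]; rfl

lemma rep_chi_chi [DecidableEq X] (x y : X) (w : W) :
    σ (LInf.chi x) (σ (LInf.chi y) w) = if x = y then σ (LInf.chi x) w else 0 := by
  rw [rep_mul_apply, LInf.chi_mul_chi]
  split_ifs <;> simp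

lemma norm_rep_sum_le (s : Finset X) (w : W) : ‖∑ x ∈ s, σ (LInf.chi x) w‖ ≤ ‖w‖ := by
  classical
  set v := ∑ x ∈ s, σ (LInf.chi x) w with hv
  have h1 : inner ℂ v v = inner ℂ v w := by
    rw [hv, sum_inner, sum_inner]
    refine Finset.sum_congr rfl fun x hx => ?_
    rw [rep_chi_inner, rep_chi_inner, map_sum]
    simp only [rep_chi_chi]
    rw [Finset.sum_ite_eq, if_pos hx]
  have h2 : ‖v‖ * ‖v‖ ≤ ‖v‖ * ‖w‖ := by
    rw [← inner_self_eq_norm_mul_norm (𝕜 := ℂ), h1]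
    exact (RCLike.re_le_norm _).trans (norm_inner_le_norm _ _)
  rcases (norm_nonneg v).eq_or_lt with h | h
  · rw [← h]; exact norm_nonneg w
  · exact le_of_mul_le_mul_left h2 h

lemma isNormalRep_of_dense {V : Type*} (e : V → W) (he : DenseRange e)
    (h : ∀ v, HasSum (fun x => σ (LInf.chi x) (e v)) (e v)) : IsNormalRep σ := by
  intro w
  rw [HasSum, Metric.tendsto_nhds]
  intro ε hε
  obtain ⟨v, hv⟩ := he.exists_dist_lt w (show 0 < ε / 3 by positivity)
  have := Metric.tendsto_nhds.1 (h v) (ε / 3) (by positivity)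
  refine this.mono fun s hs => ?_
  have h1 : dist (∑ x ∈ s, σ (LInf.chi x) w) (∑ x ∈ s, σ (LInf.chi x) (e v)) ≤ dist w (e v) := by
    rw [dist_eq_norm, dist_eq_norm, ← Finset.sum_sub_distrib]
    simp only [← map_sub]
    exact norm_rep_sum_le σ s _
  have h2 := dist_triangle4 (∑ x ∈ s, σ (LInf.chi x) w) (∑ x ∈ s, σ (LInf.chi x) (e v)) (e v) w
  rw [dist_comm (e v) w] at h2
  linarith

variable {σ}

/-- The sum of the squared norms of the components of a vector. -/
lemma IsNormalRep.summable_sq (h : IsNormalRep σ) (w : W) :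
    Summable fun x => ‖σ (LInf.chi x) w‖ ^ 2 := by
  classical
  have h1 := ((h w).mapL (innerSL ℂ w)).summable
  have h2 : ∀ x, innerSL ℂ w (σ (LInf.chi x) w) = ((‖σ (LInf.chi x) w‖ ^ 2 : ℝ) : ℂ) := by
    intro x
    have := inner_self_eq_norm_sq_to_K (𝕜 := ℂ) (σ (LInf.chi x) w)
    rw [rep_chi_inner, rep_chi_chi, if_pos rfl] at this
    rw [innerSL_apply_apply, this]; norm_cast
  simp only [h2] at h1
  exact_mod_cast h1

lemma IsNormalRep.summable_mul {W' : Type*} [NormedAddCommGroup W'] [InnerProductSpace ℂ W']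
    [CompleteSpace W'] {τ : LInf X →⋆ₐ[ℂ] (W' →L[ℂ] W')} (h : IsNormalRep σ) (h' : IsNormalRep τ)
    (w : W) (w' : W') : Summable fun x => ‖σ (LInf.chi x) w‖ * ‖τ (LInf.chi x) w'‖ := by
  refine Summable.of_nonneg_of_le (fun x => by positivity) (fun x => ?_)
    ((h.summable_sq w).add (h'.summable_sq w'))
  nlinarith [sq_nonneg (‖σ (LInf.chi x) w‖ - ‖τ (LInf.chi x) w'‖),
    sq_nonneg (‖σ (LInf.chi x) w‖), sq_nonneg (‖τ (LInf.chi x) w'‖)]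

lemma IsNormalRep.restrict (h : IsNormalRep σ) (T : Submodule ℂ W) [CompleteSpace T]
    (hT : ∀ a, ∀ w ∈ T, σ a w ∈ T) : IsNormalRep (restrictRep σ T hT) := fun w =>
  (Topology.IsInducing.subtypeVal.hasSum_iff (g := T.subtype) _ _).1 (h w)

/-- Two vectors with the same components are equal. -/
lemma IsNormalRep.ext (h : IsNormalRep σ) {v w : W}
    (hvw : ∀ x, σ (LInf.chi x) v = σ (LInf.chi x) w) : v = w :=
  (h v).unique (by simpa only [hvw] using h w)

lemma IsNormalRep.denseRange (h : IsNormalRep σ) {w : W} {S : Submodule ℂ W}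
    (hS : ∀ x, σ (LInf.chi x) w ∈ S) : w ∈ S.topologicalClosure :=
  mem_closure_of_tendsto (h w) (Filter.Eventually.of_forall fun _ => S.sum_mem fun x _ => hS x)

end

end Reps

/-- A homomorphism from a topological group to isometries is strongly continuous as soon as it is
so on a dense set. -/
lemma continuous_orbit_of_dense {G V W : Type*} [TopologicalSpace G]
    [NormedAddCommGroup W] [InnerProductSpace ℂ W]
    (U : G → (W →L[ℂ] W)) (hU : ∀ g w, ‖U g w‖ = ‖w‖) (e : V → W) (he : DenseRange e)
    (h : ∀ v, Continuous fun g => U g (e v)) (w : W) : Continuous fun g => U g w := by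
  rw [continuous_iff_continuousAt]
  intro g₀
  rw [ContinuousAt, Metric.tendsto_nhds]
  intro ε hε
  obtain ⟨v, hv⟩ := he.exists_dist_lt w (show 0 < ε / 3 by positivity)
  refine (Metric.tendsto_nhds.1 ((h v).tendsto g₀) (ε / 3) (by positivity)).mono fun g hg => ?_
  have h1 : ∀ g, dist (U g w) (U g (e v)) = dist w (e v) := fun g => by
    rw [dist_eq_norm, ← map_sub, hU, dist_eq_norm]
  have h2 := dist_triangle4 (U g w) (U g (e v)) (U g₀ (e v)) (U g₀ w)
  rw [dist_comm (U g₀ (e v)), h1, h1] at h2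
  linarith


/-! ### Multiplication and permutation operators on `ℓ²(X)` -/

section L2ops

variable {X : Type*}

lemma L2.delta_apply [DecidableEq X] (x y : X) : L2.delta x y = if y = x then 1 else 0 := by
  obtain rfl : ‹DecidableEq X› = fun a b => Classical.propDecidable (a = b) := Subsingleton.elim _ _
  exact @Pi.single_apply X (fun a b => Classical.propDecidable (a = b)) ℂ _ x 1 y

lemma L2.ext {f g : L2 X} (h : ∀ x, f x = g x) : f = g := lp.ext (funext h)

lemma L2.memlp_of_norm_le {f : X → ℂ} (g : L2 X) (C : ℝ) (h : ∀ x, ‖f x‖ ≤ C * ‖g x‖) :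
    Memℓp f 2 := by
  refine memℓp_gen ?_
  have hg := (lp.memℓp g).summable (by norm_num)
  refine Summable.of_nonneg_of_le (fun x => by positivity) (fun x => ?_)
    (hg.mul_left (C ^ (2 : ℝ≥0∞).toReal))
  have := h x
  simp only [ENNReal.toReal_ofNat, Real.rpow_ofNat] at this ⊢
  rw [← mul_pow]
  gcongr

lemma L2.norm_sq (f : L2 X) : ‖f‖ ^ 2 = ∑' x, ‖f x‖ ^ 2 := by
  have := lp.norm_rpow_eq_tsum (p := 2) (by norm_num) f
  simpa using this

lemma L2.summable_sq (f : L2 X) : Summable fun x => ‖f x‖ ^ 2 := by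
  have := (lp.memℓp f).summable (by norm_num)
  simpa using this

/-- Multiplication by a bounded function, as a bounded operator on `ℓ²(X)`. -/
def L2.mulOp (f : LInf X) : L2 X →L[ℂ] L2 X :=
  LinearMap.mkContinuous
    { toFun := fun ξ => ⟨fun x => f x * ξ x, L2.memlp_of_norm_le ξ ‖f‖ fun x => by
        rw [norm_mul]; gcongr; exact lp.norm_apply_le_norm (by simp) f x⟩
      map_add' := fun ξ η => L2.ext fun x => mul_add _ _ _
      map_smul' := fun c ξ => L2.ext fun x => mul_left_comm _ _ _ } ‖f‖ (fun ξ => by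
    refine le_of_sq_le_sq ?_ (by positivity)
    rw [L2.norm_sq, mul_pow, L2.norm_sq, ← tsum_mul_left]
    refine Summable.tsum_le_tsum (fun x => ?_) (L2.summable_sq _) ((L2.summable_sq ξ).mul_left _)
    change ‖f x * ξ x‖ ^ 2 ≤ _
    rw [norm_mul, mul_pow]
    gcongr
    exact lp.norm_apply_le_norm (by simp) f x)

@[simp] lemma L2.mulOp_apply (f : LInf X) (ξ : L2 X) (x : X) : L2.mulOp f ξ x = f x * ξ x := rfl

/-- The representation of `ℓ^∞(X)` on `ℓ²(X)` by multiplication operators. -/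
def L2.mulRep (X : Type*) : LInf X →⋆ₐ[ℂ] (L2 X →L[ℂ] L2 X) where
  toFun := L2.mulOp
  map_one' := by ext ξ x; simp
  map_mul' f g := by ext ξ x; simp [mul_assoc]
  map_zero' := by ext ξ x; simp
  map_add' f g := by ext ξ x; simp [add_mul]
  commutes' c := by ext ξ x; simp [Algebra.algebraMap_eq_smul_one]
  map_star' f := by
    rw [ContinuousLinearMap.star_eq_adjoint]
    refine (ContinuousLinearMap.eq_adjoint_iff _ _).2 fun ξ η => ?_
    rw [lp.inner_eq_tsum, lp.inner_eq_tsum]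
    refine tsum_congr fun x => ?_
    simp [mul_assoc, mul_left_comm, mul_comm]

@[simp] lemma L2.mulRep_apply (f : LInf X) (ξ : L2 X) (x : X) : L2.mulRep X f ξ x = f x * ξ x := rfl

lemma L2.mulRep_chi (x : X) (ξ : L2 X) : L2.mulRep X (LInf.chi x) ξ = ξ x • L2.delta x := by
  classical
  refine L2.ext fun y => ?_
  rw [L2.mulRep_apply, LInf.chi_apply, lp.coeFn_smul, Pi.smul_apply, L2.delta_apply, smul_eq_mul]
  split_ifs with h
  · simp [h]
  · simp

lemma L2.hasSum (ξ : L2 X) : HasSum (fun x => ξ x • L2.delta x) ξ := by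
  classical
  have := lp.hasSum_single (p := 2) (by simp) ξ
  convert! this using 2 with x
  refine L2.ext fun y => ?_
  rw [lp.coeFn_smul, Pi.smul_apply, L2.delta_apply, lp.single_apply, Pi.single_apply, smul_eq_mul]
  split_ifs with h <;> simp

lemma L2.mulRep_normal : IsNormalRep (L2.mulRep X) := fun ξ => by
  simpa only [L2.mulRep_chi] using L2.hasSum ξ

/-- The unitary operator on `ℓ²(X)` given by an action of `G` on `X`. -/
def L2.permRep (G X : Type*) [Group G] [MulAction G X] : G →* (L2 X →L[ℂ] L2 X) where
  toFun g := LinearMap.mkContinuous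
    { toFun := fun ξ => ⟨fun x => ξ (g⁻¹ • x), memℓp_gen (by
        have := (MulAction.toPerm g⁻¹ : Equiv.Perm X).summable_iff.2
          ((lp.memℓp ξ).summable (by norm_num))
        exact this)⟩
      map_add' := fun ξ η => rfl
      map_smul' := fun c ξ => rfl } 1 (fun ξ => by
    rw [one_mul]
    refine le_of_sq_le_sq (le_of_eq ?_) (by positivity)
    rw [L2.norm_sq, L2.norm_sq]
    exact (MulAction.toPerm g⁻¹ : Equiv.Perm X).tsum_eq (fun x => ‖ξ x‖ ^ 2))
  map_one' := by
    ext ξ x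
    change ξ ((1 : G)⁻¹ • x) = ξ x
    simp
  map_mul' g h := by
    ext ξ x
    change ξ ((g * h)⁻¹ • x) = ξ (h⁻¹ • g⁻¹ • x)
    rw [mul_inv_rev, mul_smul]

lemma L2.permRep_apply {G : Type*} [Group G] [MulAction G X] (g : G) (ξ : L2 X) (x : X) :
    L2.permRep G X g ξ x = ξ (g⁻¹ • x) := rfl

lemma L2.norm_permRep {G : Type*} [Group G] [MulAction G X] (g : G) (ξ : L2 X) :
    ‖L2.permRep G X g ξ‖ = ‖ξ‖ := by
  refine (sq_eq_sq₀ (norm_nonneg _) (norm_nonneg _)).1 ?_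
  rw [L2.norm_sq, L2.norm_sq]
  exact (MulAction.toPerm g⁻¹ : Equiv.Perm X).tsum_eq (fun x => ‖ξ x‖ ^ 2)

lemma L2.permRep_delta {G : Type*} [Group G] [MulAction G X] (g : G) (x : X) :
    L2.permRep G X g (L2.delta x) = L2.delta (g • x) := by
  classical
  refine L2.ext fun y => ?_
  rw [L2.permRep_apply, L2.delta_apply, L2.delta_apply]
  simp only [inv_smul_eq_iff]

end L2ops

/-! ### The relative tensor product over `ℓ^∞(X)` -/

section RelTensor

variable {X W W' : Type*} [NormedAddCommGroup W] [InnerProductSpace ℂ W] [CompleteSpace W]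
  [NormedAddCommGroup W'] [InnerProductSpace ℂ W'] [CompleteSpace W']

/-- The relative tensor product `W ⊗_{ℓ^∞(X)} W'` of a right module `W` and a left module `W'`: all
vectors `ζ` of the Hilbert space tensor product with `ζ (χ_x ⊗ 1) = (1 ⊗ χ_x) ζ` for all `x`. -/
def relTensor (σ : LInf X →⋆ₐ[ℂ] (W →L[ℂ] W)) (τ : LInf X →⋆ₐ[ℂ] (W' →L[ℂ] W')) :
    Submodule ℂ (HTensor W W') where
  carrier := {ζ | ∀ x, HTensor.map (σ (LInf.chi x)) 1 ζ = HTensor.map 1 (τ (LInf.chi x)) ζ}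
  zero_mem' := fun x => by simp
  add_mem' := fun ha hb x => by rw [map_add, map_add, ha x, hb x]
  smul_mem' := fun c _ ha x => by rw [map_smul, map_smul, ha x]

variable (σ : LInf X →⋆ₐ[ℂ] (W →L[ℂ] W)) (τ : LInf X →⋆ₐ[ℂ] (W' →L[ℂ] W'))

lemma isClosed_relTensor : IsClosed (relTensor σ τ : Set (HTensor W W')) := by
  have : (relTensor σ τ : Set (HTensor W W')) = ⋂ x, {ζ |
      HTensor.map (σ (LInf.chi x)) 1 ζ = HTensor.map 1 (τ (LInf.chi x)) ζ} := by
    ext; simp [relTensor]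
  rw [this]
  exact isClosed_iInter fun x => isClosed_eq (ContinuousLinearMap.continuous _)
    (ContinuousLinearMap.continuous _)

instance : CompleteSpace (relTensor σ τ) := (isClosed_relTensor σ τ).completeSpace_coe

/-- The orthogonal projection of an elementary tensor onto the relative tensor product, as a linear
map on the algebraic tensor product. -/
def rtmulₗ : W ⊗[ℂ] W' →ₗ[ℂ] relTensor σ τ :=
  (relTensor σ τ).orthogonalProjectionOnto.toLinearMap ∘ₗ (HTensor.incl W W').toLinearMap

/-- The image of an elementary tensor in the relative tensor product. -/
def rtmul (ξ : W) (η : W') : relTensor σ τ := rtmulₗ σ τ (ξ ⊗ₜ η)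

lemma rtmulₗ_tmul (ξ : W) (η : W') : rtmulₗ σ τ (ξ ⊗ₜ η) = rtmul σ τ ξ η := rfl

lemma rtmul_def (ξ : W) (η : W') :
    rtmul σ τ ξ η = (relTensor σ τ).orthogonalProjectionOnto (HTensor.tmul ξ η) := rfl

lemma denseRange_rtmulₗ : DenseRange (rtmulₗ σ τ) := by
  have h : Function.Surjective (relTensor σ τ).orthogonalProjectionOnto := fun w =>
    ⟨w, Submodule.orthogonalProjectionOnto_mem_subspace_eq_self w⟩
  exact (h.denseRange).comp HTensor.denseRange_incl (ContinuousLinearMap.continuous _)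

variable {σ τ}

lemma relTensor_ext_clm {V : Type*} [NormedAddCommGroup V] [InnerProductSpace ℂ V]
    {A B : relTensor σ τ →L[ℂ] V} (h : ∀ x y, A (rtmul σ τ x y) = B (rtmul σ τ x y)) : A = B := by
  have h1 : A.toLinearMap ∘ₗ rtmulₗ σ τ = B.toLinearMap ∘ₗ rtmulₗ σ τ := TensorProduct.ext' h
  ext w
  exact (denseRange_rtmulₗ σ τ).induction_on (p := fun w => A w = B w) w
    (isClosed_eq A.continuous B.continuous) (fun v => LinearMap.congr_fun h1 v)

lemma isNormalRep_ampL (hσ : IsNormalRep σ) : IsNormalRep ((HTensor.ampL W W').comp σ) := by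
  refine isNormalRep_of_dense _ (HTensor.incl W W') HTensor.denseRange_incl fun v => ?_
  induction v with
  | zero => simp only [map_zero]; exact hasSum_zero
  | tmul x y =>
    exact (HTensor.hasSum_tmul_left (hσ x) y).congr_fun fun z => HTensor.map_tmul _ _ x y
  | add a b ha hb => simpa only [map_add] using ha.add hb

lemma isNormalRep_ampR (hτ : IsNormalRep τ) : IsNormalRep ((HTensor.ampR W W').comp τ) := by
  refine isNormalRep_of_dense _ (HTensor.incl W W') HTensor.denseRange_incl fun v => ?_
  induction v with
  | zero => simp only [map_zero]; exact hasSum_zero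
  | tmul x y =>
    exact (HTensor.hasSum_tmul_right (hτ y) x).congr_fun fun z => HTensor.map_tmul _ _ x y
  | add a b ha hb => simpa only [map_add] using ha.add hb

lemma hasSum_rtmul (hσ : IsNormalRep σ) (hτ : IsNormalRep τ) (ξ : W) (η : W') :
    HasSum (fun x => HTensor.tmul (σ (LInf.chi x) ξ) (τ (LInf.chi x) η))
      (rtmul σ τ ξ η : HTensor W W') := by
  classical
  have hs : Summable (fun x => HTensor.tmul (σ (LInf.chi x) ξ) (τ (LInf.chi x) η)) := by
    refine Summable.of_norm ?_
    simp only [HTensor.norm_tmul]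
    exact hσ.summable_mul hτ ξ η
  have hmem : ∑' x, HTensor.tmul (σ (LInf.chi x) ξ) (τ (LInf.chi x) η) ∈ relTensor σ τ := by
    intro x
    rw [ContinuousLinearMap.map_tsum _ hs, ContinuousLinearMap.map_tsum _ hs]
    refine tsum_congr fun y => ?_
    simp only [HTensor.map_tmul, rep_chi_chi, one_apply_eq_self]
    split_ifs with h
    · rw [h]
    · rw [HTensor.tmul_zero_left, HTensor.tmul_zero_right]
  have hP := Submodule.eq_starProjection_of_mem_of_inner_eq_zero (u := HTensor.tmul ξ η) hmem
    (fun w hw => by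
      rw [inner_sub_left, sub_eq_zero]
      have h1 := (isNormalRep_ampL (W' := W') hσ w).mapL (innerSL ℂ (HTensor.tmul ξ η))
      have h2 := (innerSLFlip ℂ w).hasSum hs.hasSum
      refine h1.unique (h2.congr_fun fun x => ?_)
      have e1 : HTensor.tmul (σ (LInf.chi x) ξ) (τ (LInf.chi x) η) =
          ((HTensor.ampL W W').comp σ) (LInf.chi x)
            (((HTensor.ampR W W').comp τ) (LInf.chi x) (HTensor.tmul ξ η)) := by
        simp
      have e2 : ((HTensor.ampR W W').comp τ) (LInf.chi x)
          (((HTensor.ampL W W').comp σ) (LInf.chi x) w) =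
          ((HTensor.ampL W W').comp σ) (LInf.chi x)
          (((HTensor.ampR W W').comp τ) (LInf.chi x) w) := by
        simp [HTensor.map_map, ← ContinuousLinearMap.mul_def]
      have e3 : ((HTensor.ampR W W').comp τ) (LInf.chi x) w =
          ((HTensor.ampL W W').comp σ) (LInf.chi x) w := (hw x).symm
      rw [innerSLFlip_apply_apply, innerSL_apply_apply, e1, rep_chi_inner, rep_chi_inner, e2, e3,
        rep_chi_chi, if_pos rfl])
  have e : (rtmul σ τ ξ η : HTensor W W') =
      ∑' x, HTensor.tmul (σ (LInf.chi x) ξ) (τ (LInf.chi x) η) := hP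
  rw [e]
  exact hs.hasSum

lemma inner_rtmul (hσ : IsNormalRep σ) (hτ : IsNormalRep τ) (ξ ξ' : W) (η η' : W') :
    HasSum (fun x => inner ℂ ξ (σ (LInf.chi x) ξ') * inner ℂ η (τ (LInf.chi x) η'))
      (inner ℂ (rtmul σ τ ξ η) (rtmul σ τ ξ' η')) := by
  have h := (hasSum_rtmul hσ hτ ξ' η').mapL (innerSL ℂ (HTensor.tmul ξ η))
  have e : inner ℂ (rtmul σ τ ξ η) (rtmul σ τ ξ' η') =
      innerSL ℂ (HTensor.tmul ξ η) (rtmul σ τ ξ' η' : HTensor W W') := by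
    rw [innerSL_apply_apply, rtmul_def σ τ ξ η]
    exact Submodule.inner_orthogonalProjectionOnto_eq_of_mem_right _ _
  rw [e]
  refine h.congr_fun fun x => ?_
  rw [innerSL_apply_apply, HTensor.inner_tmul]

lemma norm_eq_of_inner_eq {V E F : Type*} [AddCommGroup V] [Module ℂ V]
    [NormedAddCommGroup E] [InnerProductSpace ℂ E] [NormedAddCommGroup F] [InnerProductSpace ℂ F]
    (e : V →ₗ[ℂ] E) (f : V →ₗ[ℂ] F)
    (h : ∀ v w, inner ℂ (e v) (e w) = inner ℂ (f v) (f w)) (v : V) : ‖e v‖ = ‖f v‖ := by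
  rw [norm_eq_sqrt_re_inner (𝕜 := ℂ), h, ← norm_eq_sqrt_re_inner]

/-- The tensor product of two module maps. -/
def relTensorMap {X W W' Z Z' : Type*} [NormedAddCommGroup W] [InnerProductSpace ℂ W]
    [CompleteSpace W] [NormedAddCommGroup W'] [InnerProductSpace ℂ W'] [CompleteSpace W']
    [NormedAddCommGroup Z] [InnerProductSpace ℂ Z]
    [CompleteSpace Z] [NormedAddCommGroup Z'] [InnerProductSpace ℂ Z'] [CompleteSpace Z']
    (σ : LInf X →⋆ₐ[ℂ] (W →L[ℂ] W)) (τ : LInf X →⋆ₐ[ℂ] (W' →L[ℂ] W'))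
    (σ' : LInf X →⋆ₐ[ℂ] (Z →L[ℂ] Z)) (τ' : LInf X →⋆ₐ[ℂ] (Z' →L[ℂ] Z'))
    (S : W →L[ℂ] Z) (T : W' →L[ℂ] Z')
    (hS : ∀ f w, S (σ f w) = σ' f (S w)) (hT : ∀ f w, T (τ f w) = τ' f (T w)) :
    relTensor σ τ →L[ℂ] relTensor σ' τ' :=
  (HTensor.map S T).restrict fun ζ hζ x => by
    have h1 : σ' (LInf.chi x) ∘L S = S ∘L σ (LInf.chi x) := by ext; simp [hS]
    have h2 : τ' (LInf.chi x) ∘L T = T ∘L τ (LInf.chi x) := by ext; simp [hT]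
    have := congrArg (HTensor.map S T) (hζ x)
    simp only [HTensor.map_map] at this ⊢
    rw [h1, h2]
    exact this

lemma relTensorMap_rtmul {X W W' Z Z' : Type*} [NormedAddCommGroup W] [InnerProductSpace ℂ W]
    [CompleteSpace W] [NormedAddCommGroup W'] [InnerProductSpace ℂ W'] [CompleteSpace W']
    [NormedAddCommGroup Z] [InnerProductSpace ℂ Z]
    [CompleteSpace Z] [NormedAddCommGroup Z'] [InnerProductSpace ℂ Z'] [CompleteSpace Z']
    {σ : LInf X →⋆ₐ[ℂ] (W →L[ℂ] W)} {τ : LInf X →⋆ₐ[ℂ] (W' →L[ℂ] W')}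
    {σ' : LInf X →⋆ₐ[ℂ] (Z →L[ℂ] Z)} {τ' : LInf X →⋆ₐ[ℂ] (Z' →L[ℂ] Z')}
    (h1 : IsNormalRep σ) (h2 : IsNormalRep τ) (h3 : IsNormalRep σ') (h4 : IsNormalRep τ')
    (S : W →L[ℂ] Z) (T : W' →L[ℂ] Z')
    (hS : ∀ f w, S (σ f w) = σ' f (S w)) (hT : ∀ f w, T (τ f w) = τ' f (T w)) (ξ : W) (η : W') :
    relTensorMap σ τ σ' τ' S T hS hT (rtmul σ τ ξ η) = rtmul σ' τ' (S ξ) (T η) := by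
  refine Subtype.ext ?_
  have e1 := (hasSum_rtmul h1 h2 ξ η).mapL (HTensor.map S T)
  refine e1.unique ((hasSum_rtmul h3 h4 (S ξ) (T η)).congr_fun fun x => ?_)
  rw [HTensor.map_tmul, hS, hT]

end RelTensor

/-! ### The category `C_f(K < G)` -/

/-- Left translation on `ℓ^∞(X)`: `(g f)(x) = f (g⁻¹ x)`. -/
def LInf.translate {G X : Type*} [Group G] [MulAction G X] (g : G) (f : LInf X) : LInf X :=
  ⟨fun x => f (g⁻¹ • x), memℓp_infty ⟨‖f‖, by
    rintro _ ⟨x, rfl⟩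
    exact lp.norm_apply_le_norm (by simp) f _⟩⟩

@[simp] lemma LInf.translate_apply {G X : Type*} [Group G] [MulAction G X] (g : G) (f : LInf X)
    (x : X) : LInf.translate g f x = f (g⁻¹ • x) := rfl

lemma LInf.translate_chi {G X : Type*} [Group G] [MulAction G X] (g : G) (x : X) :
    LInf.translate g (LInf.chi x) = LInf.chi (g • x) := by
  classical
  refine LInf.ext fun y => ?_
  rw [LInf.translate_apply, LInf.chi_apply, LInf.chi_apply]
  simp only [inv_smul_eq_iff]

lemma LInf.translate_one {G X : Type*} [Group G] [MulAction G X] (g : G) :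
    LInf.translate g (1 : LInf X) = 1 := rfl

section Category

variable {G : Type u} [Group G] [TopologicalSpace G]

/-- A finite-rank `L^∞(G/K)`-`G`-`L^∞(G/K)`-module: a Hilbert space with a strongly continuous
unitary representation `π` of `G` and commuting normal unital `*`-representations `left`, `right` of
`L^∞(G/K)` with `π(g)(f₁ · ξ · f₂) = (g f₁) · π(g)ξ · (g f₂)`, such that `χ_K · H` is
finite-dimensional. As `K` is open, `G/K` is discrete and `L^∞(G/K)` is `ℓ^∞(G/K)`. -/
structure CfModule (K : OpenSubgroup G) where
  carrier : Type u
  [normedAddCommGroup : NormedAddCommGroup carrier]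
  [innerProductSpace : InnerProductSpace ℂ carrier]
  [completeSpace : CompleteSpace carrier]
  π : G →* (carrier →L[ℂ] carrier)
  norm_π : ∀ g ξ, ‖π g ξ‖ = ‖ξ‖
  continuous_π : ∀ ξ, Continuous fun g => π g ξ
  left : LInf (G ⧸ (K : Subgroup G)) →⋆ₐ[ℂ] (carrier →L[ℂ] carrier)
  right : LInf (G ⧸ (K : Subgroup G)) →⋆ₐ[ℂ] (carrier →L[ℂ] carrier)
  left_normal : IsNormalRep left
  right_normal : IsNormalRep right
  left_right_comm : ∀ f₁ f₂ ξ, left f₁ (right f₂ ξ) = right f₂ (left f₁ ξ)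
  covariant : ∀ g f₁ f₂ ξ,
    π g (left f₁ (right f₂ ξ)) = left (f₁.translate g) (right (f₂.translate g) (π g ξ))
  finite_rank : FiniteDimensional ℂ
    (LinearMap.range (left (LInf.chi ((1 : G) : G ⧸ (K : Subgroup G)))).toLinearMap)

namespace CfModule

variable {K : OpenSubgroup G}

attribute [instance] normedAddCommGroup innerProductSpace completeSpace

instance : CoeSort (CfModule K) (Type u) := ⟨carrier⟩

lemma π_left (X : CfModule K) (g : G) (f : LInf (G ⧸ (K : Subgroup G))) (ξ : X) :
    X.π g (X.left f ξ) = X.left (f.translate g) (X.π g ξ) := by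
  have := X.covariant g f 1 ξ
  simpa only [LInf.translate_one, map_one, one_apply_eq_self] using this

lemma π_right (X : CfModule K) (g : G) (f : LInf (G ⧸ (K : Subgroup G))) (ξ : X) :
    X.π g (X.right f ξ) = X.right (f.translate g) (X.π g ξ) := by
  have := X.covariant g 1 f ξ
  simpa only [LInf.translate_one, map_one, one_apply_eq_self] using this

lemma π_mul_apply (X : CfModule K) (g h : G) (ξ : X) : X.π (g * h) ξ = X.π g (X.π h ξ) := by
  rw [map_mul]; rfl

lemma π_inv_apply (X : CfModule K) (g : G) (ξ : X) : X.π g⁻¹ (X.π g ξ) = ξ := by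
  rw [← π_mul_apply, inv_mul_cancel, map_one]; rfl

lemma π_apply_inv (X : CfModule K) (g : G) (ξ : X) : X.π g (X.π g⁻¹ ξ) = ξ := by
  rw [← π_mul_apply, mul_inv_cancel, map_one]; rfl

lemma π_inner (X : CfModule K) (g : G) (ξ η : X) : inner ℂ (X.π g ξ) (X.π g η) = inner ℂ ξ η :=
  (⟨(X.π g).toLinearMap, X.norm_π g⟩ : X →ₗᵢ[ℂ] X).inner_map_map ξ η

lemma π_adjoint (X : CfModule K) (g : G) : (X.π g).adjoint = X.π g⁻¹ := by
  symm
  refine (ContinuousLinearMap.eq_adjoint_iff _ _).2 fun ξ η => ?_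
  rw [← π_inner X g, π_apply_inv]

/-- The morphisms: bounded operators intertwining the `G`-representations and the bimodule
structures. -/
def homSet (X Y : CfModule K) : Submodule ℂ (X →L[ℂ] Y) where
  carrier := {T | (∀ g ξ, T (X.π g ξ) = Y.π g (T ξ)) ∧ (∀ f ξ, T (X.left f ξ) = Y.left f (T ξ)) ∧
    ∀ f ξ, T (X.right f ξ) = Y.right f (T ξ)}
  zero_mem' := by simp
  add_mem' := by
    rintro S T ⟨h1, h2, h3⟩ ⟨h4, h5, h6⟩
    simp_all
  smul_mem' := by
    rintro c S ⟨h1, h2, h3⟩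
    simp_all

/-- Type of morphisms. -/
def Hom (X Y : CfModule K) : Type u := homSet X Y

instance (X Y : CfModule K) : AddCommGroup (Hom X Y) := inferInstanceAs (AddCommGroup (homSet X Y))
instance (X Y : CfModule K) : Module ℂ (Hom X Y) := inferInstanceAs (Module ℂ (homSet X Y))

/-- The bounded operator underlying a morphism. -/
def Hom.op {X Y : CfModule K} (T : Hom X Y) : X →L[ℂ] Y := T.1

instance : Category (CfModule K) where
  Hom := Hom
  id X := ⟨ContinuousLinearMap.id ℂ X, fun _ _ => rfl, fun _ _ => rfl, fun _ _ => rfl⟩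
  comp {X Y Z} S T := ⟨T.op ∘L S.op, fun g ξ => by
      change T.1 (S.1 _) = _; rw [S.2.1, T.2.1]; rfl, fun g ξ => by
      change T.1 (S.1 _) = _; rw [S.2.2.1, T.2.2.1]; rfl, fun g ξ => by
      change T.1 (S.1 _) = _; rw [S.2.2.2, T.2.2.2]; rfl⟩

/-- The bounded operator underlying a morphism. -/
def op {X Y : CfModule K} (T : X ⟶ Y) : X →L[ℂ] Y := Hom.op T

lemma hom_ext {X Y : CfModule K} {S T : X ⟶ Y} (h : op S = op T) : S = T := Subtype.ext h

@[simp] lemma op_comp {X Y Z : CfModule K} (S : X ⟶ Y) (T : Y ⟶ Z) : op (S ≫ T) = op T ∘L op S := rfl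
@[simp] lemma op_id (X : CfModule K) : op (𝟙 X) = ContinuousLinearMap.id ℂ X := rfl

lemma op_π {X Y : CfModule K} (T : X ⟶ Y) (g : G) (ξ : X) : op T (X.π g ξ) = Y.π g (op T ξ) :=
  T.2.1 g ξ
lemma op_left {X Y : CfModule K} (T : X ⟶ Y) (f : LInf (G ⧸ (K : Subgroup G))) (ξ : X) :
    op T (X.left f ξ) = Y.left f (op T ξ) := T.2.2.1 f ξ
lemma op_right {X Y : CfModule K} (T : X ⟶ Y) (f : LInf (G ⧸ (K : Subgroup G))) (ξ : X) :
    op T (X.right f ξ) = Y.right f (op T ξ) := T.2.2.2 f ξ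

/-- Constructor for morphisms. -/
def mkHom {X Y : CfModule K} (T : X →L[ℂ] Y) (h1 : ∀ g ξ, T (X.π g ξ) = Y.π g (T ξ))
    (h2 : ∀ f ξ, T (X.left f ξ) = Y.left f (T ξ)) (h3 : ∀ f ξ, T (X.right f ξ) = Y.right f (T ξ)) :
    X ⟶ Y := (⟨T, h1, h2, h3⟩ : homSet X Y)

@[simp] lemma op_mkHom {X Y : CfModule K} (T : X →L[ℂ] Y) (h1 h2 h3) :
    op (mkHom T h1 h2 h3 : X ⟶ Y) = T := rfl

instance : Preadditive (CfModule K) where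
  homGroup X Y := inferInstanceAs (AddCommGroup (Hom X Y))
  add_comp X Y Z f g h := hom_ext (by ext ξ; exact map_add (op h) _ _)
  comp_add X Y Z f g h := hom_ext (by ext ξ; rfl)

instance : Linear ℂ (CfModule K) where
  homModule X Y := inferInstanceAs (Module ℂ (Hom X Y))
  smul_comp X Y Z c f g := hom_ext (by ext ξ; exact map_smul (op g) _ _)
  comp_smul X Y Z f c g := hom_ext (by ext ξ; rfl)

/-- The adjoint of a morphism. -/
def dag {X Y : CfModule K} (T : X ⟶ Y) : Y ⟶ X :=
  mkHom (op T).adjoint (fun g η => ext_inner_right ℂ fun ξ => by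
      rw [ContinuousLinearMap.adjoint_inner_left, ← X.π_inner g⁻¹ _ ξ, π_inv_apply,
        ContinuousLinearMap.adjoint_inner_left, op_π, ← Y.π_inner g⁻¹, π_inv_apply])
    (fun f η => ext_inner_right ℂ fun ξ => by
      rw [ContinuousLinearMap.adjoint_inner_left, rep_inner, rep_inner,
        ContinuousLinearMap.adjoint_inner_left, op_left])
    (fun f η => ext_inner_right ℂ fun ξ => by
      rw [ContinuousLinearMap.adjoint_inner_left, rep_inner, rep_inner,
        ContinuousLinearMap.adjoint_inner_left, op_right])

/-- A unitary intertwiner gives an isomorphism. -/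
def mkIso {X Y : CfModule K} (T : X ≃ₗᵢ[ℂ] Y) (h1 : ∀ g ξ, T (X.π g ξ) = Y.π g (T ξ))
    (h2 : ∀ f ξ, T (X.left f ξ) = Y.left f (T ξ)) (h3 : ∀ f ξ, T (X.right f ξ) = Y.right f (T ξ)) :
    X ≅ Y where
  hom := mkHom (T.toContinuousLinearEquiv : X →L[ℂ] Y) h1 h2 h3
  inv := mkHom (T.symm.toContinuousLinearEquiv : Y →L[ℂ] X)
    (fun g ξ => T.injective (by
      change T (T.symm _) = T (X.π g (T.symm _))
      rw [h1, T.apply_symm_apply, T.apply_symm_apply]))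
    (fun g ξ => T.injective (by
      change T (T.symm _) = T (X.left g (T.symm _))
      rw [h2, T.apply_symm_apply, T.apply_symm_apply]))
    (fun g ξ => T.injective (by
      change T (T.symm _) = T (X.right g (T.symm _))
      rw [h3, T.apply_symm_apply, T.apply_symm_apply]))
  hom_inv_id := hom_ext (by ext ξ; exact T.symm_apply_apply ξ)
  inv_hom_id := hom_ext (by ext ξ; exact T.apply_symm_apply ξ)

@[simp] lemma mkIso_hom_op {X Y : CfModule K} (T : X ≃ₗᵢ[ℂ] Y) (h1 h2 h3) (ξ : X) :
    op (mkIso (X := X) (Y := Y) T h1 h2 h3).hom ξ = T ξ := rfl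

/-- The unit object `L²(G/K)`. -/
def unit (K : OpenSubgroup G) [IsTopologicalGroup G] : CfModule K where
  carrier := L2 (G ⧸ (K : Subgroup G))
  π := L2.permRep G _
  norm_π := L2.norm_permRep
  continuous_π := by
    have hd : DenseRange (Finsupp.linearCombination ℂ
        (fun x : G ⧸ (K : Subgroup G) => L2.delta x)) := fun ξ =>
      mem_closure_of_tendsto (L2.hasSum ξ) (Filter.Eventually.of_forall fun s =>
        (LinearMap.range (Finsupp.linearCombination ℂ
          (fun x : G ⧸ (K : Subgroup G) => L2.delta x))).sum_mem fun x _ =>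
            ⟨Finsupp.single x (ξ x), by simp⟩)
    refine continuous_orbit_of_dense _ L2.norm_permRep _ hd fun v => ?_
    induction v using Finsupp.induction_linear with
    | zero => simp only [map_zero]; exact continuous_const
    | add f g hf hg => simp only [map_add]; exact hf.add hg
    | single x c =>
      simp only [Finsupp.linearCombination_single, map_smul, L2.permRep_delta]
      refine Continuous.const_smul ?_ c
      have : DiscreteTopology (G ⧸ (K : Subgroup G)) := QuotientGroup.discreteTopology K.isOpen
      obtain ⟨h, rfl⟩ := QuotientGroup.mk_surjective x
      have h1 : Continuous fun g : G => ((g * h : G) : G ⧸ (K : Subgroup G)) :=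
        continuous_quot_mk.comp (continuous_mul_const h)
      exact (continuous_of_discreteTopology (f := fun x : G ⧸ (K : Subgroup G) => L2.delta x)).comp h1
  left := L2.mulRep _
  right := L2.mulRep _
  left_normal := L2.mulRep_normal
  right_normal := L2.mulRep_normal
  left_right_comm f₁ f₂ ξ := by rw [rep_mul_apply, rep_mul_apply, mul_comm]
  covariant g f₁ f₂ ξ := rfl
  finite_rank := by
    refine Submodule.finiteDimensional_of_le
      (S₂ := ℂ ∙ (L2.delta ((1 : G) : G ⧸ (K : Subgroup G)))) ?_
    rintro _ ⟨ξ, rfl⟩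
    change L2.mulRep _ (LInf.chi _) ξ ∈ _
    rw [L2.mulRep_chi]
    exact Submodule.smul_mem _ _ (Submodule.mem_span_singleton_self _)

lemma finite_left_chi (X : CfModule K) (x : G ⧸ (K : Subgroup G)) :
    FiniteDimensional ℂ (LinearMap.range (X.left (LInf.chi x)).toLinearMap) := by
  obtain ⟨g, rfl⟩ := QuotientGroup.mk_surjective x
  have := X.finite_rank
  refine Submodule.finiteDimensional_of_le (S₂ := (LinearMap.range
    (X.left (LInf.chi ((1 : G) : G ⧸ (K : Subgroup G)))).toLinearMap).map (X.π g).toLinearMap) ?_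
  rintro _ ⟨ξ, rfl⟩
  refine ⟨_, ⟨X.π g⁻¹ ξ, rfl⟩, ?_⟩
  change X.π g (X.left _ _) = X.left _ ξ
  rw [π_left, π_apply_inv, LInf.translate_chi, MulAction.Quotient.smul_coe, smul_eq_mul, mul_one]

lemma finite_support (X : CfModule K) (x : G ⧸ (K : Subgroup G)) :
    {y | X.left (LInf.chi x) ∘L X.right (LInf.chi y) ≠ 0}.Finite := by
  classical
  have := X.finite_left_chi x
  have h : ∀ y : {y | X.left (LInf.chi x) ∘L X.right (LInf.chi y) ≠ 0},
      ∃ ξ, X.left (LInf.chi x) (X.right (LInf.chi y.1) ξ) ≠ 0 := fun y => by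
    by_contra! hc
    exact y.2 (by ext ξ; exact hc ξ)
  choose ξ hξ using h
  have hli : LinearIndependent ℂ (fun y => (⟨_, ⟨X.right (LInf.chi y.1) (ξ y), rfl⟩⟩ :
      LinearMap.range (X.left (LInf.chi x)).toLinearMap)) := by
    refine linearIndependent_of_ne_zero_of_inner_eq_zero
      (fun y hy => hξ y (congrArg Subtype.val hy)) fun y z hyz => ?_
    change inner ℂ (X.left (LInf.chi x) (X.right (LInf.chi y.1) (ξ y)))
      (X.left (LInf.chi x) (X.right (LInf.chi z.1) (ξ z))) = 0
    rw [left_right_comm, rep_chi_inner, left_right_comm, rep_chi_chi,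
      if_neg (fun h => hyz (Subtype.ext h)), inner_zero_right]
  exact hli.finite

lemma finite_range_map {E F E' F' : Type*} [NormedAddCommGroup E] [InnerProductSpace ℂ E]
    [NormedAddCommGroup F] [InnerProductSpace ℂ F] [NormedAddCommGroup E'] [InnerProductSpace ℂ E']
    [NormedAddCommGroup F'] [InnerProductSpace ℂ F'] (S : E →L[ℂ] E') (T : F →L[ℂ] F')
    [FiniteDimensional ℂ (LinearMap.range S.toLinearMap)]
    [FiniteDimensional ℂ (LinearMap.range T.toLinearMap)] :
    FiniteDimensional ℂ (LinearMap.range (HTensor.map S T).toLinearMap) := by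
  let L : (LinearMap.range S.toLinearMap) ⊗[ℂ] (LinearMap.range T.toLinearMap) →ₗ[ℂ] HTensor E' F' :=
    (HTensor.incl E' F').toLinearMap ∘ₗ TensorProduct.mapIncl _ _
  refine Submodule.finiteDimensional_of_le (S₂ := LinearMap.range L) ?_
  rintro _ ⟨w, rfl⟩
  change HTensor.map S T w ∈ LinearMap.range L
  refine HTensor.denseRange_incl.induction_on (p := fun w => HTensor.map S T w ∈ LinearMap.range L) w
    ((Submodule.closed_of_finiteDimensional (LinearMap.range L)).preimage
      (HTensor.map S T).continuous) fun v => ?_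
  induction v with
  | zero =>
    rw [map_zero, map_zero]
    exact Submodule.zero_mem _
  | tmul x y =>
    refine ⟨⟨S x, x, rfl⟩ ⊗ₜ ⟨T y, y, rfl⟩, ?_⟩
    exact (HTensor.map_tmul S T x y).symm
  | add a b ha hb => rw [map_add, map_add]; exact Submodule.add_mem _ ha hb

lemma left_mem (X Y : CfModule K) (f : LInf (G ⧸ (K : Subgroup G))) (ζ : HTensor X Y)
    (hζ : ζ ∈ relTensor X.right Y.left) :
    ((HTensor.ampL X Y).comp X.left) f ζ ∈ relTensor X.right Y.left := fun x => by
  have := congrArg (HTensor.map (X.left f) (1 : Y →L[ℂ] Y)) (hζ x)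
  change HTensor.map _ _ (HTensor.map (X.left f) 1 ζ) = HTensor.map _ _ (HTensor.map (X.left f) 1 ζ)
  have e : X.right (LInf.chi x) ∘L X.left f = X.left f ∘L X.right (LInf.chi x) := by
    ext ξ; exact (X.left_right_comm _ _ _).symm
  simp only [HTensor.map_map, ← ContinuousLinearMap.mul_def, mul_one, one_mul] at this e ⊢
  rw [e, this]

lemma right_mem (X Y : CfModule K) (f : LInf (G ⧸ (K : Subgroup G))) (ζ : HTensor X Y)
    (hζ : ζ ∈ relTensor X.right Y.left) :
    ((HTensor.ampR X Y).comp Y.right) f ζ ∈ relTensor X.right Y.left := fun x => by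
  have := congrArg (HTensor.map (1 : X →L[ℂ] X) (Y.right f)) (hζ x)
  change HTensor.map _ _ (HTensor.map 1 (Y.right f) ζ) = HTensor.map _ _ (HTensor.map 1 (Y.right f) ζ)
  have e : Y.left (LInf.chi x) ∘L Y.right f = Y.right f ∘L Y.left (LInf.chi x) := by
    ext ξ; exact Y.left_right_comm _ _ _
  simp only [HTensor.map_map, ← ContinuousLinearMap.mul_def, mul_one, one_mul] at this e ⊢
  rw [e, this]

lemma π_mem (X Y : CfModule K) (g : G) (ζ : HTensor X Y)
    (hζ : ζ ∈ relTensor X.right Y.left) :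
    HTensor.map (X.π g) (Y.π g) ζ ∈ relTensor X.right Y.left := fun x => by
  have := congrArg (HTensor.map (X.π g) (Y.π g)) (hζ (g⁻¹ • x))
  have e1 : X.right (LInf.chi x) ∘L X.π g = X.π g ∘L X.right (LInf.chi (g⁻¹ • x)) := by
    ext ξ; change _ = X.π g (X.right _ ξ); rw [π_right, LInf.translate_chi, smul_inv_smul]; rfl
  have e2 : Y.left (LInf.chi x) ∘L Y.π g = Y.π g ∘L Y.left (LInf.chi (g⁻¹ • x)) := by
    ext ξ; change _ = Y.π g (Y.left _ ξ); rw [π_left, LInf.translate_chi, smul_inv_smul]; rfl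
  simp only [HTensor.map_map, ← ContinuousLinearMap.mul_def, mul_one, one_mul] at this e1 e2 ⊢
  rw [e1, e2, this]

lemma norm_map_π (X Y : CfModule K) (g : G) (ζ : HTensor X Y) :
    ‖HTensor.map (X.π g) (Y.π g) ζ‖ = ‖ζ‖ := by
  refine (ContinuousLinearMap.norm_map_iff_adjoint_comp_self _).2 ?_ ζ
  rw [HTensor.map_adjoint, ← HTensor.map_comp, π_adjoint, π_adjoint]
  refine HTensor.ext_clm fun x y => ?_
  rw [HTensor.map_tmul]
  change HTensor.tmul (X.π g⁻¹ (X.π g x)) (Y.π g⁻¹ (Y.π g y)) = HTensor.tmul x y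
  rw [π_inv_apply, π_inv_apply]

/-- The representation `π_X ⊗ π_Y` on the relative tensor product. -/
def tensorπ (X Y : CfModule K) :
    G →* (relTensor X.right Y.left →L[ℂ] relTensor X.right Y.left) where
  toFun := fun g => (HTensor.map (X.π g) (Y.π g)).restrict (π_mem X Y g)
  map_one' := by
    ext ζ
    change HTensor.map (X.π 1) (Y.π 1) (ζ : HTensor X Y) = ζ
    rw [map_one, map_one]
    exact congrArg (fun T : HTensor X Y →L[ℂ] HTensor X Y => T ζ) (map_one (HTensor.ampL X Y))
  map_mul' := fun g h => by
    ext ζ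
    change HTensor.map (X.π (g * h)) (Y.π (g * h)) (ζ : HTensor X Y) =
      HTensor.map (X.π g) (Y.π g) (HTensor.map (X.π h) (Y.π h) ζ)
    rw [HTensor.map_map, map_mul, map_mul]
    rfl

lemma continuous_tensorπ (X Y : CfModule K) (ζ : relTensor X.right Y.left) :
    Continuous fun g => tensorπ X Y g ζ := by
  refine continuous_induced_rng.2 ?_
  refine continuous_orbit_of_dense (fun g => HTensor.map (X.π g) (Y.π g)) (norm_map_π X Y)
    (HTensor.incl X Y) HTensor.denseRange_incl (fun v => ?_) ζ.1
  induction v with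
  | zero => simp only [map_zero]; exact continuous_const
  | tmul x y =>
    have : ∀ g, HTensor.map (X.π g) (Y.π g) (HTensor.incl X Y (x ⊗ₜ y)) =
      HTensor.tmul (X.π g x) (Y.π g y) := fun g => HTensor.map_tmul _ _ x y
    simp only [this]
    exact HTensor.continuous_tmul.comp ((X.continuous_π x).prodMk (Y.continuous_π y))
  | add a b ha hb => simp only [map_add]; exact ha.add hb

/-- The left module structure on the relative tensor product. -/
def tensorLeft (X Y : CfModule K) : LInf (G ⧸ (K : Subgroup G)) →⋆ₐ[ℂ]
    (relTensor X.right Y.left →L[ℂ] relTensor X.right Y.left) :=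
  restrictRep ((HTensor.ampL X Y).comp X.left) (relTensor X.right Y.left) (left_mem X Y)

/-- The right module structure on the relative tensor product. -/
def tensorRight (X Y : CfModule K) : LInf (G ⧸ (K : Subgroup G)) →⋆ₐ[ℂ]
    (relTensor X.right Y.left →L[ℂ] relTensor X.right Y.left) :=
  restrictRep ((HTensor.ampR X Y).comp Y.right) (relTensor X.right Y.left) (right_mem X Y)

lemma tensorLeft_normal (X Y : CfModule K) : IsNormalRep (tensorLeft X Y) :=
  (isNormalRep_ampL X.left_normal).restrict _ _

lemma tensorRight_normal (X Y : CfModule K) : IsNormalRep (tensorRight X Y) :=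
  (isNormalRep_ampR Y.right_normal).restrict _ _

lemma tensorLeft_rtmul (X Y : CfModule K) (f : LInf (G ⧸ (K : Subgroup G))) (ξ : X) (η : Y) :
    tensorLeft X Y f (rtmul X.right Y.left ξ η) = rtmul X.right Y.left (X.left f ξ) η := by
  refine Subtype.ext ?_
  have h1 := (hasSum_rtmul X.right_normal Y.left_normal ξ η).mapL
    (HTensor.map (X.left f) (1 : Y →L[ℂ] Y))
  refine h1.unique ((hasSum_rtmul X.right_normal Y.left_normal (X.left f ξ) η).congr_fun fun x => ?_)
  rw [HTensor.map_tmul, left_right_comm]; rfl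

lemma tensorRight_rtmul (X Y : CfModule K) (f : LInf (G ⧸ (K : Subgroup G))) (ξ : X) (η : Y) :
    tensorRight X Y f (rtmul X.right Y.left ξ η) = rtmul X.right Y.left ξ (Y.right f η) := by
  refine Subtype.ext ?_
  have h1 := (hasSum_rtmul X.right_normal Y.left_normal ξ η).mapL
    (HTensor.map (1 : X →L[ℂ] X) (Y.right f))
  refine h1.unique ((hasSum_rtmul X.right_normal Y.left_normal ξ (Y.right f η)).congr_fun fun x => ?_)
  rw [HTensor.map_tmul, left_right_comm]; rfl

lemma tensorπ_rtmul (X Y : CfModule K) (g : G) (ξ : X) (η : Y) :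
    tensorπ X Y g (rtmul X.right Y.left ξ η) = rtmul X.right Y.left (X.π g ξ) (Y.π g η) := by
  refine Subtype.ext ?_
  have h1 := (hasSum_rtmul X.right_normal Y.left_normal ξ η).mapL (HTensor.map (X.π g) (Y.π g))
  refine h1.unique ?_
  have h2 := hasSum_rtmul X.right_normal Y.left_normal (X.π g ξ) (Y.π g η)
  refine ((MulAction.toPerm g : Equiv.Perm (G ⧸ (K : Subgroup G))).hasSum_iff.2 h2).congr_fun
    fun x => ?_
  rw [HTensor.map_tmul, π_right, π_left, LInf.translate_chi]
  rfl

lemma finite_tensor (X Y : CfModule K) : FiniteDimensional ℂ (LinearMap.range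
    (tensorLeft X Y (LInf.chi ((1 : G) : G ⧸ (K : Subgroup G)))).toLinearMap) := by
  classical
  set o : G ⧸ (K : Subgroup G) := ((1 : G) : G ⧸ (K : Subgroup G))
  set s := (X.finite_support o).toFinset with hs
  let P : G ⧸ (K : Subgroup G) → (HTensor X Y →L[ℂ] HTensor X Y) := fun x =>
    HTensor.map (X.left (LInf.chi o) ∘L X.right (LInf.chi x)) (Y.left (LInf.chi x))
  have hfin : ∀ x, FiniteDimensional ℂ (LinearMap.range (P x).toLinearMap) := fun x => by
    have := Y.finite_left_chi x
    have := X.finite_left_chi o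
    have : FiniteDimensional ℂ (LinearMap.range
        (X.left (LInf.chi o) ∘L X.right (LInf.chi x)).toLinearMap) :=
      Submodule.finiteDimensional_of_le (S₂ := LinearMap.range (X.left (LInf.chi o)).toLinearMap)
        (by rintro _ ⟨ξ, rfl⟩; exact ⟨X.right (LInf.chi x) ξ, rfl⟩)
    exact finite_range_map _ _
  let V : Submodule ℂ (HTensor X Y) := s.sup fun x => LinearMap.range (P x).toLinearMap
  have hV : FiniteDimensional ℂ V := Submodule.finiteDimensional_finset_sup s _
  let R := LinearMap.range (tensorLeft X Y (LInf.chi o)).toLinearMap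
  have hR : R.map (relTensor X.right Y.left).subtype ≤ V := by
    rintro _ ⟨_, ⟨ζ, rfl⟩, rfl⟩
    have h1 := (isNormalRep_ampL (W' := Y) X.right_normal (ζ : HTensor X Y)).mapL
      (HTensor.map (X.left (LInf.chi o)) (1 : Y →L[ℂ] Y))
    have h2 : ∀ x, HTensor.map (X.left (LInf.chi o)) (1 : Y →L[ℂ] Y)
        (((HTensor.ampL X Y).comp X.right) (LInf.chi x) (ζ : HTensor X Y)) = P x ζ := fun x => by
      have h3 : ((HTensor.ampL X Y).comp X.right) (LInf.chi x) (ζ : HTensor X Y) =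
          HTensor.map (X.right (LInf.chi x)) (Y.left (LInf.chi x)) (ζ : HTensor X Y) := by
        have h4 : ((HTensor.ampL X Y).comp X.right) (LInf.chi x) (ζ : HTensor X Y) =
          ((HTensor.ampL X Y).comp X.right) (LInf.chi x)
            (((HTensor.ampL X Y).comp X.right) (LInf.chi x) (ζ : HTensor X Y)) := by
          rw [rep_chi_chi, if_pos rfl]
        rw [h4]
        have h5 : ((HTensor.ampL X Y).comp X.right) (LInf.chi x) (ζ : HTensor X Y) =
          HTensor.map 1 (Y.left (LInf.chi x)) (ζ : HTensor X Y) := ζ.2 x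
        rw [h5]
        change HTensor.map (X.right (LInf.chi x)) 1 _ = _
        simp only [HTensor.map_map, ← ContinuousLinearMap.mul_def, mul_one, one_mul]
      rw [h3, HTensor.map_map]
      rfl
    have h3 : ∀ x ∉ s, P x ζ = 0 := fun x hx => by
      have : X.left (LInf.chi o) ∘L X.right (LInf.chi x) = 0 := by
        by_contra hc
        exact hx ((X.finite_support o).mem_toFinset.2 hc)
      simp only [P, this]
      have h0 : HTensor.map (0 : X →L[ℂ] X) (Y.left (LInf.chi x)) = 0 :=
        HTensor.ext_clm (by simp [HTensor.tmul_zero_left])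
      rw [h0]; rfl
    simp only [h2] at h1
    have h4 := h1.unique (hasSum_sum_of_ne_finset_zero h3)
    change HTensor.map (X.left (LInf.chi o)) (1 : Y →L[ℂ] Y) (ζ : HTensor X Y) ∈ V
    rw [h4]
    exact V.sum_mem fun x hx => Finset.le_sup (f := fun x => LinearMap.range (P x).toLinearMap) hx
      ⟨(ζ : HTensor X Y), rfl⟩
  have hfR : FiniteDimensional ℂ (R.map (relTensor X.right Y.left).subtype) :=
    Submodule.finiteDimensional_of_le hR
  exact LinearEquiv.finiteDimensional (R.equivMapOfInjective _
    (Submodule.subtype_injective _)).symm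

/-- The tensor product `X ⊗_{L^∞(G/K)} Y`, with the representation `π_X ⊗ π_Y` of `G`, the left
module structure of `X` and the right module structure of `Y`. -/
def tensor (X Y : CfModule K) : CfModule K where
  carrier := relTensor X.right Y.left
  π := tensorπ X Y
  norm_π g ξ := norm_map_π X Y g ξ
  continuous_π := continuous_tensorπ X Y
  left := tensorLeft X Y
  right := tensorRight X Y
  left_normal := tensorLeft_normal X Y
  right_normal := tensorRight_normal X Y
  left_right_comm f₁ f₂ ζ := Subtype.ext (by
    change HTensor.map (X.left f₁) 1 (HTensor.map 1 (Y.right f₂) (ζ : HTensor X Y)) =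
      HTensor.map 1 (Y.right f₂) (HTensor.map (X.left f₁) 1 (ζ : HTensor X Y))
    simp only [HTensor.map_map, ← ContinuousLinearMap.mul_def, mul_one, one_mul])
  covariant g f₁ f₂ ζ := Subtype.ext (by
    change HTensor.map (X.π g) (Y.π g)
        (HTensor.map (X.left f₁) 1 (HTensor.map 1 (Y.right f₂) (ζ : HTensor X Y))) =
      HTensor.map (X.left (f₁.translate g)) 1 (HTensor.map 1 (Y.right (f₂.translate g))
        (HTensor.map (X.π g) (Y.π g) (ζ : HTensor X Y)))
    have e1 : X.π g * X.left f₁ = X.left (f₁.translate g) * X.π g := by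
      ext ξ; exact π_left X g f₁ ξ
    have e2 : Y.π g * Y.right f₂ = Y.right (f₂.translate g) * Y.π g := by
      ext ξ; exact π_right Y g f₂ ξ
    simp only [HTensor.map_map, ← ContinuousLinearMap.mul_def, mul_one, one_mul, e1, e2])
  finite_rank := finite_tensor X Y

end CfModule
end Category

/-! ### The monoidal structure of `C_f(K < G)` -/

lemma clm_intertwine {E F : Type*} [NormedAddCommGroup E] [InnerProductSpace ℂ E]
    [NormedAddCommGroup F] [InnerProductSpace ℂ F] {M : E →L[ℂ] F} {A : E →L[ℂ] E} {B : F →L[ℂ] F}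
    (h : M ∘L A = B ∘L M) (v : E) : M (A v) = B (M v) := DFunLike.congr_fun h v

section DoubleSum

variable {X Y W : Type*} [NormedAddCommGroup W] [InnerProductSpace ℂ W] [CompleteSpace W]

lemma IsNormalRep.hasSum_sq {σ : LInf X →⋆ₐ[ℂ] (W →L[ℂ] W)} (h : IsNormalRep σ) (w : W) :
    HasSum (fun x => ‖σ (LInf.chi x) w‖ ^ 2) (‖w‖ ^ 2) := by
  classical
  have h1 := (h w).mapL (innerSL ℂ w)
  have h2 : ∀ x, innerSL ℂ w (σ (LInf.chi x) w) = ((‖σ (LInf.chi x) w‖ ^ 2 : ℝ) : ℂ) := by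
    intro x
    have := inner_self_eq_norm_sq_to_K (𝕜 := ℂ) (σ (LInf.chi x) w)
    rw [rep_chi_inner, rep_chi_chi, if_pos rfl] at this
    rw [innerSL_apply_apply, this]; norm_cast
  have h3 : innerSL ℂ w w = ((‖w‖ ^ 2 : ℝ) : ℂ) := by
    rw [innerSL_apply_apply, inner_self_eq_norm_sq_to_K (𝕜 := ℂ) w]; norm_cast
  simp only [h2, h3] at h1
  exact_mod_cast h1

variable {σ : LInf X →⋆ₐ[ℂ] (W →L[ℂ] W)} {τ : LInf Y →⋆ₐ[ℂ] (W →L[ℂ] W)}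

lemma summable_sq_prod (hσ : IsNormalRep σ) (hτ : IsNormalRep τ)
    (hc : ∀ f g w, σ f (τ g w) = τ g (σ f w)) (w : W) :
    Summable fun p : X × Y => ‖σ (LInf.chi p.1) (τ (LInf.chi p.2) w)‖ ^ 2 := by
  refine (summable_prod_of_nonneg (fun p => by positivity)).2 ⟨fun x => ?_, ?_⟩
  · simp only [hc]; exact (hτ.hasSum_sq _).summable
  · simp only [hc, (hτ.hasSum_sq _).tsum_eq]; exact (hσ.hasSum_sq w).summable

lemma summable_mul_inner_mul (hσ : IsNormalRep σ) (hτ : IsNormalRep τ)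
    (hc : ∀ f g w, σ f (τ g w) = τ g (σ f w)) (w w' : W) (a : X → ℂ) (b : Y → ℂ) (A B : ℝ)
    (ha : ∀ x, ‖a x‖ ≤ A) (hb : ∀ y, ‖b y‖ ≤ B) :
    Summable fun p : X × Y =>
      a p.1 * inner ℂ w (σ (LInf.chi p.1) (τ (LInf.chi p.2) w')) * b p.2 := by
  classical
  have hs := ((summable_sq_prod hσ hτ hc w).add (summable_sq_prod hσ hτ hc w')).mul_left (A * B)
  refine Summable.of_norm_bounded hs fun p => ?_
  have h1 : inner ℂ w (σ (LInf.chi p.1) (τ (LInf.chi p.2) w')) =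
      inner ℂ (σ (LInf.chi p.1) (τ (LInf.chi p.2) w)) (σ (LInf.chi p.1) (τ (LInf.chi p.2) w')) := by
    rw [rep_chi_inner, rep_chi_chi, if_pos rfl, hc (LInf.chi p.1) _ w', rep_chi_inner, rep_chi_chi,
      if_pos rfl]
  have h2 := norm_inner_le_norm (𝕜 := ℂ) (σ (LInf.chi p.1) (τ (LInf.chi p.2) w))
    (σ (LInf.chi p.1) (τ (LInf.chi p.2) w'))
  rw [norm_mul, norm_mul, h1]
  have hA : 0 ≤ A := (norm_nonneg _).trans (ha p.1)
  set s := ‖σ (LInf.chi p.1) (τ (LInf.chi p.2) w)‖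
  set t := ‖σ (LInf.chi p.1) (τ (LInf.chi p.2) w')‖
  have h3 : ‖(inner ℂ (σ (LInf.chi p.1) (τ (LInf.chi p.2) w))
    (σ (LInf.chi p.1) (τ (LInf.chi p.2) w')) : ℂ)‖ ≤ s ^ 2 + t ^ 2 := by
    nlinarith [sq_nonneg (s - t), sq_nonneg s, sq_nonneg t]
  calc _ ≤ A * (s ^ 2 + t ^ 2) * B := by
        gcongr
        · exact ha _
        · exact hb _
    _ = _ := by ring

end DoubleSum

/-- A square-summable function is bounded. -/
def L2.toLInf (X : Type*) : L2 X →ₗ[ℂ] LInf X where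
  toFun ξ := ⟨ξ, (lp.memℓp ξ).of_exponent_ge le_top⟩
  map_add' _ _ := rfl
  map_smul' _ _ := rfl

@[simp] lemma L2.toLInf_apply {X : Type*} (ξ : L2 X) (x : X) : L2.toLInf X ξ x = ξ x := rfl

lemma L2.toLInf_delta {X : Type*} (x : X) : L2.toLInf X (L2.delta x) = LInf.chi x := by
  classical
  refine LInf.ext fun y => ?_
  rw [L2.toLInf_apply, L2.delta_apply, LInf.chi_apply]

namespace CfModule

variable {G : Type u} [Group G] [TopologicalSpace G] {K : OpenSubgroup G}

/-- The class of an elementary tensor in the relative tensor product. -/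
def tm {X Y : CfModule K} (ξ : X) (η : Y) : tensor X Y := rtmul X.right Y.left ξ η

/-- The linear map from the algebraic tensor product to the relative tensor product. -/
def tmₗ (X Y : CfModule K) : X ⊗[ℂ] Y →ₗ[ℂ] tensor X Y := rtmulₗ X.right Y.left

lemma tmₗ_tmul {X Y : CfModule K} (ξ : X) (η : Y) : tmₗ X Y (ξ ⊗ₜ η) = tm ξ η := rfl

lemma denseRange_tmₗ (X Y : CfModule K) : DenseRange (tmₗ X Y) := denseRange_rtmulₗ _ _

/-- The bilinear map `tm`, as a continuous map of the first variable. -/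
def tmL {X Y : CfModule K} (η : Y) : X →L[ℂ] tensor X Y :=
  (relTensor X.right Y.left).orthogonalProjectionOnto ∘L
    (HTensor.incl X Y).toContinuousLinearMap ∘L (TensorProduct.mkL ℂ X Y).flip η

/-- The bilinear map `tm`, as a continuous map of the second variable. -/
def tmR {X Y : CfModule K} (ξ : X) : Y →L[ℂ] tensor X Y :=
  (relTensor X.right Y.left).orthogonalProjectionOnto ∘L
    (HTensor.incl X Y).toContinuousLinearMap ∘L TensorProduct.mkL ℂ X Y ξ

lemma tmL_apply {X Y : CfModule K} (ξ : X) (η : Y) : tmL η ξ = tm ξ η := rfl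
lemma tmR_apply {X Y : CfModule K} (ξ : X) (η : Y) : tmR ξ η = tm ξ η := rfl

section
variable {X Y Z : CfModule K} {W : Type*} [NormedAddCommGroup W] [InnerProductSpace ℂ W]

lemma clm_ext {A B : tensor X Y →L[ℂ] W} (h : ∀ ξ η, A (tm ξ η) = B (tm ξ η)) : A = B :=
  relTensor_ext_clm h

lemma clm_ext_left {A B : tensor (tensor X Y) Z →L[ℂ] W}
    (h : ∀ ξ η ζ, A (tm (tm ξ η) ζ) = B (tm (tm ξ η) ζ)) : A = B :=
  clm_ext fun v ζ => by
    have : A ∘L tmL ζ = B ∘L tmL ζ := clm_ext fun ξ η => h ξ η ζ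
    exact DFunLike.congr_fun this v

lemma clm_ext_left4 {Z' : CfModule K} {A B : tensor (tensor (tensor X Y) Z) Z' →L[ℂ] W}
    (h : ∀ ξ η ζ ζ', A (tm (tm (tm ξ η) ζ) ζ') = B (tm (tm (tm ξ η) ζ) ζ')) : A = B :=
  clm_ext fun v ζ' => by
    have : A ∘L tmL ζ' = B ∘L tmL ζ' := clm_ext_left fun ξ η ζ => h ξ η ζ ζ'
    exact DFunLike.congr_fun this v

lemma hom_ext_tm {A B : tensor X Y ⟶ Z} (h : ∀ ξ η, op A (tm ξ η) = op B (tm ξ η)) : A = B :=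
  hom_ext (clm_ext h)

lemma tm_π (g : G) (ξ : X) (η : Y) : (tensor X Y).π g (tm ξ η) = tm (X.π g ξ) (Y.π g η) :=
  tensorπ_rtmul X Y g ξ η
lemma tm_left (f) (ξ : X) (η : Y) : (tensor X Y).left f (tm ξ η) = tm (X.left f ξ) η :=
  tensorLeft_rtmul X Y f ξ η
lemma tm_right (f) (ξ : X) (η : Y) : (tensor X Y).right f (tm ξ η) = tm ξ (Y.right f η) :=
  tensorRight_rtmul X Y f ξ η

lemma tm_inner (ξ ξ' : X) (η η' : Y) :
    HasSum (fun x => inner ℂ ξ (X.right (LInf.chi x) ξ') * inner ℂ η (Y.left (LInf.chi x) η'))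
      (inner ℂ (tm ξ η) (tm ξ' η')) := inner_rtmul X.right_normal Y.left_normal ξ ξ' η η'

lemma tm_balanced (f : LInf (G ⧸ (K : Subgroup G))) (ξ : X) (η : Y) :
    tm (X.right f ξ) η = tm ξ (Y.left f η) := by
  refine Subtype.ext ?_
  have h1 := hasSum_rtmul X.right_normal Y.left_normal (X.right f ξ) η
  refine h1.unique ((hasSum_rtmul X.right_normal Y.left_normal ξ (Y.left f η)).congr_fun
    fun x => ?_)
  rw [rep_chi_apply, rep_chi_apply, HTensor.tmul_smul_left, HTensor.tmul_smul_right]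

end

/-- The tensor product of morphisms. -/
def tensorHom' {X X' Y Y' : CfModule K} (S : X ⟶ X') (T : Y ⟶ Y') : tensor X Y ⟶ tensor X' Y' :=
  let M : tensor X Y →L[ℂ] tensor X' Y' := relTensorMap X.right Y.left X'.right Y'.left (op S) (op T)
    (op_right S) (op_left T)
  have hM : ∀ ξ η, M (tm ξ η) = tm (op S ξ) (op T η) := fun ξ η =>
    relTensorMap_rtmul X.right_normal Y.left_normal X'.right_normal Y'.left_normal _ _ _ _ ξ η
  mkHom M
    (fun g => clm_intertwine (M := M) (clm_ext fun ξ η => by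
      simp only [ContinuousLinearMap.comp_apply, tm_π, hM, op_π]))
    (fun g => clm_intertwine (M := M) (clm_ext fun ξ η => by
      simp only [ContinuousLinearMap.comp_apply, tm_left, hM, op_left]))
    (fun g => clm_intertwine (M := M) (clm_ext fun ξ η => by
      simp only [ContinuousLinearMap.comp_apply, tm_right, hM, op_right]))

@[simp] lemma tensorHom'_tm {X X' Y Y' : CfModule K} (S : X ⟶ X') (T : Y ⟶ Y') (ξ : X) (η : Y) :
    op (tensorHom' S T) (tm ξ η) = tm (op S ξ) (op T η) :=
  relTensorMap_rtmul X.right_normal Y.left_normal X'.right_normal Y'.left_normal (op S) (op T)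
    (op_right S) (op_left T) ξ η

lemma eq_top_of_dense {X Y : CfModule K} {V : Type*} (d : V → X) (hd : DenseRange d)
    (S : Submodule ℂ (tensor X Y)) (hS : IsClosed (S : Set (tensor X Y)))
    (h : ∀ v η, tm (d v) η ∈ S) (w : tensor X Y) : w ∈ S := by
  refine (denseRange_tmₗ X Y).induction_on (p := (· ∈ S)) w hS fun v => ?_
  induction v with
  | zero => rw [map_zero]; exact S.zero_mem
  | tmul ξ η =>
    exact hd.induction_on (p := fun ξ => tmL η ξ ∈ S) ξ (hS.preimage (tmL η).continuous)
      fun v => h v η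
  | add a b ha hb => rw [map_add]; exact S.add_mem ha hb

lemma eq_top_of_dense' {X Y : CfModule K} {V : Type*} (d : V → Y) (hd : DenseRange d)
    (S : Submodule ℂ (tensor X Y)) (hS : IsClosed (S : Set (tensor X Y)))
    (h : ∀ v ξ, tm ξ (d v) ∈ S) (w : tensor X Y) : w ∈ S := by
  refine (denseRange_tmₗ X Y).induction_on (p := (· ∈ S)) w hS fun v => ?_
  induction v with
  | zero => rw [map_zero]; exact S.zero_mem
  | tmul ξ η =>
    exact hd.induction_on (p := fun η => tmR ξ η ∈ S) η (hS.preimage (tmR ξ).continuous)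
      fun v => h v ξ
  | add a b ha hb => rw [map_add]; exact S.add_mem ha hb

section Associator

variable (X Y Z : CfModule K)

/-- The map `(ξ ⊗ η) ⊗ ζ ↦ (ξ ⊗ η) ⊗ ζ`. -/
def assocL : (X ⊗[ℂ] Y) ⊗[ℂ] Z →ₗ[ℂ] tensor (tensor X Y) Z :=
  tmₗ (tensor X Y) Z ∘ₗ (tmₗ X Y).rTensor Z

/-- The map `(ξ ⊗ η) ⊗ ζ ↦ ξ ⊗ (η ⊗ ζ)`. -/
def assocR : (X ⊗[ℂ] Y) ⊗[ℂ] Z →ₗ[ℂ] tensor X (tensor Y Z) :=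
  tmₗ X (tensor Y Z) ∘ₗ (tmₗ Y Z).lTensor X ∘ₗ (TensorProduct.assoc ℂ X Y Z).toLinearMap

lemma denseRange_assocL : DenseRange (assocL X Y Z) := by
  let S := (LinearMap.range (assocL X Y Z)).topologicalClosure
  refine fun w => eq_top_of_dense (tmₗ X Y) (denseRange_tmₗ X Y) S
    (Submodule.isClosed_topologicalClosure _) (fun v ζ => ?_) w
  exact Submodule.le_topologicalClosure _ ⟨v ⊗ₜ ζ, rfl⟩

lemma denseRange_assocR : DenseRange (assocR X Y Z) := by
  let S := (LinearMap.range (assocR X Y Z)).topologicalClosure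
  refine fun w => eq_top_of_dense' (tmₗ Y Z) (denseRange_tmₗ Y Z) S
    (Submodule.isClosed_topologicalClosure _) (fun v ξ => ?_) w
  refine Submodule.le_topologicalClosure _ ⟨(TensorProduct.assoc ℂ X Y Z).symm (ξ ⊗ₜ v), ?_⟩
  change tmₗ X (tensor Y Z) ((tmₗ Y Z).lTensor X (TensorProduct.assoc ℂ X Y Z
    ((TensorProduct.assoc ℂ X Y Z).symm (ξ ⊗ₜ v)))) = _
  rw [LinearEquiv.apply_symm_apply]
  rfl

variable {X Y Z}

lemma inner_tm_tm (ξ ξ' : X) (η η' : Y) (ζ ζ' : Z) :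
    inner ℂ (tm (tm ξ η) ζ) (tm (tm ξ' η') ζ') = inner ℂ (tm ξ (tm η ζ)) (tm ξ' (tm η' ζ')) := by
  have hs := summable_mul_inner_mul Y.left_normal Y.right_normal Y.left_right_comm η η'
    (fun x => inner ℂ ξ (X.right (LInf.chi x) ξ')) (fun y => inner ℂ ζ (Z.left (LInf.chi y) ζ'))
    (‖ξ‖ * ‖ξ'‖) (‖ζ‖ * ‖ζ'‖) (fun x => (norm_inner_le_norm _ _).trans (by
      gcongr; simpa using norm_rep_sum_le X.right {x} ξ')) (fun y => (norm_inner_le_norm _ _).trans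
      (by gcongr; simpa using norm_rep_sum_le Z.left {y} ζ'))
  have h1 := tm_inner (tm ξ η) (tm ξ' η') ζ ζ'
  have h2 := tm_inner ξ ξ' (tm η ζ) (tm η' ζ')
  simp only [tm_right, tm_left] at h1 h2
  rw [← h1.tsum_eq, ← h2.tsum_eq]
  have h3 : ∀ y, inner ℂ (tm ξ η) (tm ξ' (Y.right (LInf.chi y) η')) *
      inner ℂ ζ (Z.left (LInf.chi y) ζ') = ∑' x, inner ℂ ξ (X.right (LInf.chi x) ξ') *
      inner ℂ η (Y.left (LInf.chi x) (Y.right (LInf.chi y) η')) *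
      inner ℂ ζ (Z.left (LInf.chi y) ζ') := fun y => by
    rw [tsum_mul_right, (tm_inner ξ ξ' η (Y.right (LInf.chi y) η')).tsum_eq]
  have h4 : ∀ x, inner ℂ ξ (X.right (LInf.chi x) ξ') *
      inner ℂ (tm η ζ) (tm (Y.left (LInf.chi x) η') ζ') = ∑' y,
      inner ℂ ξ (X.right (LInf.chi x) ξ') *
      inner ℂ η (Y.left (LInf.chi x) (Y.right (LInf.chi y) η')) *
      inner ℂ ζ (Z.left (LInf.chi y) ζ') := fun x => by
    simp only [mul_assoc]
    rw [tsum_mul_left, ← (tm_inner η (Y.left (LInf.chi x) η') ζ ζ').tsum_eq]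
    simp only [left_right_comm]
  simp only [h3, h4]
  exact hs.tsum_comm

lemma inner_assoc (v w : (X ⊗[ℂ] Y) ⊗[ℂ] Z) :
    inner ℂ (assocL X Y Z v) (assocL X Y Z w) = inner ℂ (assocR X Y Z v) (assocR X Y Z w) := by
  induction v with
  | zero => simp only [map_zero, inner_zero_left]
  | add a b ha hb => simp only [map_add, inner_add_left, ha, hb]
  | tmul v ζ =>
  induction v with
  | zero => simp only [TensorProduct.zero_tmul, map_zero, inner_zero_left]
  | add a b ha hb => simp only [TensorProduct.add_tmul, map_add, inner_add_left, ha, hb]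
  | tmul ξ η =>
  induction w with
  | zero => simp only [map_zero, inner_zero_right]
  | add a b ha hb => simp only [map_add, inner_add_right, ha, hb]
  | tmul w ζ' =>
  induction w with
  | zero => simp only [TensorProduct.zero_tmul, map_zero, inner_zero_right]
  | add a b ha hb => simp only [TensorProduct.add_tmul, map_add, inner_add_right, ha, hb]
  | tmul ξ' η' => exact inner_tm_tm ξ ξ' η η' ζ ζ'

variable (X Y Z) in
/-- The unitary `(X ⊗ Y) ⊗ Z ≃ X ⊗ (Y ⊗ Z)`. -/
def assocU : tensor (tensor X Y) Z ≃ₗᵢ[ℂ] tensor X (tensor Y Z) :=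
  isoOfInner (assocL X Y Z) (assocR X Y Z) (denseRange_assocL X Y Z) (denseRange_assocR X Y Z)
    (norm_eq_of_inner_eq _ _ inner_assoc)

lemma assocU_tm (ξ : X) (η : Y) (ζ : Z) : assocU X Y Z (tm (tm ξ η) ζ) = tm ξ (tm η ζ) :=
  isoOfInner_apply (assocL X Y Z) (assocR X Y Z) _ _ _ ((ξ ⊗ₜ η) ⊗ₜ ζ)

/-- The associator. -/
def assoc (X Y Z : CfModule K) : tensor (tensor X Y) Z ≅ tensor X (tensor Y Z) :=
  let M : tensor (tensor X Y) Z →L[ℂ] tensor X (tensor Y Z) :=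
    (assocU X Y Z).toContinuousLinearEquiv
  have hM : ∀ ξ η ζ, M (tm (tm ξ η) ζ) = tm ξ (tm η ζ) := assocU_tm
  mkIso (assocU X Y Z)
    (fun g => clm_intertwine (M := M) (clm_ext_left
      fun ξ η ζ => by simp only [ContinuousLinearMap.comp_apply, tm_π, hM]))
    (fun g => clm_intertwine (M := M) (clm_ext_left
      fun ξ η ζ => by simp only [ContinuousLinearMap.comp_apply, tm_left, hM]))
    (fun g => clm_intertwine (M := M) (clm_ext_left
      fun ξ η ζ => by simp only [ContinuousLinearMap.comp_apply, tm_right, hM]))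

@[simp] lemma assoc_tm (ξ : X) (η : Y) (ζ : Z) :
    op (assoc X Y Z).hom (tm (tm ξ η) ζ) = tm ξ (tm η ζ) := assocU_tm ξ η ζ

end Associator

section Unitors

variable [IsTopologicalGroup G] (X : CfModule K)

/-- The map `a ⊗ ξ ↦ a · ξ`. -/
def lunitF : unit K ⊗[ℂ] X →ₗ[ℂ] X :=
  TensorProduct.lift ((ContinuousLinearMap.coeLM ℂ ∘ₗ X.left.toAlgHom.toLinearMap) ∘ₗ
    L2.toLInf (G ⧸ (K : Subgroup G)))

/-- The map `ξ ⊗ a ↦ ξ · a`. -/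
def runitF : X ⊗[ℂ] unit K →ₗ[ℂ] X :=
  TensorProduct.lift ((ContinuousLinearMap.coeLM ℂ ∘ₗ X.right.toAlgHom.toLinearMap) ∘ₗ
    L2.toLInf (G ⧸ (K : Subgroup G))).flip

lemma lunitF_tmul (a : unit K) (ξ : X) : lunitF X (a ⊗ₜ ξ) = X.left (L2.toLInf _ a) ξ := rfl
lemma runitF_tmul (a : unit K) (ξ : X) : runitF X (ξ ⊗ₜ a) = X.right (L2.toLInf _ a) ξ := rfl

lemma denseRange_lunitF : DenseRange (lunitF X) := fun ξ =>
  X.left_normal.denseRange (S := LinearMap.range (lunitF X)) fun x =>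
    ⟨(show unit K from L2.delta x) ⊗ₜ ξ, congrArg (fun f => X.left f ξ) (L2.toLInf_delta x)⟩

lemma denseRange_runitF : DenseRange (runitF X) := fun ξ =>
  X.right_normal.denseRange (S := LinearMap.range (runitF X)) fun x =>
    ⟨ξ ⊗ₜ (show unit K from L2.delta x), congrArg (fun f => X.right f ξ) (L2.toLInf_delta x)⟩

lemma unit_inner_chi {A : Type*} (a b : L2 A) (x : A) :
    inner ℂ a (L2.mulRep _ (LInf.chi x) b) = star (L2.toLInf _ a x) * L2.toLInf _ b x := by
  classical
  have : inner ℂ a (L2.delta x) = star (a x) := by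
    have := lp.inner_single_right (𝕜 := ℂ) x (1 : ℂ) a
    simp only [RCLike.inner_apply, one_mul] at this
    convert! this using 2
  rw [L2.mulRep_chi, inner_smul_right, this, mul_comm]
  rfl

lemma inner_rep_rep {A W : Type*} [NormedAddCommGroup W] [InnerProductSpace ℂ W] [CompleteSpace W]
    {σ : LInf A →⋆ₐ[ℂ] (W →L[ℂ] W)} (h : IsNormalRep σ) (a b : LInf A) (ξ η : W) :
    HasSum (fun x => star (a x) * b x * inner ℂ ξ (σ (LInf.chi x) η))
      (inner ℂ (σ a ξ) (σ b η)) := by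
  have h1 := (h (σ b η)).mapL (innerSL ℂ (σ a ξ))
  refine h1.congr_fun fun x => ?_
  rw [innerSL_apply_apply, rep_chi_apply, inner_smul_right, rep_inner, rep_apply_chi,
    inner_smul_right, lp.star_apply]
  ring

lemma inner_lunit (v w : unit K ⊗[ℂ] X) :
    inner ℂ (tmₗ (unit K) X v) (tmₗ (unit K) X w) = inner ℂ (lunitF X v) (lunitF X w) := by
  induction v with
  | zero => simp only [map_zero, inner_zero_left]
  | add a b ha hb => simp only [map_add, inner_add_left, ha, hb]
  | tmul a ξ =>
  induction w with
  | zero => simp only [map_zero, inner_zero_right]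
  | add a b ha hb => simp only [map_add, inner_add_right, ha, hb]
  | tmul b η =>
    refine (tm_inner a b ξ η).unique ((inner_rep_rep X.left_normal (L2.toLInf _ a) (L2.toLInf _ b)
      ξ η).congr_fun fun x => ?_)
    exact congrArg (· * inner ℂ ξ (X.left (LInf.chi x) η))
      (unit_inner_chi (a : L2 (G ⧸ (K : Subgroup G))) b x)

lemma inner_runit (v w : X ⊗[ℂ] unit K) :
    inner ℂ (tmₗ X (unit K) v) (tmₗ X (unit K) w) = inner ℂ (runitF X v) (runitF X w) := by
  induction v with
  | zero => simp only [map_zero, inner_zero_left]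
  | add a b ha hb => simp only [map_add, inner_add_left, ha, hb]
  | tmul ξ a =>
  induction w with
  | zero => simp only [map_zero, inner_zero_right]
  | add a b ha hb => simp only [map_add, inner_add_right, ha, hb]
  | tmul η b =>
    refine (tm_inner ξ η a b).unique ((inner_rep_rep X.right_normal (L2.toLInf _ a) (L2.toLInf _ b)
      ξ η).congr_fun fun x => ?_)
    exact (mul_comm _ _).trans (congrArg (· * inner ℂ ξ (X.right (LInf.chi x) η))
      (unit_inner_chi (a : L2 (G ⧸ (K : Subgroup G))) b x))

/-- The unitary `L²(G/K) ⊗ X ≃ X`. -/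
def lunitU : tensor (unit K) X ≃ₗᵢ[ℂ] X :=
  isoOfInner (tmₗ (unit K) X) (lunitF X) (denseRange_tmₗ _ _) (denseRange_lunitF X)
    (norm_eq_of_inner_eq _ _ (inner_lunit X))

/-- The unitary `X ⊗ L²(G/K) ≃ X`. -/
def runitU : tensor X (unit K) ≃ₗᵢ[ℂ] X :=
  isoOfInner (tmₗ X (unit K)) (runitF X) (denseRange_tmₗ _ _) (denseRange_runitF X)
    (norm_eq_of_inner_eq _ _ (inner_runit X))

variable {X}

lemma lunitU_tm (a : unit K) (ξ : X) : lunitU X (tm a ξ) = X.left (L2.toLInf _ a) ξ :=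
  isoOfInner_apply (tmₗ (unit K) X) (lunitF X) _ _ _ (a ⊗ₜ ξ)

lemma runitU_tm (a : unit K) (ξ : X) : runitU X (tm ξ a) = X.right (L2.toLInf _ a) ξ :=
  isoOfInner_apply (tmₗ X (unit K)) (runitF X) _ _ _ (ξ ⊗ₜ a)

lemma toLInf_π (g : G) (a : unit K) :
    L2.toLInf (G ⧸ (K : Subgroup G)) ((unit K).π g a) = (L2.toLInf _ a).translate g := rfl
lemma toLInf_left (f : LInf (G ⧸ (K : Subgroup G))) (a : unit K) :
    L2.toLInf (G ⧸ (K : Subgroup G)) ((unit K).left f a) = f * L2.toLInf _ a := rfl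
lemma toLInf_right (f : LInf (G ⧸ (K : Subgroup G))) (a : unit K) :
    L2.toLInf (G ⧸ (K : Subgroup G)) ((unit K).right f a) = f * L2.toLInf _ a := rfl

variable (X)

/-- The left unitor. -/
def lunit : tensor (unit K) X ≅ X :=
  let M : tensor (unit K) X →L[ℂ] X := (lunitU X).toContinuousLinearEquiv
  have hM : ∀ a ξ, M (tm a ξ) = X.left (L2.toLInf _ a) ξ := lunitU_tm
  mkIso (lunitU X)
    (fun g => clm_intertwine (M := M) (clm_ext fun a ξ => by
      simp only [ContinuousLinearMap.comp_apply, tm_π, hM, toLInf_π, π_left]))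
    (fun g => clm_intertwine (M := M) (clm_ext fun a ξ => by
      simp only [ContinuousLinearMap.comp_apply, tm_left, hM, toLInf_left, rep_mul_apply]))
    (fun g => clm_intertwine (M := M) (clm_ext fun a ξ => by
      simp only [ContinuousLinearMap.comp_apply, tm_right, hM, left_right_comm]))

/-- The right unitor. -/
def runit : tensor X (unit K) ≅ X :=
  let M : tensor X (unit K) →L[ℂ] X := (runitU X).toContinuousLinearEquiv
  have hM : ∀ ξ a, M (tm ξ a) = X.right (L2.toLInf _ a) ξ := fun ξ a => runitU_tm a ξ
  mkIso (runitU X)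
    (fun g => clm_intertwine (M := M) (clm_ext fun ξ a => by
      simp only [ContinuousLinearMap.comp_apply, tm_π, hM, toLInf_π, π_right]))
    (fun g => clm_intertwine (M := M) (clm_ext fun ξ a => by
      simp only [ContinuousLinearMap.comp_apply, tm_left, hM, left_right_comm]))
    (fun g => clm_intertwine (M := M) (clm_ext fun ξ a => by
      simp only [ContinuousLinearMap.comp_apply, tm_right, hM, toLInf_right, rep_mul_apply]))

variable {X}

@[simp] lemma lunit_tm (a : unit K) (ξ : X) :
    op (lunit X).hom (tm a ξ) = X.left (L2.toLInf _ a) ξ := lunitU_tm a ξ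
@[simp] lemma runit_tm (a : unit K) (ξ : X) :
    op (runit X).hom (tm ξ a) = X.right (L2.toLInf _ a) ξ := runitU_tm a ξ

end Unitors

variable [IsTopologicalGroup G]

instance : MonoidalCategoryStruct (CfModule K) where
  tensorObj := tensor
  whiskerLeft X _ _ T := tensorHom' (𝟙 X) T
  whiskerRight T Y := tensorHom' T (𝟙 Y)
  tensorHom := tensorHom'
  tensorUnit := unit K
  associator := assoc
  leftUnitor := lunit
  rightUnitor := runit

instance : MonoidalCategory (CfModule K) := MonoidalCategory.ofTensorHom
  (id_tensorHom_id := fun X Y => hom_ext_tm fun ξ η => tensorHom'_tm (𝟙 X) (𝟙 Y) ξ η)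
  (id_tensorHom := fun _ _ _ _ => rfl)
  (tensorHom_id := fun _ _ => rfl)
  (tensorHom_comp_tensorHom := fun f₁ f₂ g₁ g₂ => hom_ext_tm fun ξ η => by
    change op (tensorHom' g₁ g₂) (op (tensorHom' f₁ f₂) (tm ξ η)) =
      op (tensorHom' (f₁ ≫ g₁) (f₂ ≫ g₂)) (tm ξ η)
    simp only [tensorHom'_tm, op_comp, ContinuousLinearMap.comp_apply])
  (associator_naturality := fun {X₁ X₂ X₃ Y₁ Y₂ Y₃} f₁ f₂ f₃ => hom_ext (clm_ext_left
    fun ξ η ζ => by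
      change op (assoc Y₁ Y₂ Y₃).hom (op (tensorHom' (tensorHom' f₁ f₂) f₃) (tm (tm ξ η) ζ)) =
        op (tensorHom' f₁ (tensorHom' f₂ f₃)) (op (assoc X₁ X₂ X₃).hom (tm (tm ξ η) ζ))
      simp only [tensorHom'_tm, assoc_tm]))
  (leftUnitor_naturality := fun {X Y} f => hom_ext_tm fun a ξ => by
    change op (lunit Y).hom (op (tensorHom' (𝟙 (unit K)) f) (tm a ξ)) =
      op f (op (lunit X).hom (tm a ξ))
    simp only [tensorHom'_tm, lunit_tm, op_left]
    rfl)
  (rightUnitor_naturality := fun {X Y} f => hom_ext_tm fun ξ a => by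
    change op (runit Y).hom (op (tensorHom' f (𝟙 (unit K))) (tm ξ a)) =
      op f (op (runit X).hom (tm ξ a))
    simp only [tensorHom'_tm, runit_tm, op_right]
    rfl)
  (pentagon := fun W X Y Z => by
    have h : ∀ w x y z, op (tensorHom' (assoc W X Y).hom (𝟙 Z) ≫ (assoc W (tensor X Y) Z).hom ≫
        tensorHom' (𝟙 W) (assoc X Y Z).hom) (tm (tm (tm w x) y) z) =
        op ((assoc (tensor W X) Y Z).hom ≫ (assoc W X (tensor Y Z)).hom)
          (tm (tm (tm w x) y) z) := fun w x y z => by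
      simp only [op_comp, ContinuousLinearMap.comp_apply, tensorHom'_tm, assoc_tm]
      rfl
    exact hom_ext (clm_ext_left4 h))
  (triangle := fun X Y => hom_ext (clm_ext_left fun ξ a η => by
    change op (tensorHom' (𝟙 X) (lunit Y).hom) (op (assoc X (unit K) Y).hom (tm (tm ξ a) η)) =
      op (tensorHom' (runit X).hom (𝟙 Y)) (tm (tm ξ a) η)
    simp only [tensorHom'_tm, assoc_tm, lunit_tm, runit_tm]
    exact (tm_balanced _ _ _).symm))

end CfModule

/-! ### Finite-dimensional Hilbert spaces -/

/-- A finite-dimensional Hilbert space. -/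
structure HilbF where
  carrier : Type u
  [normedAddCommGroup : NormedAddCommGroup carrier]
  [innerProductSpace : InnerProductSpace ℂ carrier]
  [finiteDimensional : FiniteDimensional ℂ carrier]

/-- The one-dimensional Hilbert space `ℂ`, in an arbitrary universe. -/
instance : InnerProductSpace ℂ (ULift.{u} ℂ) where
  inner a b := inner ℂ a.down b.down
  norm_sq_eq_re_inner a := norm_sq_eq_re_inner (𝕜 := ℂ) a.down
  conj_inner_symm a b := inner_conj_symm a.down b.down
  add_left a b c := inner_add_left a.down b.down c.down
  smul_left a b c := inner_smul_left a.down b.down c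

namespace HilbF

instance : CoeSort HilbF.{u} (Type u) := ⟨carrier⟩

attribute [instance] normedAddCommGroup innerProductSpace finiteDimensional

/-- Morphisms are all linear maps. -/
instance : Category HilbF.{u} where
  Hom X Y := X →ₗ[ℂ] Y
  id X := LinearMap.id
  comp S T := T ∘ₗ S

/-- The linear map underlying a morphism. -/
def lin {X Y : HilbF.{u}} (T : X ⟶ Y) : X →ₗ[ℂ] Y := T

/-- A linear map as a morphism. -/
def ofLin {X Y : HilbF.{u}} (T : X →ₗ[ℂ] Y) : X ⟶ Y := T

@[simp] lemma lin_comp {X Y Z : HilbF.{u}} (S : X ⟶ Y) (T : Y ⟶ Z) :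
    lin (S ≫ T) = lin T ∘ₗ lin S := rfl
@[simp] lemma lin_id (X : HilbF.{u}) : lin (𝟙 X) = LinearMap.id := rfl
@[simp] lemma lin_ofLin {X Y : HilbF.{u}} (T : X →ₗ[ℂ] Y) : lin (ofLin T) = T := rfl

lemma hom_ext {X Y : HilbF.{u}} {S T : X ⟶ Y} (h : lin S = lin T) : S = T := h

/-- A linear equivalence as an isomorphism. -/
def isoOfLin {X Y : HilbF.{u}} (e : X ≃ₗ[ℂ] Y) : X ≅ Y where
  hom := ofLin e.toLinearMap
  inv := ofLin e.symm.toLinearMap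
  hom_inv_id := hom_ext (LinearMap.ext e.symm_apply_apply)
  inv_hom_id := hom_ext (LinearMap.ext e.apply_symm_apply)

@[simp] lemma lin_isoOfLin {X Y : HilbF.{u}} (e : X ≃ₗ[ℂ] Y) :
    lin (isoOfLin e).hom = e.toLinearMap := rfl

instance : Preadditive HilbF.{u} where
  homGroup X Y := inferInstanceAs (AddCommGroup (X →ₗ[ℂ] Y))
  add_comp _ _ _ f g h := hom_ext (LinearMap.comp_add (lin f) (lin g) (lin h))
  comp_add _ _ _ f g h := hom_ext (LinearMap.add_comp (lin f) (lin h) (lin g))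

instance : Linear ℂ HilbF.{u} where
  homModule X Y := inferInstanceAs (Module ℂ (X →ₗ[ℂ] Y))
  smul_comp _ _ _ c f g := hom_ext (LinearMap.comp_smul (lin g) c (lin f))
  comp_smul _ _ _ f c g := hom_ext (LinearMap.smul_comp c (lin g) (lin f))

/-- The tensor product. -/
def tensor (X Y : HilbF.{u}) : HilbF.{u} := ⟨X ⊗[ℂ] Y⟩

/-- The tensor unit. -/
def unit : HilbF.{u} := ⟨ULift.{u} ℂ⟩

instance : MonoidalCategoryStruct HilbF.{u} where
  tensorObj := tensor
  whiskerLeft X _ _ T := ofLin ((lin T).lTensor X)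
  whiskerRight T Y := ofLin ((lin T).rTensor Y)
  tensorHom S T := ofLin (TensorProduct.map (lin S) (lin T))
  tensorUnit := unit
  associator X Y Z := isoOfLin (X := tensor (tensor X Y) Z) (Y := tensor X (tensor Y Z))
    (TensorProduct.assoc ℂ X Y Z)
  leftUnitor X := isoOfLin (X := tensor unit X) ((TensorProduct.congr
    (ULift.moduleEquiv : ULift.{u} ℂ ≃ₗ[ℂ] ℂ) (LinearEquiv.refl ℂ X)).trans
      (TensorProduct.lid ℂ X))
  rightUnitor X := isoOfLin (X := tensor X unit) ((TensorProduct.congr (LinearEquiv.refl ℂ X)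
    (ULift.moduleEquiv : ULift.{u} ℂ ≃ₗ[ℂ] ℂ)).trans (TensorProduct.rid ℂ X))

instance : MonoidalCategory HilbF.{u} := MonoidalCategory.ofTensorHom
  (id_tensorHom_id := fun _ _ => hom_ext TensorProduct.map_id)
  (id_tensorHom := fun _ _ _ _ => rfl)
  (tensorHom_id := fun _ _ => rfl)
  (tensorHom_comp_tensorHom := fun f₁ f₂ g₁ g₂ => hom_ext
    (TensorProduct.map_comp (lin g₁) (lin g₂) (lin f₁) (lin f₂)).symm)
  (associator_naturality := fun _ _ _ => hom_ext
    (TensorProduct.ext_threefold fun _ _ _ => rfl))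
  (leftUnitor_naturality := fun f => hom_ext (TensorProduct.ext' fun a ξ =>
    ((lin f).map_smul a.down ξ).symm))
  (rightUnitor_naturality := fun f => hom_ext (TensorProduct.ext' fun ξ a =>
    ((lin f).map_smul a.down ξ).symm))
  (pentagon := fun _ _ _ _ => hom_ext (TensorProduct.ext (TensorProduct.ext_threefold
    fun _ _ _ => rfl)))
  (triangle := fun X Y => hom_ext (TensorProduct.ext_threefold fun ξ a η =>
    (TensorProduct.smul_tmul a.down (ξ : X) (η : Y)).symm))

end HilbF

/-! ### Fiber functors -/

/-- An involutive contravariant structure on the morphisms, the adjoint operation of a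
`C^*`-category. -/
class HasDagger (C : Type*) [Category C] where
  dagger : ∀ {X Y : C}, (X ⟶ Y) → (Y ⟶ X)
  dagger_dagger : ∀ {X Y : C} (f : X ⟶ Y), dagger (dagger f) = f
  dagger_comp : ∀ {X Y Z : C} (f : X ⟶ Y) (g : Y ⟶ Z), dagger (f ≫ g) = dagger g ≫ dagger f
  dagger_id : ∀ X : C, dagger (𝟙 X) = 𝟙 X

instance : HasDagger HilbF.{u} where
  dagger f := HilbF.ofLin (HilbF.lin f).adjoint
  dagger_dagger f := HilbF.hom_ext (LinearMap.adjoint_adjoint (HilbF.lin f))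
  dagger_comp f g := HilbF.hom_ext (LinearMap.adjoint_comp (HilbF.lin g) (HilbF.lin f))
  dagger_id _ := HilbF.hom_ext (LinearMap.adjoint_id)

instance {G : Type u} [Group G] [TopologicalSpace G] (K : OpenSubgroup G) :
    HasDagger (CfModule K) where
  dagger f := CfModule.dag f
  dagger_dagger f := CfModule.hom_ext (ContinuousLinearMap.adjoint_adjoint (CfModule.op f))
  dagger_comp f g := CfModule.hom_ext
    (ContinuousLinearMap.adjoint_comp (CfModule.op g) (CfModule.op f))
  dagger_id _ := CfModule.hom_ext ContinuousLinearMap.adjoint_id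

section Fiber

open Functor

/-- A fiber functor: a monoidal functor `F` to finite-dimensional Hilbert spaces that is faithful
and unitary, i.e. linear and compatible with adjoints, with unitary structure maps
`F(X ⊗ Y) → F(X) ⊗ F(Y)` and `F(1) → ℂ`. -/
structure IsFiberFunctor {C : Type*} [Category C] [Preadditive C] [Linear ℂ C]
    [MonoidalCategory C] [HasDagger C] (F : C ⥤ HilbF.{u}) [F.Monoidal] : Prop where
  faithful : F.Faithful
  additive : F.Additive
  linear : F.Linear ℂ
  map_dagger : ∀ {X Y : C} (f : X ⟶ Y), F.map (HasDagger.dagger f) = HasDagger.dagger (F.map f)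
  tensor_unitary : ∀ X Y, HasDagger.dagger (OplaxMonoidal.δ F X Y) = LaxMonoidal.μ F X Y
  unit_unitary : HasDagger.dagger (OplaxMonoidal.η F) = LaxMonoidal.ε F

/-- `X` has a conjugate and `d` is its categorical dimension: there is a standard solution
`s : 1 → X ⊗ X'`, `t : 1 → X' ⊗ X` of the conjugate equations, and `d = s^* s`. -/
def HasCategoricalDimension {C : Type*} [Category C] [Preadditive C] [Linear ℂ C]
    [MonoidalCategory C] [HasDagger C] (X : C) (d : ℂ) : Prop :=
  ∃ (X' : C) (s : 𝟙_ C ⟶ X ⊗ X') (t : 𝟙_ C ⟶ X' ⊗ X),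
    (ρ_ X').inv ≫ X' ◁ s ≫ (α_ X' X X').inv ≫ HasDagger.dagger t ▷ X' ≫ (λ_ X').hom = 𝟙 X' ∧
    (ρ_ X).inv ≫ X ◁ t ≫ (α_ X X' X).inv ≫ HasDagger.dagger s ▷ X ≫ (λ_ X).hom = 𝟙 X ∧
    (∀ T : X ⟶ X, s ≫ T ▷ X' ≫ HasDagger.dagger s = t ≫ X' ◁ T ≫ HasDagger.dagger t) ∧
    s ≫ HasDagger.dagger s = d • 𝟙 (𝟙_ C)

/-- A functor is dimension-preserving if every object has a categorical dimension, equal to the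
dimension of its image. -/
def IsDimensionPreserving {C : Type*} [Category C] [Preadditive C] [Linear ℂ C]
    [MonoidalCategory C] [HasDagger C] (F : C ⥤ HilbF.{u}) : Prop :=
  ∀ X, HasCategoricalDimension X (Module.finrank ℂ (F.obj X) : ℂ) ∧
    ∀ d, HasCategoricalDimension X d → d = Module.finrank ℂ (F.obj X)

variable {G : Type u} [Group G] [TopologicalSpace G] (K : OpenSubgroup G)

/-- The subspace `χ_K · X`. -/
def CfModule.fiber {K : OpenSubgroup G} (X : CfModule K) : Submodule ℂ X :=
  LinearMap.range (X.left (LInf.chi ((1 : G) : G ⧸ (K : Subgroup G)))).toLinearMap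

instance {K : OpenSubgroup G} (X : CfModule K) : FiniteDimensional ℂ X.fiber := X.finite_rank

lemma CfModule.op_mem_fiber {K : OpenSubgroup G} {X Y : CfModule K} (T : X ⟶ Y) (ξ : X)
    (hξ : ξ ∈ X.fiber) : CfModule.op T ξ ∈ Y.fiber := by
  obtain ⟨ξ, rfl⟩ := hξ
  exact ⟨CfModule.op T ξ, (CfModule.op_left T _ ξ).symm⟩

/-- The functor `X ↦ χ_K · X`, acting on morphisms by restriction. -/
def fiberFunctor : CfModule K ⥤ HilbF.{u} where
  obj X := ⟨X.fiber⟩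
  map {X Y} T := HilbF.ofLin (X := ⟨X.fiber⟩) (Y := ⟨Y.fiber⟩)
    ((CfModule.op T).toLinearMap.restrict (p := X.fiber) (q := Y.fiber)
      (CfModule.op_mem_fiber T))
  map_id _ := rfl
  map_comp _ _ := rfl

end Fiber

section FiberIncl

variable {G : Type u} [Group G] [TopologicalSpace G] [IsTopologicalGroup G] {K : OpenSubgroup G}

/-- The inclusion of the relative tensor product in the Hilbert space tensor product. -/
def CfModule.toHTensor {X Y : CfModule K} : (X ⊗ Y : CfModule K) →L[ℂ] HTensor X Y :=
  (relTensor X.right Y.left).subtypeL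

/-- The inclusion of `(χ_K · X) ⊗ (χ_K · Y)` in the Hilbert space tensor product of `X` and `Y`. -/
def CfModule.fiberIncl (X Y : CfModule K) :
    ((fiberFunctor K).obj X ⊗ (fiberFunctor K).obj Y : HilbF.{u}) →ₗ[ℂ] HTensor X Y :=
  (HTensor.incl X Y).toLinearMap ∘ₗ TensorProduct.mapIncl X.fiber Y.fiber

end FiberIncl

/-! ### Compact quantum groups -/

section QuantumGroups

variable {H H' : Type*} [NormedAddCommGroup H] [InnerProductSpace ℂ H] [CompleteSpace H]
  [NormedAddCommGroup H'] [InnerProductSpace ℂ H'] [CompleteSpace H']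

/-- The minimal (spatial) tensor product of two concrete `C^*`-algebras: the closed `*`-algebra
generated by the operators `a ⊗ b` on the Hilbert space tensor product. -/
def minTensor (A : StarSubalgebra ℂ (H →L[ℂ] H)) (B : StarSubalgebra ℂ (H' →L[ℂ] H')) :
    StarSubalgebra ℂ (HTensor H H' →L[ℂ] HTensor H H') :=
  (StarAlgebra.adjoin ℂ {T | ∃ a ∈ A, ∃ b ∈ B, T = HTensor.map a b}).topologicalClosure

/-- The elementary tensor `a ⊗ b` in the minimal tensor product. -/
def minTmul {A : StarSubalgebra ℂ (H →L[ℂ] H)} {B : StarSubalgebra ℂ (H' →L[ℂ] H')}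
    (a : A) (b : B) : minTensor A B :=
  ⟨HTensor.map a b, StarSubalgebra.le_topologicalClosure _
    (StarAlgebra.subset_adjoin ℂ _ ⟨a, a.2, b, b.2, rfl⟩)⟩

/-- A compact quantum group, on a unital `C^*`-algebra `A` of operators on the Hilbert space `H`
(every `C^*`-algebra is of this form, up to isomorphism): a unital `*`-homomorphism
`Δ : A → A ⊗ A` that is co-associative, `(Δ ⊗ id) Δ = (id ⊗ Δ) Δ`, and such that `Δ(A) (1 ⊗ A)` and
`Δ(A) (A ⊗ 1)` span dense subspaces of `A ⊗ A`. The equality in `(A ⊗ A) ⊗ A = A ⊗ (A ⊗ A)` is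
expressed through the matrix coefficients of both sides. -/
structure CompactQuantumGroup (H : Type*) [NormedAddCommGroup H] [InnerProductSpace ℂ H]
    [CompleteSpace H] where
  A : StarSubalgebra ℂ (H →L[ℂ] H)
  isClosed : IsClosed (A : Set (H →L[ℂ] H))
  Δ : A →⋆ₐ[ℂ] minTensor A A
  coassoc : ∃ (Φ : minTensor A A →⋆ₐ[ℂ] minTensor (minTensor A A) A)
    (Ψ : minTensor A A →⋆ₐ[ℂ] minTensor A (minTensor A A)),
    (∀ a b, Φ (minTmul a b) = minTmul (Δ a) b) ∧ (∀ a b, Ψ (minTmul a b) = minTmul a (Δ b)) ∧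
    ∀ (a : A) (ξ η ζ ξ' η' ζ' : H),
      inner ℂ (HTensor.tmul (HTensor.tmul ξ η) ζ) ((Φ (Δ a) :
        HTensor (HTensor H H) H →L[ℂ] HTensor (HTensor H H) H)
          (HTensor.tmul (HTensor.tmul ξ' η') ζ')) =
      inner ℂ (HTensor.tmul ξ (HTensor.tmul η ζ)) ((Ψ (Δ a) :
        HTensor H (HTensor H H) →L[ℂ] HTensor H (HTensor H H))
          (HTensor.tmul ξ' (HTensor.tmul η' ζ')))
  dense_right : Dense (Submodule.span ℂ {T | ∃ a b : A, T = Δ a * minTmul 1 b} :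
    Set (minTensor A A))
  dense_left : Dense (Submodule.span ℂ {T | ∃ a b : A, T = Δ a * minTmul b 1} :
    Set (minTensor A A))

namespace CompactQuantumGroup

/-- The Haar state: a state `h` with `(id ⊗ h) Δ(a) = h(a) 1 = (h ⊗ id) Δ(a)`. -/
structure IsHaarState (𝔾 : CompactQuantumGroup H) (h : 𝔾.A →ₗ[ℂ] ℂ) : Prop where
  map_one : h 1 = 1
  nonneg : ∀ a, 0 ≤ (h (star a * a)).re ∧ (h (star a * a)).im = 0
  right_invariant : ∃ S : minTensor 𝔾.A 𝔾.A →L[ℂ] 𝔾.A,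
    (∀ a b, S (minTmul a b) = h b • a) ∧ ∀ a, S (𝔾.Δ a) = h a • 1
  left_invariant : ∃ S : minTensor 𝔾.A 𝔾.A →L[ℂ] 𝔾.A,
    (∀ a b, S (minTmul a b) = h a • b) ∧ ∀ a, S (𝔾.Δ a) = h a • 1

/-- A compact quantum group is of Kac type if its Haar state is a trace. -/
def IsKac (𝔾 : CompactQuantumGroup H) : Prop :=
  ∃ h : 𝔾.A →ₗ[ℂ] ℂ, 𝔾.IsHaarState h ∧ ∀ a b, h (a * b) = h (b * a)

/-- A finite-dimensional unitary representation, as a unitary matrix `u` over `A` with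
`Δ(u_ij) = ∑_k u_ik ⊗ u_kj`. -/
structure IsRep (𝔾 : CompactQuantumGroup H) {n : Type*} [Fintype n] [DecidableEq n]
    (u : Matrix n n 𝔾.A) : Prop where
  unitary : star u * u = 1 ∧ u * star u = 1
  comul : ∀ i j, 𝔾.Δ (u i j) = ∑ k, minTmul (u i k) (u k j)

/-- The scalar matrix of a linear map with respect to orthonormal bases, as a matrix over `A`. -/
def scalarMatrix (𝔾 : CompactQuantumGroup H) {m n V W : Type*} [Fintype m] [DecidableEq m]
    [Fintype n] [NormedAddCommGroup V] [InnerProductSpace ℂ V] [NormedAddCommGroup W]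
    [InnerProductSpace ℂ W] (b : OrthonormalBasis m ℂ V) (c : OrthonormalBasis n ℂ W)
    (T : V →ₗ[ℂ] W) : Matrix n m 𝔾.A :=
  (LinearMap.toMatrix b.toBasis c.toBasis T).map (algebraMap ℂ 𝔾.A)

end CompactQuantumGroup

open CompactQuantumGroup in
/-- `𝔾` is the compact quantum group associated by Tannaka-Krein duality to the fiber functor `F`:
every `F(X)` carries a unitary representation `u_X` of `𝔾`, such that
* the intertwiners from `u_X` to `u_Y` are precisely the maps `F(f)`, `f : X ⟶ Y`;
* the structure map `F(X ⊗ Y) → F(X) ⊗ F(Y)` intertwines `u_{X ⊗ Y}` with the tensor product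
  representation `(u_X)_{ij} (u_Y)_{kl}`, and `u_1` is trivial;
* every finite-dimensional unitary representation of `𝔾` is unitarily equivalent to some `u_X`.

Thus `F` factors as an equivalence of `C` with `Rep(𝔾)` followed by the forgetful functor. The
representations are written as matrices with respect to an orthonormal basis of `F(X)`. -/
def IsTannakaKreinDual {C : Type*} [Category C] [MonoidalCategory C] (F : C ⥤ HilbF.{u})
    [F.Monoidal] (𝔾 : CompactQuantumGroup H) : Prop :=
  let b := fun X : C => stdOrthonormalBasis ℂ (F.obj X)
  ∃ u : ∀ X : C, Matrix (Fin (Module.finrank ℂ (F.obj X))) (Fin (Module.finrank ℂ (F.obj X))) 𝔾.A,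
    (∀ X, 𝔾.IsRep (u X)) ∧
    (∀ X Y (T : F.obj X →ₗ[ℂ] F.obj Y), (∃ f : X ⟶ Y, F.map f = HilbF.ofLin T) ↔
      u Y * 𝔾.scalarMatrix (b X) (b Y) T = 𝔾.scalarMatrix (b X) (b Y) T * u X) ∧
    (∀ X Y, Matrix.kroneckerMap (· * ·) (u X) (u Y) *
        𝔾.scalarMatrix (b (X ⊗ Y)) ((b X).tensorProduct (b Y))
          (HilbF.lin (Functor.OplaxMonoidal.δ F X Y)) =
      𝔾.scalarMatrix (b (X ⊗ Y)) ((b X).tensorProduct (b Y))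
          (HilbF.lin (Functor.OplaxMonoidal.δ F X Y)) * u (X ⊗ Y)) ∧
    u (𝟙_ C) = 1 ∧
    ∀ (n : ℕ) (v : Matrix (Fin n) (Fin n) 𝔾.A), 𝔾.IsRep v →
      ∃ (X : C) (W : EuclideanSpace ℂ (Fin n) ≃ₗᵢ[ℂ] F.obj X),
        u X * 𝔾.scalarMatrix (EuclideanSpace.basisFun (Fin n) ℂ) (b X) W.toLinearEquiv.toLinearMap =
          𝔾.scalarMatrix (EuclideanSpace.basisFun (Fin n) ℂ) (b X) W.toLinearEquiv.toLinearMap * v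

end QuantumGroups

/-! ### The bicrossed product -/

section Bicrossed

variable {G : Type u} [Group G] [TopologicalSpace G] [IsTopologicalGroup G]

/-- For `s, r ∈ Γ`, the set of all `k ∈ K` with `k s ∈ r K`. -/
def moveSet (K : OpenSubgroup G) (s r : G) : Set K := {k | r⁻¹ * (k : G) * s ∈ K}

lemma isClopen_moveSet (K : OpenSubgroup G) (s r : G) : IsClopen (moveSet K s r) :=
  K.isClopen.preimage (f := fun k : K => r⁻¹ * (k : G) * s) (by fun_prop)

/-- The indicator function of `moveSet`, as a continuous function. -/
def moveInd (K : OpenSubgroup G) (s r : G) : C(K, ℂ) where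
  toFun := (moveSet K s r).indicator fun _ => 1
  continuous_toFun := (isClopen_moveSet K s r).continuous_indicator continuous_const

/-- `𝔾` is the bicrossed product of the matched pair `G = Γ K`. The group `Γ` acts on
`Γ \ G = K` by right multiplication; the algebra of `𝔾` is the crossed product of `C(K)` by this
action, in its canonical faithful representation on `ℓ²(G)`: a function `f` acts by
`δ_{γk} ↦ f(k) δ_{γk}` and `s ∈ Γ` by the unitary `v_s : δ_g ↦ δ_{g s⁻¹}`. The comultiplication is
dual to the multiplication of `K` and twisted by the action of `K` on `G / K = Γ`:
`Δ(f)(k, k') = f(k k')` for `f ∈ C(K)` and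
`Δ(v_s) = ∑_r v_r ⊗ 1_{k' s ∈ r K} v_s`, the sum running over `r ∈ Γ`. -/
def IsBicrossedProduct (K : OpenSubgroup G) (Γ : Subgroup G)
    (𝔾 : CompactQuantumGroup (L2 G)) : Prop :=
  ∃ (m : C(K, ℂ) → 𝔾.A) (v : Γ → 𝔾.A),
    (∀ (f : C(K, ℂ)) (γ : Γ) (k : K),
      (m f : L2 G →L[ℂ] L2 G) (L2.delta ((γ : G) * k)) = f k • L2.delta ((γ : G) * k)) ∧
    (∀ (s : Γ) (g : G), (v s : L2 G →L[ℂ] L2 G) (L2.delta g) = L2.delta (g * (s : G)⁻¹)) ∧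
    𝔾.A = (StarAlgebra.adjoin ℂ ({T | ∃ f, T = (m f : L2 G →L[ℂ] L2 G)} ∪
      {T | ∃ s, T = (v s : L2 G →L[ℂ] L2 G)})).topologicalClosure ∧
    (∀ (f : C(K, ℂ)) (γ γ' : Γ) (k k' : K),
      (𝔾.Δ (m f) : HTensor (L2 G) (L2 G) →L[ℂ] HTensor (L2 G) (L2 G))
        (HTensor.tmul (L2.delta ((γ : G) * k)) (L2.delta ((γ' : G) * k'))) =
      f (k * k') • HTensor.tmul (L2.delta ((γ : G) * k)) (L2.delta ((γ' : G) * k'))) ∧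
    ∀ s : Γ, HasSum (fun r : Γ => minTmul (v r) (m (moveInd K s r) * v s)) (𝔾.Δ (v s))

end Bicrossed

end

/-!
Everything reduces to the following data on the fiber `V = χ_K · X` of a module `X`: a unitary
representation `π` of `K` and an orthogonal grading `V = ⊕_γ V_γ` by `Γ = G / K` (the right action),
related by `π(k) V_γ = V_{γ'}` where `k γ ∈ γ' K`. Since the translates `π(γ) V`, `γ ∈ Γ`, are
mutually orthogonal and span a dense subspace of `X`, the morphisms `X → Y` are the linear maps
`χ_K · X → χ_K · Y` that respect these data (`exists_map_iff`), and induction from `K` to `G` shows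
that all such data occur (`MatchedRep.toModule`).

The inverses of the structure maps are `v ⊗ w ↦ ∑_γ v χ_γ ⊗ π(γ) w` (`CfModule.mu`). These maps are
isometric since `V_γ ⊥ V_δ` for `γ ≠ δ`, surjective since their range is dense, and associative since
the degree of the image of `V_γ ⊗ W_δ` is `γ δ`. Hence the fiber functor is a unitary monoidal
functor.

The comultiplication of the bicrossed product is implemented by a unitary on `ℓ²(G × G)` that
permutes the basis (`Bicrossed.comulOp`), and so all its properties are identities in the group. The
average over `K` of the diagonal coefficients of an operator on `ℓ²(G)` is an invariant state. On the
span of the `f v_s` it is a trace, because the Haar measure of `K`, which is invariant under left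
translations by `K`, is also invariant under the action of `Γ` on `K = Γ \ G`
(`haar_inter_mul_right`). Hence the bicrossed product is of Kac type.

An element `a` of the bicrossed product is determined by its coefficients `a_s(k) = ⟨δ_k, a δ_{ks}⟩`,
the functions in its formal expansion `∑_s a_s v_s`. In these terms a finite-dimensional unitary
representation `w` is a family of matrices `w_s(k)`, and the condition on the comultiplication says
that `w_s(k) = π(k) p_s` for a representation `π` of `K` and projections `p_s` that form a grading
compatible with `π` (`Bicrossed.exists_rep_eq`). So the representations of the bicrossed product are
given by the same data as modules. The formulas for the tensor products agree as well
(`Bicrossed.kronecker_modRep`), and this is the Tannaka-Krein duality.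

For the categorical dimension, the morphisms `1 → X ⊗ Y` are identified with the scalar matrices `S`
that satisfy `u S u'ᵀ = S`, where `u` and `u'` are the representations of the bicrossed product on
the fibers (`Bicrossed.exists_unitHomVec_eq_iff_coords`). The complex conjugate of a unitary
representation `u` is again a unitary representation, because the conjugate data again form a
representation of `K` with a grading (`MatchedRep.conj`). So it comes from a module, and the identity
matrices give a standard solution of the conjugate equations with dimension `dim V`. Conversely, let
`S` and `R` be the matrices of a standard solution. Then `S S^*` and its inverse `Rᵀ R̄` commute with
`u`, and hence their difference `B` comes from an endomorphism of `X`. The standardness condition for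
this endomorphism is `Tr(B²) = 0`. Therefore `B = 0`, so that `S S^* = 1` and the dimension is
`Tr(S S^*) = dim V`.
-/

set_option linter.unusedSectionVars false

noncomputable section

/-! ### The decomposition `G = Γ K` -/

section MatchedPair

variable {G : Type u} [Group G] [TopologicalSpace G] {K : OpenSubgroup G} {Γ : Subgroup G}
  (h : Γ.IsComplement' (K : Subgroup G))

/-- The component in `Γ` of an element of `G = Γ K`. -/
def gam (g : G) : Γ := (h.equiv g).1

/-- The component in `K` of an element of `G = Γ K`. -/
def kap (g : G) : K := ⟨(h.equiv g).2.1, (h.equiv g).2.2⟩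

lemma gam_mul_kap (g : G) : (gam h g : G) * kap h g = g := h.equiv_fst_mul_equiv_snd g

lemma gam_kap_unique (h : Γ.IsComplement' (K : Subgroup G)) {γ γ' : Γ} {k k' : K}
    (e : (γ : G) * k = γ' * k') : γ = γ' ∧ k = k' := by
  have := Function.Bijective.injective h (a₁ := (⟨γ, γ.2⟩, ⟨k, k.2⟩))
    (a₂ := (⟨γ', γ'.2⟩, ⟨k', k'.2⟩)) e
  exact ⟨congrArg Prod.fst this, Subtype.ext (congrArg (fun p => (p.2 : G)) this)⟩

lemma gam_mk (γ : Γ) (k : K) : gam h ((γ : G) * k) = γ :=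
  (gam_kap_unique h (gam_mul_kap h _)).1

lemma kap_mk (γ : Γ) (k : K) : kap h ((γ : G) * k) = k :=
  (gam_kap_unique h (gam_mul_kap h _)).2

@[simp] lemma gam_coe (γ : Γ) : gam h (γ : G) = γ := by simpa using gam_mk h γ 1
@[simp] lemma kap_coe (γ : Γ) : kap h (γ : G) = 1 := by simpa using kap_mk h γ 1
@[simp] lemma gam_coeK (k : K) : gam h (k : G) = 1 := by simpa using gam_mk h 1 k
@[simp] lemma kap_coeK (k : K) : kap h (k : G) = k := by simpa using kap_mk h 1 k

lemma eq_gam_of_mul {g : G} {γ : Γ} {k : K} (e : g = γ * k) : gam h g = γ := by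
  rw [e, gam_mk]

lemma gam_eq_iff (g : G) (γ : Γ) : gam h g = γ ↔ (γ : G)⁻¹ * g ∈ K := by
  constructor
  · rintro rfl
    rw [inv_mul_eq_iff_eq_mul.2 (gam_mul_kap h g).symm]
    exact (kap h g).2
  · intro hk
    exact eq_gam_of_mul h (k := ⟨_, hk⟩) (by simp)

@[simp] lemma gam_mul_left (γ : Γ) (g : G) : gam h ((γ : G) * g) = γ * gam h g := by
  conv_lhs => rw [← gam_mul_kap h g, ← mul_assoc]
  exact gam_mk h (γ * gam h g) (kap h g)

@[simp] lemma kap_mul_left (γ : Γ) (g : G) : kap h ((γ : G) * g) = kap h g := by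
  conv_lhs => rw [← gam_mul_kap h g, ← mul_assoc]
  exact kap_mk h (γ * gam h g) (kap h g)

@[simp] lemma gam_mul_right (g : G) (k : K) : gam h (g * k) = gam h g := by
  conv_lhs => rw [← gam_mul_kap h g, mul_assoc]
  exact gam_mk h (gam h g) (kap h g * k)

@[simp] lemma kap_mul_right (g : G) (k : K) : kap h (g * k) = kap h g * k := by
  conv_lhs => rw [← gam_mul_kap h g, mul_assoc]
  exact kap_mk h (gam h g) (kap h g * k)

lemma gam_mul_gam (g g' : G) : gam h (g * gam h g') = gam h (g * g') := by
  conv_rhs => rw [← gam_mul_kap h g', ← mul_assoc, gam_mul_right]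

lemma kap_mul_gam (g g' : G) : kap h (g * gam h g') * kap h g' = kap h (g * g') := by
  conv_rhs => rw [← gam_mul_kap h g', ← mul_assoc, kap_mul_right]

lemma kap_kap_mul (g g' : G) : kap h (kap h g * g') = kap h (g * g') := by
  conv_rhs => rw [← gam_mul_kap h g, mul_assoc, kap_mul_left]

lemma gam_mul (g g' : G) : gam h (g * g') = gam h g * gam h (kap h g * g') := by
  conv_lhs => rw [← gam_mul_kap h g, mul_assoc, gam_mul_left]

/-- The coset `g K` is determined by the component of `g` in `Γ`. -/
lemma mk_gam (g : G) : ((gam h g : G) : G ⧸ (K : Subgroup G)) = (g : G ⧸ (K : Subgroup G)) := by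
  rw [QuotientGroup.eq]
  exact (gam_eq_iff h g _).1 rfl

/-- The group `Γ` represents the cosets of `K`. -/
def gamEquiv : Γ ≃ G ⧸ (K : Subgroup G) :=
  Equiv.ofBijective (fun γ => ((γ : G) : G ⧸ (K : Subgroup G))) ⟨fun γ γ' e => by
    rw [QuotientGroup.eq] at e
    simpa using ((gam_eq_iff h γ' γ).2 e).symm, fun x => by
    obtain ⟨g, rfl⟩ := QuotientGroup.mk_surjective x
    exact ⟨gam h g, mk_gam h g⟩⟩

@[simp] lemma gamEquiv_apply (γ : Γ) : gamEquiv h γ = ((γ : G) : G ⧸ (K : Subgroup G)) := rfl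

lemma mk_eq_mk_iff (h : Γ.IsComplement' (K : Subgroup G)) {γ γ' : Γ} :
    ((γ : G) : G ⧸ (K : Subgroup G)) = (γ' : G) ↔ γ = γ' :=
  (gamEquiv h).injective.eq_iff

/-- If `k γ = γ' k'` with `γ' ∈ Γ` and `k' ∈ K`, then `k' γ⁻¹ = γ'⁻¹ k`, whose component in `Γ` is
`γ'⁻¹`. -/
lemma gam_mul_inv_gam (k : K) (γ : Γ) :
    gam h (kap h (k * γ) * (γ : G)⁻¹) = (gam h (k * γ))⁻¹ := by
  refine eq_gam_of_mul h (k := k) ?_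
  rw [(inv_mul_eq_iff_eq_mul.2 (gam_mul_kap h (k * γ)).symm).symm, InvMemClass.coe_inv]
  group

lemma gam_mul_inj (g : G) {γ γ' : Γ} : gam h (g * γ) = gam h (g * γ') ↔ γ = γ' := by
  refine ⟨fun e => ?_, fun e => by rw [e]⟩
  have : gam h (g⁻¹ * gam h (g * γ)) = gam h (g⁻¹ * gam h (g * γ')) := by rw [e]
  simpa [gam_mul_gam] using this

section
variable [IsTopologicalGroup G]

lemma isLocallyConstant_gam : IsLocallyConstant (gam h) := by
  rw [IsLocallyConstant.iff_exists_open]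
  intro g
  refine ⟨(fun x => (gam h g : G)⁻¹ * x) ⁻¹' (K : Set G),
    K.isOpen.preimage (continuous_const_mul _), (gam_eq_iff h g _).1 rfl, fun x hx => ?_⟩
  exact (gam_eq_iff h x _).2 hx

lemma continuous_kap : Continuous (kap h) := by
  rw [continuous_iff_continuousAt]
  intro g
  rw [Topology.IsInducing.subtypeVal.continuousAt_iff]
  have h1 : (fun x => (gam h g : G)⁻¹ * x) =ᶠ[nhds g] Subtype.val ∘ kap h := by
    filter_upwards [(isLocallyConstant_gam h).isOpen_fiber (gam h g) |>.mem_nhds rfl] with x hx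
    exact inv_mul_eq_iff_eq_mul.2 (hx ▸ (gam_mul_kap h x).symm)
  exact (continuous_const_mul _).continuousAt.congr h1

lemma finite_range_gam_mul (hK : IsCompact (K : Set G)) (x : G) :
    (Set.range fun k : K => gam h (k * x)).Finite := by
  have : CompactSpace K := isCompact_iff_compactSpace.1 hK
  exact ((isLocallyConstant_gam h).comp_continuous
    (f := fun k : K => (k : G) * x) (by fun_prop)).range_finite

end
end MatchedPair

/-! ### Unitary representations of `K` with a compatible grading by `Γ` -/

section MatchedRep

variable {G : Type u} [Group G] [TopologicalSpace G] {K : OpenSubgroup G} {Γ : Subgroup G}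

/-- A finite-dimensional unitary representation of `K` with a compatible orthogonal grading by
`Γ = G / K`, written in matrices: `π` is the representation and `p γ` is the projection on the
component of degree `γ`. These are the data that a finite-rank module has on its fiber, and the data
that a finite-dimensional unitary representation of the bicrossed product consists of. -/
structure MatchedRep (h : Γ.IsComplement' (K : Subgroup G)) (n : Type*) [Fintype n]
    [DecidableEq n] where
  π : K →* Matrix n n ℂ
  star_mul_π : ∀ k, star (π k) * π k = 1
  continuous_π : Continuous π
  p : Γ → Matrix n n ℂ
  star_p : ∀ γ, star (p γ) = p γ
  p_mul_self : ∀ γ, p γ * p γ = p γ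
  p_mul_of_ne : ∀ γ δ, γ ≠ δ → p γ * p δ = 0
  π_mul_p : ∀ k γ, π k * p γ = p (gam h (k * γ)) * π k
  supp : Finset Γ
  p_eq_zero : ∀ γ ∉ supp, p γ = 0
  sum_p : ∑ γ ∈ supp, p γ = 1

namespace MatchedRep

variable {h : Γ.IsComplement' (K : Subgroup G)} {n m : Type*} [Fintype n] [DecidableEq n]
  [Fintype m] [DecidableEq m] (D : MatchedRep h n) (E : MatchedRep h m)

lemma π_mul_star (k : K) : D.π k * star (D.π k) = 1 := mul_eq_one_comm.1 (D.star_mul_π k)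

open Classical in
lemma p_mul_p (γ δ : Γ) : D.p γ * D.p δ = if γ = δ then D.p γ else 0 := by
  split_ifs with e
  · rw [← e, p_mul_self]
  · exact D.p_mul_of_ne _ _ e

/-- A matrix that commutes with the representations and the gradings. -/
def Intertwines (M : Matrix m n ℂ) : Prop :=
  (∀ k, M * D.π k = E.π k * M) ∧ ∀ γ, M * D.p γ = E.p γ * M

/-- Entrywise complex conjugation. -/
def cj : Matrix n n ℂ →+* Matrix n n ℂ := (starRingEnd ℂ).mapMatrix

lemma star_cj (M : Matrix n n ℂ) : star (cj M) = cj (star M) := rfl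

/-- The component of degree `γ` of the action of `k` on the conjugate, before conjugation. -/
def twist (k : K) (γ : Γ) : Matrix n n ℂ := D.π (kap h (k * (γ : G)⁻¹)) * D.p γ

/-- The degree, as a component of the given representation, of the image of `twist k γ`. -/
lemma p_mul_twist (k : K) (γ : Γ) :
    D.p (gam h (k * (γ : G)⁻¹))⁻¹ * D.twist k γ = D.twist k γ := by
  have e := gam_mul_inv_gam h k γ⁻¹
  simp only [InvMemClass.coe_inv, inv_inv] at e
  rw [twist, D.π_mul_p, e, ← mul_assoc, p_mul_self]

lemma inv_gam_inj (h : Γ.IsComplement' (K : Subgroup G)) (k : K) {γ δ : Γ}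
    (e : (gam h (k * (γ : G)⁻¹))⁻¹ = (gam h (k * (δ : G)⁻¹))⁻¹) : γ = δ := by
  have := (gam_mul_inj h (k : G) (γ := γ⁻¹) (γ' := δ⁻¹)).1 (by simpa using e)
  simpa using this

lemma twist_mul_twist (k k' : K) (γ : Γ) :
    D.twist k (gam h (k' * (γ : G)⁻¹))⁻¹ * D.twist k' γ = D.twist (k * k') γ := by
  rw [twist, mul_assoc, p_mul_twist, twist, ← mul_assoc, ← map_mul, InvMemClass.coe_inv, inv_inv,
    kap_mul_gam, ← mul_assoc, twist, Subgroup.coe_mul]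

lemma twist_mul_twist_of_ne (k k' : K) (γ δ : Γ) (hne : δ ≠ (gam h (k' * (γ : G)⁻¹))⁻¹) :
    D.twist k δ * D.twist k' γ = 0 := by
  rw [← D.p_mul_twist k' γ, twist, mul_assoc, ← mul_assoc (D.p δ), D.p_mul_of_ne _ _ hne, zero_mul,
    mul_zero]

lemma twist_eq_zero (k : K) (γ : Γ) (hγ : γ ∉ D.supp) : D.twist k γ = 0 := by
  rw [twist, D.p_eq_zero _ hγ, mul_zero]

lemma sum_twist_mul_sum_twist (k k' : K) :
    (∑ γ ∈ D.supp, D.twist k γ) * ∑ γ ∈ D.supp, D.twist k' γ =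
      ∑ γ ∈ D.supp, D.twist (k * k') γ := by
  classical
  rw [Finset.mul_sum]
  refine Finset.sum_congr rfl fun γ _ => ?_
  rw [Finset.sum_mul, Finset.sum_eq_single (gam h (k' * (γ : G)⁻¹))⁻¹, twist_mul_twist]
  · exact fun δ _ hδ => D.twist_mul_twist_of_ne _ _ _ _ hδ
  · intro hn
    rw [D.twist_eq_zero _ _ hn, zero_mul]

lemma star_twist_mul_twist (k : K) (γ : Γ) : star (D.twist k γ) * D.twist k γ = D.p γ := by
  rw [twist, star_mul, star_p, mul_assoc, ← mul_assoc (star _), star_mul_π, one_mul, p_mul_self]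

lemma star_twist_mul_twist_of_ne (k : K) {γ δ : Γ} (hne : γ ≠ δ) :
    star (D.twist k γ) * D.twist k δ = 0 := by
  rw [← p_mul_twist, ← D.p_mul_twist k δ, star_mul, star_p, mul_assoc, ← mul_assoc (D.p _),
    D.p_mul_of_ne _ _ fun e => hne (inv_gam_inj h k e), zero_mul, mul_zero]

/-- The conjugate of a matched representation: the component of degree `γ` is the complex conjugate
of the component of degree `γ⁻¹`, on which `k ∈ K` acts through the `K`-component of `k γ`. -/
def conj [IsTopologicalGroup G] : MatchedRep h n where
  π :=
    { toFun := fun k => cj (∑ γ ∈ D.supp, D.twist k γ)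
      map_one' := by
        rw [← map_one (cj (n := n)), ← D.sum_p]
        congr 1
        refine Finset.sum_congr rfl fun γ _ => ?_
        have := kap_coe h γ⁻¹
        rw [InvMemClass.coe_inv] at this
        rw [twist, Subgroup.coe_one, one_mul, this, map_one, one_mul]
      map_mul' := fun k k' => by rw [← map_mul, sum_twist_mul_sum_twist] }
  star_mul_π k := by
    change star (cj _) * cj _ = 1
    rw [star_cj, ← map_mul, ← map_one (cj (n := n)), ← D.sum_p, star_sum, Finset.sum_mul]
    congr 1
    refine Finset.sum_congr rfl fun γ hγ => ?_
    rw [Finset.mul_sum, Finset.sum_eq_single γ, star_twist_mul_twist]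
    · exact fun δ _ hδ => D.star_twist_mul_twist_of_ne k hδ.symm
    · exact fun hn => absurd hγ hn
  continuous_π := by
    change Continuous fun k => (∑ γ ∈ D.supp, D.twist k γ).map star
    refine Continuous.matrix_map (continuous_finsetSum _ fun γ _ => ?_) continuous_star
    refine Continuous.matrix_mul (D.continuous_π.comp ?_) continuous_const
    exact (continuous_kap h).comp (by fun_prop)
  p γ := cj (D.p γ⁻¹)
  star_p γ := by rw [star_cj, star_p]
  p_mul_self γ := by rw [← map_mul, p_mul_self]
  p_mul_of_ne γ δ e := by rw [← map_mul, D.p_mul_of_ne _ _ (by simpa using e), map_zero]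
  π_mul_p k γ := by
    change cj _ * cj _ = cj _ * cj _
    rw [← map_mul, ← map_mul]
    congr 1
    have h1 : ∀ δ, D.twist k δ * D.p γ⁻¹ = D.p (gam h (k * γ))⁻¹ * D.twist k δ := fun δ => by
      by_cases e : δ = γ⁻¹
      · subst e
        have := D.p_mul_twist k γ⁻¹
        simp only [InvMemClass.coe_inv, inv_inv] at this
        rw [this, twist, mul_assoc, p_mul_self]
      · rw [← p_mul_twist, ← mul_assoc (D.p _), D.p_mul_of_ne, zero_mul, p_mul_twist, twist,
          mul_assoc, D.p_mul_of_ne _ _ e, mul_zero]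
        intro e'
        refine e (inv_gam_inj h k ?_)
        rw [← e']
        simp
    rw [Finset.sum_mul, Finset.mul_sum]
    exact Finset.sum_congr rfl fun δ _ => h1 δ
  supp := D.supp.map (Equiv.inv Γ).toEmbedding
  p_eq_zero γ hγ := by
    rw [D.p_eq_zero, map_zero]
    intro hn
    exact hγ (Finset.mem_map.2 ⟨γ⁻¹, hn, by simp⟩)
  sum_p := by
    rw [Finset.sum_map, ← map_one (cj (n := n)), ← D.sum_p, map_sum]
    simp

/-- The operators of the conjugate on its component of degree `γ`. -/
lemma conj_π_mul_p [IsTopologicalGroup G] (k : K) (γ : Γ) :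
    D.conj.π k * D.conj.p γ = cj (D.π (kap h (k * γ)) * D.p γ⁻¹) := by
  change cj (∑ δ ∈ D.supp, D.twist k δ) * cj (D.p γ⁻¹) = _
  rw [← map_mul, Finset.sum_mul, Finset.sum_eq_single γ⁻¹]
  · rw [twist, mul_assoc, p_mul_self, InvMemClass.coe_inv, inv_inv]
  · intro δ _ hδ
    rw [twist, mul_assoc, D.p_mul_of_ne _ _ hδ, mul_zero]
  · intro hn
    rw [D.p_eq_zero _ hn, mul_zero]

end MatchedRep
end MatchedRep

/-! ### The fiber of a module -/

section FiberData

variable {G : Type u} [Group G] [TopologicalSpace G] {K : OpenSubgroup G} {Γ : Subgroup G}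

namespace CfModule

lemma mem_fiber_iff (X : CfModule K) (ξ : X) :
    ξ ∈ X.fiber ↔ X.left (LInf.chi ((1 : G) : G ⧸ (K : Subgroup G))) ξ = ξ := by
  classical
  refine ⟨?_, fun e => ⟨ξ, e⟩⟩
  rintro ⟨η, rfl⟩
  change X.left _ (X.left _ η) = X.left _ η
  rw [rep_chi_chi, if_pos rfl]

lemma left_chi_mem_fiber (X : CfModule K) (ξ : X) :
    X.left (LInf.chi ((1 : G) : G ⧸ (K : Subgroup G))) ξ ∈ X.fiber := ⟨ξ, rfl⟩

lemma chi_smul (g g' : G) : LInf.translate g (LInf.chi ((g' : G) : G ⧸ (K : Subgroup G))) =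
    LInf.chi ((g * g' : G) : G ⧸ (K : Subgroup G)) := LInf.translate_chi _ _

lemma left_fiber (X : CfModule K) (f : LInf (G ⧸ (K : Subgroup G))) (v : X.fiber) :
    X.left f (v : X) = f ((1 : G) : G ⧸ (K : Subgroup G)) • (v : X) := by
  conv_lhs => rw [← (X.mem_fiber_iff _).1 v.2]
  rw [rep_apply_chi, (X.mem_fiber_iff _).1 v.2]

lemma left_π_fiber (X : CfModule K) (f : LInf (G ⧸ (K : Subgroup G))) (g : G) (v : X.fiber) :
    X.left f (X.π g v) = f (g : G ⧸ (K : Subgroup G)) • X.π g (v : X) := by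
  have e : f = LInf.translate g (LInf.translate g⁻¹ f) := LInf.ext fun x => by simp
  rw [e, ← π_left, left_fiber, map_smul, ← e, LInf.translate_apply, inv_inv,
    MulAction.Quotient.smul_coe, smul_eq_mul, mul_one]

lemma left_chi_π_fiber [DecidableEq (G ⧸ (K : Subgroup G))] (X : CfModule K)
    (x : G ⧸ (K : Subgroup G)) (g : G) (v : X.fiber) :
    X.left (LInf.chi x) (X.π g v) =
      if (g : G ⧸ (K : Subgroup G)) = x then X.π g (v : X) else 0 := by
  rw [left_π_fiber, LInf.chi_apply]
  split_ifs <;> simp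

/-- The component `χ_{gK} ξ`, moved to the fiber. -/
def toFiber (X : CfModule K) (g : G) (ξ : X) : X.fiber :=
  ⟨X.π g⁻¹ (X.left (LInf.chi (g : G ⧸ (K : Subgroup G))) ξ), by
    rw [mem_fiber_iff, π_left, chi_smul, inv_mul_cancel]
    classical
    rw [rep_chi_chi, if_pos rfl]⟩

lemma π_toFiber (X : CfModule K) (g : G) (ξ : X) :
    X.π g (X.toFiber g ξ) = X.left (LInf.chi (g : G ⧸ (K : Subgroup G))) ξ :=
  π_apply_inv X g _

/-- The action of `K` on the fiber. -/
def kact (X : CfModule K) (k : K) : X.fiber →ₗ[ℂ] X.fiber :=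
  (X.π k).toLinearMap.restrict fun v hv => by
    rw [mem_fiber_iff] at hv ⊢
    have : LInf.chi ((1 : G) : G ⧸ (K : Subgroup G)) =
        LInf.translate (k : G) (LInf.chi ((1 : G) : G ⧸ (K : Subgroup G))) := by
      rw [chi_smul, mul_one]
      exact congrArg _ (QuotientGroup.eq.2 (by simp))
    change X.left _ (X.π k v) = X.π k v
    rw [this, ← π_left, hv]

@[simp] lemma coe_kact (X : CfModule K) (k : K) (v : X.fiber) :
    (X.kact k v : X) = X.π (k : G) (v : X) := rfl

/-- The right module structure of the fiber. -/
def ract (X : CfModule K) (f : LInf (G ⧸ (K : Subgroup G))) : X.fiber →ₗ[ℂ] X.fiber :=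
  (X.right f).toLinearMap.restrict fun v hv => by
    rw [mem_fiber_iff] at hv ⊢
    change X.left _ (X.right f v) = X.right f v
    rw [left_right_comm, hv]

@[simp] lemma coe_ract (X : CfModule K) (f : LInf (G ⧸ (K : Subgroup G))) (v : X.fiber) :
    (X.ract f v : X) = X.right f (v : X) := rfl

/-- The projection of the fiber on its component of degree `γ`. -/
def gr (X : CfModule K) (γ : Γ) : X.fiber →ₗ[ℂ] X.fiber :=
  X.ract (LInf.chi ((γ : G) : G ⧸ (K : Subgroup G)))

@[simp] lemma coe_gr (X : CfModule K) (γ : Γ) (v : X.fiber) :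
    (X.gr γ v : X) = X.right (LInf.chi ((γ : G) : G ⧸ (K : Subgroup G))) (v : X) := rfl

lemma gr_gr [DecidableEq Γ] (h : Γ.IsComplement' (K : Subgroup G)) (X : CfModule K) (γ δ : Γ)
    (v : X.fiber) : X.gr γ (X.gr δ v) = if γ = δ then X.gr γ v else 0 := by
  classical
  refine Subtype.ext ?_
  rw [coe_gr, coe_gr, rep_chi_chi]
  simp only [mk_eq_mk_iff h]
  split_ifs <;> rfl

lemma gr_ract (X : CfModule K) (f : LInf (G ⧸ (K : Subgroup G))) (γ : Γ) (v : X.fiber) :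
    X.gr γ (X.ract f v) = f ((γ : G) : G ⧸ (K : Subgroup G)) • X.gr γ v :=
  Subtype.ext (by
    rw [coe_gr, coe_ract, rep_chi_apply, Submodule.coe_smul, coe_gr])

lemma kact_mul (X : CfModule K) (k k' : K) (v : X.fiber) :
    X.kact (k * k') v = X.kact k (X.kact k' v) := Subtype.ext (π_mul_apply X _ _ _)

lemma kact_one (X : CfModule K) (v : X.fiber) : X.kact 1 v = v := Subtype.ext (by simp)

lemma inner_kact (X : CfModule K) (k : K) (v w : X.fiber) :
    inner ℂ (X.kact k v) (X.kact k w) = inner ℂ v w := π_inner X _ _ _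

lemma inner_gr (X : CfModule K) (γ : Γ) (v w : X.fiber) :
    inner ℂ (X.gr γ v) w = inner ℂ v (X.gr γ w) := rep_chi_inner _ _ _ _

lemma kact_gr (h : Γ.IsComplement' (K : Subgroup G)) (X : CfModule K) (k : K) (γ : Γ)
    (v : X.fiber) : X.kact k (X.gr γ v) = X.gr (gam h (k * γ)) (X.kact k v) :=
  Subtype.ext (by rw [coe_kact, coe_gr, coe_gr, coe_kact, π_right, chi_smul, mk_gam])

lemma finite_gr (h : Γ.IsComplement' (K : Subgroup G)) (X : CfModule K) :
    {γ : Γ | ∃ v, X.gr γ v ≠ 0}.Finite := by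
  refine ((X.finite_support ((1 : G) : G ⧸ (K : Subgroup G))).preimage
    (f := fun γ : Γ => ((γ : G) : G ⧸ (K : Subgroup G)))
      ((gamEquiv h).injective.injOn)).subset ?_
  rintro γ ⟨v, hv⟩ e
  refine hv (Subtype.ext ?_)
  have := DFunLike.congr_fun e (v : X)
  rw [ContinuousLinearMap.comp_apply, left_right_comm, (X.mem_fiber_iff _).1 v.2] at this
  exact this

/-- The finite set of degrees that occur in the fiber. -/
def grSupp (h : Γ.IsComplement' (K : Subgroup G)) (X : CfModule K) : Finset Γ :=
  (X.finite_gr h).toFinset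

lemma gr_eq_zero (h : Γ.IsComplement' (K : Subgroup G)) (X : CfModule K) {γ : Γ}
    (hγ : γ ∉ X.grSupp h) (v : X.fiber) : X.gr γ v = 0 := by
  by_contra hc
  exact hγ ((X.finite_gr h).mem_toFinset.2 ⟨v, hc⟩)

lemma sum_gr (h : Γ.IsComplement' (K : Subgroup G)) (X : CfModule K) (v : X.fiber) :
    ∑ γ ∈ X.grSupp h, X.gr γ v = v := by
  refine Subtype.ext ?_
  have h1 := (gamEquiv h).hasSum_iff.2 (X.right_normal (v : X))
  have h2 : HasSum (fun γ : Γ => (X.gr γ v : X)) (∑ γ ∈ X.grSupp h, (X.gr γ v : X)) :=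
    hasSum_sum_of_ne_finset_zero fun γ hγ => by rw [X.gr_eq_zero h hγ]; rfl
  rw [AddSubmonoidClass.coe_finsetSum]
  exact h2.unique h1

lemma fiber_ext_gr (h : Γ.IsComplement' (K : Subgroup G)) (X : CfModule K) {v w : X.fiber}
    (e : ∀ γ : Γ, X.gr γ v = X.gr γ w) : v = w := by
  rw [← X.sum_gr h v, ← X.sum_gr h w]
  exact Finset.sum_congr rfl fun γ _ => e γ

/-- The translates of the fiber span a dense subspace. -/
lemma mem_of_fiber (h : Γ.IsComplement' (K : Subgroup G)) (X : CfModule K) (S : Submodule ℂ X)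
    (hS : IsClosed (S : Set X)) (hv : ∀ (γ : Γ) (v : X.fiber), X.π γ v ∈ S) (ξ : X) : ξ ∈ S := by
  have h1 := X.left_normal.denseRange (w := ξ) (S := S) fun x => by
    obtain ⟨γ, rfl⟩ := (gamEquiv h).surjective x
    rw [gamEquiv_apply, ← π_toFiber]
    exact hv _ _
  rwa [hS.submodule_topologicalClosure_eq] at h1

lemma clm_ext_fiber (h : Γ.IsComplement' (K : Subgroup G)) (X : CfModule K) {W : Type*}
    [NormedAddCommGroup W] [NormedSpace ℂ W] {A B : X →L[ℂ] W}
    (e : ∀ (γ : Γ) (v : X.fiber), A (X.π γ v) = B (X.π γ v)) : A = B := by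
  ext ξ
  exact X.mem_of_fiber h (LinearMap.eqLocus A.toLinearMap B.toLinearMap)
    (isClosed_eq A.continuous B.continuous) e ξ

/-- The translates of the fiber, as isometries. -/
def fiberIsom (X : CfModule K) (γ : Γ) : X.fiber →ₗᵢ[ℂ] X where
  toLinearMap := (X.π γ).toLinearMap ∘ₗ X.fiber.subtype
  norm_map' v := X.norm_π γ v

@[simp] lemma fiberIsom_apply (X : CfModule K) (γ : Γ) (v : X.fiber) :
    X.fiberIsom γ v = X.π γ (v : X) := rfl

lemma orthogonal_fiberIsom (h : Γ.IsComplement' (K : Subgroup G)) (X : CfModule K) :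
    OrthogonalFamily ℂ (fun _ : Γ => X.fiber) X.fiberIsom := by
  classical
  intro γ δ hne v w
  have h1 := X.left_chi_π_fiber ((γ : G) : G ⧸ (K : Subgroup G)) γ v
  have h2 := X.left_chi_π_fiber ((γ : G) : G ⧸ (K : Subgroup G)) δ w
  rw [if_pos rfl] at h1
  rw [if_neg (fun e => hne ((mk_eq_mk_iff h).1 e).symm)] at h2
  rw [fiberIsom_apply, fiberIsom_apply, ← h1, rep_chi_inner, h2, inner_zero_right]

/-- A linear map between the fibers extends to the modules, compatibly with the translations by
`Γ`. -/
lemma exists_extension (h : Γ.IsComplement' (K : Subgroup G)) (X Y : CfModule K)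
    (T : X.fiber →ₗ[ℂ] Y.fiber) :
    ∃ A : X →L[ℂ] Y, ∀ (γ : Γ) (v : X.fiber), A (X.π γ v) = Y.π γ (T v) := by
  let e : (Γ →₀ X.fiber) →ₗ[ℂ] X := Finsupp.lsum ℂ fun γ => (X.fiberIsom γ).toLinearMap
  let f : (Γ →₀ X.fiber) →ₗ[ℂ] Y := Finsupp.lsum ℂ fun γ => (Y.fiberIsom γ).toLinearMap ∘ₗ T
  have hd : DenseRange e := fun ξ => X.mem_of_fiber h (LinearMap.range e).topologicalClosure
    (Submodule.isClosed_topologicalClosure _) (fun γ v => Submodule.le_topologicalClosure _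
      ⟨Finsupp.single γ v, by simp [e]⟩) ξ
  let T' : X.fiber →L[ℂ] Y.fiber := T.toContinuousLinearMap
  have hb : ∀ v, ‖f v‖ ≤ ‖T'‖ * ‖e v‖ := fun v => by
    refine le_of_sq_le_sq ?_ (by positivity)
    have h1 : ‖f v‖ ^ 2 = ∑ γ ∈ v.support, ‖T (v γ)‖ ^ 2 :=
      (Y.orthogonal_fiberIsom h).norm_sum (fun γ => T (v γ)) v.support
    have h2 : ‖e v‖ ^ 2 = ∑ γ ∈ v.support, ‖v γ‖ ^ 2 :=
      (X.orthogonal_fiberIsom h).norm_sum (fun γ => v γ) v.support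
    rw [mul_pow, h1, h2, Finset.mul_sum]
    refine Finset.sum_le_sum fun γ _ => ?_
    rw [← mul_pow]
    gcongr
    exact T'.le_opNorm (v γ)
  refine ⟨f.extendOfNorm e, fun γ v => ?_⟩
  have := LinearMap.extendOfNorm_eq (f := f) (e := e) hd ⟨_, hb⟩ (Finsupp.single γ v)
  simpa [e, f] using this

end CfModule

/-- The morphisms between two modules are the linear maps between the fibers that commute with the
action of `K` and preserve the grading. -/
lemma exists_map_iff (h : Γ.IsComplement' (K : Subgroup G)) {X Y : CfModule K}
    (T : X.fiber →ₗ[ℂ] Y.fiber) :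
    (∃ f : X ⟶ Y, (fiberFunctor K).map f =
        HilbF.ofLin (X := (fiberFunctor K).obj X) (Y := (fiberFunctor K).obj Y) T) ↔
      (∀ k v, T (X.kact k v) = Y.kact k (T v)) ∧ ∀ (γ : Γ) v, T (X.gr γ v) = Y.gr γ (T v) := by
  constructor
  · rintro ⟨f, hf⟩
    have hT : ∀ v, (T v : Y) = CfModule.op f v := fun v =>
      (congrArg Subtype.val (LinearMap.congr_fun hf v)).symm
    refine ⟨fun k v => Subtype.ext ?_, fun γ v => Subtype.ext ?_⟩
    · rw [hT, CfModule.coe_kact, CfModule.coe_kact, hT, CfModule.op_π]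
    · rw [hT, CfModule.coe_gr, CfModule.coe_gr, hT, CfModule.op_right]
  · rintro ⟨h1, h2⟩
    obtain ⟨A, hA⟩ := CfModule.exists_extension h X Y T
    have h3 : ∀ f v, T (X.ract f v) = Y.ract f (T v) := fun f v =>
      Y.fiber_ext_gr h fun γ => by
        rw [← h2, X.gr_ract, Y.gr_ract, map_smul, h2]
    have hAπ : ∀ g (v : X.fiber), A (X.π g (v : X)) = Y.π g (T v : Y) := fun g v => by
      conv_lhs => rw [← gam_mul_kap h g, CfModule.π_mul_apply, ← CfModule.coe_kact, hA, h1,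
        CfModule.coe_kact, ← CfModule.π_mul_apply, gam_mul_kap h g]
    have hr : ∀ (Z : CfModule K) (f : LInf (G ⧸ (K : Subgroup G))) (g : G) (v : Z.fiber),
        Z.right f (Z.π g (v : Z)) = Z.π g (Z.ract (f.translate g⁻¹) v : Z) := fun Z f g v => by
      rw [CfModule.coe_ract, CfModule.π_right]
      congr 2
      exact LInf.ext fun x => by simp
    refine ⟨CfModule.mkHom A (fun g => clm_intertwine (M := A) (X.clm_ext_fiber h fun γ v => ?_))
      (fun f => clm_intertwine (M := A) (X.clm_ext_fiber h fun γ v => ?_))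
      (fun f => clm_intertwine (M := A) (X.clm_ext_fiber h fun γ v => ?_)), ?_⟩
    · rw [ContinuousLinearMap.comp_apply, ContinuousLinearMap.comp_apply, ← CfModule.π_mul_apply,
        hAπ, hAπ, CfModule.π_mul_apply]
    · rw [ContinuousLinearMap.comp_apply, ContinuousLinearMap.comp_apply, CfModule.left_π_fiber,
        map_smul, hAπ, CfModule.left_π_fiber]
    · rw [ContinuousLinearMap.comp_apply, ContinuousLinearMap.comp_apply, hr, hAπ, hAπ, hr, h3]
    · refine HilbF.hom_ext (LinearMap.ext fun v => Subtype.ext ?_)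
      have := hAπ 1 v
      simp only [map_one] at this
      exact this

end FiberData

/-! ### The monoidal structure of the fiber functor -/

section FiberTensor

variable {G : Type u} [Group G] [TopologicalSpace G] {K : OpenSubgroup G} {Γ : Subgroup G}
  (h : Γ.IsComplement' (K : Subgroup G))

namespace CfModule

variable (X Y Z : CfModule K)

/-- Every tensor is a sum of elementary tensors with a homogeneous first factor. -/
lemma tensor_gr_induction (h : Γ.IsComplement' (K : Subgroup G)) {X : CfModule K} {W : Type*}
    [AddCommGroup W] [Module ℂ W] {P : X.fiber ⊗[ℂ] W → Prop} (hadd : ∀ a b, P a → P b → P (a + b))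
    (hgr : ∀ (γ : Γ) v w, P (X.gr γ v ⊗ₜ w)) (t : X.fiber ⊗[ℂ] W) : P t := by
  have h0 : P 0 := by simpa using hgr 1 0 0
  induction t with
  | zero => exact h0
  | add a b ha hb => exact hadd a b ha hb
  | tmul v w =>
    rw [← X.sum_gr h v, TensorProduct.sum_tmul]
    exact Finset.sum_induction _ P hadd h0 fun γ _ => hgr γ v w

lemma linearMap_ext_gr (h : Γ.IsComplement' (K : Subgroup G)) {X : CfModule K} {V W : Type*}
    [AddCommGroup V] [Module ℂ V] [AddCommGroup W] [Module ℂ W] {A B : X.fiber ⊗[ℂ] V →ₗ[ℂ] W}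
    (e : ∀ (γ : Γ) v w, A (X.gr γ v ⊗ₜ w) = B (X.gr γ v ⊗ₜ w)) : A = B :=
  LinearMap.ext (tensor_gr_induction h (fun a b ha hb => by rw [map_add, map_add, ha, hb]) e)

lemma linearMap_ext_gr₃ (h : Γ.IsComplement' (K : Subgroup G)) {X Y : CfModule K} {V W : Type*}
    [AddCommGroup V] [Module ℂ V] [AddCommGroup W] [Module ℂ W]
    {A B : (X.fiber ⊗[ℂ] Y.fiber) ⊗[ℂ] V →ₗ[ℂ] W}
    (e : ∀ (γ δ : Γ) u v w, A ((X.gr γ u ⊗ₜ Y.gr δ v) ⊗ₜ w) = B ((X.gr γ u ⊗ₜ Y.gr δ v) ⊗ₜ w)) :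
    A = B := by
  refine TensorProduct.ext (linearMap_ext_gr h fun γ u v => LinearMap.ext fun w => ?_)
  rw [← Y.sum_gr h v, TensorProduct.tmul_sum, map_sum, map_sum, LinearMap.sum_apply,
    LinearMap.sum_apply]
  exact Finset.sum_congr rfl fun δ _ => e γ δ u v w

/-- The map `v ⊗ w ↦ ∑_γ v χ_γ ⊗ π(γ) w`. -/
def muAux : X.fiber ⊗[ℂ] Y.fiber →ₗ[ℂ] tensor X Y :=
  ∑ γ ∈ X.grSupp h, tmₗ X Y ∘ₗ TensorProduct.map (X.fiber.subtype ∘ₗ X.gr γ)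
    ((Y.π γ).toLinearMap ∘ₗ Y.fiber.subtype)

lemma muAux_gr (γ : Γ) (v : X.fiber) (w : Y.fiber) :
    muAux h X Y (X.gr γ v ⊗ₜ w) = tm (X.gr γ v : X) (Y.π γ (w : Y)) := by
  classical
  have h1 : ∀ δ, (tmₗ X Y ∘ₗ TensorProduct.map (X.fiber.subtype ∘ₗ X.gr δ)
      ((Y.π δ).toLinearMap ∘ₗ Y.fiber.subtype)) (X.gr γ v ⊗ₜ w) =
      if δ = γ then tm (X.gr γ v : X) (Y.π γ (w : Y)) else 0 := fun δ => by
    change tmₗ X Y ((X.gr δ (X.gr γ v) : X) ⊗ₜ Y.π δ (w : Y)) = _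
    rw [gr_gr h]
    split_ifs with e
    · rw [e]; rfl
    · rw [Submodule.coe_zero, TensorProduct.zero_tmul, map_zero]
  rw [muAux, LinearMap.sum_apply]
  simp only [h1]
  rw [Finset.sum_ite_eq']
  split_ifs with hγ
  · rfl
  · rw [X.gr_eq_zero h hγ, Submodule.coe_zero]
    exact (map_zero (tmL (X := X) (Y.π γ (w : Y)))).symm

lemma tm_mem_fiber (v : X.fiber) (η : Y) : tm (v : X) η ∈ (tensor X Y).fiber := by
  rw [mem_fiber_iff, tm_left, (X.mem_fiber_iff _).1 v.2]

/-- The map `v ⊗ w ↦ ∑_γ v χ_γ ⊗ π(γ) w` to the fiber of the tensor product; it is the inverse of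
the structure map of the fiber functor. -/
def mu : X.fiber ⊗[ℂ] Y.fiber →ₗ[ℂ] (tensor X Y).fiber :=
  (muAux h X Y).codRestrict _ (tensor_gr_induction h
    (fun a b ha hb => by rw [map_add]; exact add_mem ha hb)
    (fun γ v w => by rw [muAux_gr]; exact tm_mem_fiber X Y _ _))

lemma coe_mu_gr (γ : Γ) (v : X.fiber) (w : Y.fiber) :
    (mu h X Y (X.gr γ v ⊗ₜ w) : tensor X Y) = tm (X.gr γ v : X) (Y.π γ (w : Y)) :=
  muAux_gr h X Y γ v w

variable {X Y} in
lemma coe_mu_of_gr {γ : Γ} {v : X.fiber} (hv : X.gr γ v = v) (w : Y.fiber) :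
    (mu h X Y (v ⊗ₜ w) : tensor X Y) = tm (v : X) (Y.π γ (w : Y)) := by
  rw [← hv, coe_mu_gr]

/-- On homogeneous vectors, `mu` is `v ⊗ w ↦ v ⊗ π(γ) w` in the Hilbert space tensor product, and
components of different degrees are mapped to orthogonal vectors. -/
lemma inner_mu (s t : X.fiber ⊗[ℂ] Y.fiber) : inner ℂ (mu h X Y s) (mu h X Y t) = inner ℂ s t := by
  classical
  refine tensor_gr_induction h (P := fun s => inner ℂ (mu h X Y s) (mu h X Y t) = inner ℂ s t)
    (fun a b ha hb => by
      rw [map_add, inner_add_left, ha, hb]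
      exact (inner_add_left (𝕜 := ℂ) a b t).symm) (fun γ v w => ?_) s
  refine tensor_gr_induction h (P := fun t => inner ℂ (mu h X Y (X.gr γ v ⊗ₜ w)) (mu h X Y t) =
    inner ℂ (X.gr γ v ⊗ₜ w) t)
    (fun a b ha hb => by
      rw [map_add, inner_add_right, ha, hb]
      exact (inner_add_right (𝕜 := ℂ) _ a b).symm)
    (fun δ v' w' => ?_) t
  rw [Submodule.coe_inner, coe_mu_gr, coe_mu_gr, TensorProduct.inner_tmul]
  have h1 := tm_inner (X := X) (Y := Y) (X.gr γ v) (X.gr δ v') (Y.π γ (w : Y)) (Y.π δ (w' : Y))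
  refine h1.unique ?_
  have h2 : inner ℂ (X.gr γ v) (X.gr δ v') * inner ℂ w w' =
      inner ℂ (X.gr γ v : X) (X.right (LInf.chi ((δ : G) : G ⧸ (K : Subgroup G))) (X.gr δ v')) *
        inner ℂ (Y.π γ (w : Y))
          (Y.left (LInf.chi ((δ : G) : G ⧸ (K : Subgroup G))) (Y.π δ (w' : Y))) := by
    rw [← coe_gr, gr_gr h, if_pos rfl, left_chi_π_fiber, if_pos rfl]
    by_cases e : γ = δ
    · rw [e, π_inner]; rfl
    · rw [← Submodule.coe_inner, inner_gr, gr_gr h, if_neg e, inner_zero_right, zero_mul, zero_mul]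
  rw [h2]
  refine hasSum_single _ fun x hx => ?_
  rw [left_chi_π_fiber, if_neg (Ne.symm hx), inner_zero_right, mul_zero]

lemma norm_mu (t : X.fiber ⊗[ℂ] Y.fiber) : ‖mu h X Y t‖ = ‖t‖ := by
  rw [norm_eq_sqrt_re_inner (𝕜 := ℂ), inner_mu]
  exact (norm_eq_sqrt_re_inner (𝕜 := ℂ) t).symm

/-- The range is closed, since it is finite-dimensional, and it contains the images under `χ_K` of
the dense set of the finite sums of elementary tensors. -/
lemma mu_surjective : Function.Surjective (mu h X Y) := by
  let S : Submodule ℂ (tensor X Y) := LinearMap.range ((tensor X Y).fiber.subtype ∘ₗ mu h X Y)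
  have hS : IsClosed (S : Set (tensor X Y)) := Submodule.closed_of_finiteDimensional S
  have h1 : ∀ ζ : tensor X Y,
      (tensor X Y).left (LInf.chi ((1 : G) : G ⧸ (K : Subgroup G))) ζ ∈ S := fun ζ => by
    refine (denseRange_tmₗ X Y).induction_on (p := fun ζ =>
      (tensor X Y).left (LInf.chi ((1 : G) : G ⧸ (K : Subgroup G))) ζ ∈ S) ζ
      (hS.preimage (ContinuousLinearMap.continuous _)) fun t => ?_
    induction t with
    | zero => rw [map_zero, map_zero]; exact S.zero_mem
    | add a b ha hb => rw [map_add, map_add]; exact S.add_mem ha hb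
    | tmul ξ η =>
      rw [tmₗ_tmul, tm_left]
      let v : X.fiber := ⟨_, X.left_chi_mem_fiber ξ⟩
      change tm (v : X) η ∈ S
      rw [← X.sum_gr h v, AddSubmonoidClass.coe_finsetSum, ← tmL_apply, map_sum]
      refine S.sum_mem fun γ _ => ⟨X.gr γ v ⊗ₜ Y.toFiber γ η, ?_⟩
      change (mu h X Y (X.gr γ v ⊗ₜ Y.toFiber γ η) : tensor X Y) = _
      classical
      rw [coe_mu_gr, π_toFiber, ← tm_balanced, ← coe_gr, gr_gr h, if_pos rfl]
      rfl
  intro ζ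
  obtain ⟨t, ht⟩ := h1 ζ
  rw [((tensor X Y).mem_fiber_iff _).1 ζ.2] at ht
  exact ⟨t, Subtype.ext ht⟩

/-- The unitary `mu`. -/
def muEquiv : X.fiber ⊗[ℂ] Y.fiber ≃ₗᵢ[ℂ] (tensor X Y).fiber where
  toLinearEquiv := LinearEquiv.ofBijective (mu h X Y)
    ⟨(injective_iff_map_eq_zero (mu h X Y)).2 fun t e =>
      norm_eq_zero.1 (by rw [← norm_mu h X Y, e, norm_zero]), mu_surjective h X Y⟩
  norm_map' := norm_mu h X Y

@[simp] lemma muEquiv_apply (t : X.fiber ⊗[ℂ] Y.fiber) : muEquiv h X Y t = mu h X Y t := rfl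

lemma inner_muEquiv (v : X.fiber ⊗[ℂ] Y.fiber) (w : (tensor X Y).fiber) :
    inner ℂ (muEquiv h X Y v) w = inner ℂ v ((muEquiv h X Y).symm w) := by
  conv_lhs => rw [← (muEquiv h X Y).apply_symm_apply w]
  exact inner_mu h X Y _ _

/-- The grading of the fiber of a tensor product. -/
lemma gr_mu (γ δ : Γ) (v : X.fiber) (w : Y.fiber) :
    (tensor X Y).gr δ (mu h X Y (X.gr γ v ⊗ₜ w)) = mu h X Y (X.gr γ v ⊗ₜ Y.gr (γ⁻¹ * δ) w) := by
  refine Subtype.ext ?_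
  rw [coe_gr, coe_mu_gr, coe_mu_gr, tm_right, coe_gr Y, π_right, chi_smul, ← Subgroup.coe_mul,
    mul_inv_cancel_left]

/-- The action of `K` on the fiber of a tensor product. -/
lemma kact_mu (k : K) (γ : Γ) (v : X.fiber) (w : Y.fiber) :
    (tensor X Y).kact k (mu h X Y (X.gr γ v ⊗ₜ w)) =
      mu h X Y (X.kact k (X.gr γ v) ⊗ₜ Y.kact (kap h (k * γ)) w) := by
  refine Subtype.ext ?_
  rw [coe_kact, coe_mu_gr, tm_π, kact_gr h, coe_mu_gr, ← kact_gr h, coe_kact, coe_kact,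
    ← π_mul_apply, ← π_mul_apply, gam_mul_kap h]

/-- The map `mu` is associative. -/
lemma mu_assoc (γ δ : Γ) (u : X.fiber) (v : Y.fiber) (w : Z.fiber) :
    op (assoc X Y Z).hom (mu h (tensor X Y) Z (mu h X Y (X.gr γ u ⊗ₜ Y.gr δ v) ⊗ₜ w)) =
      mu h X (tensor Y Z) (X.gr γ u ⊗ₜ mu h Y Z (Y.gr δ v ⊗ₜ w)) := by
  have e : (tensor X Y).gr (γ * δ) (mu h X Y (X.gr γ u ⊗ₜ Y.gr δ v)) =
      mu h X Y (X.gr γ u ⊗ₜ Y.gr δ v) := by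
    classical
    rw [gr_mu, inv_mul_cancel_left, gr_gr h, if_pos rfl]
  rw [coe_mu_of_gr h e, coe_mu_gr, coe_mu_gr, assoc_tm, coe_mu_gr, tm_π, Subgroup.coe_mul,
    π_mul_apply]

end CfModule

end FiberTensor

section FiberDagger

open CfModule

variable {G : Type u} [Group G] [TopologicalSpace G] {K : OpenSubgroup G}

lemma map_dagger {X Y : CfModule K} (f : X ⟶ Y) : (fiberFunctor K).map (HasDagger.dagger f) =
    HasDagger.dagger ((fiberFunctor K).map f) := by
  refine HilbF.hom_ext ?_
  refine (LinearMap.eq_adjoint_iff _ _).2 fun v w => ?_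
  exact (op f).adjoint_inner_left (w.1 : X) (v.1 : Y)

end FiberDagger

section FiberMonoidal

lemma L2.inner_delta {A : Type*} (x : A) (ξ : L2 A) : inner ℂ (L2.delta x) ξ = ξ x := by
  classical
  have := lp.inner_single_left (𝕜 := ℂ) x (1 : ℂ) ξ
  simp only [RCLike.inner_apply, map_one, mul_one] at this
  convert! this using 2

lemma L2.norm_delta {A : Type*} (x : A) : ‖(L2.delta x : L2 A)‖ = 1 := by
  classical
  rw [norm_eq_sqrt_re_inner (𝕜 := ℂ), L2.inner_delta, L2.delta_apply, if_pos rfl]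
  simp

open CfModule

variable {G : Type u} [Group G] [TopologicalSpace G] [IsTopologicalGroup G] {K : OpenSubgroup G}
  {Γ : Subgroup G} (h : Γ.IsComplement' (K : Subgroup G))

lemma delta_mem_fiber : (show unit K from L2.delta ((1 : G) : G ⧸ (K : Subgroup G))) ∈
    (unit K).fiber := by
  classical
  rw [mem_fiber_iff]
  refine (L2.mulRep_chi _ _).trans ?_
  have : (L2.delta ((1 : G) : G ⧸ (K : Subgroup G)) : L2 (G ⧸ (K : Subgroup G)))
      ((1 : G) : G ⧸ (K : Subgroup G)) = 1 := (L2.delta_apply _ _).trans (if_pos rfl)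
  exact (congrArg (· • _) this).trans (one_smul ℂ _)

/-- The unit vector of the fiber of `L²(G/K)`. -/
def unitVec (K : OpenSubgroup G) : (unit K).fiber :=
  ⟨L2.delta ((1 : G) : G ⧸ (K : Subgroup G)), delta_mem_fiber⟩

lemma norm_unitVec : ‖unitVec K‖ = 1 := by
  exact L2.norm_delta ((1 : G) : G ⧸ (K : Subgroup G))

lemma eq_smul_unitVec (v : (unit K).fiber) : ∃ c : ℂ, v = c • unitVec K := by
  have e : ∀ ξ : L2 (G ⧸ (K : Subgroup G)),
      L2.mulRep _ (LInf.chi ((1 : G) : G ⧸ (K : Subgroup G))) ξ = ξ →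
      ∃ c : ℂ, ξ = c • L2.delta ((1 : G) : G ⧸ (K : Subgroup G)) :=
    fun ξ hξ => ⟨ξ ((1 : G) : G ⧸ (K : Subgroup G)), hξ.symm.trans (L2.mulRep_chi _ _)⟩
  obtain ⟨c, hc⟩ := e v.1 ((mem_fiber_iff _ _).1 v.2)
  exact ⟨c, Subtype.ext hc⟩

/-- The unitary `ℂ ≃ χ_K · L²(G/K)`. -/
def unitEquiv (K : OpenSubgroup G) : ULift.{u} ℂ ≃ₗ[ℂ] (unit K).fiber :=
  LinearEquiv.ofBijective
    (LinearMap.toSpanSingleton ℂ (unit K).fiber (unitVec K) ∘ₗ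
      (ULift.moduleEquiv : ULift.{u} ℂ ≃ₗ[ℂ] ℂ).toLinearMap)
    ⟨fun a b e => by
      have e' : a.down • unitVec K = b.down • unitVec K := e
      have hne : unitVec K ≠ 0 := by
        rw [← norm_ne_zero_iff, norm_unitVec]; exact one_ne_zero
      exact ULift.ext _ _ (smul_left_injective ℂ hne e'), fun v => by
      obtain ⟨c, rfl⟩ := eq_smul_unitVec v
      exact ⟨⟨c⟩, rfl⟩⟩

lemma unitEquiv_apply (a : ULift.{u} ℂ) : unitEquiv K a = a.down • unitVec K := rfl

lemma gr_unitVec : (unit K).gr (1 : Γ) (unitVec K) = unitVec K := by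
  refine Subtype.ext ?_
  exact (mem_fiber_iff _ _).1 (unitVec K).2

lemma lunit_mu (X : CfModule K) (a : ℂ) (v : X.fiber) :
    op (lunit X).hom (mu h (unit K) X ((a • unitVec K) ⊗ₜ v)) = a • (v : X) := by
  have e : (unit K).gr (1 : Γ) (a • unitVec K) = a • unitVec K := by rw [map_smul, gr_unitVec]
  have e2 : L2.toLInf _ ((a • unitVec K : (unit K).fiber) : unit K) =
      a • LInf.chi ((1 : G) : G ⧸ (K : Subgroup G)) :=
    (map_smul (L2.toLInf _) a _).trans (congrArg (a • ·) (L2.toLInf_delta _))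
  rw [coe_mu_of_gr h e, lunit_tm, e2, map_smul, Subgroup.coe_one, map_one]
  exact congrArg (a • ·) ((X.mem_fiber_iff _).1 v.2)

lemma π_unitVec (g : G) : (unit K).π g (unitVec K : unit K) =
    (L2.delta (g : G ⧸ (K : Subgroup G)) : L2 (G ⧸ (K : Subgroup G))) := by
  refine (L2.permRep_delta g ((1 : G) : G ⧸ (K : Subgroup G))).trans ?_
  rw [MulAction.Quotient.smul_coe, smul_eq_mul, mul_one]

lemma runit_mu (X : CfModule K) (γ : Γ) (v : X.fiber) (a : ℂ) :
    op (runit X).hom (mu h X (unit K) (X.gr γ v ⊗ₜ (a • unitVec K))) = a • (X.gr γ v : X) := by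
  have e2 : L2.toLInf _ ((unit K).π γ ((a • unitVec K : (unit K).fiber) : unit K)) =
      a • LInf.chi ((γ : G) : G ⧸ (K : Subgroup G)) :=
    (congrArg (L2.toLInf _) (map_smul ((unit K).π γ) a _)).trans ((map_smul (L2.toLInf _) a _).trans
      (congrArg (fun f : LInf (G ⧸ (K : Subgroup G)) => a • f)
        ((congrArg (L2.toLInf _) (π_unitVec (γ : G))).trans (L2.toLInf_delta _))))
  classical
  rw [coe_mu_gr, runit_tm, e2, map_smul]
  refine congrArg (fun η : X => a • η) ?_
  exact congrArg Subtype.val ((gr_gr h X γ γ v).trans (if_pos rfl))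

/-- The monoidal structure of the fiber functor. -/
def fiberCore : (fiberFunctor K).CoreMonoidal where
  εIso := HilbF.isoOfLin (X := HilbF.unit) (Y := (fiberFunctor K).obj (unit K)) (unitEquiv K)
  μIso X Y := HilbF.isoOfLin (X := HilbF.tensor ((fiberFunctor K).obj X) ((fiberFunctor K).obj Y))
    (Y := (fiberFunctor K).obj (tensor X Y)) (muEquiv h X Y).toLinearEquiv
  μIso_hom_natural_left {X Y} f Z := HilbF.hom_ext (linearMap_ext_gr h (X := X)
    fun γ v w => by
      have e : Y.gr γ (HilbF.lin ((fiberFunctor K).map f) (X.gr γ v)) =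
          HilbF.lin ((fiberFunctor K).map f) (X.gr γ v) := by
        classical
        refine Subtype.ext ?_
        refine (op_right f _ _).symm.trans (congrArg (op f) ?_)
        exact congrArg Subtype.val ((gr_gr h X γ γ v).trans (if_pos rfl))
      refine Subtype.ext ((coe_mu_of_gr h e w).trans ?_)
      exact ((congrArg (op (tensorHom' f (𝟙 Z))) (coe_mu_gr h X Z γ v w)).trans
        (tensorHom'_tm f (𝟙 Z) _ _)).symm)
  μIso_hom_natural_right {X Y} Z f := HilbF.hom_ext (linearMap_ext_gr h (X := Z)
    fun γ v w => by
      refine Subtype.ext ((coe_mu_gr h Z Y γ v _).trans ?_)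
      refine Eq.trans ?_ ((congrArg (op (tensorHom' (𝟙 Z) f)) (coe_mu_gr h Z X γ v w)).trans
        (tensorHom'_tm (𝟙 Z) f _ _)).symm
      exact congrArg (tm (Z.gr γ v : Z)) (op_π f _ _).symm)
  associativity X Y Z := HilbF.hom_ext (linearMap_ext_gr₃ h (X := X) (Y := Y)
    fun γ δ u v w => Subtype.ext (mu_assoc h X Y Z γ δ u v w))
  left_unitality X := HilbF.hom_ext (TensorProduct.ext' fun a v =>
    Subtype.ext (lunit_mu h X a.down v).symm)
  right_unitality X := HilbF.hom_ext (linearMap_ext_gr h (X := X) fun γ v a =>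
    Subtype.ext (runit_mu h X γ v a.down).symm)

/-- The fiber functor is monoidal. -/
@[reducible] def fiberMonoidal : (fiberFunctor K).Monoidal := (fiberCore h).toMonoidal

/-- The unitary `ℂ ≃ χ_K · L²(G/K)`. -/
def unitIsom (K : OpenSubgroup G) : ULift.{u} ℂ ≃ₗᵢ[ℂ] (unit K).fiber where
  toLinearEquiv := unitEquiv K
  norm_map' a := by
    rw [unitEquiv_apply, norm_smul, norm_unitVec, mul_one]
    rfl

lemma tensor_unitary (X Y : CfModule K) : letI := fiberMonoidal h
    HasDagger.dagger (Functor.OplaxMonoidal.δ (fiberFunctor K) X Y) =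
      Functor.LaxMonoidal.μ (fiberFunctor K) X Y := by
  let := fiberMonoidal h
  exact HilbF.hom_ext (Eq.symm ((LinearMap.eq_adjoint_iff _ _).2 (inner_muEquiv h X Y)))

lemma unit_unitary : letI := fiberMonoidal h
    HasDagger.dagger (Functor.OplaxMonoidal.η (fiberFunctor K)) =
      Functor.LaxMonoidal.ε (fiberFunctor K) := by
  let := fiberMonoidal h
  refine HilbF.hom_ext (Eq.symm ((LinearMap.eq_adjoint_iff _ _).2 fun v w => ?_))
  exact (unitIsom K).inner_map_eq_flip v w

lemma isFiberFunctor : letI := fiberMonoidal h; IsFiberFunctor (fiberFunctor K) :=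
  letI := fiberMonoidal h
  { faithful := ⟨fun {X Y f g} e => hom_ext (X.clm_ext_fiber h fun γ v => by
      rw [op_π, op_π]
      exact congrArg _ (congrArg Subtype.val (LinearMap.congr_fun e v)))⟩
    additive := ⟨rfl⟩
    linear := ⟨fun _ _ => rfl⟩
    map_dagger := map_dagger
    tensor_unitary := tensor_unitary h
    unit_unitary := unit_unitary h }

lemma toHTensor_mu (X Y : CfModule K) (γ : Γ) (v : X.fiber) (w : Y.fiber) :
    toHTensor (mu h X Y (X.gr γ v ⊗ₜ w)).1 = HTensor.tmul (X.gr γ v : X) (Y.π γ (w : Y)) := by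
  classical
  have e1 : (mu h X Y (X.gr γ v ⊗ₜ w)).1 = rtmul X.right Y.left (X.gr γ v : X) (Y.π γ (w : Y)) :=
    coe_mu_gr h X Y γ v w
  have h1 := hasSum_rtmul X.right_normal Y.left_normal (X.gr γ v : X) (Y.π γ (w : Y))
  rw [e1]
  refine h1.unique ?_
  have h2 : HTensor.tmul (X.gr γ v : X) (Y.π γ (w : Y)) =
      HTensor.tmul (X.right (LInf.chi ((γ : G) : G ⧸ (K : Subgroup G))) (X.gr γ v))
        (Y.left (LInf.chi ((γ : G) : G ⧸ (K : Subgroup G))) (Y.π γ (w : Y))) := by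
    rw [← coe_gr, gr_gr h, if_pos rfl, left_chi_π_fiber, if_pos rfl]
  rw [h2]
  refine hasSum_single _ fun x hx => ?_
  rw [left_chi_π_fiber, if_neg (Ne.symm hx), HTensor.tmul_zero_right]

/-- The structure map of the fiber functor is given by `∑_γ 1 ⊗ π(γ)^* χ_γ`. -/
lemma hasSum_structure_map (X Y : CfModule K) (t : X.fiber ⊗[ℂ] Y.fiber) :
    HasSum (fun γ : Γ => HTensor.map (1 : X →L[ℂ] X)
        ((Y.π (γ : G)).adjoint ∘L Y.left (LInf.chi ((γ : G) : G ⧸ (K : Subgroup G))))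
        (toHTensor (mu h X Y t).1)) (fiberIncl X Y t) := by
  classical
  refine tensor_gr_induction h (P := fun t => HasSum (fun γ : Γ => HTensor.map (1 : X →L[ℂ] X)
        ((Y.π (γ : G)).adjoint ∘L Y.left (LInf.chi ((γ : G) : G ⧸ (K : Subgroup G))))
        (toHTensor (mu h X Y t).1)) (fiberIncl X Y t)) (fun a b ha hb => ?_) (fun γ v w => ?_) t
  · have e1 : fiberIncl X Y (a + b) = fiberIncl X Y a + fiberIncl X Y b :=
      (fiberIncl X Y).map_add a b
    rw [e1]
    simpa only [map_add, Submodule.coe_add] using! ha.add hb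
  · have e : ∀ δ : Γ, HTensor.map (1 : X →L[ℂ] X)
        ((Y.π (δ : G)).adjoint ∘L Y.left (LInf.chi ((δ : G) : G ⧸ (K : Subgroup G))))
        (toHTensor (mu h X Y (X.gr γ v ⊗ₜ w)).1) =
        if δ = γ then HTensor.tmul (X.gr γ v : X) (w : Y) else 0 := fun δ => by
      rw [toHTensor_mu, HTensor.map_tmul, ContinuousLinearMap.comp_apply, left_chi_π_fiber]
      simp only [mk_eq_mk_iff h]
      by_cases hδ : δ = γ
      · rw [if_pos hδ.symm, if_pos hδ, π_adjoint, hδ, π_inv_apply]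
        rfl
      · rw [if_neg (Ne.symm hδ), if_neg hδ, map_zero, HTensor.tmul_zero_right]
    simp only [e]
    exact hasSum_ite_eq γ _

end FiberMonoidal

/-! ### Modules with a prescribed fiber -/

section BlockOperators

variable {ι E : Type*} [NormedAddCommGroup E] [InnerProductSpace ℂ E]

/-- The bounded operator `(A ξ)(i) = A i (ξ (e i))` on `ℓ²(ι, E)`. -/
def blockOp (e : ι ≃ ι) (A : ι → E →L[ℂ] E) (C : ℝ) (hC : 0 ≤ C) (hA : ∀ i, ‖A i‖ ≤ C) :
    lp (fun _ : ι => E) 2 →L[ℂ] lp (fun _ : ι => E) 2 :=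
  have key : ∀ (ξ : lp (fun _ : ι => E) 2) i,
      ‖A i (ξ (e i))‖ ^ (2 : ℝ≥0∞).toReal ≤ C ^ 2 * ‖ξ (e i)‖ ^ (2 : ℝ≥0∞).toReal := fun ξ i => by
    simp only [ENNReal.toReal_ofNat, Real.rpow_ofNat, ← mul_pow]
    gcongr
    exact ((A i).le_opNorm _).trans (by gcongr; exact hA i)
  have hs : ∀ ξ : lp (fun _ : ι => E) 2, Summable fun i => ‖ξ (e i)‖ ^ (2 : ℝ≥0∞).toReal :=
    fun ξ => e.summable_iff.2 ((lp.memℓp ξ).summable (by norm_num))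
  have hm : ∀ ξ : lp (fun _ : ι => E) 2, Summable fun i =>
      ‖A i (ξ (e i))‖ ^ (2 : ℝ≥0∞).toReal := fun ξ =>
    .of_nonneg_of_le (fun i => by positivity) (key ξ) ((hs ξ).mul_left _)
  LinearMap.mkContinuous
    { toFun := fun ξ => (⟨fun i => A i (ξ (e i)), memℓp_gen (hm ξ)⟩ : lp (fun _ : ι => E) 2)
      map_add' := fun ξ η => lp.ext (funext fun i => map_add (A i) _ _)
      map_smul' := fun c ξ => lp.ext (funext fun i => map_smul (A i) c _) } C (fun ξ => by
    have h1 := lp.norm_rpow_eq_tsum (p := 2) (by norm_num)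
      (⟨fun i => A i (ξ (e i)), memℓp_gen (hm ξ)⟩ : lp (fun _ : ι => E) 2)
    have h2 := lp.norm_rpow_eq_tsum (p := 2) (by norm_num) ξ
    have h3 := e.tsum_eq (fun i => ‖ξ i‖ ^ (2 : ℝ≥0∞).toReal)
    have h4 := Summable.tsum_le_tsum (key ξ) (hm ξ) ((hs ξ).mul_left _)
    rw [tsum_mul_left, h3, ← h2] at h4
    rw [← h1] at h4
    refine le_of_sq_le_sq ?_ (by positivity)
    simpa [mul_pow] using h4)

lemma blockOp_apply (e : ι ≃ ι) (A : ι → E →L[ℂ] E) (C : ℝ) (hC : 0 ≤ C) (hA : ∀ i, ‖A i‖ ≤ C)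
    (ξ : lp (fun _ : ι => E) 2) (i : ι) : blockOp e A C hC hA ξ i = A i (ξ (e i)) := rfl

lemma norm_blockOp (e : ι ≃ ι) (A : ι → E →L[ℂ] E) (C : ℝ) (hC : 0 ≤ C) (hA : ∀ i, ‖A i‖ ≤ C)
    (h : ∀ i v, ‖A i v‖ = ‖v‖) (ξ : lp (fun _ : ι => E) 2) : ‖blockOp e A C hC hA ξ‖ = ‖ξ‖ := by
  have h1 := lp.norm_rpow_eq_tsum (p := 2) (by norm_num) (blockOp e A C hC hA ξ)
  have h2 := lp.norm_rpow_eq_tsum (p := 2) (by norm_num) ξ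
  have h3 := e.tsum_eq (fun i => ‖ξ i‖ ^ (2 : ℝ≥0∞).toReal)
  simp only [blockOp_apply, h, h3, ← h2] at h1
  refine (sq_eq_sq₀ (norm_nonneg _) (norm_nonneg _)).1 ?_
  simpa using h1

lemma blockOp_single [DecidableEq ι] (e : ι ≃ ι) (A : ι → E →L[ℂ] E) (C : ℝ) (hC : 0 ≤ C)
    (hA : ∀ i, ‖A i‖ ≤ C) (i : ι) (v : E) :
    blockOp e A C hC hA (lp.single 2 i v) = lp.single 2 (e.symm i) (A (e.symm i) v) := by
  refine lp.ext (funext fun j => ?_)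
  rw [blockOp_apply, lp.single_apply, lp.single_apply]
  by_cases hj : e j = i
  · obtain rfl : j = e.symm i := by rw [← hj, e.symm_apply_apply]
    rw [e.apply_symm_apply, Pi.single_eq_same, Pi.single_eq_same]
  · rw [Pi.single_eq_of_ne hj, Pi.single_eq_of_ne, map_zero]
    rintro rfl
    exact hj (e.apply_symm_apply i)

/-- The inclusion of the finitely supported families in `ℓ²(ι, E)`. -/
def finsuppToLp (ι E : Type*) [NormedAddCommGroup E] [InnerProductSpace ℂ E] [DecidableEq ι] :
    (ι →₀ E) →ₗ[ℂ] lp (fun _ : ι => E) 2 :=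
  Finsupp.lsum ℂ fun i => (lp.lsingle (𝕜 := ℂ) (E := fun _ : ι => E) 2 i)

lemma finsuppToLp_single [DecidableEq ι] (i : ι) (v : E) :
    finsuppToLp ι E (Finsupp.single i v) = lp.single 2 i v := by
  simp [finsuppToLp]

lemma denseRange_finsuppToLp [DecidableEq ι] : DenseRange (finsuppToLp ι E) := fun ξ => by
  refine mem_closure_of_tendsto (lp.hasSum_single (p := 2) (by simp) ξ)
    (Filter.Eventually.of_forall fun s => ⟨∑ i ∈ s, Finsupp.single i (ξ i), ?_⟩)
  rw [map_sum]
  exact Finset.sum_congr rfl fun i _ => finsuppToLp_single i _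

/-- The direct sum of the representations `A i` on `E`, on `ℓ²(ι, E)`. -/
def blockRep {Y : Type*} [CompleteSpace E] (A : ι → LInf Y →⋆ₐ[ℂ] (E →L[ℂ] E)) :
    LInf Y →⋆ₐ[ℂ] (lp (fun _ : ι => E) 2 →L[ℂ] lp (fun _ : ι => E) 2) where
  toFun f := blockOp (Equiv.refl ι) (fun i => A i f) ‖f‖ (norm_nonneg f)
    fun i => NonUnitalStarAlgHom.norm_apply_le (A i) f
  map_one' := by ext ξ i; simp [blockOp_apply]
  map_mul' f g := by ext ξ i; simp [blockOp_apply]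
  map_zero' := by ext ξ i; simp [blockOp_apply]
  map_add' f g := by ext ξ i; simp [blockOp_apply]
  commutes' c := by ext ξ i; simp [blockOp_apply, Algebra.algebraMap_eq_smul_one]
  map_star' f := by
    rw [ContinuousLinearMap.star_eq_adjoint]
    refine (ContinuousLinearMap.eq_adjoint_iff _ _).2 fun ξ η => ?_
    rw [lp.inner_eq_tsum, lp.inner_eq_tsum]
    refine tsum_congr fun i => ?_
    rw [blockOp_apply, blockOp_apply, map_star, ContinuousLinearMap.star_eq_adjoint,
      ContinuousLinearMap.adjoint_inner_left]
    rfl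

lemma isNormalRep_blockRep {Y : Type*} [CompleteSpace E] (A : ι → LInf Y →⋆ₐ[ℂ] (E →L[ℂ] E))
    (h : ∀ i, IsNormalRep (A i)) : IsNormalRep (blockRep A) := by
  classical
  refine isNormalRep_of_dense _ (finsuppToLp ι E) denseRange_finsuppToLp fun v => ?_
  induction v using Finsupp.induction_linear with
  | zero => simp only [map_zero]; exact hasSum_zero
  | single i v =>
    have := (h i v).mapL (lp.singleContinuousLinearMap ℂ (fun _ : ι => E) 2 i)
    rw [finsuppToLp_single]
    refine this.congr_fun fun x => ?_
    exact blockOp_single (Equiv.refl ι) (fun i => A i (LInf.chi x)) ‖(LInf.chi x : LInf Y)‖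
      (norm_nonneg _) (fun i => NonUnitalStarAlgHom.norm_apply_le (A i) _) i v
  | add a b ha hb => simpa only [map_add] using ha.add hb

end BlockOperators

namespace MatchedRep

variable {G : Type u} [Group G] [TopologicalSpace G] {K : OpenSubgroup G} {Γ : Subgroup G}
variable {h : Γ.IsComplement' (K : Subgroup G)} {n : Type*} [Fintype n] [DecidableEq n]
  (D : MatchedRep h n)

/-- The representation of the functions on `Γ` defined by the grading. -/
def ρ (F : Γ → ℂ) : Matrix n n ℂ := ∑ γ ∈ D.supp, F γ • D.p γ

lemma p_mul_ρ (γ : Γ) (F : Γ → ℂ) : D.p γ * D.ρ F = F γ • D.p γ := by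
  rw [ρ, Finset.mul_sum, Finset.sum_eq_single γ]
  · rw [mul_smul_comm, p_mul_self]
  · intro δ _ hδ
    rw [mul_smul_comm, D.p_mul_of_ne _ _ hδ.symm, smul_zero]
  · intro hγ
    rw [D.p_eq_zero _ hγ, zero_mul]

lemma ext_p {M N : Matrix n n ℂ} (e : ∀ γ, D.p γ * M = D.p γ * N) : M = N := by
  rw [← one_mul M, ← one_mul N, ← D.sum_p, Finset.sum_mul, Finset.sum_mul]
  exact Finset.sum_congr rfl fun γ _ => e γ

lemma p_mul_π (γ : Γ) (k : K) :
    D.p γ * D.π k = D.π k * D.p (gam h ((k : G)⁻¹ * γ)) := by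
  rw [D.π_mul_p, gam_mul_gam, mul_inv_cancel_left, gam_coe]

lemma π_mul_ρ (k : K) (F : Γ → ℂ) :
    D.π k * D.ρ F = D.ρ (fun γ => F (gam h ((k : G)⁻¹ * γ))) * D.π k := by
  refine D.ext_p fun γ => ?_
  rw [← mul_assoc, ← mul_assoc, p_mul_ρ, p_mul_π, mul_assoc, p_mul_ρ, smul_mul_assoc, p_mul_π,
    mul_smul_comm]

/-- The representation of `ℓ^∞(G / K)` on the fiber that the grading, shifted by `γ`, defines. -/
def rightFiber (γ : Γ) : LInf (G ⧸ (K : Subgroup G)) →⋆ₐ[ℂ]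
    (EuclideanSpace ℂ n →L[ℂ] EuclideanSpace ℂ n) :=
  (Matrix.toEuclideanCLM (n := n) (𝕜 := ℂ)).toStarAlgHom.comp
  { toFun := fun f => D.ρ fun δ => f (((γ : G) * δ : G) : G ⧸ (K : Subgroup G))
    map_one' := D.ext_p fun δ => by rw [p_mul_ρ]; simp
    map_mul' := fun f g => D.ext_p fun δ => by
      rw [← mul_assoc, p_mul_ρ, p_mul_ρ, smul_mul_assoc, p_mul_ρ, smul_smul]; rfl
    map_zero' := D.ext_p fun δ => by rw [p_mul_ρ]; simp
    map_add' := fun f g => D.ext_p fun δ => by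
      rw [mul_add, p_mul_ρ, p_mul_ρ, p_mul_ρ, ← add_smul]; rfl
    commutes' := fun c => D.ext_p fun δ => by
      rw [p_mul_ρ, Algebra.algebraMap_eq_smul_one, Algebra.algebraMap_eq_smul_one]; simp
    map_star' := fun f => by
      rw [ρ, ρ, star_sum]
      refine Finset.sum_congr rfl fun δ _ => ?_
      rw [star_smul, star_p]; rfl }

lemma rightFiber_apply (γ : Γ) (f : LInf (G ⧸ (K : Subgroup G))) :
    D.rightFiber γ f = Matrix.toEuclideanCLM (n := n) (𝕜 := ℂ)
      (D.ρ fun δ => f (((γ : G) * δ : G) : G ⧸ (K : Subgroup G))) := rfl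

lemma isNormalRep_rightFiber (γ : Γ) : IsNormalRep (D.rightFiber γ) := fun v => by
  classical
  have e : ∀ x, D.rightFiber γ (LInf.chi x) v = ∑ δ ∈ D.supp,
      if x = (((γ : G) * δ : G) : G ⧸ (K : Subgroup G)) then
        Matrix.toEuclideanCLM (n := n) (𝕜 := ℂ) (D.p δ) v else 0 := fun x => by
    rw [rightFiber_apply, ρ, map_sum, sum_apply]
    refine Finset.sum_congr rfl fun δ _ => ?_
    rw [map_smul, LInf.chi_apply]
    split_ifs with h1 h2 h2
    · simp
    · exact absurd h1.symm h2
    · exact absurd h2.symm h1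
    · simp
  simp only [e]
  convert! hasSum_sum fun δ (_ : δ ∈ D.supp) =>
    hasSum_ite_eq (((γ : G) * δ : G) : G ⧸ (K : Subgroup G))
      (Matrix.toEuclideanCLM (n := n) (𝕜 := ℂ) (D.p δ) v) using 1
  rw [← sum_apply, ← map_sum, D.sum_p, map_one]
  rfl

/-- Evaluation at a point as a representation on a Hilbert space, by scalars. -/
def _root_.evalRep {Y : Type*} (y : Y) (E : Type*) [NormedAddCommGroup E] [InnerProductSpace ℂ E]
    [CompleteSpace E] : LInf Y →⋆ₐ[ℂ] (E →L[ℂ] E) where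
  toFun f := f y • 1
  map_one' := by simp
  map_mul' f g := by simp [smul_smul, mul_comm]
  map_zero' := by simp
  map_add' f g := by simp [add_smul]
  commutes' c := by simp [Algebra.algebraMap_eq_smul_one]
  map_star' f := by simp

lemma _root_.isNormalRep_evalRep {Y : Type*} (y : Y) (E : Type*) [NormedAddCommGroup E]
    [InnerProductSpace ℂ E] [CompleteSpace E] : IsNormalRep (evalRep y E) := fun v => by
  classical
  convert! hasSum_ite_eq y v using 2 with x
  change (LInf.chi x y • (1 : E →L[ℂ] E)) v = _
  rw [LInf.chi_apply]
  split_ifs with h1 h2 h2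
  · simp
  · exact absurd h1.symm h2
  · exact absurd h2.symm h1
  · simp

lemma norm_π_apply (k : K) (v : EuclideanSpace ℂ n) :
    ‖Matrix.toEuclideanCLM (n := n) (𝕜 := ℂ) (D.π k) v‖ = ‖v‖ := by
  set T := Matrix.toEuclideanCLM (n := n) (𝕜 := ℂ) (D.π k)
  have hT : star T * T = 1 := by rw [← map_star, ← map_mul, D.star_mul_π, map_one]
  exact (ContinuousLinearMap.norm_map_iff_adjoint_comp_self T).2 hT v

variable [IsTopologicalGroup G]

/-- The action of `g` on the left cosets of `K`, as a permutation of `Γ`. -/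
def shift (h : Γ.IsComplement' (K : Subgroup G)) (g : G) : Γ ≃ Γ where
  toFun γ := gam h (g * γ)
  invFun γ := gam h (g⁻¹ * γ)
  left_inv γ := by
    beta_reduce
    rw [gam_mul_gam, inv_mul_cancel_left, gam_coe]
  right_inv γ := by
    beta_reduce
    rw [gam_mul_gam, mul_inv_cancel_left, gam_coe]

/-- The representation of `G` induced by the representation `π` of `K`. -/
def inducedOp (g : G) : lp (fun _ : Γ => EuclideanSpace ℂ n) 2 →L[ℂ]
    lp (fun _ : Γ => EuclideanSpace ℂ n) 2 :=
  blockOp (shift h g).symm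
    (fun γ => Matrix.toEuclideanCLM (n := n) (𝕜 := ℂ) (D.π (kap h (g⁻¹ * γ))⁻¹)) 1 zero_le_one
    fun _ => ContinuousLinearMap.opNorm_le_bound _ zero_le_one fun v => by
      rw [norm_π_apply, one_mul]

lemma inducedOp_apply (g : G) (ξ : lp (fun _ : Γ => EuclideanSpace ℂ n) 2) (γ : Γ) :
    D.inducedOp g ξ γ = Matrix.toEuclideanCLM (n := n) (𝕜 := ℂ) (D.π (kap h (g⁻¹ * γ))⁻¹)
      (ξ (gam h (g⁻¹ * γ))) := rfl

lemma norm_inducedOp (g : G) (ξ : lp (fun _ : Γ => EuclideanSpace ℂ n) 2) :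
    ‖D.inducedOp g ξ‖ = ‖ξ‖ :=
  norm_blockOp _ _ _ _ _ (fun _ _ => D.norm_π_apply _ _) ξ

lemma inducedOp_single [DecidableEq Γ] (g : G) (γ : Γ) (v : EuclideanSpace ℂ n) :
    D.inducedOp g (lp.single 2 γ v) = lp.single 2 (gam h (g * γ))
      (Matrix.toEuclideanCLM (n := n) (𝕜 := ℂ) (D.π (kap h (g * γ))) v) := by
  have e : kap h (g⁻¹ * gam h (g * γ)) = (kap h (g * γ))⁻¹ := by
    rw [eq_inv_iff_mul_eq_one, kap_mul_gam, inv_mul_cancel_left, kap_coe]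
  refine (blockOp_single _ _ _ _ _ γ v).trans ?_
  change lp.single (E := fun _ : Γ => EuclideanSpace ℂ n) 2 (gam h (g * γ))
    (Matrix.toEuclideanCLM (n := n) (𝕜 := ℂ) (D.π (kap h (g⁻¹ * gam h (g * γ)))⁻¹) v) = _
  rw [e, inv_inv]

lemma continuous_inducedOp (ξ : lp (fun _ : Γ => EuclideanSpace ℂ n) 2) :
    Continuous fun g => D.inducedOp g ξ := by
  classical
  refine continuous_orbit_of_dense D.inducedOp D.norm_inducedOp
    (finsuppToLp Γ (EuclideanSpace ℂ n)) denseRange_finsuppToLp (fun v => ?_) ξ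
  induction v using Finsupp.induction_linear with
  | zero => simp only [map_zero]; exact continuous_const
  | add a b ha hb => simp only [map_add]; exact ha.add hb
  | single γ v =>
    simp only [finsuppToLp_single, inducedOp_single]
    have h1 : Continuous fun g : G => Matrix.toEuclideanCLM (n := n) (𝕜 := ℂ)
        (D.π (kap h (g * γ))) v := by
      have h2 : Continuous (Matrix.toEuclideanCLM (n := n) (𝕜 := ℂ)) :=
        LinearMap.continuous_of_finiteDimensional
          (Matrix.toEuclideanCLM (n := n) (𝕜 := ℂ)).toAlgEquiv.toLinearMap
      exact (h2.comp (D.continuous_π.comp ((continuous_kap h).comp (by fun_prop)))).clm_apply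
        continuous_const
    rw [continuous_iff_continuousAt]
    intro g₀
    have h3 : ∀ᶠ g in nhds g₀, gam h (g * γ) = gam h (g₀ * γ) :=
      ((isLocallyConstant_gam h).comp_continuous (f := fun g : G => g * (γ : G))
        (by fun_prop)).eventually_eq g₀
    refine ContinuousAt.congr (f := fun g => lp.singleContinuousLinearMap ℂ
      (fun _ : Γ => EuclideanSpace ℂ n) 2 (gam h (g₀ * γ)) (Matrix.toEuclideanCLM (n := n) (𝕜 := ℂ)
        (D.π (kap h (g * γ))) v)) ?_ ?_
    · exact ((ContinuousLinearMap.continuous _).comp h1).continuousAt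
    · filter_upwards [h3] with g hg
      rw [hg]; rfl

lemma π_rightFiber (g : G) (γ : Γ) (f : LInf (G ⧸ (K : Subgroup G))) (v : EuclideanSpace ℂ n) :
    Matrix.toEuclideanCLM (n := n) (𝕜 := ℂ) (D.π (kap h (g⁻¹ * γ))⁻¹)
        (D.rightFiber (gam h (g⁻¹ * γ)) f v) =
      D.rightFiber γ (f.translate g)
        (Matrix.toEuclideanCLM (n := n) (𝕜 := ℂ) (D.π (kap h (g⁻¹ * γ))⁻¹) v) := by
  set k := kap h (g⁻¹ * γ) with hk
  set γ' := gam h (g⁻¹ * γ) with hγ'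
  have e0 : g⁻¹ * γ = γ' * k := (gam_mul_kap h _).symm
  have e2 : ∀ δ : Γ, (((γ' : G) * gam h (((k⁻¹ : K) : G)⁻¹ * δ) : G) : G ⧸ (K : Subgroup G)) =
      g⁻¹ • (((γ : G) * δ : G) : G ⧸ (K : Subgroup G)) := fun δ => by
    rw [InvMemClass.coe_inv, inv_inv]
    change _ = ((g⁻¹ * (γ * δ) : G) : G ⧸ (K : Subgroup G))
    rw [← mul_assoc, e0, mul_assoc]
    exact congrArg (fun x : G ⧸ (K : Subgroup G) => (γ' : G) • x) (mk_gam h ((k : G) * δ))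
  rw [rightFiber_apply, rightFiber_apply, ← mul_apply_eq_comp,
    ← mul_apply_eq_comp, ← map_mul, ← map_mul, π_mul_ρ]
  simp only [e2, LInf.translate_apply]

/-- The left action of `ℓ^∞(G / K)` on `ℓ²(Γ, ℂⁿ)`, by multiplication. -/
def leftRep (_h : Γ.IsComplement' (K : Subgroup G)) (n : Type*) [Fintype n] :
    LInf (G ⧸ (K : Subgroup G)) →⋆ₐ[ℂ] (lp (fun _ : Γ => EuclideanSpace ℂ n) 2 →L[ℂ]
      lp (fun _ : Γ => EuclideanSpace ℂ n) 2) :=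
  blockRep fun γ : Γ => evalRep ((γ : G) : G ⧸ (K : Subgroup G)) _

lemma leftRep_apply (f : LInf (G ⧸ (K : Subgroup G)))
    (ξ : lp (fun _ : Γ => EuclideanSpace ℂ n) 2) (γ : Γ) :
    leftRep h n f ξ γ = f ((γ : G) : G ⧸ (K : Subgroup G)) • ξ γ := rfl

lemma leftRep_chi [DecidableEq Γ] (ξ : lp (fun _ : Γ => EuclideanSpace ℂ n) 2) :
    leftRep h n (LInf.chi ((1 : G) : G ⧸ (K : Subgroup G))) ξ =
      lp.lsingle (𝕜 := ℂ) (E := fun _ : Γ => EuclideanSpace ℂ n) 2 1 (ξ 1) := by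
  classical
  refine lp.ext (funext fun γ => ?_)
  rw [leftRep_apply, LInf.chi_apply]
  change _ = lp.single (E := fun _ : Γ => EuclideanSpace ℂ n) 2 (1 : Γ) (ξ 1) γ
  rw [lp.single_apply]
  by_cases hγ : γ = 1
  · subst hγ
    rw [Pi.single_eq_same, OneMemClass.coe_one, if_pos rfl, one_smul]
  · rw [Pi.single_eq_of_ne hγ, if_neg, zero_smul]
    rw [← OneMemClass.coe_one Γ, mk_eq_mk_iff h]
    exact hγ

/-- The right action of `ℓ^∞(G / K)` on `ℓ²(Γ, ℂⁿ)`, through the grading. -/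
def rightRep : LInf (G ⧸ (K : Subgroup G)) →⋆ₐ[ℂ] (lp (fun _ : Γ => EuclideanSpace ℂ n) 2 →L[ℂ]
      lp (fun _ : Γ => EuclideanSpace ℂ n) 2) :=
  blockRep D.rightFiber

lemma rightRep_apply (f : LInf (G ⧸ (K : Subgroup G)))
    (ξ : lp (fun _ : Γ => EuclideanSpace ℂ n) 2) (γ : Γ) :
    D.rightRep f ξ γ = D.rightFiber γ f (ξ γ) := rfl

lemma inducedOp_left_right (g : G) (f₁ f₂ : LInf (G ⧸ (K : Subgroup G)))
    (ξ : lp (fun _ : Γ => EuclideanSpace ℂ n) 2) :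
    D.inducedOp g (leftRep h n f₁ (D.rightRep f₂ ξ)) =
      leftRep h n (f₁.translate g) (D.rightRep (f₂.translate g) (D.inducedOp g ξ)) := by
  refine lp.ext (funext fun γ => ?_)
  rw [inducedOp_apply, leftRep_apply, leftRep_apply, rightRep_apply, rightRep_apply,
    inducedOp_apply, map_smul, π_rightFiber, mk_gam]
  rfl

lemma inducedOp_mul (g g' : G) (ξ : lp (fun _ : Γ => EuclideanSpace ℂ n) 2) :
    D.inducedOp (g * g') ξ = D.inducedOp g (D.inducedOp g' ξ) := by
  refine lp.ext (funext fun γ => ?_)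
  rw [inducedOp_apply, inducedOp_apply, inducedOp_apply]
  have e1 : kap h ((g * g')⁻¹ * γ) = kap h (g'⁻¹ * gam h (g⁻¹ * γ)) * kap h (g⁻¹ * γ) := by
    rw [kap_mul_gam, mul_inv_rev, mul_assoc]
  have e2 : gam h ((g * g')⁻¹ * γ) = gam h (g'⁻¹ * gam h (g⁻¹ * γ)) := by
    rw [gam_mul_gam, mul_inv_rev, mul_assoc]
  rw [e1, e2, mul_inv_rev, map_mul, map_mul]
  rfl

lemma inducedOp_one (ξ : lp (fun _ : Γ => EuclideanSpace ℂ n) 2) : D.inducedOp 1 ξ = ξ := by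
  refine lp.ext (funext fun γ => ?_)
  rw [inducedOp_apply, inv_one, one_mul, gam_coe, kap_coe, inv_one, map_one, map_one]; rfl

/-- The module with prescribed data on the fiber: the representation of `G` induced by the
representation of `K`. -/
def toModule {n : Type} [Fintype n] [DecidableEq n] (D : MatchedRep h n) : CfModule K where
  carrier := lp (fun _ : Γ => EuclideanSpace ℂ n) 2
  π :=
    { toFun := D.inducedOp
      map_one' := by ext1 ξ; exact D.inducedOp_one ξ
      map_mul' := fun g g' => by ext1 ξ; exact D.inducedOp_mul g g' ξ }
  norm_π := D.norm_inducedOp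
  continuous_π := D.continuous_inducedOp
  left := leftRep h n
  right := D.rightRep
  left_normal := isNormalRep_blockRep _ fun _ => isNormalRep_evalRep _ _
  right_normal := isNormalRep_blockRep _ D.isNormalRep_rightFiber
  left_right_comm f₁ f₂ ξ := lp.ext (funext fun γ => by
    rw [leftRep_apply, rightRep_apply, rightRep_apply, leftRep_apply, map_smul])
  covariant := D.inducedOp_left_right
  finite_rank := by
    classical
    refine Submodule.finiteDimensional_of_le (S₂ := LinearMap.range
      (lp.lsingle (𝕜 := ℂ) (E := fun _ : Γ => EuclideanSpace ℂ n) 2 1)) ?_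
    rintro _ ⟨ξ, rfl⟩
    exact ⟨ξ 1, (leftRep_chi ξ).symm⟩

lemma single_mem_fiber [DecidableEq Γ] {n : Type} [Fintype n] [DecidableEq n] (D : MatchedRep h n)
    (v : EuclideanSpace ℂ n) :
    (lp.lsingle (𝕜 := ℂ) (E := fun _ : Γ => EuclideanSpace ℂ n) 2 1 v : D.toModule) ∈
      D.toModule.fiber := by
  refine ⟨(lp.lsingle (𝕜 := ℂ) (E := fun _ : Γ => EuclideanSpace ℂ n) 2 1 v : D.toModule), ?_⟩
  refine (leftRep_chi (h := h) (lp.lsingle (𝕜 := ℂ) (E := fun _ : Γ => EuclideanSpace ℂ n) 2 1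
    v)).trans (congrArg _ ?_)
  exact lp.single_apply_self (E := fun _ : Γ => EuclideanSpace ℂ n) 2 1 v

/-- The identification of `ℂⁿ` with the fiber of the induced module. -/
def toFiberEquiv [DecidableEq Γ] {n : Type} [Fintype n] [DecidableEq n] (D : MatchedRep h n) :
    EuclideanSpace ℂ n ≃ₗᵢ[ℂ] D.toModule.fiber :=
  LinearIsometryEquiv.ofSurjective
    { toFun := fun v => ⟨_, D.single_mem_fiber v⟩
      map_add' := fun v w => Subtype.ext (map_add _ v w)
      map_smul' := fun c v => Subtype.ext (map_smul _ c v)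
      norm_map' := fun v =>
        lp.norm_single (E := fun _ : Γ => EuclideanSpace ℂ n) (by norm_num) 1 v }
    (by
      rintro ⟨_, ξ, rfl⟩
      let η : lp (fun _ : Γ => EuclideanSpace ℂ n) 2 := ξ
      exact ⟨η 1, Subtype.ext (leftRep_chi (h := h) η).symm⟩)

lemma coe_toFiberEquiv [DecidableEq Γ] {n : Type} [Fintype n] [DecidableEq n]
    (D : MatchedRep h n) (v : EuclideanSpace ℂ n) :
    (D.toFiberEquiv v : D.toModule) = lp.single (E := fun _ : Γ => EuclideanSpace ℂ n) 2 1 v := rfl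

lemma kact_toFiberEquiv [DecidableEq Γ] {n : Type} [Fintype n] [DecidableEq n]
    (D : MatchedRep h n) (k : K) (v : EuclideanSpace ℂ n) : D.toModule.kact k (D.toFiberEquiv v) =
      D.toFiberEquiv (Matrix.toEuclideanCLM (n := n) (𝕜 := ℂ) (D.π k) v) := by
  classical
  refine Subtype.ext ?_
  rw [CfModule.coe_kact, coe_toFiberEquiv, coe_toFiberEquiv]
  refine (D.inducedOp_single k 1 v).trans ?_
  rw [OneMemClass.coe_one, mul_one, gam_coeK, kap_coeK]

lemma gr_toFiberEquiv [DecidableEq Γ] {n : Type} [Fintype n] [DecidableEq n]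
    (D : MatchedRep h n) (γ : Γ) (v : EuclideanSpace ℂ n) : D.toModule.gr γ (D.toFiberEquiv v) =
      D.toFiberEquiv (Matrix.toEuclideanCLM (n := n) (𝕜 := ℂ) (D.p γ) v) := by
  classical
  refine Subtype.ext ?_
  rw [CfModule.coe_gr, coe_toFiberEquiv, coe_toFiberEquiv]
  refine (blockOp_single (Equiv.refl Γ)
    (fun i => D.rightFiber i (LInf.chi ((γ : G) : G ⧸ (K : Subgroup G))))
    ‖(LInf.chi ((γ : G) : G ⧸ (K : Subgroup G)) : LInf (G ⧸ (K : Subgroup G)))‖ (norm_nonneg _)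
    (fun i => NonUnitalStarAlgHom.norm_apply_le (D.rightFiber i) _) 1 v).trans ?_
  change lp.single (E := fun _ : Γ => EuclideanSpace ℂ n) 2 1 (D.rightFiber 1 _ v) = _
  rw [rightFiber_apply]
  congr 3
  refine D.ext_p fun δ => ?_
  rw [p_mul_ρ, OneMemClass.coe_one, one_mul, LInf.chi_apply, p_mul_p]
  by_cases e : δ = γ
  · rw [if_pos e, e, if_pos rfl, one_smul]
  · rw [if_neg e, if_neg, zero_smul]
    rwa [mk_eq_mk_iff h]

end MatchedRep

/-! ### Operators on Hilbert space tensor products -/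

section Generators

variable {B : Type*} [Ring B] [StarRing B] [Algebra ℂ B] [StarModule ℂ B]

/-- The `*`-algebra generated by a set is contained in the linear span of every `*`-closed
multiplicative monoid that contains the set. -/
lemma StarAlgebra.mem_span_of_mem_adjoin {s t : Set B} (hst : s ⊆ t) (h1 : (1 : B) ∈ t)
    (hmul : ∀ x ∈ t, ∀ y ∈ t, x * y ∈ t) (hstar : ∀ x ∈ t, star x ∈ t) {x : B}
    (hx : x ∈ StarAlgebra.adjoin ℂ s) : x ∈ Submodule.span ℂ t := by
  induction hx using StarAlgebra.adjoin_induction with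
  | mem x hx => exact Submodule.subset_span (hst hx)
  | algebraMap r =>
    rw [Algebra.algebraMap_eq_smul_one]
    exact Submodule.smul_mem _ _ (Submodule.subset_span h1)
  | add x y _ _ hx hy => exact Submodule.add_mem _ hx hy
  | mul x y hx' hy' hx hy =>
    clear hx' hy'
    induction hx using Submodule.span_induction with
    | mem x hx =>
      induction hy using Submodule.span_induction with
      | mem y hy => exact Submodule.subset_span (hmul x hx y hy)
      | zero => rw [mul_zero]; exact Submodule.zero_mem _
      | add y z _ _ hy hz => rw [mul_add]; exact Submodule.add_mem _ hy hz
      | smul c y _ hy => rw [mul_smul_comm]; exact Submodule.smul_mem _ _ hy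
    | zero => rw [zero_mul]; exact Submodule.zero_mem _
    | add x z _ _ hx hz => rw [add_mul]; exact Submodule.add_mem _ hx hz
    | smul c x _ hx => rw [smul_mul_assoc]; exact Submodule.smul_mem _ _ hx
  | star x hx' hx =>
    clear hx'
    induction hx using Submodule.span_induction with
    | mem x hx => exact Submodule.subset_span (hstar x hx)
    | zero => rw [star_zero]; exact Submodule.zero_mem _
    | add x z _ _ hx hz => rw [star_add]; exact Submodule.add_mem _ hx hz
    | smul c x _ hx => rw [star_smul]; exact Submodule.smul_mem _ _ hx

lemma StarAlgebra.mem_of_mem_topologicalClosure_adjoin [TopologicalSpace B] [IsTopologicalRing B]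
    [ContinuousStar B] {s t : Set B} (hst : s ⊆ t) (h1 : (1 : B) ∈ t)
    (hmul : ∀ x ∈ t, ∀ y ∈ t, x * y ∈ t) (hstar : ∀ x ∈ t, star x ∈ t) (S : Submodule ℂ B)
    (hS : IsClosed (S : Set B)) (ht : t ⊆ S) {x : B}
    (hx : x ∈ (StarAlgebra.adjoin ℂ s).topologicalClosure) : x ∈ S :=
  closure_minimal (fun _ hy => Submodule.span_le.2 ht
    (StarAlgebra.mem_span_of_mem_adjoin hst h1 hmul hstar hy)) hS hx

end Generators

section MinTensor

variable {H H' : Type*} [NormedAddCommGroup H] [InnerProductSpace ℂ H] [CompleteSpace H]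
  [NormedAddCommGroup H'] [InnerProductSpace ℂ H'] [CompleteSpace H']
  {A : StarSubalgebra ℂ (H →L[ℂ] H)} {B : StarSubalgebra ℂ (H' →L[ℂ] H')}

lemma map_mem_minTensor {a : H →L[ℂ] H} (ha : a ∈ A) {b : H' →L[ℂ] H'} (hb : b ∈ B) :
    HTensor.map a b ∈ minTensor A B :=
  (minTmul (⟨a, ha⟩ : A) (⟨b, hb⟩ : B)).2

lemma isClosed_minTensor : IsClosed (minTensor A B : Set (HTensor H H' →L[ℂ] HTensor H H')) :=
  StarSubalgebra.isClosed_topologicalClosure _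

lemma HTensor.map_mul_map (a a' : H →L[ℂ] H) (b b' : H' →L[ℂ] H') :
    HTensor.map a b * HTensor.map a' b' = HTensor.map (a * a') (b * b') :=
  (HTensor.map_comp a' b' a b).symm

lemma HTensor.star_map (a : H →L[ℂ] H) (b : H' →L[ℂ] H') :
    star (HTensor.map a b) = HTensor.map (star a) (star b) := HTensor.map_adjoint a b

lemma HTensor.map_one_one : HTensor.map (1 : H →L[ℂ] H) (1 : H' →L[ℂ] H') = 1 :=
  map_one (HTensor.ampL H H')

/-- The elementary tensors span a dense subspace of the minimal tensor product. -/
lemma mem_of_mem_minTensor (S : Submodule ℂ (HTensor H H' →L[ℂ] HTensor H H'))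
    (hS : IsClosed (S : Set (HTensor H H' →L[ℂ] HTensor H H')))
    (h : ∀ a ∈ A, ∀ b ∈ B, HTensor.map a b ∈ S) {T : HTensor H H' →L[ℂ] HTensor H H'}
    (hT : T ∈ minTensor A B) : T ∈ S := by
  refine StarAlgebra.mem_of_mem_topologicalClosure_adjoin subset_rfl ?_ ?_ ?_ S hS ?_ hT
  · exact ⟨1, one_mem A, 1, one_mem B, HTensor.map_one_one.symm⟩
  · rintro _ ⟨a, ha, b, hb, rfl⟩ _ ⟨a', ha', b', hb', rfl⟩
    exact ⟨_, mul_mem ha ha', _, mul_mem hb hb', HTensor.map_mul_map _ _ _ _⟩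
  · rintro _ ⟨a, ha, b, hb, rfl⟩
    exact ⟨_, star_mem ha, _, star_mem hb, HTensor.star_map _ _⟩
  · rintro _ ⟨a, ha, b, hb, rfl⟩
    exact h a ha b hb

end MinTensor

section StoneWeierstrass

variable {X Y : Type*} [TopologicalSpace X] [TopologicalSpace Y] [CompactSpace X] [CompactSpace Y]

/-- The function `(x, y) ↦ f x * g y`. -/
def prodFun (f : C(X, ℂ)) (g : C(Y, ℂ)) : C(X × Y, ℂ) :=
  f.comp ⟨Prod.fst, continuous_fst⟩ * g.comp ⟨Prod.snd, continuous_snd⟩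

lemma prodFun_apply (f : C(X, ℂ)) (g : C(Y, ℂ)) (p : X × Y) : prodFun f g p = f p.1 * g p.2 := rfl

lemma exists_apply_ne {Z : Type*} [TopologicalSpace Z] [CompactSpace Z] [T2Space Z] {x y : Z}
    (hxy : x ≠ y) : ∃ f : C(Z, ℂ), f x ≠ f y := by
  obtain ⟨f, h0, h1, -⟩ := exists_continuous_zero_one_of_isClosed (isClosed_singleton (x := x))
    (isClosed_singleton (x := y)) (Set.disjoint_singleton.2 hxy)
  refine ⟨⟨fun z => f z, by fun_prop⟩, ?_⟩
  have h2 := h0 rfl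
  have h3 := h1 rfl
  simp only [ContinuousMap.coe_mk, h2, h3]
  simp

/-- The products `f ⊗ g` span a dense subspace of `C(X × Y)`. -/
lemma mem_of_prodFun_mem [T2Space X] [T2Space Y] (S : Submodule ℂ C(X × Y, ℂ))
    (hS : IsClosed (S : Set C(X × Y, ℂ))) (h : ∀ f g, prodFun f g ∈ S) (F : C(X × Y, ℂ)) :
    F ∈ S := by
  have hsep : (StarAlgebra.adjoin ℂ
      {F : C(X × Y, ℂ) | ∃ f g, F = prodFun f g}).SeparatesPoints := by
    intro p q hpq
    by_cases h1 : p.1 = q.1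
    · obtain ⟨f, hf⟩ := exists_apply_ne fun h2 => hpq (Prod.ext h1 h2)
      refine ⟨_, ⟨prodFun 1 f, StarAlgebra.subset_adjoin ℂ _ ⟨1, f, rfl⟩, rfl⟩, ?_⟩
      simpa [prodFun_apply] using hf
    · obtain ⟨f, hf⟩ := exists_apply_ne h1
      refine ⟨_, ⟨prodFun f 1, StarAlgebra.subset_adjoin ℂ _ ⟨f, 1, rfl⟩, rfl⟩, ?_⟩
      simpa [prodFun_apply] using hf
  have := ContinuousMap.starSubalgebra_topologicalClosure_eq_top_of_separatesPoints _ hsep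
  refine StarAlgebra.mem_of_mem_topologicalClosure_adjoin subset_rfl ?_ ?_ ?_ S hS ?_
    (this ▸ StarSubalgebra.mem_top : F ∈ _)
  · exact ⟨1, 1, by ext p; simp [prodFun_apply]⟩
  · rintro _ ⟨f, g, rfl⟩ _ ⟨f', g', rfl⟩
    exact ⟨f * f', g * g', by ext p; simp [prodFun_apply]; ring⟩
  · rintro _ ⟨f, g, rfl⟩
    exact ⟨star f, star g, by ext p; simp [prodFun_apply]⟩
  · rintro _ ⟨f, g, rfl⟩
    exact h f g

end StoneWeierstrass

section Delta

variable {X Y W : Type*} [NormedAddCommGroup W] [InnerProductSpace ℂ W]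

lemma L2.clm_ext {A B : L2 X →L[ℂ] W} (h : ∀ x, A (L2.delta x) = B (L2.delta x)) : A = B := by
  ext1 ξ
  refine ((L2.hasSum ξ).mapL A).unique ?_
  simpa only [map_smul, h] using (L2.hasSum ξ).mapL B

/-- The bounded operator `x ↦ x ⊗ y`. -/
def HTensor.tmulL {E F : Type*} [NormedAddCommGroup E] [InnerProductSpace ℂ E]
    [NormedAddCommGroup F] [InnerProductSpace ℂ F] (y : F) : E →L[ℂ] HTensor E F :=
  LinearMap.mkContinuous
    { toFun := fun x => HTensor.tmul x y
      map_add' := fun _ _ => HTensor.tmul_add_left _ _ _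
      map_smul' := fun _ _ => HTensor.tmul_smul_left _ _ _ } ‖y‖
    fun x => by
      change ‖HTensor.tmul x y‖ ≤ _
      rw [HTensor.norm_tmul, mul_comm]

@[simp] lemma HTensor.tmulL_apply {E F : Type*} [NormedAddCommGroup E] [InnerProductSpace ℂ E]
    [NormedAddCommGroup F] [InnerProductSpace ℂ F] (x : E) (y : F) :
    HTensor.tmulL y x = HTensor.tmul x y := rfl

/-- The bounded operator `y ↦ x ⊗ y`. -/
def HTensor.tmulR {E F : Type*} [NormedAddCommGroup E] [InnerProductSpace ℂ E]
    [NormedAddCommGroup F] [InnerProductSpace ℂ F] (x : E) : F →L[ℂ] HTensor E F :=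
  LinearMap.mkContinuous
    { toFun := fun y => HTensor.tmul x y
      map_add' := fun _ _ => HTensor.tmul_add_right _ _ _
      map_smul' := fun _ _ => HTensor.tmul_smul_right _ _ _ } ‖x‖
    fun y => by
      change ‖HTensor.tmul x y‖ ≤ _
      rw [HTensor.norm_tmul]

@[simp] lemma HTensor.tmulR_apply {E F : Type*} [NormedAddCommGroup E] [InnerProductSpace ℂ E]
    [NormedAddCommGroup F] [InnerProductSpace ℂ F] (x : E) (y : F) :
    HTensor.tmulR x y = HTensor.tmul x y := rfl

lemma HTensor.clm_ext_deltaL {E : Type*} [NormedAddCommGroup E] [InnerProductSpace ℂ E]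
    {A B : HTensor (L2 X) E →L[ℂ] W}
    (h : ∀ x y, A (HTensor.tmul (L2.delta x) y) = B (HTensor.tmul (L2.delta x) y)) : A = B :=
  HTensor.ext_clm fun ξ y => congrArg (fun T : L2 X →L[ℂ] W => T ξ)
    (L2.clm_ext (A := A ∘L HTensor.tmulL y) (B := B ∘L HTensor.tmulL y) fun x => h x y)

lemma HTensor.clm_ext_deltaR {E : Type*} [NormedAddCommGroup E] [InnerProductSpace ℂ E]
    {A B : HTensor E (L2 X) →L[ℂ] W}
    (h : ∀ y x, A (HTensor.tmul y (L2.delta x)) = B (HTensor.tmul y (L2.delta x))) : A = B :=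
  HTensor.ext_clm fun y ξ => congrArg (fun T : L2 X →L[ℂ] W => T ξ)
    (L2.clm_ext (A := A ∘L HTensor.tmulR y) (B := B ∘L HTensor.tmulR y) fun x => h y x)

lemma HTensor.clm_ext_delta {A B : HTensor (L2 X) (L2 Y) →L[ℂ] W}
    (h : ∀ x y, A (HTensor.tmul (L2.delta x) (L2.delta y)) =
      B (HTensor.tmul (L2.delta x) (L2.delta y))) : A = B :=
  HTensor.clm_ext_deltaL fun x η => congrArg (fun T : L2 Y →L[ℂ] W => T η)
    (L2.clm_ext (A := A ∘L HTensor.tmulR (L2.delta x)) (B := B ∘L HTensor.tmulR (L2.delta x))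
      fun y => h x y)

lemma L2.inner_delta_delta [DecidableEq X] (x y : X) :
    inner ℂ (L2.delta x) (L2.delta y) = if x = y then (1 : ℂ) else 0 := by
  rw [L2.inner_delta, L2.delta_apply]

/-- The orthonormal basis `δ_x ⊗ δ_y` of `ℓ²(X) ⊗ ℓ²(Y)`. -/
def HTensor.deltaBasis (X Y : Type*) : HilbertBasis (X × Y) ℂ (HTensor (L2 X) (L2 Y)) :=
  HilbertBasis.mkOfOrthogonalEqBot
    (v := fun p : X × Y => HTensor.tmul (L2.delta p.1) (L2.delta p.2))
    (by
      classical
      rw [orthonormal_iff_ite]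
      rintro ⟨x, y⟩ ⟨x', y'⟩
      rw [HTensor.inner_tmul, L2.inner_delta_delta, L2.inner_delta_delta]
      simp only [Prod.mk.injEq]
      split_ifs <;> simp_all)
    (by
      rw [eq_bot_iff]
      intro v hv
      rw [Submodule.mem_orthogonal'] at hv
      have : innerSL ℂ v = 0 := HTensor.clm_ext_delta fun x y => by
        rw [zero_apply]
        exact hv _ (Submodule.subset_span ⟨(x, y), rfl⟩)
      exact innerSL_inj.1 (this.trans (map_zero _).symm))

/-- The identification `ℓ²(X) ⊗ ℓ²(Y) = ℓ²(X × Y)`. -/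
def HTensor.toL2 (X Y : Type*) : HTensor (L2 X) (L2 Y) ≃ₗᵢ[ℂ] L2 (X × Y) :=
  (HTensor.deltaBasis X Y).repr

lemma HTensor.toL2_delta (x : X) (y : Y) :
    HTensor.toL2 X Y (HTensor.tmul (L2.delta x) (L2.delta y)) = L2.delta (x, y) := by
  classical
  have h1 : HTensor.deltaBasis X Y (x, y) = HTensor.tmul (L2.delta x) (L2.delta y) := by
    rw [HTensor.deltaBasis, HilbertBasis.coe_mkOfOrthogonalEqBot]
  rw [← h1]
  refine ((HTensor.deltaBasis X Y).repr_self (x, y)).trans (L2.ext fun p => ?_)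
  rw [L2.delta_apply, lp.single_apply, Pi.single_apply]

lemma HTensor.toL2_symm_delta (x : X) (y : Y) :
    (HTensor.toL2 X Y).symm (L2.delta (x, y)) = HTensor.tmul (L2.delta x) (L2.delta y) := by
  rw [← HTensor.toL2_delta, LinearIsometryEquiv.symm_apply_apply]

/-- The unitary of `ℓ²(X)` defined by a permutation. -/
def L2.permIso (e : Equiv.Perm X) : L2 X ≃ₗᵢ[ℂ] L2 X where
  toFun := L2.permRep (Equiv.Perm X) X e
  invFun := L2.permRep (Equiv.Perm X) X e⁻¹
  map_add' := map_add _
  map_smul' := map_smul _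
  norm_map' := L2.norm_permRep e
  left_inv ξ := by
    rw [← mul_apply_eq_comp, ← map_mul, inv_mul_cancel, map_one]; rfl
  right_inv ξ := by
    rw [← mul_apply_eq_comp, ← map_mul, mul_inv_cancel, map_one]; rfl

lemma L2.permIso_delta (e : Equiv.Perm X) (x : X) :
    L2.permIso e (L2.delta x) = L2.delta (e x) := L2.permRep_delta e x

/-- The unitary of `ℓ²(X) ⊗ ℓ²(Y)` defined by a permutation of `X × Y`. -/
def HTensor.permIso (e : Equiv.Perm (X × Y)) : HTensor (L2 X) (L2 Y) ≃ₗᵢ[ℂ] HTensor (L2 X) (L2 Y) :=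
  ((HTensor.toL2 X Y).trans (L2.permIso e)).trans (HTensor.toL2 X Y).symm

lemma HTensor.permIso_delta (e : Equiv.Perm (X × Y)) (x : X) (y : Y) :
    HTensor.permIso e (HTensor.tmul (L2.delta x) (L2.delta y)) =
      HTensor.tmul (L2.delta (e (x, y)).1) (L2.delta (e (x, y)).2) := by
  change (HTensor.toL2 X Y).symm (L2.permIso e (HTensor.toL2 X Y _)) = _
  rw [HTensor.toL2_delta, L2.permIso_delta, ← HTensor.toL2_symm_delta]

lemma HTensor.permIso_symm_delta (e : Equiv.Perm (X × Y)) (x : X) (y : Y) :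
    (HTensor.permIso e).symm (HTensor.tmul (L2.delta x) (L2.delta y)) =
      HTensor.tmul (L2.delta (e.symm (x, y)).1) (L2.delta (e.symm (x, y)).2) := by
  rw [LinearIsometryEquiv.symm_apply_eq, HTensor.permIso_delta]
  simp

end Delta

section Assoc

variable (E F H : Type*) [NormedAddCommGroup E] [InnerProductSpace ℂ E] [NormedAddCommGroup F]
  [InnerProductSpace ℂ F] [NormedAddCommGroup H] [InnerProductSpace ℂ H]

namespace HTensor

/-- The inclusion of the algebraic triple tensor product. -/
def incl₃L : (E ⊗[ℂ] F) ⊗[ℂ] H →ₗ[ℂ] HTensor (HTensor E F) H :=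
  (incl (HTensor E F) H).toLinearMap ∘ₗ (incl E F).toLinearMap.rTensor H

/-- The inclusion of the algebraic triple tensor product, bracketed on the right. -/
def incl₃R : (E ⊗[ℂ] F) ⊗[ℂ] H →ₗ[ℂ] HTensor E (HTensor F H) :=
  (incl E (HTensor F H)).toLinearMap ∘ₗ (incl F H).toLinearMap.lTensor E ∘ₗ
    (TensorProduct.assoc ℂ E F H).toLinearMap

/-- The inclusion of the algebraic triple tensor product, with the first two factors exchanged. -/
def incl₃S : (E ⊗[ℂ] F) ⊗[ℂ] H →ₗ[ℂ] HTensor F (HTensor E H) :=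
  incl₃R F E H ∘ₗ (TensorProduct.comm ℂ E F).toLinearMap.rTensor H

variable {E F H} in
lemma mem_of_tmul_mem {V W : Type*} (d : V → E) (hd : DenseRange d) (d' : W → F)
    (hd' : DenseRange d') (S : Submodule ℂ (HTensor E F)) (hS : IsClosed (S : Set (HTensor E F)))
    (h : ∀ v w, tmul (d v) (d' w) ∈ S) (z : HTensor E F) : z ∈ S := by
  refine denseRange_incl.induction_on (p := (· ∈ S)) z hS fun v => ?_
  induction v with
  | zero => rw [map_zero]; exact S.zero_mem
  | tmul x y =>
    refine hd.induction_on (p := fun x => tmulL y x ∈ S) x (hS.preimage (tmulL y).continuous)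
      fun v => ?_
    exact hd'.induction_on (p := fun y => tmulR (d v) y ∈ S) y
      (hS.preimage (tmulR (d v)).continuous) fun w => h v w
  | add a b ha hb => rw [map_add]; exact S.add_mem ha hb

lemma denseRange_incl₃L : DenseRange (incl₃L E F H) :=
  mem_of_tmul_mem (incl E F) denseRange_incl id Function.surjective_id.denseRange
    (LinearMap.range (incl₃L E F H)).topologicalClosure (Submodule.isClosed_topologicalClosure _)
    fun v w => Submodule.le_topologicalClosure _ ⟨v ⊗ₜ w, rfl⟩

lemma denseRange_incl₃R : DenseRange (incl₃R E F H) :=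
  mem_of_tmul_mem id Function.surjective_id.denseRange (incl F H) denseRange_incl
    (LinearMap.range (incl₃R E F H)).topologicalClosure (Submodule.isClosed_topologicalClosure _)
    fun v w => Submodule.le_topologicalClosure _
      ⟨(TensorProduct.assoc ℂ E F H).symm (v ⊗ₜ w), by
        simp only [incl₃R, LinearMap.comp_apply, LinearEquiv.coe_coe,
          LinearEquiv.apply_symm_apply]
        rfl⟩

lemma denseRange_incl₃S : DenseRange (incl₃S E F H) := by
  have h : Function.Surjective ((TensorProduct.comm ℂ E F).toLinearMap.rTensor H) :=
    LinearMap.rTensor_surjective H (TensorProduct.comm ℂ E F).surjective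
  intro z
  refine closure_mono ?_ (denseRange_incl₃R F E H z)
  rintro _ ⟨v, rfl⟩
  obtain ⟨w, rfl⟩ := h v
  exact ⟨w, rfl⟩

variable {E F H} in
lemma incl₃L_tmul (x : E) (y : F) (z : H) : incl₃L E F H ((x ⊗ₜ y) ⊗ₜ z) = tmul (tmul x y) z := rfl
variable {E F H} in
lemma incl₃R_tmul (x : E) (y : F) (z : H) : incl₃R E F H ((x ⊗ₜ y) ⊗ₜ z) = tmul x (tmul y z) := rfl
variable {E F H} in
lemma incl₃S_tmul (x : E) (y : F) (z : H) : incl₃S E F H ((x ⊗ₜ y) ⊗ₜ z) = tmul y (tmul x z) := rfl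

variable {E F H}

lemma inner_ext₃ {W W' : Type*} [NormedAddCommGroup W] [InnerProductSpace ℂ W]
    [NormedAddCommGroup W'] [InnerProductSpace ℂ W'] (e : (E ⊗[ℂ] F) ⊗[ℂ] H →ₗ[ℂ] W)
    (f : (E ⊗[ℂ] F) ⊗[ℂ] H →ₗ[ℂ] W')
    (h : ∀ x y z x' y' z', inner ℂ (e ((x ⊗ₜ y) ⊗ₜ z)) (e ((x' ⊗ₜ y') ⊗ₜ z')) =
      inner ℂ (f ((x ⊗ₜ y) ⊗ₜ z)) (f ((x' ⊗ₜ y') ⊗ₜ z'))) (v w) :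
    inner ℂ (e v) (e w) = inner ℂ (f v) (f w) := by
  induction v with
  | zero => simp only [map_zero, inner_zero_left]
  | add a b ha hb => simp only [map_add, inner_add_left, ha, hb]
  | tmul v ζ =>
  induction v with
  | zero => simp only [TensorProduct.zero_tmul, map_zero, inner_zero_left]
  | add a b ha hb => simp only [TensorProduct.add_tmul, map_add, inner_add_left, ha, hb]
  | tmul ξ η =>
  induction w with
  | zero => simp only [map_zero, inner_zero_right]
  | add a b ha hb => simp only [map_add, inner_add_right, ha, hb]
  | tmul w ζ' =>
  induction w with
  | zero => simp only [TensorProduct.zero_tmul, map_zero, inner_zero_right]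
  | add a b ha hb => simp only [TensorProduct.add_tmul, map_add, inner_add_right, ha, hb]
  | tmul ξ' η' => exact h _ _ _ _ _ _

variable (E F H)

/-- The associativity isomorphism `(E ⊗ F) ⊗ H ≃ E ⊗ (F ⊗ H)`. -/
def assocIso : HTensor (HTensor E F) H ≃ₗᵢ[ℂ] HTensor E (HTensor F H) :=
  isoOfInner (incl₃L E F H) (incl₃R E F H) (denseRange_incl₃L E F H) (denseRange_incl₃R E F H)
    (norm_eq_of_inner_eq _ _ (inner_ext₃ _ _ fun x y z x' y' z' => by
      simp only [incl₃L_tmul, incl₃R_tmul, inner_tmul, mul_assoc]))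

/-- The isomorphism `E ⊗ (F ⊗ H) ≃ F ⊗ (E ⊗ H)`. -/
def leftCommIso : HTensor E (HTensor F H) ≃ₗᵢ[ℂ] HTensor F (HTensor E H) :=
  isoOfInner (incl₃R E F H) (incl₃S E F H) (denseRange_incl₃R E F H) (denseRange_incl₃S E F H)
    (norm_eq_of_inner_eq _ _ (inner_ext₃ _ _ fun x y z x' y' z' => by
      simp only [incl₃R_tmul, incl₃S_tmul, inner_tmul, mul_left_comm]))

variable {E F H}

lemma assocIso_tmul (x : E) (y : F) (z : H) :
    assocIso E F H (tmul (tmul x y) z) = tmul x (tmul y z) :=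
  isoOfInner_apply (incl₃L E F H) (incl₃R E F H) _ _ _ ((x ⊗ₜ y) ⊗ₜ z)

lemma leftCommIso_tmul (x : E) (y : F) (z : H) :
    leftCommIso E F H (tmul x (tmul y z)) = tmul y (tmul x z) :=
  isoOfInner_apply (incl₃R E F H) (incl₃S E F H) _ _ _ ((x ⊗ₜ y) ⊗ₜ z)

lemma assocIso_symm_tmul (x : E) (y : F) (z : H) :
    (assocIso E F H).symm (tmul x (tmul y z)) = tmul (tmul x y) z := by
  rw [LinearIsometryEquiv.symm_apply_eq, assocIso_tmul]

lemma leftCommIso_symm_tmul (x : E) (y : F) (z : H) :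
    (leftCommIso E F H).symm (tmul y (tmul x z)) = tmul x (tmul y z) := by
  rw [LinearIsometryEquiv.symm_apply_eq, leftCommIso_tmul]

lemma clm_ext₃L {W : Type*} [NormedAddCommGroup W] [InnerProductSpace ℂ W]
    {A B : HTensor (HTensor E F) H →L[ℂ] W}
    (h : ∀ x y z, A (tmul (tmul x y) z) = B (tmul (tmul x y) z)) : A = B :=
  ext_clm fun w z => congrArg (fun T : HTensor E F →L[ℂ] W => T w)
    (ext_clm (A := A ∘L tmulL z) (B := B ∘L tmulL z) fun x y => h x y z)

lemma clm_ext₃R {W : Type*} [NormedAddCommGroup W] [InnerProductSpace ℂ W]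
    {A B : HTensor E (HTensor F H) →L[ℂ] W}
    (h : ∀ x y z, A (tmul x (tmul y z)) = B (tmul x (tmul y z))) : A = B :=
  ext_clm fun x w => congrArg (fun T : HTensor F H →L[ℂ] W => T w)
    (ext_clm (A := A ∘L tmulR x) (B := B ∘L tmulR x) fun y z => h x y z)

/-- The tensor product of two unitaries. -/
def mapIso {E' F' : Type*} [NormedAddCommGroup E'] [InnerProductSpace ℂ E']
    [NormedAddCommGroup F'] [InnerProductSpace ℂ F'] (U : E ≃ₗᵢ[ℂ] E') (V : F ≃ₗᵢ[ℂ] F') :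
    HTensor E F ≃ₗᵢ[ℂ] HTensor E' F' :=
  isoOfInner (incl E F).toLinearMap
    ((incl E' F').toLinearMap ∘ₗ (TensorProduct.congr U.toLinearEquiv V.toLinearEquiv).toLinearMap)
    denseRange_incl
    (fun z => closure_mono (by
      rintro _ ⟨v, rfl⟩
      exact ⟨(TensorProduct.congr U.toLinearEquiv V.toLinearEquiv).symm v,
        congrArg (incl E' F') (LinearEquiv.apply_symm_apply _ v)⟩) (denseRange_incl z))
    fun v => ((incl E F).norm_map v).trans
      (((TensorProduct.congrIsometry U V).norm_map v).symm.trans ((incl E' F').norm_map _).symm)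

lemma mapIso_tmul {E' F' : Type*} [NormedAddCommGroup E'] [InnerProductSpace ℂ E']
    [NormedAddCommGroup F'] [InnerProductSpace ℂ F'] (U : E ≃ₗᵢ[ℂ] E') (V : F ≃ₗᵢ[ℂ] F')
    (x : E) (y : F) : mapIso U V (tmul x y) = tmul (U x) (V y) :=
  isoOfInner_apply (incl E F).toLinearMap _ _ _ _ (x ⊗ₜ y)

lemma mapIso_symm_tmul {E' F' : Type*} [NormedAddCommGroup E'] [InnerProductSpace ℂ E']
    [NormedAddCommGroup F'] [InnerProductSpace ℂ F'] (U : E ≃ₗᵢ[ℂ] E') (V : F ≃ₗᵢ[ℂ] F')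
    (x : E') (y : F') : (mapIso U V).symm (tmul x y) = tmul (U.symm x) (V.symm y) := by
  rw [LinearIsometryEquiv.symm_apply_eq, mapIso_tmul, LinearIsometryEquiv.apply_symm_apply,
    LinearIsometryEquiv.apply_symm_apply]

end HTensor
end Assoc

/-! ### The `C^*`-algebra of the bicrossed product and its comultiplication -/

lemma StarAlgHom.continuous_of_cstar {B C : Type*} [CStarAlgebra B] [CStarAlgebra C]
    (φ : B →⋆ₐ[ℂ] C) : Continuous φ :=
  AddMonoidHomClass.continuous_of_bound φ 1 fun x => by
    rw [one_mul]; exact NonUnitalStarAlgHom.norm_apply_le φ x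

section ContinuousFunctions

variable {X Z : Type*} [TopologicalSpace Z] [CompactSpace Z]

/-- The bounded function `f ∘ θ` for a continuous function `f` on a compact space. -/
def pullback (θ : X → Z) : C(Z, ℂ) →⋆ₐ[ℂ] LInf X where
  toFun f := ⟨fun x => f (θ x), memℓp_infty ⟨‖f‖, by
    rintro _ ⟨x, rfl⟩
    exact f.norm_coe_le_norm _⟩⟩
  map_one' := rfl
  map_mul' _ _ := rfl
  map_zero' := rfl
  map_add' _ _ := rfl
  commutes' _ := rfl
  map_star' _ := rfl

/-- The action of continuous functions by multiplication operators. -/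
def pullbackRep (θ : X → Z) : C(Z, ℂ) →⋆ₐ[ℂ] (L2 X →L[ℂ] L2 X) :=
  (L2.mulRep X).comp (pullback θ)

lemma pullbackRep_apply (θ : X → Z) (f : C(Z, ℂ)) (ξ : L2 X) (x : X) :
    pullbackRep θ f ξ x = f (θ x) * ξ x := rfl

lemma pullbackRep_delta (θ : X → Z) (f : C(Z, ℂ)) (x : X) :
    pullbackRep θ f (L2.delta x) = f (θ x) • L2.delta x := by
  classical
  refine L2.ext fun y => ?_
  rw [pullbackRep_apply, lp.coeFn_smul, Pi.smul_apply, L2.delta_apply, smul_eq_mul]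
  split_ifs with h
  · rw [h]
  · simp

end ContinuousFunctions

section Cancellation

variable {B C : Type*} [CStarAlgebra B] [CStarAlgebra C]
  (A : StarSubalgebra ℂ B) (D ι κ : B →⋆ₐ[ℂ] C)

/-- The closed span of the products `D a * ι b`, `a, b ∈ A`. -/
def productSpan : Submodule ℂ C :=
  (Submodule.span ℂ {T | ∃ a ∈ A, ∃ b ∈ A, T = D a * ι b}).topologicalClosure

lemma isClosed_productSpan : IsClosed (productSpan A D ι : Set C) :=
  Submodule.isClosed_topologicalClosure _

variable {A D ι κ}

lemma mul_mem_productSpan {a b : B} (ha : a ∈ A) (hb : b ∈ A) : D a * ι b ∈ productSpan A D ι :=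
  Submodule.le_topologicalClosure _ (Submodule.subset_span ⟨a, ha, b, hb, rfl⟩)

/-- A bounded operator that maps the generators to a closed subspace maps the closed span there. -/
lemma productSpan_induction (S : Submodule ℂ C) (hS : IsClosed (S : Set C)) (φ : C →L[ℂ] C)
    (h : ∀ a ∈ A, ∀ b ∈ A, φ (D a * ι b) ∈ S) {T : C} (hT : T ∈ productSpan A D ι) : φ T ∈ S := by
  refine Submodule.topologicalClosure_minimal _ (t := S.comap φ.toLinearMap) ?_
    (hS.preimage φ.continuous) hT
  rw [Submodule.span_le]
  rintro _ ⟨a, ha, b, hb, rfl⟩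
  exact h a ha b hb

lemma productSpan_mul_right {T : C} (hT : T ∈ productSpan A D ι) {b : B} (hb : b ∈ A) :
    T * ι b ∈ productSpan A D ι :=
  productSpan_induction (φ := (ContinuousLinearMap.mul ℂ C).flip (ι b)) _
    (isClosed_productSpan A D ι) (fun a ha b' hb' => by
      change D a * ι b' * ι b ∈ _
      rw [mul_assoc, ← map_mul]
      exact mul_mem_productSpan ha (mul_mem hb' hb)) hT

lemma productSpan_mul_left {T : C} (hT : T ∈ productSpan A D ι) {a : B} (ha : a ∈ A) :
    D a * T ∈ productSpan A D ι :=
  productSpan_induction (φ := ContinuousLinearMap.mul ℂ C (D a)) _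
    (isClosed_productSpan A D ι) (fun a' ha' b hb => by
      change D a * (D a' * ι b) ∈ _
      rw [← mul_assoc, ← map_mul]
      exact mul_mem_productSpan (mul_mem ha ha') hb) hT

/-- The elements `a` for which `κ a` is in the closed span form an algebra if `ι` and `κ`
commute. -/
lemma productSpan_map_mul (hc : ∀ a b, ι a * κ b = κ b * ι a) {x y : B}
    (hx : κ x ∈ productSpan A D ι) (hy : κ y ∈ productSpan A D ι) :
    κ (x * y) ∈ productSpan A D ι := by
  rw [map_mul]
  refine productSpan_induction (φ := (ContinuousLinearMap.mul ℂ C).flip (κ y)) _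
    (isClosed_productSpan A D ι) (fun a ha b hb => ?_) hx
  change D a * ι b * κ y ∈ _
  rw [mul_assoc, hc, ← mul_assoc]
  exact productSpan_mul_right (productSpan_mul_left hy ha) hb

end Cancellation

namespace Bicrossed

variable {G : Type u} [Group G] [TopologicalSpace G]
  {K : OpenSubgroup G} {Γ : Subgroup G} (h : Γ.IsComplement' (K : Subgroup G))

/-- The action of functions on `K = Γ \ G` on `ℓ²(G)`. -/
def mOp [CompactSpace K] : C(K, ℂ) →⋆ₐ[ℂ] (L2 G →L[ℂ] L2 G) := pullbackRep (kap h)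

lemma mOp_delta [CompactSpace K] (f : C(K, ℂ)) (g : G) :
    mOp h f (L2.delta g) = f (kap h g) • L2.delta g := pullbackRep_delta _ _ _

/-- The right translation `δ_g ↦ δ_{g s⁻¹}`. -/
def vOp (s : Γ) : L2 G →L[ℂ] L2 G := L2.permRep (Equiv.Perm G) G (Equiv.mulRight (s : G)⁻¹)

lemma vOp_delta (s : Γ) (g : G) : vOp s (L2.delta g) = L2.delta (g * (s : G)⁻¹) :=
  L2.permRep_delta _ _

lemma vOp_mul (s t : Γ) : vOp s * vOp t = vOp (s * t) := L2.clm_ext fun g => by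
  rw [mul_apply_eq_comp, vOp_delta, vOp_delta, vOp_delta, Subgroup.coe_mul, mul_inv_rev, mul_assoc]

lemma vOp_one : vOp (1 : Γ) = 1 := L2.clm_ext fun g => by
  rw [vOp_delta, OneMemClass.coe_one, inv_one, mul_one]; rfl

lemma star_vOp (s : Γ) : star (vOp s) = vOp s⁻¹ := by
  have h1 : star (vOp s) * vOp s = 1 :=
    (ContinuousLinearMap.norm_map_iff_adjoint_comp_self (vOp s)).1 (L2.norm_permRep _)
  have h2 : vOp s * vOp s⁻¹ = 1 := by rw [vOp_mul, mul_inv_cancel, vOp_one]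
  exact left_inv_eq_right_inv h1 h2

variable [IsTopologicalGroup G]

/-- The action of `Γ` on functions on `K = Γ \ G` by right translation. -/
def act (s : Γ) (f : C(K, ℂ)) : C(K, ℂ) :=
  f.comp ⟨fun k => kap h ((k : G) * s), (continuous_kap h).comp (by fun_prop)⟩

lemma act_apply (s : Γ) (f : C(K, ℂ)) (k : K) : act h s f k = f (kap h ((k : G) * s)) := rfl

variable [CompactSpace K]

lemma vOp_mul_mOp (s : Γ) (f : C(K, ℂ)) : vOp s * mOp h f = mOp h (act h s f) * vOp s :=
  L2.clm_ext fun g => by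
    rw [mul_apply_eq_comp, mul_apply_eq_comp, mOp_delta, map_smul, vOp_delta, mOp_delta, act_apply,
      kap_kap_mul, inv_mul_cancel_right]

/-- The `C^*`-algebra of the bicrossed product: the crossed product of `C(K)` by `Γ`. -/
def alg : StarSubalgebra ℂ (L2 G →L[ℂ] L2 G) :=
  (StarAlgebra.adjoin ℂ ({T | ∃ f, T = mOp h f} ∪ {T | ∃ s : Γ, T = vOp s})).topologicalClosure

lemma isClosed_alg : IsClosed (alg h : Set (L2 G →L[ℂ] L2 G)) :=
  StarSubalgebra.isClosed_topologicalClosure _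

lemma mOp_mem (f : C(K, ℂ)) : mOp h f ∈ alg h :=
  StarSubalgebra.le_topologicalClosure _ (StarAlgebra.subset_adjoin ℂ _ (Or.inl ⟨f, rfl⟩))

lemma vOp_mem (s : Γ) : vOp s ∈ alg h :=
  StarSubalgebra.le_topologicalClosure _ (StarAlgebra.subset_adjoin ℂ _ (Or.inr ⟨s, rfl⟩))

/-- The products `f v_s` span a dense subspace. -/
lemma mem_of_mem_alg (S : Submodule ℂ (L2 G →L[ℂ] L2 G))
    (hS : IsClosed (S : Set (L2 G →L[ℂ] L2 G))) (hmem : ∀ f (s : Γ), mOp h f * vOp s ∈ S)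
    {T : L2 G →L[ℂ] L2 G} (hT : T ∈ alg h) : T ∈ S := by
  refine StarAlgebra.mem_of_mem_topologicalClosure_adjoin
    (t := {T | ∃ (f : C(K, ℂ)) (s : Γ), T = mOp h f * vOp s}) ?_ ?_ ?_ ?_ S hS ?_ hT
  · rintro _ (⟨f, rfl⟩ | ⟨s, rfl⟩)
    · exact ⟨f, 1, by rw [vOp_one, mul_one]⟩
    · exact ⟨1, s, by rw [map_one, one_mul]⟩
  · exact ⟨1, 1, by rw [map_one, vOp_one, one_mul]⟩
  · rintro _ ⟨f, s, rfl⟩ _ ⟨f', s', rfl⟩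
    refine ⟨f * act h s f', s * s', ?_⟩
    rw [mul_assoc, ← mul_assoc (vOp s), vOp_mul_mOp, map_mul, ← vOp_mul]
    simp only [mul_assoc]
  · rintro _ ⟨f, s, rfl⟩
    refine ⟨act h s⁻¹ (star f), s⁻¹, ?_⟩
    rw [star_mul, star_vOp, ← map_star, vOp_mul_mOp]
  · rintro _ ⟨f, s, rfl⟩
    exact hmem f s

/-- The permutation of `G × G` that implements the comultiplication. -/
def wEquiv : Equiv.Perm (G × G) where
  toFun p := (p.1 * (gam h p.2 : G)⁻¹, p.1 * kap h p.2)
  invFun p := (p.1 * gam h (p.1⁻¹ * p.2), p.1⁻¹ * p.2)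
  left_inv := by
    rintro ⟨g, g'⟩
    have : (g * (gam h g' : G)⁻¹)⁻¹ * (g * kap h g') = g' := by
      rw [mul_inv_rev, inv_inv, mul_assoc, inv_mul_cancel_left, gam_mul_kap]
    simp only [this, inv_mul_cancel_right]
  right_inv := by
    rintro ⟨a, b⟩
    have := gam_mul_kap h (a⁻¹ * b)
    refine Prod.ext (mul_inv_cancel_right _ _) ?_
    change a * gam h (a⁻¹ * b) * kap h (a⁻¹ * b) = b
    rw [mul_assoc, this, mul_inv_cancel_left]

/-- The unitary `W` on `ℓ²(G) ⊗ ℓ²(G)` that implements the comultiplication. -/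
def W : HTensor (L2 G) (L2 G) ≃ₗᵢ[ℂ] HTensor (L2 G) (L2 G) := HTensor.permIso (wEquiv h)

lemma W_delta (g g' : G) : W h (HTensor.tmul (L2.delta g) (L2.delta g')) =
    HTensor.tmul (L2.delta (g * (gam h g' : G)⁻¹)) (L2.delta (g * kap h g')) :=
  HTensor.permIso_delta _ _ _

lemma W_symm_delta (a b : G) : (W h).symm (HTensor.tmul (L2.delta a) (L2.delta b)) =
    HTensor.tmul (L2.delta (a * gam h (a⁻¹ * b))) (L2.delta (a⁻¹ * b)) :=
  HTensor.permIso_symm_delta _ _ _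

/-- The comultiplication `x ↦ W^* (1 ⊗ x) W`, for all bounded operators. -/
def comulOp : (L2 G →L[ℂ] L2 G) →⋆ₐ[ℂ] (HTensor (L2 G) (L2 G) →L[ℂ] HTensor (L2 G) (L2 G)) :=
  ((W h).symm.conjStarAlgEquiv.toStarAlgHom).comp (HTensor.ampR (L2 G) (L2 G))

lemma comulOp_apply (x : L2 G →L[ℂ] L2 G) (ζ : HTensor (L2 G) (L2 G)) :
    comulOp h x ζ = (W h).symm (HTensor.map 1 x (W h ζ)) := rfl

/-- The action of functions on `K × K` on `ℓ²(G) ⊗ ℓ²(G)`. -/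
def mmOp : C(K × K, ℂ) →⋆ₐ[ℂ] (HTensor (L2 G) (L2 G) →L[ℂ] HTensor (L2 G) (L2 G)) :=
  ((HTensor.toL2 G G).symm.conjStarAlgEquiv.toStarAlgHom).comp
    (pullbackRep fun p : G × G => (kap h p.1, kap h p.2))

lemma mmOp_delta (F : C(K × K, ℂ)) (g g' : G) :
    mmOp h F (HTensor.tmul (L2.delta g) (L2.delta g')) =
      F (kap h g, kap h g') • HTensor.tmul (L2.delta g) (L2.delta g') := by
  change (HTensor.toL2 G G).symm (pullbackRep _ F (HTensor.toL2 G G _)) = _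
  rw [HTensor.toL2_delta, pullbackRep_delta, map_smul, HTensor.toL2_symm_delta]

lemma mmOp_prodFun (f f' : C(K, ℂ)) : mmOp h (prodFun f f') = HTensor.map (mOp h f) (mOp h f') :=
  HTensor.clm_ext_delta fun g g' => by
    rw [mmOp_delta, HTensor.map_tmul, mOp_delta, mOp_delta, HTensor.tmul_smul_left,
      HTensor.tmul_smul_right, smul_smul, prodFun_apply]

lemma mmOp_comp_mem [T2Space K]
    (S : Submodule ℂ (HTensor (L2 G) (L2 G) →L[ℂ] HTensor (L2 G) (L2 G)))
    (hS : IsClosed (S : Set (HTensor (L2 G) (L2 G) →L[ℂ] HTensor (L2 G) (L2 G))))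
    (θ : C(K × K, K × K)) (hmem : ∀ f f', mmOp h ((prodFun f f').comp θ) ∈ S) (F : C(K × K, ℂ)) :
    mmOp h (F.comp θ) ∈ S := by
  let φ : C(K × K, ℂ) →⋆ₐ[ℂ] (HTensor (L2 G) (L2 G) →L[ℂ] HTensor (L2 G) (L2 G)) :=
    (mmOp h).comp (ContinuousMap.compStarAlgHom' ℂ ℂ θ)
  exact mem_of_prodFun_mem (S.comap φ.toLinearMap) (hS.preimage
    (StarAlgHom.continuous_of_cstar φ)) hmem F

lemma mmOp_mem [T2Space K] (F : C(K × K, ℂ)) : mmOp h F ∈ minTensor (alg h) (alg h) :=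
  mmOp_comp_mem h (minTensor (alg h) (alg h)).toSubalgebra.toSubmodule isClosed_minTensor
    (ContinuousMap.id _) (fun f f' => by
      change mmOp h (prodFun f f') ∈ minTensor (alg h) (alg h)
      rw [mmOp_prodFun]
      exact map_mem_minTensor (mOp_mem h f) (mOp_mem h f')) F

instance _root_.OpenSubgroup.instIsTopologicalGroup (K : OpenSubgroup G) : IsTopologicalGroup K :=
  inferInstanceAs (IsTopologicalGroup (K : Subgroup G))

/-- The function `(k, k') ↦ f (k k')`. -/
def mulFun (f : C(K, ℂ)) : C(K × K, ℂ) := f.comp ⟨fun p => p.1 * p.2, continuous_mul⟩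

lemma comulOp_mOp (f : C(K, ℂ)) : comulOp h (mOp h f) = mmOp h (mulFun f) :=
  HTensor.clm_ext_delta fun g g' => by
    rw [comulOp_apply, W_delta, HTensor.map_tmul, mOp_delta, HTensor.tmul_smul_right, map_smul,
      mmOp_delta, one_apply_eq_self, ← W_delta, LinearIsometryEquiv.symm_apply_apply, kap_mul_right]
    rfl

open Classical in
lemma moveInd_apply (s r : Γ) (k : K) :
    moveInd K (s : G) (r : G) k = if gam h ((k : G) * s) = r then 1 else 0 := by
  change Set.indicator (moveSet K (s : G) (r : G)) (fun _ => (1 : ℂ)) k = _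
  rw [Set.indicator_apply]
  congr 1
  rw [gam_eq_iff, ← mul_assoc]; rfl

/-- The finitely many elements of `Γ` in the orbit of `s` under `K`. -/
def orbit (s : Γ) : Finset Γ :=
  (finite_range_gam_mul h (isCompact_iff_compactSpace.2 inferInstance : IsCompact (K : Set G))
    (s : G)).toFinset

lemma mem_orbit (s : Γ) (k : K) : gam h ((k : G) * s) ∈ orbit h s :=
  (Set.Finite.mem_toFinset _).2 ⟨k, rfl⟩

lemma moveInd_eq_zero (s r : Γ) (hr : r ∉ orbit h s) : moveInd K (s : G) (r : G) = 0 := by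
  classical
  ext k
  rw [moveInd_apply h, if_neg, ContinuousMap.zero_apply]
  rintro rfl
  exact hr (mem_orbit h s k)

/-- The formula `Δ(v_s) = ∑_r v_r ⊗ 1_{ks ∈ rK} v_s`. The sum is finite, because the indicator
function vanishes unless `r` is in the finite orbit of `s` under `K`. -/
lemma comulOp_vOp (s : Γ) : comulOp h (vOp s) =
    ∑ r ∈ orbit h s, HTensor.map (vOp r) (mOp h (moveInd K (s : G) (r : G)) * vOp s) := by
  classical
  refine HTensor.clm_ext_delta fun g g' => ?_
  rw [sum_apply]
  have e1 : (g * (gam h g' : G)⁻¹)⁻¹ * (g * kap h g' * (s : G)⁻¹) = g' * (s : G)⁻¹ := by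
    conv_rhs => rw [← gam_mul_kap h g']
    group
  have e2 : gam h (kap h (g' * (s : G)⁻¹) * s) = (gam h (g' * (s : G)⁻¹))⁻¹ * gam h g' := by
    have := gam_mul h (g' * (s : G)⁻¹) s
    rw [inv_mul_cancel_right] at this
    rw [this, inv_mul_cancel_left]
  rw [comulOp_apply, W_delta, HTensor.map_tmul, vOp_delta, one_apply_eq_self, W_symm_delta, e1,
    Finset.sum_eq_single (gam h (kap h (g' * (s : G)⁻¹) * s))]
  · rw [HTensor.map_tmul, mul_apply_eq_comp, vOp_delta, vOp_delta, mOp_delta, moveInd_apply h,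
      if_pos rfl, one_smul, e2]
    congr 2
    push_cast
    group
  · intro r _ hr
    rw [HTensor.map_tmul, mul_apply_eq_comp, vOp_delta, vOp_delta, mOp_delta, moveInd_apply h,
      if_neg hr.symm, zero_smul, HTensor.tmul_zero_right]
  · exact fun hn => absurd (mem_orbit h s _) hn

lemma comulOp_mem [T2Space K] {a : L2 G →L[ℂ] L2 G} (ha : a ∈ alg h) :
    comulOp h a ∈ minTensor (alg h) (alg h) := by
  refine mem_of_mem_alg h
    ((minTensor (alg h) (alg h)).toSubalgebra.toSubmodule.comap (comulOp h).toLinearMap)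
    (isClosed_minTensor.preimage (map_continuous (comulOp h))) (fun f s => ?_) ha
  change comulOp h (mOp h f * vOp s) ∈ minTensor (alg h) (alg h)
  rw [map_mul, comulOp_mOp, comulOp_vOp]
  exact mul_mem (mmOp_mem h _) (sum_mem fun r _ => map_mem_minTensor (vOp_mem h r)
    (mul_mem (mOp_mem h _) (vOp_mem h s)))

end Bicrossed

/-! ### The bicrossed product as a compact quantum group -/

namespace Bicrossed

variable {G : Type u} [Group G] [TopologicalSpace G] [IsTopologicalGroup G]
  {K : OpenSubgroup G} {Γ : Subgroup G} (h : Γ.IsComplement' (K : Subgroup G)) [CompactSpace K]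

section Density

variable [T2Space K]

lemma productSpan_mem {ι κ : (L2 G →L[ℂ] L2 G) →⋆ₐ[ℂ] (HTensor (L2 G) (L2 G) →L[ℂ]
      HTensor (L2 G) (L2 G))} (hc : ∀ a b, ι a * κ b = κ b * ι a)
    (hm : ∀ f, κ (mOp h f) ∈ productSpan (alg h) (comulOp h) ι)
    (hv : ∀ s : Γ, κ (vOp s) ∈ productSpan (alg h) (comulOp h) ι) {a b : L2 G →L[ℂ] L2 G}
    (ha : a ∈ alg h) (hb : b ∈ alg h) : κ a * ι b ∈ productSpan (alg h) (comulOp h) ι :=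
  productSpan_mul_right (mem_of_mem_alg h
    ((productSpan (alg h) (comulOp h) ι).comap κ.toLinearMap)
    ((isClosed_productSpan _ _ _).preimage (map_continuous κ))
    (fun f s => productSpan_map_mul hc (hm f) (hv s)) ha) hb

lemma ampR_mul_ampL (a b : L2 G →L[ℂ] L2 G) :
    HTensor.ampR (L2 G) (L2 G) a * HTensor.ampL (L2 G) (L2 G) b = HTensor.map b a := by
  rw [HTensor.ampR_apply, HTensor.ampL_apply, HTensor.map_mul_map, one_mul, mul_one]

lemma ampL_mul_ampR (a b : L2 G →L[ℂ] L2 G) :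
    HTensor.ampL (L2 G) (L2 G) b * HTensor.ampR (L2 G) (L2 G) a = HTensor.map b a := by
  rw [HTensor.ampR_apply, HTensor.ampL_apply, HTensor.map_mul_map, one_mul, mul_one]

/-- The homeomorphism `(x, y) ↦ (x y, y)` carries `f ⊗ f'` to `Δ(f) (1 ⊗ f')`. -/
lemma ampL_mOp_mem (f : C(K, ℂ)) : HTensor.ampL (L2 G) (L2 G) (mOp h f) ∈
    productSpan (alg h) (comulOp h) (HTensor.ampR (L2 G) (L2 G)) := by
  have h1 := mmOp_comp_mem h (productSpan (alg h) (comulOp h) (HTensor.ampR (L2 G) (L2 G)))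
    (isClosed_productSpan _ _ _) ⟨fun p => (p.1 * p.2, p.2), by fun_prop⟩ (fun f f' => by
      have : comulOp h (mOp h f) * HTensor.ampR (L2 G) (L2 G) (mOp h f') ∈
        productSpan (alg h) (comulOp h) (HTensor.ampR (L2 G) (L2 G)) :=
        mul_mem_productSpan (mOp_mem h f) (mOp_mem h f')
      rw [comulOp_mOp, HTensor.ampR_apply, ← map_one (mOp h), ← mmOp_prodFun, ← map_mul] at this
      convert! this using 2
      ext p
      simp [prodFun_apply, mulFun]) (f.comp ⟨fun p => p.1 * p.2⁻¹, by fun_prop⟩)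
  convert! h1
  rw [HTensor.ampL_apply, ← map_one (mOp h), ← mmOp_prodFun]
  congr 1
  ext p
  simp [prodFun_apply]

/-- The products `Δ(f) (f' ⊗ 1)` are the functions `f(xy) f'(x)`. Since `(x, y) ↦ (xy, x)` is a
homeomorphism of `K × K`, their closed span contains all continuous functions, in particular `f(y)`.
-/
lemma ampR_mOp_mem (f : C(K, ℂ)) : HTensor.ampR (L2 G) (L2 G) (mOp h f) ∈
    productSpan (alg h) (comulOp h) (HTensor.ampL (L2 G) (L2 G)) := by
  have h1 := mmOp_comp_mem h (productSpan (alg h) (comulOp h) (HTensor.ampL (L2 G) (L2 G)))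
    (isClosed_productSpan _ _ _) ⟨fun p => (p.1 * p.2, p.1), by fun_prop⟩ (fun f f' => by
      have : comulOp h (mOp h f) * HTensor.ampL (L2 G) (L2 G) (mOp h f') ∈
        productSpan (alg h) (comulOp h) (HTensor.ampL (L2 G) (L2 G)) :=
        mul_mem_productSpan (mOp_mem h f) (mOp_mem h f')
      rw [comulOp_mOp, HTensor.ampL_apply, ← map_one (mOp h), ← mmOp_prodFun, ← map_mul] at this
      convert! this using 2
      ext p
      simp [prodFun_apply, mulFun]) (f.comp ⟨fun p => p.2⁻¹ * p.1, by fun_prop⟩)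
  convert! h1
  rw [HTensor.ampR_apply, ← map_one (mOp h), ← mmOp_prodFun]
  congr 1
  ext p
  simp [prodFun_apply]

lemma moveInd_mul_moveInd_of_ne (h : Γ.IsComplement' (K : Subgroup G)) (s : Γ)
    {r r' : Γ} (hr : r ≠ r') :
    moveInd K (s : G) (r : G) * moveInd K (s : G) (r' : G) = 0 := by
  classical
  ext k
  rw [ContinuousMap.mul_apply, moveInd_apply h, moveInd_apply h, ContinuousMap.zero_apply]
  split_ifs with h1 h2
  · exact absurd (h1.symm.trans h2) hr
  all_goals simp

lemma moveInd_mul_self (h : Γ.IsComplement' (K : Subgroup G)) (s r : Γ) :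
    moveInd K (s : G) (r : G) * moveInd K (s : G) (r : G) = moveInd K (s : G) (r : G) := by
  classical
  ext k
  rw [ContinuousMap.mul_apply, moveInd_apply h]
  split_ifs <;> simp

lemma sum_moveInd (s : Γ) : ∑ r ∈ orbit h s, moveInd K (s : G) (r : G) = 1 := by
  classical
  ext k
  rw [ContinuousMap.sum_apply, Finset.sum_eq_single (gam h ((k : G) * s)), moveInd_apply h,
    if_pos rfl]
  · rfl
  · intro r _ hr
    rw [moveInd_apply h, if_neg hr.symm]
  · exact fun hn => absurd (mem_orbit h s k) hn

/-- `k` moves `s` to `r` if and only if its inverse moves `r` to `s`. -/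
lemma gam_mul_eq_iff (k : K) (s r : Γ) :
    gam h ((k : G) * s) = r ↔ gam h (((k⁻¹ : K) : G) * r) = s := by
  constructor
  · rintro rfl
    rw [gam_mul_gam, InvMemClass.coe_inv, inv_mul_cancel_left, gam_coe]
  · rintro rfl
    rw [gam_mul_gam, InvMemClass.coe_inv, mul_inv_cancel_left, gam_coe]

lemma sum_moveInd' (r : Γ) : ∑ s ∈ orbit h r, moveInd K (s : G) (r : G) = 1 := by
  classical
  ext k
  rw [ContinuousMap.sum_apply, Finset.sum_eq_single (gam h (((k⁻¹ : K) : G) * r)),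
    moveInd_apply h, if_pos ((gam_mul_eq_iff h _ _ _).2 rfl)]
  · rfl
  · intro s _ hs
    rw [moveInd_apply h, if_neg fun e => hs ((gam_mul_eq_iff h _ _ _).1 e).symm]
  · exact fun hn => absurd (mem_orbit h r k⁻¹) hn

lemma comulOp_vOp_mul (s r : Γ) :
    comulOp h (vOp s) * HTensor.map 1 (vOp s⁻¹ * mOp h (moveInd K (s : G) (r : G))) =
      HTensor.map (vOp r) (mOp h (moveInd K (s : G) (r : G))) := by
  have e : ∀ r' : Γ, HTensor.map (vOp r') (mOp h (moveInd K (s : G) (r' : G)) * vOp s) *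
      HTensor.map 1 (vOp s⁻¹ * mOp h (moveInd K (s : G) (r : G))) =
      HTensor.map (vOp r')
        (mOp h (moveInd K (s : G) (r' : G) * moveInd K (s : G) (r : G))) := fun r' => by
    rw [HTensor.map_mul_map, mul_one, mul_assoc, ← mul_assoc (vOp s), vOp_mul, mul_inv_cancel,
      vOp_one, one_mul, map_mul]
  rw [comulOp_vOp, Finset.sum_mul, Finset.sum_eq_single r, e, moveInd_mul_self h]
  · intro r' _ hr
    rw [e, moveInd_mul_moveInd_of_ne h s hr, map_zero]
    rw [← ampL_mul_ampR, map_zero, mul_zero]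
  · intro hr
    rw [e, moveInd_eq_zero h s r hr, mul_zero, map_zero, ← ampL_mul_ampR, map_zero, mul_zero]

/-- `v_r ⊗ 1 = ∑_s Δ(v_s) (1 ⊗ v_s^* 1_{k s ∈ r K})`. -/
lemma ampL_vOp_mem (r : Γ) : HTensor.ampL (L2 G) (L2 G) (vOp r) ∈
    productSpan (alg h) (comulOp h) (HTensor.ampR (L2 G) (L2 G)) := by
  have e : HTensor.ampL (L2 G) (L2 G) (vOp r) = ∑ s ∈ orbit h r,
      comulOp h (vOp s) * HTensor.ampR (L2 G) (L2 G)
        (vOp s⁻¹ * mOp h (moveInd K (s : G) (r : G))) := by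
    have e1 : ∀ s, comulOp h (vOp s) * HTensor.ampR (L2 G) (L2 G)
        (vOp s⁻¹ * mOp h (moveInd K (s : G) (r : G))) = HTensor.ampL (L2 G) (L2 G) (vOp r) *
          HTensor.ampR (L2 G) (L2 G) (mOp h (moveInd K (s : G) (r : G))) := fun s => by
      rw [HTensor.ampR_apply, comulOp_vOp_mul, ampL_mul_ampR]
    simp only [e1]
    rw [← Finset.mul_sum, ← map_sum, ← map_sum, sum_moveInd', map_one, map_one, mul_one]
  rw [e]
  exact sum_mem fun s _ => mul_mem_productSpan (vOp_mem h s)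
    (mul_mem (vOp_mem h _) (mOp_mem h _))

/-- `1 ⊗ v_s = ∑_r Δ(v_s) (1 ⊗ v_s^* 1_{k s ∈ r K} v_s) (v_r^* ⊗ 1)`. -/
lemma ampR_vOp_mem (s : Γ) : HTensor.ampR (L2 G) (L2 G) (vOp s) ∈
    productSpan (alg h) (comulOp h) (HTensor.ampL (L2 G) (L2 G)) := by
  have e : HTensor.ampR (L2 G) (L2 G) (vOp s) = ∑ r ∈ orbit h s,
      comulOp h (vOp s) * HTensor.ampR (L2 G) (L2 G)
        (mOp h (act h s⁻¹ (moveInd K (s : G) (r : G)))) *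
        HTensor.ampL (L2 G) (L2 G) (vOp r⁻¹) := by
    have e1 : ∀ r : Γ, comulOp h (vOp s) * HTensor.ampR (L2 G) (L2 G)
        (mOp h (act h s⁻¹ (moveInd K (s : G) (r : G)))) *
        HTensor.ampL (L2 G) (L2 G) (vOp r⁻¹) =
          HTensor.ampR (L2 G) (L2 G) (mOp h (moveInd K (s : G) (r : G))) *
          HTensor.ampR (L2 G) (L2 G) (vOp s) := fun r => by
      have e2 : mOp h (act h s⁻¹ (moveInd K (s : G) (r : G))) =
          vOp s⁻¹ * mOp h (moveInd K (s : G) (r : G)) * vOp s := by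
        rw [vOp_mul_mOp, mul_assoc, vOp_mul, inv_mul_cancel, vOp_one, mul_one]
      rw [e2, map_mul, ← mul_assoc, HTensor.ampR_apply (vOp s⁻¹ * _), comulOp_vOp_mul, mul_assoc,
        ampR_mul_ampL, HTensor.map_mul_map, vOp_mul, mul_inv_cancel, vOp_one, ← map_mul]
      rfl
    simp only [e1]
    rw [← Finset.sum_mul, ← map_sum, ← map_sum, sum_moveInd, map_one, map_one, one_mul]
  rw [e]
  exact sum_mem fun r _ => productSpan_mul_right
    (productSpan_mul_left (ampR_mOp_mem h _) (vOp_mem h s)) (vOp_mem h _)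

lemma minTensor_le_productSpan_ampR {T : HTensor (L2 G) (L2 G) →L[ℂ] HTensor (L2 G) (L2 G)}
    (hT : T ∈ minTensor (alg h) (alg h)) :
    T ∈ productSpan (alg h) (comulOp h) (HTensor.ampR (L2 G) (L2 G)) :=
  mem_of_mem_minTensor _ (isClosed_productSpan _ _ _) (fun a ha b hb => by
    rw [← ampL_mul_ampR]
    exact productSpan_mem h (fun a b => (ampR_mul_ampL a b).trans (ampL_mul_ampR a b).symm)
      (ampL_mOp_mem h) (ampL_vOp_mem h) ha hb) hT

lemma minTensor_le_productSpan_ampL {T : HTensor (L2 G) (L2 G) →L[ℂ] HTensor (L2 G) (L2 G)}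
    (hT : T ∈ minTensor (alg h) (alg h)) :
    T ∈ productSpan (alg h) (comulOp h) (HTensor.ampL (L2 G) (L2 G)) :=
  mem_of_mem_minTensor _ (isClosed_productSpan _ _ _) (fun a ha b hb => by
    rw [← ampR_mul_ampL]
    exact productSpan_mem h (fun a b => (ampL_mul_ampR b a).trans (ampR_mul_ampL b a).symm)
      (ampR_mOp_mem h) (ampR_vOp_mem h) hb ha) hT

end Density

section Coassoc

/-- `(Δ ⊗ id)`, for all bounded operators. -/
def comulL : (HTensor (L2 G) (L2 G) →L[ℂ] HTensor (L2 G) (L2 G)) →⋆ₐ[ℂ]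
    (HTensor (HTensor (L2 G) (L2 G)) (L2 G) →L[ℂ] HTensor (HTensor (L2 G) (L2 G)) (L2 G)) :=
  (((HTensor.mapIso (W h) (LinearIsometryEquiv.refl ℂ (L2 G))).trans
    (HTensor.assocIso (L2 G) (L2 G) (L2 G))).symm.conjStarAlgEquiv.toStarAlgHom).comp
      (HTensor.ampR (L2 G) (HTensor (L2 G) (L2 G)))

lemma comulL_apply (T : HTensor (L2 G) (L2 G) →L[ℂ] HTensor (L2 G) (L2 G)) (ζ) :
    comulL h T ζ = (HTensor.mapIso (W h) (LinearIsometryEquiv.refl ℂ (L2 G))).symm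
      ((HTensor.assocIso (L2 G) (L2 G) (L2 G)).symm (HTensor.map 1 T
        (HTensor.assocIso (L2 G) (L2 G) (L2 G)
          (HTensor.mapIso (W h) (LinearIsometryEquiv.refl ℂ (L2 G)) ζ)))) := rfl

/-- `(id ⊗ Δ)`, for all bounded operators. -/
def comulR : (HTensor (L2 G) (L2 G) →L[ℂ] HTensor (L2 G) (L2 G)) →⋆ₐ[ℂ]
    (HTensor (L2 G) (HTensor (L2 G) (L2 G)) →L[ℂ] HTensor (L2 G) (HTensor (L2 G) (L2 G))) :=
  (((HTensor.mapIso (LinearIsometryEquiv.refl ℂ (L2 G)) (W h)).trans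
    (HTensor.leftCommIso (L2 G) (L2 G) (L2 G))).symm.conjStarAlgEquiv.toStarAlgHom).comp
      (HTensor.ampR (L2 G) (HTensor (L2 G) (L2 G)))

lemma comulR_apply (T : HTensor (L2 G) (L2 G) →L[ℂ] HTensor (L2 G) (L2 G)) (ζ) :
    comulR h T ζ = (HTensor.mapIso (LinearIsometryEquiv.refl ℂ (L2 G)) (W h)).symm
      ((HTensor.leftCommIso (L2 G) (L2 G) (L2 G)).symm (HTensor.map 1 T
        (HTensor.leftCommIso (L2 G) (L2 G) (L2 G)
          (HTensor.mapIso (LinearIsometryEquiv.refl ℂ (L2 G)) (W h) ζ)))) := rfl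

lemma comulL_map (a b : L2 G →L[ℂ] L2 G) :
    comulL h (HTensor.map a b) = HTensor.map (comulOp h a) b := by
  have e : ∀ ζ : HTensor (HTensor (L2 G) (L2 G)) (L2 G),
      (HTensor.assocIso (L2 G) (L2 G) (L2 G)).symm (HTensor.map 1 (HTensor.map a b)
        (HTensor.assocIso (L2 G) (L2 G) (L2 G) ζ)) = HTensor.map (HTensor.map 1 a) b ζ := by
    intro ζ
    rw [LinearIsometryEquiv.symm_apply_eq]
    refine DFunLike.congr_fun (HTensor.clm_ext₃L
      (A := HTensor.map 1 (HTensor.map a b) ∘L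
        (HTensor.assocIso (L2 G) (L2 G) (L2 G)).toContinuousLinearEquiv.toContinuousLinearMap)
      (B := (HTensor.assocIso (L2 G) (L2 G) (L2 G)).toContinuousLinearEquiv.toContinuousLinearMap ∘L
        HTensor.map (HTensor.map 1 a) b) fun x y z => ?_) ζ
    change HTensor.map 1 (HTensor.map a b) (HTensor.assocIso _ _ _ _) =
      HTensor.assocIso _ _ _ (HTensor.map (HTensor.map 1 a) b _)
    rw [HTensor.assocIso_tmul, HTensor.map_tmul, HTensor.map_tmul, HTensor.map_tmul,
      HTensor.map_tmul, HTensor.assocIso_tmul]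
  refine HTensor.ext_clm fun w z => ?_
  rw [comulL_apply, e, HTensor.mapIso_tmul, HTensor.map_tmul, HTensor.mapIso_symm_tmul,
    HTensor.map_tmul, comulOp_apply]
  rfl

lemma comulR_map (a b : L2 G →L[ℂ] L2 G) :
    comulR h (HTensor.map a b) = HTensor.map a (comulOp h b) := by
  have e : ∀ ζ : HTensor (L2 G) (HTensor (L2 G) (L2 G)),
      (HTensor.leftCommIso (L2 G) (L2 G) (L2 G)).symm (HTensor.map 1 (HTensor.map a b)
        (HTensor.leftCommIso (L2 G) (L2 G) (L2 G) ζ)) = HTensor.map a (HTensor.map 1 b) ζ := by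
    intro ζ
    rw [LinearIsometryEquiv.symm_apply_eq]
    refine DFunLike.congr_fun (HTensor.clm_ext₃R
      (A := HTensor.map 1 (HTensor.map a b) ∘L
        (HTensor.leftCommIso (L2 G) (L2 G) (L2 G)).toContinuousLinearEquiv.toContinuousLinearMap)
      (B := (HTensor.leftCommIso (L2 G) (L2 G)
        (L2 G)).toContinuousLinearEquiv.toContinuousLinearMap ∘L
        HTensor.map a (HTensor.map 1 b)) fun x y z => ?_) ζ
    change HTensor.map 1 (HTensor.map a b) (HTensor.leftCommIso _ _ _ _) =
      HTensor.leftCommIso _ _ _ (HTensor.map a (HTensor.map 1 b) _)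
    rw [HTensor.leftCommIso_tmul, HTensor.map_tmul, HTensor.map_tmul, HTensor.map_tmul,
      HTensor.map_tmul, HTensor.leftCommIso_tmul]
  refine HTensor.ext_clm fun w z => ?_
  rw [comulR_apply, e, HTensor.mapIso_tmul, HTensor.map_tmul, HTensor.mapIso_symm_tmul,
    HTensor.map_tmul, comulOp_apply]
  rfl

lemma map_one_comulOp (a : L2 G →L[ℂ] L2 G) (ζ : HTensor (L2 G) (HTensor (L2 G) (L2 G))) :
    HTensor.map 1 (comulOp h a) ζ =
      (HTensor.mapIso (LinearIsometryEquiv.refl ℂ (L2 G)) (W h)).symm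
        (HTensor.map 1 (HTensor.map 1 a)
        (HTensor.mapIso (LinearIsometryEquiv.refl ℂ (L2 G)) (W h) ζ)) := by
  symm
  rw [LinearIsometryEquiv.symm_apply_eq]
  refine DFunLike.congr_fun (HTensor.ext_clm
    (A := HTensor.map 1 (HTensor.map 1 a) ∘L (HTensor.mapIso (LinearIsometryEquiv.refl ℂ (L2 G))
      (W h)).toContinuousLinearEquiv.toContinuousLinearMap)
    (B := (HTensor.mapIso (LinearIsometryEquiv.refl ℂ (L2 G))
      (W h)).toContinuousLinearEquiv.toContinuousLinearMap ∘L HTensor.map 1 (comulOp h a))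
    fun x w => ?_) ζ
  change HTensor.map 1 (HTensor.map 1 a) (HTensor.mapIso _ _ _) =
    HTensor.mapIso _ _ (HTensor.map 1 (comulOp h a) _)
  rw [HTensor.mapIso_tmul, HTensor.map_tmul, HTensor.map_tmul, HTensor.mapIso_tmul, comulOp_apply,
    LinearIsometryEquiv.apply_symm_apply]
  rfl

/-- The unitary that implements `(Δ ⊗ id) Δ`. -/
def unitL : HTensor (HTensor (L2 G) (L2 G)) (L2 G) ≃ₗᵢ[ℂ] HTensor (L2 G) (HTensor (L2 G) (L2 G)) :=
  ((HTensor.mapIso (W h) (LinearIsometryEquiv.refl ℂ (L2 G))).trans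
    (HTensor.assocIso (L2 G) (L2 G) (L2 G))).trans
      (HTensor.mapIso (LinearIsometryEquiv.refl ℂ (L2 G)) (W h))

/-- The unitary that implements `(id ⊗ Δ) Δ`. -/
def unitR : HTensor (L2 G) (HTensor (L2 G) (L2 G)) ≃ₗᵢ[ℂ] HTensor (L2 G) (HTensor (L2 G) (L2 G)) :=
  ((HTensor.mapIso (LinearIsometryEquiv.refl ℂ (L2 G)) (W h)).trans
    (HTensor.leftCommIso (L2 G) (L2 G) (L2 G))).trans
      (HTensor.mapIso (LinearIsometryEquiv.refl ℂ (L2 G)) (W h))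

lemma comulL_comulOp (a : L2 G →L[ℂ] L2 G) (ζ) :
    comulL h (comulOp h a) ζ = (unitL h).symm (HTensor.map 1 (HTensor.map 1 a) (unitL h ζ)) := by
  rw [comulL_apply, map_one_comulOp]; rfl

lemma comulR_comulOp (a : L2 G →L[ℂ] L2 G) (ζ) :
    comulR h (comulOp h a) ζ = (unitR h).symm (HTensor.map 1 (HTensor.map 1 a) (unitR h ζ)) := by
  rw [comulR_apply, map_one_comulOp]; rfl

/-- The unitaries `unitL` and `unitR` differ by the permutation `(q, p, c) ↦ (p, p q, c)`, which
leaves the last factor alone. -/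
lemma unitL_symm_tmul (p q : G) (η : L2 G) :
    HTensor.assocIso _ _ _ ((unitL h).symm
      (HTensor.tmul (L2.delta p) (HTensor.tmul (L2.delta (p * q)) η))) =
    (unitR h).symm (HTensor.tmul (L2.delta q) (HTensor.tmul (L2.delta p) η)) := by
  refine DFunLike.congr_fun (L2.clm_ext
    (A := ((unitL h).symm.trans
      (HTensor.assocIso _ _ _)).toContinuousLinearEquiv.toContinuousLinearMap ∘L
        HTensor.tmulR (L2.delta p) ∘L HTensor.tmulR (L2.delta (p * q)))
    (B := (unitR h).symm.toContinuousLinearEquiv.toContinuousLinearMap ∘L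
        HTensor.tmulR (L2.delta q) ∘L HTensor.tmulR (L2.delta p)) fun c => ?_) η
  have e1 : (p * q)⁻¹ * c = q⁻¹ * (p⁻¹ * c) := by group
  have e2 : gam h (p⁻¹ * (p * q * gam h (q⁻¹ * (p⁻¹ * c)))) = gam h (p⁻¹ * c) := by
    rw [← mul_assoc, inv_mul_cancel_left, gam_mul_gam, mul_inv_cancel_left]
  change HTensor.assocIso _ _ _ ((HTensor.mapIso _ _).symm ((HTensor.assocIso _ _ _).symm
    ((HTensor.mapIso _ _).symm (HTensor.tmul _ (HTensor.tmul _ _))))) =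
    (HTensor.mapIso _ _).symm ((HTensor.leftCommIso _ _ _).symm
      ((HTensor.mapIso _ _).symm (HTensor.tmul _ (HTensor.tmul _ _))))
  rw [HTensor.mapIso_symm_tmul, HTensor.mapIso_symm_tmul, W_symm_delta, W_symm_delta, e1,
    HTensor.assocIso_symm_tmul, HTensor.leftCommIso_symm_tmul, HTensor.mapIso_symm_tmul,
    HTensor.mapIso_symm_tmul]
  have e3 : ∀ ξ : L2 G, (LinearIsometryEquiv.refl ℂ (L2 G)).symm ξ = ξ := fun _ => rfl
  simp only [e3]
  rw [W_symm_delta, W_symm_delta, HTensor.assocIso_tmul, e2, ← mul_assoc p⁻¹, inv_mul_cancel_left]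

/-- Coassociativity. Both sides conjugate `1 ⊗ 1 ⊗ a`, up to the order of the factors, by a
permutation of the basis, so they are compared on the basis vectors. -/
lemma assocIso_comulL (a : L2 G →L[ℂ] L2 G) (ζ) :
    HTensor.assocIso _ _ _ (comulL h (comulOp h a) ζ) =
      comulR h (comulOp h a) (HTensor.assocIso _ _ _ ζ) := by
  refine DFunLike.congr_fun (HTensor.clm_ext_deltaR
    (A := (HTensor.assocIso (L2 G) (L2 G) (L2 G)).toContinuousLinearEquiv.toContinuousLinearMap ∘L
      comulL h (comulOp h a))
    (B := comulR h (comulOp h a) ∘L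
      (HTensor.assocIso (L2 G) (L2 G) (L2 G)).toContinuousLinearEquiv.toContinuousLinearMap)
    fun w z => ?_) ζ
  refine DFunLike.congr_fun (HTensor.clm_ext_delta
    (A := (HTensor.assocIso (L2 G) (L2 G) (L2 G)).toContinuousLinearEquiv.toContinuousLinearMap ∘L
      comulL h (comulOp h a) ∘L HTensor.tmulL (L2.delta z))
    (B := comulR h (comulOp h a) ∘L
      (HTensor.assocIso (L2 G) (L2 G) (L2 G)).toContinuousLinearEquiv.toContinuousLinearMap ∘L
        HTensor.tmulL (L2.delta z))
    fun x y => ?_) w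
  change HTensor.assocIso _ _ _ (comulL h (comulOp h a) (HTensor.tmul _ _)) =
    comulR h (comulOp h a) (HTensor.assocIso _ _ _ (HTensor.tmul _ _))
  have e1 : unitL h (HTensor.tmul (HTensor.tmul (L2.delta x) (L2.delta y)) (L2.delta z)) =
      HTensor.tmul (L2.delta (x * (gam h y : G)⁻¹)) (HTensor.tmul
        (L2.delta (x * (gam h y : G)⁻¹ * (y * (gam h z : G)⁻¹)))
          (L2.delta (x * kap h y * kap h z))) := by
    have e : x * (gam h y : G)⁻¹ * (y * (gam h z : G)⁻¹) = x * kap h y * (gam h z : G)⁻¹ := by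
      have hy : (gam h y : G)⁻¹ * y = kap h y := by rw [inv_mul_eq_iff_eq_mul, gam_mul_kap]
      rw [mul_assoc x, ← mul_assoc _ y, hy, mul_assoc]
    change HTensor.mapIso _ _ (HTensor.assocIso _ _ _ (HTensor.mapIso _ _ (HTensor.tmul _ _))) = _
    rw [HTensor.mapIso_tmul, W_delta, HTensor.assocIso_tmul, HTensor.mapIso_tmul,
      LinearIsometryEquiv.coe_refl, id_eq, id_eq, W_delta, e]
  have e2 : unitR h (HTensor.tmul (L2.delta x) (HTensor.tmul (L2.delta y) (L2.delta z))) =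
      HTensor.tmul (L2.delta (y * (gam h z : G)⁻¹)) (HTensor.tmul
        (L2.delta (x * (gam h y : G)⁻¹)) (L2.delta (x * kap h y * kap h z))) := by
    change HTensor.mapIso _ _
      (HTensor.leftCommIso _ _ _ (HTensor.mapIso _ _ (HTensor.tmul _ _))) = _
    rw [HTensor.mapIso_tmul, W_delta, HTensor.leftCommIso_tmul, HTensor.mapIso_tmul,
      LinearIsometryEquiv.coe_refl, id_eq, id_eq, W_delta, gam_mul_right, kap_mul_right,
      mul_assoc x, Subgroup.coe_mul]
  rw [HTensor.assocIso_tmul, comulL_comulOp, comulR_comulOp, e1, e2, HTensor.map_tmul,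
    HTensor.map_tmul, HTensor.map_tmul, HTensor.map_tmul]
  exact unitL_symm_tmul h _ _ _

end Coassoc

section Definition

variable [T2Space K]

/-- A `*`-homomorphism that maps elementary tensors to a closed subspace maps the minimal tensor
product there. -/
lemma map_mem_of_mem_minTensor {C : Type*} [CStarAlgebra C]
    (φ : (HTensor (L2 G) (L2 G) →L[ℂ] HTensor (L2 G) (L2 G)) →⋆ₐ[ℂ] C) (S : StarSubalgebra ℂ C)
    (hS : IsClosed (S : Set C)) (hφ : ∀ a ∈ alg h, ∀ b ∈ alg h, φ (HTensor.map a b) ∈ S)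
    {T : HTensor (L2 G) (L2 G) →L[ℂ] HTensor (L2 G) (L2 G)} (hT : T ∈ minTensor (alg h) (alg h)) :
    φ T ∈ S :=
  mem_of_mem_minTensor (S.toSubalgebra.toSubmodule.comap φ.toLinearMap)
    (hS.preimage (StarAlgHom.continuous_of_cstar φ)) hφ hT

/-- The density conditions for a compact quantum group follow from the corresponding statements
about operators on `ℓ²(G) ⊗ ℓ²(G)`. -/
lemma dense_of_productSpan (ι : (L2 G →L[ℂ] L2 G) →⋆ₐ[ℂ] (HTensor (L2 G) (L2 G) →L[ℂ]
    HTensor (L2 G) (L2 G))) (D : alg h → minTensor (alg h) (alg h))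
    (hD : ∀ a, (D a : HTensor (L2 G) (L2 G) →L[ℂ] HTensor (L2 G) (L2 G)) = comulOp h a)
    (j : alg h → minTensor (alg h) (alg h))
    (hj : ∀ a, (j a : HTensor (L2 G) (L2 G) →L[ℂ] HTensor (L2 G) (L2 G)) = ι a)
    (hd : ∀ T ∈ minTensor (alg h) (alg h), T ∈ productSpan (alg h) (comulOp h) ι) :
    Dense (Submodule.span ℂ {T | ∃ a b : alg h, T = D a * j b} :
      Set (minTensor (alg h) (alg h))) := by
  intro T
  rw [closure_subtype]
  have := hd T T.2
  refine closure_mono ?_ this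
  have e : (Submodule.span ℂ {T | ∃ a b : alg h, T = D a * j b}).map
      (minTensor (alg h) (alg h)).toSubalgebra.toSubmodule.subtype =
      Submodule.span ℂ {T | ∃ a ∈ alg h, ∃ b ∈ alg h, T = comulOp h a * ι b} := by
    rw [Submodule.map_span]
    congr 1
    ext T
    constructor
    · rintro ⟨_, ⟨a, b, rfl⟩, rfl⟩
      exact ⟨a, a.2, b, b.2, by rw [← hD, ← hj]; rfl⟩
    · rintro ⟨a, ha, b, hb, rfl⟩
      exact ⟨D ⟨a, ha⟩ * j ⟨b, hb⟩, ⟨_, _, rfl⟩, by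
        change (D ⟨a, ha⟩ : HTensor (L2 G) (L2 G) →L[ℂ] HTensor (L2 G) (L2 G)) *
          (j ⟨b, hb⟩ : HTensor (L2 G) (L2 G) →L[ℂ] HTensor (L2 G) (L2 G)) = _
        rw [hD, hj]⟩
  rw [← e]
  rfl

/-- The bicrossed product of the matched pair `G = Γ K`, as a compact quantum group. -/
def quantumGroup : CompactQuantumGroup (L2 G) where
  A := alg h
  isClosed := isClosed_alg h
  Δ := ((comulOp h).comp (alg h).subtype).codRestrict (minTensor (alg h) (alg h))
    fun a => comulOp_mem h a.2
  coassoc := by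
    refine ⟨((comulL h).comp (minTensor (alg h) (alg h)).subtype).codRestrict _
        fun T => map_mem_of_mem_minTensor h (comulL h) _ isClosed_minTensor (fun a ha b hb => by
          rw [comulL_map]; exact map_mem_minTensor (comulOp_mem h ha) hb) T.2,
      ((comulR h).comp (minTensor (alg h) (alg h)).subtype).codRestrict _
        fun T => map_mem_of_mem_minTensor h (comulR h) _ isClosed_minTensor (fun a ha b hb => by
          rw [comulR_map]; exact map_mem_minTensor ha (comulOp_mem h hb)) T.2,
      fun a b => Subtype.ext (comulL_map h a b), fun a b => Subtype.ext (comulR_map h a b), ?_⟩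
    intro a ξ η ζ ξ' η' ζ'
    change inner ℂ _ (comulL h (comulOp h a) _) = inner ℂ _ (comulR h (comulOp h a) _)
    rw [← HTensor.assocIso_tmul ξ η ζ, ← HTensor.assocIso_tmul ξ' η' ζ', ← assocIso_comulL,
      LinearIsometryEquiv.inner_map_map]
  dense_right := dense_of_productSpan h (HTensor.ampR (L2 G) (L2 G)) _ (fun _ => rfl)
    (fun b => minTmul 1 b) (fun _ => rfl) fun _ hT => minTensor_le_productSpan_ampR h hT
  dense_left := dense_of_productSpan h (HTensor.ampL (L2 G) (L2 G)) _ (fun _ => rfl)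
    (fun b => minTmul b 1) (fun _ => rfl) fun _ hT => minTensor_le_productSpan_ampL h hT

/-- The function `f`, as an element of the bicrossed product. -/
def m (f : C(K, ℂ)) : (quantumGroup h).A := ⟨mOp h f, mOp_mem h f⟩

/-- The unitary of `s ∈ Γ`, as an element of the bicrossed product. -/
def v (s : Γ) : (quantumGroup h).A := ⟨vOp s, vOp_mem h s⟩

lemma comul_v (s : Γ) : (quantumGroup h).Δ (v h s) =
    ∑ r ∈ orbit h s, minTmul (v h r) (m h (moveInd K (s : G) (r : G)) * v h s) :=
  Subtype.ext ((comulOp_vOp h s).trans (by rw [AddSubmonoidClass.coe_finsetSum]; rfl))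

lemma isBicrossedProduct : IsBicrossedProduct K Γ (quantumGroup h) := by
  refine ⟨m h, v h, fun f γ k => ?_, fun s g => vOp_delta s g, rfl, fun f γ γ' k k' => ?_,
    fun s => ?_⟩
  · exact (mOp_delta h f _).trans (by rw [kap_mk])
  · change comulOp h (mOp h f) _ = _
    rw [comulOp_mOp, mmOp_delta, kap_mk, kap_mk]
    rfl
  · rw [comul_v]
    refine hasSum_sum_of_ne_finset_zero fun r hr => ?_
    refine Subtype.ext ?_
    change HTensor.map (vOp r) (mOp h (moveInd K (s : G) (r : G)) * vOp s) = 0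
    rw [moveInd_eq_zero h s r hr, map_zero, zero_mul, ← ampL_mul_ampR, map_zero, mul_zero]

end Definition

end Bicrossed

/-! ### Invariance of the Haar measure of `K` -/

section Invariance

open MeasureTheory Measure

variable {G : Type u} [Group G] [TopologicalSpace G] [IsTopologicalGroup G]
  {K : OpenSubgroup G} {Γ : Subgroup G} [MeasurableSpace G] [BorelSpace G]

lemma measurable_kap (h : Γ.IsComplement' (K : Subgroup G)) : Measurable (kap h) :=
  (continuous_kap h).measurable

variable [LocallyCompactSpace G]

/-- The Haar probability measure of the compact open subgroup `K`, as a measure on `G`. -/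
def haarProb (K : OpenSubgroup G) : Measure G :=
  ((haar : Measure G) (K : Set G))⁻¹ • (haar : Measure G).restrict (K : Set G)

lemma haarProb_apply (K : OpenSubgroup G) {B : Set G} (hB : MeasurableSet B) :
    haarProb K B = ((haar : Measure G) (K : Set G))⁻¹ * (haar : Measure G) (B ∩ K) := by
  rw [haarProb, Measure.smul_apply, Measure.restrict_apply hB, smul_eq_mul]

lemma haar_openSubgroup_ne_zero : (haar : Measure G) (K : Set G) ≠ 0 :=
  (K.isOpen.measure_pos _ ⟨1, K.one_mem⟩).ne'

lemma ae_mem_haarProb : ∀ᵐ g ∂(haarProb K), g ∈ K :=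
  Measure.ae_smul_measure (ae_restrict_mem K.isOpen.measurableSet) _

lemma integral_haarProb_mul_left {F : Type*} [NormedAddCommGroup F] [NormedSpace ℝ F] (f : G → F)
    (k : K) : ∫ g, f (k * g) ∂(haarProb K) = ∫ g, f g ∂(haarProb K) := by
  have hν : Measure.map (fun g => (k : G) * g) (haarProb K) = haarProb K := by
    ext B hB
    rw [Measure.map_apply (measurable_const_mul _) hB,
      haarProb_apply K (hB.preimage (measurable_const_mul _)), haarProb_apply K hB,
      ← measure_preimage_mul (haar : Measure G) (k : G) (B ∩ K)]
    congr 2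
    ext g
    simp only [Set.mem_inter_iff, Set.mem_preimage, SetLike.mem_coe]
    rw [mul_mem_cancel_left k.2]
  conv_rhs => rw [← hν]
  exact ((Homeomorph.mulLeft (k : G)).toMeasurableEquiv.measurableEmbedding.integral_map f).symm

variable [CompactSpace K]

lemma haar_openSubgroup_ne_top : (haar : Measure G) (K : Set G) ≠ ∞ :=
  (isCompact_iff_compactSpace.2 inferInstance : IsCompact (K : Set G)).measure_ne_top

instance : IsProbabilityMeasure (haarProb K) := ⟨by
  rw [haarProb_apply K MeasurableSet.univ, Set.univ_inter,
    ENNReal.inv_mul_cancel haar_openSubgroup_ne_zero haar_openSubgroup_ne_top]⟩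

lemma integrable_haarProb {F : Type*} [NormedAddCommGroup F] [NormedSpace ℝ F] {f : G → F}
    (hf : Continuous f) : Integrable f (haarProb K) :=
  Integrable.smul_measure (hf.continuousOn.integrableOn_compact'
    (isCompact_iff_compactSpace.2 inferInstance : IsCompact (K : Set G)) K.isOpen.measurableSet)
    (ENNReal.inv_ne_top.2 haar_openSubgroup_ne_zero)

/-- The sets `r⁻¹ K x ∩ K`, `r ∈ Γ`, form a finite partition of `K`. Thus the measures of a
`Γ`-invariant set in `K` and in `K x` are the same. -/
lemma haar_inter_mul_right (h : Γ.IsComplement' (K : Subgroup G)) {B : Set G} (hB : MeasurableSet B)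
    (hΓ : ∀ (γ : Γ) (g : G), (γ : G) * g ∈ B ↔ g ∈ B) (x : G) :
    (haar : Measure G) {g | g ∈ B ∧ g * x⁻¹ ∈ K} = (haar : Measure G) (B ∩ K) := by
  classical
  set R : Finset Γ := (finite_range_gam_mul h
    (isCompact_iff_compactSpace.2 inferInstance : IsCompact (K : Set G)) x).toFinset
  have hR : ∀ k : K, gam h (k * x) ∈ R := fun k => (Set.Finite.mem_toFinset _).2 ⟨k, rfl⟩
  have hKm := K.isOpen.measurableSet
  have hm : ∀ r : Γ, MeasurableSet {g : G | g ∈ B ∧ g * x⁻¹ ∈ K ∧ (r : G)⁻¹ * g ∈ K} := fun r =>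
    hB.inter ((hKm.preimage (measurable_mul_const _)).inter (hKm.preimage (measurable_const_mul _)))
  have hm' : ∀ r : Γ, MeasurableSet {g : G | g ∈ B ∧ r * g * x⁻¹ ∈ K ∧ g ∈ K} := fun r =>
    hB.inter ((hKm.preimage ((measurable_mul_const _).comp (measurable_const_mul _))).inter hKm)
  have e1 : {g | g ∈ B ∧ g * x⁻¹ ∈ K} =
      ⋃ r ∈ R, {g : G | g ∈ B ∧ g * x⁻¹ ∈ K ∧ (r : G)⁻¹ * g ∈ K} := by
    ext g
    simp only [Set.mem_ofPred_eq, Set.mem_iUnion, exists_prop]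
    constructor
    · rintro ⟨hg, hgx⟩
      have := hR ⟨_, hgx⟩
      rw [inv_mul_cancel_right] at this
      exact ⟨_, this, hg, hgx, (gam_eq_iff h _ _).1 rfl⟩
    · rintro ⟨r, -, hg, hgx, -⟩
      exact ⟨hg, hgx⟩
  -- The translation by `r` maps the part of `B ∩ K` belonging to `r` to the part of `B ∩ K x`
  -- belonging to `r`.
  have e2 : B ∩ K = ⋃ r ∈ R, {g : G | g ∈ B ∧ r * g * x⁻¹ ∈ K ∧ g ∈ K} := by
    ext g
    simp only [Set.mem_ofPred_eq, Set.mem_iUnion, exists_prop, Set.mem_inter_iff, SetLike.mem_coe]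
    constructor
    · rintro ⟨hg, hgK⟩
      have e : g * x⁻¹ = gam h (g * x⁻¹) * kap h (g * x⁻¹) := (gam_mul_kap h _).symm
      have e' : (kap h (g * x⁻¹) : G) * x = ((gam h (g * x⁻¹))⁻¹ : Γ) * ((⟨g, hgK⟩ : K) : G) := by
        rw [InvMemClass.coe_inv, eq_inv_mul_iff_mul_eq, ← mul_assoc, ← e, inv_mul_cancel_right]
      have := hR (kap h (g * x⁻¹))
      rw [e', gam_mk] at this
      refine ⟨_, this, hg, ?_, hgK⟩
      rw [mul_assoc, InvMemClass.coe_inv, e]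
      simp
    · rintro ⟨r, -, hg, -, hgK⟩
      exact ⟨hg, hgK⟩
  rw [e1, e2, measure_biUnion_finset ?_ fun r _ => hm r, measure_biUnion_finset ?_ fun r _ => hm' r]
  · refine Finset.sum_congr rfl fun r _ => ?_
    rw [← measure_preimage_mul (haar : Measure G) (r : G)⁻¹
      {g : G | g ∈ B ∧ r * g * x⁻¹ ∈ K ∧ g ∈ K}]
    congr 1
    ext g
    have := hΓ r⁻¹ g
    rw [InvMemClass.coe_inv] at this
    simp only [Set.mem_ofPred_eq, Set.mem_preimage, this, mul_inv_cancel_left]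
  · intro r _ r' _ hrr
    rw [Function.onFun, Set.disjoint_left]
    rintro g ⟨-, hg, hgK⟩ ⟨-, hg', -⟩
    refine hrr ?_
    have key : ∀ r : Γ, (r : G) * g * x⁻¹ ∈ K → gam h (g * x⁻¹) = r⁻¹ := fun r hr => by
      rw [gam_eq_iff, InvMemClass.coe_inv, inv_inv, ← mul_assoc]; exact hr
    exact inv_injective ((key r hg).symm.trans (key r' hg'))
  · intro r _ r' _ hrr
    rw [Function.onFun, Set.disjoint_left]
    rintro g ⟨-, -, hg⟩ ⟨-, -, hg'⟩
    exact hrr (((gam_eq_iff h _ _).2 hg).symm.trans ((gam_eq_iff h _ _).2 hg'))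

/-- On `Γ`-invariant sets, the Haar measure of `K` is invariant under right translation by all
elements of `G`. -/
lemma haarProb_mul_right (h : Γ.IsComplement' (K : Subgroup G)) {B : Set G} (hB : MeasurableSet B)
    (hΓ : ∀ (γ : Γ) (g : G), (γ : G) * g ∈ B ↔ g ∈ B) (x : G) :
    haarProb K {g | g * x ∈ B} = haarProb K B := by
  have key : ∀ {B : Set G}, MeasurableSet B → (∀ (γ : Γ) (g : G), (γ : G) * g ∈ B ↔ g ∈ B) →
      haarProb K {g | g * x ∈ B} =
        haarScalarFactor (map (fun g => g * x) (haar : Measure G)) haar * haarProb K B := by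
    intro B hB hΓ
    have hc : IsCompact (closure {g | g ∈ B ∧ g * x⁻¹ ∈ K}) := by
      refine ((isCompact_iff_compactSpace.2 inferInstance : IsCompact (K : Set G)).image
        (continuous_mul_const x)).closure_of_subset ?_
      rintro g ⟨-, hg⟩
      exact ⟨g * x⁻¹, hg, inv_mul_cancel_right _ _⟩
    have e := measure_isMulInvariant_eq_smul_of_isCompact_closure
      (map (fun g => g * x) (haar : Measure G)) haar hc
    have hm : MeasurableSet {g | g ∈ B ∧ g * x⁻¹ ∈ K} :=
      hB.inter (K.isOpen.measurableSet.preimage (measurable_mul_const _))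
    have e' : (fun g : G => g * x) ⁻¹' {g | g ∈ B ∧ g * x⁻¹ ∈ K} = {g | g * x ∈ B} ∩ K := by
      ext g
      simp
    rw [Measure.map_apply (measurable_mul_const x) hm, e', haar_inter_mul_right h hB hΓ x] at e
    rw [haarProb_apply K (show MeasurableSet {g | g * x ∈ B} from
      hB.preimage (measurable_mul_const x)), e, haarProb_apply K hB,
      ENNReal.smul_def, smul_eq_mul, mul_left_comm]
  -- Both sides are `1` for `B = G`, so the scalar factor is `1`.
  have h1 := key (B := Set.univ) MeasurableSet.univ (by simp)
  simp only [Set.mem_univ, Set.ofPred_true, measure_univ, mul_one] at h1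
  rw [key hB hΓ, ← h1, one_mul]

/-- The average over `K` of a `Γ`-invariant function is invariant under right translation by all
elements of `G`. -/
lemma integral_haarProb_mul_right (h : Γ.IsComplement' (K : Subgroup G)) {F : Type*}
    [NormedAddCommGroup F] [NormedSpace ℝ F] {f : G → F}
    (hf : Continuous f) (hΓ : ∀ (γ : Γ) (g : G), f (γ * g) = f g) (x : G) :
    ∫ g, f (g * x) ∂(haarProb K) = ∫ g, f g ∂(haarProb K) := by
  have e : ∀ g, f g = f (kap h g) := fun g => by
    conv_lhs => rw [← gam_mul_kap h g, hΓ]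
  have hm : Measurable fun g => kap h (g * x) := (measurable_kap h).comp (measurable_mul_const x)
  have hν : Measure.map (fun g => kap h (g * x)) (haarProb K) =
      Measure.map (kap h) (haarProb K) := by
    ext B hB
    rw [Measure.map_apply hm hB, Measure.map_apply (measurable_kap h) hB]
    exact haarProb_mul_right h (B := kap h ⁻¹' B) (measurable_kap h hB) (fun γ g => by simp) x
  have hfK : Continuous fun k : K => f k := hf.comp continuous_subtype_val
  have h1 : ∫ k : K, f k ∂(Measure.map (fun g => kap h (g * x)) (haarProb K)) =
      ∫ g, f (g * x) ∂(haarProb K) := by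
    rw [integral_map hm.aemeasurable hfK.aestronglyMeasurable_of_compactSpace]
    exact integral_congr_ae (.of_forall fun g => (e _).symm)
  have h2 : ∫ k : K, f k ∂(Measure.map (kap h) (haarProb K)) = ∫ g, f g ∂(haarProb K) := by
    rw [integral_map (measurable_kap h).aemeasurable hfK.aestronglyMeasurable_of_compactSpace]
    exact integral_congr_ae (.of_forall fun g => (e _).symm)
  rw [← h1, hν, h2]

end Invariance

/-! ### The tracial state of the bicrossed product -/

section Coefficients

variable {X : Type*}

/-- The matrix coefficient `⟨δ_x, a δ_y⟩` of a bounded operator `a` on `ℓ²(X)`. -/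
def L2.coef (x y : X) : (L2 X →L[ℂ] L2 X) →L[ℂ] ℂ :=
  innerSL ℂ (L2.delta x) ∘L ContinuousLinearMap.apply ℂ (L2 X) (L2.delta y)

lemma L2.coef_apply (x y : X) (a : L2 X →L[ℂ] L2 X) :
    L2.coef x y a = inner ℂ (L2.delta x) (a (L2.delta y)) := rfl

lemma L2.norm_coef_le (x y : X) : ‖(L2.coef x y : (L2 X →L[ℂ] L2 X) →L[ℂ] ℂ)‖ ≤ 1 :=
  ContinuousLinearMap.opNorm_le_bound _ zero_le_one fun a => by
    have h1 := norm_inner_le_norm (𝕜 := ℂ) (L2.delta x) (a (L2.delta y))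
    have h2 := a.le_opNorm (L2.delta y)
    rw [L2.norm_delta] at h1 h2
    rw [L2.coef_apply]
    linarith

lemma L2.ext_coef {a b : L2 X →L[ℂ] L2 X} (h : ∀ x y, L2.coef x y a = L2.coef x y b) : a = b :=
  L2.clm_ext fun y => L2.ext fun x => by
    rw [← L2.inner_delta, ← L2.inner_delta]; exact h x y

/-- The compression `T ↦ V^* T V` of bounded operators by a contraction `V`. -/
def compress {E F : Type*} [NormedAddCommGroup E] [InnerProductSpace ℂ E] [CompleteSpace E]
    [NormedAddCommGroup F] [InnerProductSpace ℂ F] [CompleteSpace F] (V : E →L[ℂ] F) :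
    (F →L[ℂ] F) →L[ℂ] (E →L[ℂ] E) :=
  (ContinuousLinearMap.compL ℂ E F E V.adjoint) ∘L (ContinuousLinearMap.compL ℂ E F F).flip V

lemma compress_apply {E F : Type*} [NormedAddCommGroup E] [InnerProductSpace ℂ E] [CompleteSpace E]
    [NormedAddCommGroup F] [InnerProductSpace ℂ F] [CompleteSpace F] (V : E →L[ℂ] F)
    (T : F →L[ℂ] F) : compress V T = V.adjoint ∘L T ∘L V := rfl

lemma norm_compress_le {E F : Type*} [NormedAddCommGroup E] [InnerProductSpace ℂ E]
    [CompleteSpace E] [NormedAddCommGroup F] [InnerProductSpace ℂ F] [CompleteSpace F]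
    {V : E →L[ℂ] F} (hV : ‖V‖ ≤ 1) : ‖compress V‖ ≤ 1 :=
  ContinuousLinearMap.opNorm_le_bound _ zero_le_one fun T => by
    have h1 : ‖V.adjoint‖ ≤ 1 := by rwa [LinearIsometryEquiv.norm_map]
    rw [compress_apply, one_mul]
    calc ‖V.adjoint ∘L T ∘L V‖ ≤ ‖V.adjoint‖ * (‖T‖ * ‖V‖) :=
          (ContinuousLinearMap.opNorm_comp_le _ _).trans
            (mul_le_mul_of_nonneg_left (ContinuousLinearMap.opNorm_comp_le _ _) (norm_nonneg _))
      _ ≤ 1 * (‖T‖ * 1) := by gcongr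
      _ = ‖T‖ := by ring

/-- For a uniformly bounded family of operators `L z`, the vectors `a` for which `z ↦ L z a` is
continuous form a closed subspace. -/
def contSubmodule {Z E F : Type*} [TopologicalSpace Z] [NormedAddCommGroup E] [NormedSpace ℂ E]
    [NormedAddCommGroup F] [NormedSpace ℂ F] (L : Z → E →L[ℂ] F) : Submodule ℂ E where
  carrier := {a | Continuous fun z => L z a}
  zero_mem' := by simpa using continuous_const
  add_mem' ha hb := by
    simp only [Set.mem_ofPred_eq, map_add] at *
    exact ha.add hb
  smul_mem' c a ha := by
    simp only [Set.mem_ofPred_eq, map_smul] at *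
    exact ha.const_smul c

lemma isClosed_contSubmodule {Z E F : Type*} [TopologicalSpace Z] [NormedAddCommGroup E]
    [NormedSpace ℂ E] [NormedAddCommGroup F] [NormedSpace ℂ F] {L : Z → E →L[ℂ] F}
    (hL : ∀ z, ‖L z‖ ≤ 1) : IsClosed (contSubmodule L : Set E) := by
  refine isClosed_of_closure_subset fun a ha => ?_
  refine continuous_of_uniform_approx_of_continuous fun U hU => ?_
  obtain ⟨ε, hε, hU⟩ := Metric.mem_uniformity_dist.1 hU
  obtain ⟨b, hb, hab⟩ := Metric.mem_closure_iff.1 ha ε hε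
  refine ⟨fun z => L z b, hb, fun z => hU ?_⟩
  rw [dist_eq_norm, ← map_sub]
  refine ((L z).le_opNorm _).trans_lt (lt_of_le_of_lt ?_ hab)
  rw [dist_eq_norm]
  exact mul_le_of_le_one_left (norm_nonneg _) (hL z)

section Average

open MeasureTheory

variable {G : Type u} [Group G] [TopologicalSpace G] [IsTopologicalGroup G]
  [MeasurableSpace G] [BorelSpace G] [LocallyCompactSpace G] (K : OpenSubgroup G) [CompactSpace K]

/-- The average over `K` of a uniformly bounded family of operators, on a subspace of vectors on
which the family is continuous. -/
def haarAverage {E F : Type*} [NormedAddCommGroup E] [NormedSpace ℂ E] [NormedAddCommGroup F]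
    [NormedSpace ℂ F] (S : Submodule ℂ E) (L : G → E →L[ℂ] F)
    (hL : ∀ g, ‖L g‖ ≤ 1) (hS : S ≤ contSubmodule L) : S →L[ℂ] F :=
  LinearMap.mkContinuous
    { toFun := fun a => ∫ g, L g a ∂(haarProb K)
      map_add' := fun a b => by
        simp only [Submodule.coe_add, map_add]
        exact integral_add (integrable_haarProb (hS a.2)) (integrable_haarProb (hS b.2))
      map_smul' := fun c a => by
        simp only [Submodule.coe_smul, map_smul, RingHom.id_apply]
        exact integral_smul c _ } 1
    fun a => by
      have := norm_integral_le_of_norm_le_const (μ := haarProb K) (f := fun g => L g a)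
        (C := 1 * ‖a‖) (.of_forall fun g =>
          ((L g).le_opNorm a).trans (mul_le_mul_of_nonneg_right (hL g) (norm_nonneg _)))
      simpa using this

end Average

end Coefficients

namespace Bicrossed

variable {G : Type u} [Group G] [TopologicalSpace G]
  {K : OpenSubgroup G} {Γ : Subgroup G} (h : Γ.IsComplement' (K : Subgroup G)) [CompactSpace K]

section Coefficients

open L2 (coef delta)

lemma coef_mul_vOp (x y : G) (b : L2 G →L[ℂ] L2 G) (s : Γ) :
    coef x y (b * vOp s) = coef x (y * (s : G)⁻¹) b := by
  rw [L2.coef_apply, mul_apply_eq_comp, vOp_delta]; rfl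

lemma coef_mul_mOp (x y : G) (b : L2 G →L[ℂ] L2 G) (f : C(K, ℂ)) :
    coef x y (b * mOp h f) = f (kap h y) * coef x y b := by
  rw [L2.coef_apply, mul_apply_eq_comp, mOp_delta, map_smul, inner_smul_right]; rfl

lemma coef_mOp_mul (x y : G) (b : L2 G →L[ℂ] L2 G) (f : C(K, ℂ)) :
    coef x y (mOp h f * b) = f (kap h x) * coef x y b := by
  rw [L2.coef_apply, mul_apply_eq_comp, L2.inner_delta, L2.coef_apply, L2.inner_delta]
  exact pullbackRep_apply _ _ _ _

lemma coef_vOp_mul (x y : G) (b : L2 G →L[ℂ] L2 G) (s : Γ) :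
    coef x y (vOp s * b) = coef (x * s) y b := by
  rw [L2.coef_apply, mul_apply_eq_comp, ← ContinuousLinearMap.adjoint_inner_left,
    ← ContinuousLinearMap.star_eq_adjoint, star_vOp, vOp_delta, InvMemClass.coe_inv, inv_inv]; rfl

open Classical in
lemma coef_mOp_mul_vOp (x y : G) (f : C(K, ℂ)) (s : Γ) :
    coef x y (mOp h f * vOp s) = if x * s = y then f (kap h x) else 0 := by
  rw [coef_mOp_mul, L2.coef_apply, vOp_delta, L2.inner_delta_delta, mul_ite, mul_one, mul_zero]
  simp only [eq_mul_inv_iff_mul_eq]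

variable [IsTopologicalGroup G]

/-- The operators in the bicrossed product commute with the left translations by `Γ`. -/
lemma coef_mul_left {a : L2 G →L[ℂ] L2 G} (ha : a ∈ alg h) (γ : Γ) (x y : G) :
    coef (γ * x) (γ * y) a = coef x y a := by
  classical
  refine sub_eq_zero.1 (mem_of_mem_alg h (coef ((γ : G) * x) (γ * y) - coef x y).ker
    (ContinuousLinearMap.isClosed_ker _) (fun f s => sub_eq_zero.2 ?_) ha)
  change coef _ _ _ = coef _ _ _
  rw [coef_mOp_mul_vOp, coef_mOp_mul_vOp, kap_mul_left, mul_assoc, mul_right_inj]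

lemma coef_eq_zero {a : L2 G →L[ℂ] L2 G} (ha : a ∈ alg h) {x y : G} (hxy : x⁻¹ * y ∉ Γ) :
    coef x y a = 0 := by
  classical
  refine mem_of_mem_alg h (coef x y).ker (ContinuousLinearMap.isClosed_ker _) (fun f s => ?_) ha
  change coef x y _ = 0
  rw [coef_mOp_mul_vOp, if_neg]
  rintro rfl
  exact hxy (by simp)

lemma continuous_coef {a : L2 G →L[ℂ] L2 G} (ha : a ∈ alg h) (s : Γ) :
    Continuous fun g : G => coef g (g * s) a := by
  classical
  refine mem_of_mem_alg h (contSubmodule fun g : G => coef g (g * s))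
    (isClosed_contSubmodule fun g => L2.norm_coef_le _ _) (fun f t => ?_) ha
  change Continuous fun g : G => coef g (g * s) _
  simp only [coef_mOp_mul_vOp, mul_right_inj, SetLike.coe_eq_coe]
  by_cases hts : t = s
  · simp only [if_pos hts]
    exact f.continuous.comp (continuous_kap h)
  · simp only [if_neg hts]
    exact continuous_const

lemma continuous_coef_self {a : L2 G →L[ℂ] L2 G} (ha : a ∈ alg h) :
    Continuous fun g : G => coef g g a := by
  simpa using continuous_coef h ha 1

open Classical in
lemma inner_comulOp (a : L2 G →L[ℂ] L2 G) (x x' y y' : G) :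
    inner ℂ (HTensor.tmul (delta x) (delta x')) (comulOp h a (HTensor.tmul (delta y) (delta y'))) =
      (if x * (gam h x' : G)⁻¹ = y * (gam h y' : G)⁻¹ then 1 else 0) *
        coef (x * kap h x') (y * kap h y') a := by
  rw [comulOp_apply, W_delta, ← (W h).inner_map_map, LinearIsometryEquiv.apply_symm_apply, W_delta,
    HTensor.map_tmul, one_apply_eq_self, HTensor.inner_tmul, L2.inner_delta_delta]
  rfl

lemma alg_le_contSubmodule : (alg h).toSubalgebra.toSubmodule ≤
    contSubmodule fun g : G => coef g g := fun _ ha => continuous_coef_self h ha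

end Coefficients

section HaarState

open MeasureTheory
open L2 (coef delta)

variable [IsTopologicalGroup G] [MeasurableSpace G] [BorelSpace G] [LocallyCompactSpace G]

/-- The Haar state of the bicrossed product: the average over `K` of the diagonal coefficients. -/
def haarState : alg h →L[ℂ] ℂ :=
  haarAverage K (alg h).toSubalgebra.toSubmodule (fun g => coef g g)
    (fun g => L2.norm_coef_le g g) (alg_le_contSubmodule h)

lemma haarState_apply (a : alg h) : haarState h a =
    ∫ g, coef g g (a : L2 G →L[ℂ] L2 G) ∂(haarProb K) := rfl

lemma haarState_one : haarState h 1 = 1 := by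
  classical
  have e : ∀ g : G, coef g g ((1 : alg h) : L2 G →L[ℂ] L2 G) = 1 := fun g => by
    change inner ℂ (delta g) (delta g) = (1 : ℂ)
    rw [L2.inner_delta_delta, if_pos rfl]
  rw [haarState_apply, integral_congr_ae (.of_forall e)]
  simp

lemma haarState_nonneg (a : alg h) :
    0 ≤ (haarState h (star a * a)).re ∧ (haarState h (star a * a)).im = 0 := by
  have e : ∀ g : G, coef g g ((star a * a : alg h) : L2 G →L[ℂ] L2 G) =
      ((‖(a : L2 G →L[ℂ] L2 G) (delta g)‖ ^ 2 : ℝ) : ℂ) := fun g => by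
    change inner ℂ (delta g) (star (a : L2 G →L[ℂ] L2 G) ((a : L2 G →L[ℂ] L2 G) (delta g))) = _
    rw [ContinuousLinearMap.star_eq_adjoint, ContinuousLinearMap.adjoint_inner_right,
      inner_self_eq_norm_sq_to_K]
    norm_cast
  rw [haarState_apply]
  simp only [e]
  rw [integral_complex_ofReal, Complex.ofReal_re, Complex.ofReal_im]
  exact ⟨integral_nonneg fun g => by positivity, rfl⟩

/-- The diagonal coefficients of `v_s b` and `b v_s` are translates of the `Γ`-invariant function
`g ↦ ⟨δ_{gs}, b δ_g⟩` by elements of `G`. -/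
lemma haarState_mul_comm (a b : alg h) : haarState h (a * b) = haarState h (b * a) := by
  have key : ∀ (f : C(K, ℂ)) (s : Γ), haarState h (⟨mOp h f * vOp s, mul_mem (mOp_mem h f)
      (vOp_mem h s)⟩ * b) = haarState h (b * ⟨mOp h f * vOp s, mul_mem (mOp_mem h f)
      (vOp_mem h s)⟩) := by
    intro f s
    set F : G → ℂ := fun g => f (kap h g) * coef (g * s) g (b : L2 G →L[ℂ] L2 G) with hF
    have hFc : Continuous F := by
      refine (f.continuous.comp (continuous_kap h)).mul ?_
      have := (continuous_coef h b.2 s⁻¹).comp (continuous_mul_const (s : G))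
      simpa [Function.comp_def] using this
    have hFΓ : ∀ (γ : Γ) (g : G), F (γ * g) = F g := fun γ g => by
      simp only [hF, kap_mul_left, mul_assoc, coef_mul_left h b.2]
    have e1 : ∀ g, coef g g (mOp h f * vOp s * (b : L2 G →L[ℂ] L2 G)) = F g := fun g => by
      rw [mul_assoc, coef_mOp_mul, coef_vOp_mul]
    have e2 : ∀ g, coef g g ((b : L2 G →L[ℂ] L2 G) * (mOp h f * vOp s)) = F (g * (s : G)⁻¹) :=
      fun g => by
        rw [← mul_assoc, coef_mul_vOp, coef_mul_mOp]
        simp only [hF, inv_mul_cancel_right]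
    rw [haarState_apply, haarState_apply]
    change ∫ g, coef g g (mOp h f * vOp s * (b : L2 G →L[ℂ] L2 G)) ∂_ =
      ∫ g, coef g g ((b : L2 G →L[ℂ] L2 G) * (mOp h f * vOp s)) ∂_
    simp only [e1, e2]
    exact (integral_haarProb_mul_right h hFc hFΓ _).symm
  let S : Submodule ℂ (alg h) :=
    { carrier := {a | haarState h (a * b) = haarState h (b * a)}
      zero_mem' := by simp
      add_mem' := fun {x y} hx hy => by
        simp only [Set.mem_ofPred_eq, add_mul, mul_add, map_add] at *
        rw [hx, hy]
      smul_mem' := fun c x hx => by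
        simp only [Set.mem_ofPred_eq, smul_mul_assoc, mul_smul_comm, map_smul] at *
        rw [hx] }
  have hS : IsClosed (S : Set (alg h)) :=
    isClosed_eq ((haarState h).continuous.comp (continuous_mul_const b))
      ((haarState h).continuous.comp (continuous_const_mul b))
  have := mem_of_mem_alg h (S.map (alg h).toSubalgebra.toSubmodule.subtype)
    ((isClosed_alg h).isClosedEmbedding_subtypeVal.isClosedMap _ hS)
    (fun f s => ⟨_, key f s, rfl⟩) a.2
  obtain ⟨a', ha', e⟩ := this
  rwa [show a' = a from Subtype.ext e] at ha'

end HaarState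

end Bicrossed

/-! ### Slice maps and the invariance of the state -/

section SliceMaps

open L2 (coef delta)

variable {X : Type*}

lemma norm_tmulL_le {E F : Type*} [NormedAddCommGroup E] [InnerProductSpace ℂ E]
    [NormedAddCommGroup F] [InnerProductSpace ℂ F] {y : F} (hy : ‖y‖ = 1) :
    ‖(HTensor.tmulL y : E →L[ℂ] HTensor E F)‖ ≤ 1 :=
  ContinuousLinearMap.opNorm_le_bound _ zero_le_one fun x => by
    rw [HTensor.tmulL_apply, HTensor.norm_tmul, hy, mul_one, one_mul]

lemma norm_tmulR_le {E F : Type*} [NormedAddCommGroup E] [InnerProductSpace ℂ E]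
    [NormedAddCommGroup F] [InnerProductSpace ℂ F] {x : E} (hx : ‖x‖ = 1) :
    ‖(HTensor.tmulR x : F →L[ℂ] HTensor E F)‖ ≤ 1 :=
  ContinuousLinearMap.opNorm_le_bound _ zero_le_one fun y => by
    rw [HTensor.tmulR_apply, HTensor.norm_tmul, hx]

/-- The slice map `a ⊗ b ↦ ⟨δ_x, b δ_x⟩ a`. -/
def sliceR (x : X) : (HTensor (L2 X) (L2 X) →L[ℂ] HTensor (L2 X) (L2 X)) →L[ℂ]
    (L2 X →L[ℂ] L2 X) := compress (HTensor.tmulL (delta x))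

/-- The slice map `a ⊗ b ↦ ⟨δ_x, a δ_x⟩ b`. -/
def sliceL (x : X) : (HTensor (L2 X) (L2 X) →L[ℂ] HTensor (L2 X) (L2 X)) →L[ℂ]
    (L2 X →L[ℂ] L2 X) := compress (HTensor.tmulR (delta x))

lemma norm_sliceR_le (x : X) : ‖sliceR x‖ ≤ 1 := norm_compress_le (norm_tmulL_le (L2.norm_delta x))

lemma norm_sliceL_le (x : X) : ‖sliceL x‖ ≤ 1 := norm_compress_le (norm_tmulR_le (L2.norm_delta x))

lemma coef_sliceR (x y z : X) (T : HTensor (L2 X) (L2 X) →L[ℂ] HTensor (L2 X) (L2 X)) :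
    coef y z (sliceR x T) = inner ℂ (HTensor.tmul (delta y) (delta x))
      (T (HTensor.tmul (delta z) (delta x))) := by
  rw [L2.coef_apply, sliceR, compress_apply, ContinuousLinearMap.comp_apply,
    ContinuousLinearMap.adjoint_inner_right]
  rfl

lemma coef_sliceL (x y z : X) (T : HTensor (L2 X) (L2 X) →L[ℂ] HTensor (L2 X) (L2 X)) :
    coef y z (sliceL x T) = inner ℂ (HTensor.tmul (delta x) (delta y))
      (T (HTensor.tmul (delta x) (delta z))) := by
  rw [L2.coef_apply, sliceL, compress_apply, ContinuousLinearMap.comp_apply,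
    ContinuousLinearMap.adjoint_inner_right]
  rfl

lemma sliceR_map (x : X) (a b : L2 X →L[ℂ] L2 X) :
    sliceR x (HTensor.map a b) = coef x x b • a :=
  L2.ext_coef fun y z => by
    rw [coef_sliceR, HTensor.map_tmul, HTensor.inner_tmul, mul_comm, map_smul]; rfl

lemma sliceL_map (x : X) (a b : L2 X →L[ℂ] L2 X) :
    sliceL x (HTensor.map a b) = coef x x a • b :=
  L2.ext_coef fun y z => by
    rw [coef_sliceL, HTensor.map_tmul, HTensor.inner_tmul, map_smul]; rfl

end SliceMaps

namespace Bicrossed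

open MeasureTheory
open L2 (coef delta)

variable {G : Type u} [Group G] [TopologicalSpace G] [IsTopologicalGroup G]
  {K : OpenSubgroup G} {Γ : Subgroup G} (h : Γ.IsComplement' (K : Subgroup G)) [CompactSpace K]

lemma minTensor_le_contSubmodule_sliceR :
    (minTensor (alg h) (alg h)).toSubalgebra.toSubmodule ≤ contSubmodule (sliceR (X := G)) :=
  fun _ hT => mem_of_mem_minTensor _ (isClosed_contSubmodule norm_sliceR_le) (fun a _ b hb => by
    change Continuous fun g => sliceR g (HTensor.map a b)
    simp only [sliceR_map]
    exact (continuous_coef_self h hb).smul continuous_const) hT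

lemma minTensor_le_contSubmodule_sliceL :
    (minTensor (alg h) (alg h)).toSubalgebra.toSubmodule ≤ contSubmodule (sliceL (X := G)) :=
  fun _ hT => mem_of_mem_minTensor _ (isClosed_contSubmodule norm_sliceL_le) (fun a ha b _ => by
    change Continuous fun g => sliceL g (HTensor.map a b)
    simp only [sliceL_map]
    exact (continuous_coef_self h ha).smul continuous_const) hT

/-- A bounded operator that maps the elementary tensors to the algebra maps the minimal tensor
product to the algebra. -/
lemma slice_mem_alg (L : (HTensor (L2 G) (L2 G) →L[ℂ] HTensor (L2 G) (L2 G)) →L[ℂ]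
    (L2 G →L[ℂ] L2 G)) (hL : ∀ a ∈ alg h, ∀ b ∈ alg h, L (HTensor.map a b) ∈ alg h)
    {T : HTensor (L2 G) (L2 G) →L[ℂ] HTensor (L2 G) (L2 G)} (hT : T ∈ minTensor (alg h) (alg h)) :
    L T ∈ alg h :=
  mem_of_mem_minTensor ((alg h).toSubalgebra.toSubmodule.comap L.toLinearMap)
    ((isClosed_alg h).preimage L.continuous) hL hT

variable [MeasurableSpace G] [BorelSpace G] [LocallyCompactSpace G]

lemma integral_mem_alg {f : G → (L2 G →L[ℂ] L2 G)} (hf : Continuous f) (hmem : ∀ g, f g ∈ alg h) :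
    ∫ g, f g ∂(haarProb K) ∈ alg h :=
  Convex.integral_mem (s := (alg h : Set (L2 G →L[ℂ] L2 G)))
    ((alg h).toSubalgebra.toSubmodule.restrictScalars ℝ).convex (isClosed_alg h)
    (.of_forall hmem) (integrable_haarProb hf)

/-- The integrated slice map `id ⊗ h`. -/
def haarSliceR : minTensor (alg h) (alg h) →L[ℂ] alg h :=
  (haarAverage K (minTensor (alg h) (alg h)).toSubalgebra.toSubmodule sliceR norm_sliceR_le
    (minTensor_le_contSubmodule_sliceR h)).codRestrict (alg h).toSubalgebra.toSubmodule fun T =>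
      integral_mem_alg h (minTensor_le_contSubmodule_sliceR h T.2) fun g =>
        slice_mem_alg h (sliceR g) (fun a ha b _ => by
          rw [sliceR_map]; exact (alg h).smul_mem ha _) T.2

/-- The integrated slice map `h ⊗ id`. -/
def haarSliceL : minTensor (alg h) (alg h) →L[ℂ] alg h :=
  (haarAverage K (minTensor (alg h) (alg h)).toSubalgebra.toSubmodule sliceL norm_sliceL_le
    (minTensor_le_contSubmodule_sliceL h)).codRestrict (alg h).toSubalgebra.toSubmodule fun T =>
      integral_mem_alg h (minTensor_le_contSubmodule_sliceL h T.2) fun g =>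
        slice_mem_alg h (sliceL g) (fun a _ b hb => by
          rw [sliceL_map]; exact (alg h).smul_mem hb _) T.2

lemma coef_integral {f : G → (L2 G →L[ℂ] L2 G)} (hf : Continuous f) (x y : G) :
    coef x y (∫ g, f g ∂(haarProb K)) = ∫ g, coef x y (f g) ∂(haarProb K) :=
  ((coef x y).integral_comp_comm (integrable_haarProb hf)).symm

variable [T2Space K]

/-- The right invariance of the Haar state comes from the left invariance of the Haar measure of
`K`, because the diagonal coefficients are `Γ`-invariant. -/
lemma haarSliceR_comul (a : alg h) : haarSliceR h ((quantumGroup h).Δ a) = haarState h a • 1 := by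
  classical
  refine Subtype.ext (L2.ext_coef fun x y => ?_)
  have hc := minTensor_le_contSubmodule_sliceR h (comulOp_mem h a.2)
  change coef x y (∫ g, sliceR g (comulOp h a) ∂_) = coef x y (haarState h a • 1)
  rw [coef_integral hc, map_smul]
  simp only [coef_sliceR, inner_comulOp, mul_left_inj]
  by_cases hxy : x = y
  · subst hxy
    simp only [if_true, one_mul]
    rw [L2.coef_apply, one_apply_eq_self, L2.inner_delta_delta, if_pos rfl, smul_eq_mul, mul_one,
      haarState_apply]
    refine Eq.trans ?_ (integral_haarProb_mul_left (fun g => coef g g (a : L2 G →L[ℂ] L2 G))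
      (kap h x))
    refine integral_congr_ae (ae_mem_haarProb.mono fun g hg => ?_)
    have e1 : (kap h g : G) = g := by have := kap_coeK h ⟨g, hg⟩; exact congrArg Subtype.val this
    have e2 : x * g = gam h x * (kap h x * g) := by rw [← mul_assoc, gam_mul_kap]
    beta_reduce
    rw [e1, e2, coef_mul_left h a.2]
  · simp only [if_neg hxy, zero_mul, integral_zero]
    rw [L2.coef_apply, one_apply_eq_self, L2.inner_delta_delta, if_neg hxy, smul_zero]

/-- Invariance of the Haar state on one side: a diagonal coefficient of an element of the algebra is
a `Γ`-invariant function on `G`, so that its average over `K` is invariant under right translation.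
-/
lemma haarSliceL_comul (a : alg h) : haarSliceL h ((quantumGroup h).Δ a) = haarState h a • 1 := by
  classical
  refine Subtype.ext (L2.ext_coef fun x y => ?_)
  have hc := minTensor_le_contSubmodule_sliceL h (comulOp_mem h a.2)
  change coef x y (∫ g, sliceL g (comulOp h a) ∂_) = coef x y (haarState h a • 1)
  rw [coef_integral hc, map_smul]
  simp only [coef_sliceL, inner_comulOp, mul_right_inj, inv_inj, SetLike.coe_eq_coe]
  by_cases hxy : x = y
  · subst hxy
    simp only [if_true, one_mul]
    rw [L2.coef_apply, one_apply_eq_self, L2.inner_delta_delta, if_pos rfl, smul_eq_mul, mul_one,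
      haarState_apply]
    exact integral_haarProb_mul_right h (continuous_coef_self h a.2)
      (fun γ g => coef_mul_left h a.2 γ g g) _
  · have e : ∀ g : G, (if gam h x = gam h y then (1 : ℂ) else 0) *
        coef (g * kap h x) (g * kap h y) (a : L2 G →L[ℂ] L2 G) = 0 := fun g => by
      split_ifs with hg
      · rw [one_mul]
        refine coef_eq_zero h a.2 fun hmem => hxy ?_
        rw [mul_inv_rev, mul_assoc, inv_mul_cancel_left] at hmem
        have h1 := gam_coe h ⟨_, hmem⟩
        have h2 := gam_coeK h ((kap h x)⁻¹ * kap h y)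
        have h3 := h1.symm.trans h2
        have h4 : (kap h x : G)⁻¹ * kap h y = 1 := congrArg Subtype.val h3
        rw [← gam_mul_kap h x, ← gam_mul_kap h y, hg, inv_mul_eq_one.1 h4]
      · rw [zero_mul]
    rw [integral_congr_ae (.of_forall e), integral_zero, L2.coef_apply, one_apply_eq_self,
      L2.inner_delta_delta, if_neg hxy, smul_zero]

lemma isHaarState : (quantumGroup h).IsHaarState (haarState h).toLinearMap where
  map_one := haarState_one h
  nonneg := haarState_nonneg h
  right_invariant := ⟨haarSliceR h, fun a b => Subtype.ext (by
      change ∫ g, sliceR g (HTensor.map (a : L2 G →L[ℂ] L2 G) (b : L2 G →L[ℂ] L2 G)) ∂(haarProb K) =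
        (∫ g, coef g g (b : L2 G →L[ℂ] L2 G) ∂(haarProb K)) • (a : L2 G →L[ℂ] L2 G)
      simp only [sliceR_map]
      exact integral_smul_const _ _), haarSliceR_comul h⟩
  left_invariant := ⟨haarSliceL h, fun a b => Subtype.ext (by
      change ∫ g, sliceL g (HTensor.map (a : L2 G →L[ℂ] L2 G) (b : L2 G →L[ℂ] L2 G)) ∂(haarProb K) =
        (∫ g, coef g g (a : L2 G →L[ℂ] L2 G) ∂(haarProb K)) • (b : L2 G →L[ℂ] L2 G)
      simp only [sliceL_map]
      exact integral_smul_const _ _), haarSliceL_comul h⟩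

lemma isKac : (quantumGroup h).IsKac :=
  ⟨(haarState h).toLinearMap, isHaarState h, haarState_mul_comm h⟩

end Bicrossed

/-! ### Coefficients of elements of the bicrossed product -/

namespace Bicrossed

open L2 (coef delta)

variable {G : Type u} [Group G] [TopologicalSpace G] [IsTopologicalGroup G]
  {K : OpenSubgroup G} {Γ : Subgroup G} (h : Γ.IsComplement' (K : Subgroup G)) [CompactSpace K]

section Eval

variable [T2Space K]

/-- The coefficient `⟨δ_k, a δ_{ks}⟩` of an element of the bicrossed product. It is the value at `k`
of the function `f_s` in the formal expansion `a = ∑_s f_s v_s`. -/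
def ev (k : K) (s : Γ) : (quantumGroup h).A →ₗ[ℂ] ℂ :=
  (coef (k : G) (k * s)).toLinearMap ∘ₗ (alg h).toSubalgebra.toSubmodule.subtype

lemma ev_apply (k : K) (s : Γ) (a : (quantumGroup h).A) :
    ev h k s a = coef (k : G) (k * s) (a : L2 G →L[ℂ] L2 G) := rfl

/-- The elements of the algebra commute with the left translations by `Γ`, so all their coefficients
are determined by those at the points of `K`. -/
lemma coef_eq_ev (a : (quantumGroup h).A) (g : G) (s : Γ) :
    coef g (g * s) (a : L2 G →L[ℂ] L2 G) = ev h (kap h g) s a := by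
  have e1 := coef_mul_left h a.2 (gam h g) (kap h g : G) (kap h g * s)
  rw [← mul_assoc, gam_mul_kap] at e1
  exact e1

/-- An element of the bicrossed product is determined by its coefficients `a_s(k)`. -/
lemma ext_ev {a b : (quantumGroup h).A} (e : ∀ k s, ev h k s a = ev h k s b) : a = b := by
  refine Subtype.ext (L2.ext_coef fun x y => ?_)
  by_cases hxy : x⁻¹ * y ∈ Γ
  · have := (coef_eq_ev h a x ⟨_, hxy⟩).trans ((e _ _).trans (coef_eq_ev h b x ⟨_, hxy⟩).symm)
    rwa [mul_inv_cancel_left] at this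
  · rw [coef_eq_zero h a.2 hxy, coef_eq_zero h b.2 hxy]

lemma continuous_ev (s : Γ) (a : (quantumGroup h).A) : Continuous fun k => ev h k s a :=
  (continuous_coef h a.2 s).comp continuous_subtype_val

open Classical in
lemma ev_m_mul_v (k : K) (s t : Γ) (f : C(K, ℂ)) :
    ev h k s (m h f * v h t) = if t = s then f k else 0 := by
  refine (coef_mOp_mul_vOp h _ _ f t).trans ?_
  simp only [mul_right_inj, SetLike.coe_eq_coe, kap_coeK]

open Classical in
lemma ev_one (k : K) (s : Γ) : ev h k s 1 = if s = 1 then 1 else 0 := by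
  have := ev_m_mul_v h k s 1 1
  have e : m h 1 * v h 1 = 1 := Subtype.ext (by
    change mOp h 1 * vOp 1 = 1
    rw [map_one, vOp_one, one_mul])
  rw [e] at this
  rw [this]
  simp only [eq_comm, ContinuousMap.one_apply]

lemma ev_star (k : K) (s : Γ) (a : (quantumGroup h).A) :
    ev h k s (star a) = star (ev h (kap h ((k : G) * s)) s⁻¹ a) := by
  rw [← coef_eq_ev, ev_apply]
  change inner ℂ _ (star (a : L2 G →L[ℂ] L2 G) _) = _
  rw [ContinuousLinearMap.star_eq_adjoint, ContinuousLinearMap.adjoint_inner_right,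
    InvMemClass.coe_inv, mul_inv_cancel_right, ← inner_conj_symm]
  rfl

/-- The product of two elements of which the second one has a finite expansion. -/
lemma ev_mul (k : K) (s : Γ) (a b : (quantumGroup h).A) (S : Finset Γ)
    (hS : ∀ k, ∀ t ∉ S, ev h k t b = 0) : ev h k s (a * b) =
      ∑ t ∈ S, ev h k (s * t⁻¹) a * ev h (kap h ((k : G) * s * (t : G)⁻¹)) t b := by
  classical
  have e0 : ∀ (t : Γ), coef ((k : G) * s * (t : G)⁻¹) (k * s) (b : L2 G →L[ℂ] L2 G) =
      ev h (kap h ((k : G) * s * (t : G)⁻¹)) t b := fun t => by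
    rw [← coef_eq_ev, inv_mul_cancel_right]
  have e : (b : L2 G →L[ℂ] L2 G) (delta ((k : G) * s)) =
      ∑ t ∈ S, ev h (kap h ((k : G) * s * (t : G)⁻¹)) t b • delta ((k : G) * s * (t : G)⁻¹) := by
    refine L2.ext fun z => ?_
    rw [← L2.inner_delta, ← L2.inner_delta, inner_sum]
    simp only [inner_smul_right, L2.inner_delta_delta]
    by_cases hz : z⁻¹ * (k * s) ∈ Γ
    · have hz' : ∀ t : Γ, z = k * s * (t : G)⁻¹ ↔ (⟨_, hz⟩ : Γ) = t := fun t => by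
        rw [eq_mul_inv_iff_mul_eq, ← eq_inv_mul_iff_mul_eq, Subtype.ext_iff]
        exact eq_comm
      simp only [hz', mul_ite, mul_one, mul_zero]
      rw [Finset.sum_ite_eq]
      have e1 := e0 ⟨_, hz⟩
      rw [← (hz' ⟨_, hz⟩).2 rfl] at e1
      split_ifs with hm
      · rw [← (hz' ⟨_, hz⟩).2 rfl, ← e1]; rfl
      · rw [hS _ _ hm] at e1
        exact e1
    · rw [Finset.sum_eq_zero fun t _ => ?_]
      · exact coef_eq_zero h b.2 hz
      · rw [if_neg, mul_zero]
        rintro rfl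
        have : ((k : G) * s * (t : G)⁻¹)⁻¹ * (k * s) = t := by group
        exact hz ((congrArg (· ∈ Γ) this).mpr t.2)
  change inner ℂ _ ((a : L2 G →L[ℂ] L2 G) ((b : L2 G →L[ℂ] L2 G) _)) = _
  rw [e, map_sum, inner_sum]
  refine Finset.sum_congr rfl fun t _ => ?_
  rw [map_smul, inner_smul_right, mul_comm, ev_apply h k (s * t⁻¹), L2.coef_apply,
    Subgroup.coe_mul, InvMemClass.coe_inv, mul_assoc (k : G)]

end Eval

section Comul

/-- The coefficients of the elements of the minimal tensor product have the same symmetry and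
support as those of the elementary tensors. -/
lemma minTensor_ext_coef {S T : HTensor (L2 G) (L2 G) →L[ℂ] HTensor (L2 G) (L2 G)}
    (hS : S ∈ minTensor (alg h) (alg h)) (hT : T ∈ minTensor (alg h) (alg h))
    (e : ∀ (k k' : K) (s s' : Γ),
      inner ℂ (HTensor.tmul (delta (k : G)) (delta (k' : G)))
        (S (HTensor.tmul (delta ((k : G) * s)) (delta ((k' : G) * s')))) =
      inner ℂ (HTensor.tmul (delta (k : G)) (delta (k' : G)))
        (T (HTensor.tmul (delta ((k : G) * s)) (delta ((k' : G) * s'))))) : S = T := by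
  -- The matrix coefficient of an operator at `δ_x ⊗ δ_x'` and `δ_y ⊗ δ_y'`.
  let c : G → G → G → G →
      ((HTensor (L2 G) (L2 G) →L[ℂ] HTensor (L2 G) (L2 G)) →L[ℂ] ℂ) := fun x x' y y' =>
    innerSL ℂ (HTensor.tmul (delta x) (delta x')) ∘L
      ContinuousLinearMap.apply ℂ _ (HTensor.tmul (delta y) (delta y'))
  have hc : ∀ x x' y y' a b, c x x' y y' (HTensor.map a b) = coef x y a * coef x' y' b :=
    fun x x' y y' a b => by
      change inner ℂ _ (HTensor.map a b _) = _
      rw [HTensor.map_tmul, HTensor.inner_tmul]; rfl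
  have h1 : ∀ T ∈ minTensor (alg h) (alg h), ∀ (γ γ' : Γ) x x' y y',
      c (γ * x) (γ' * x') (γ * y) (γ' * y') T = c x x' y y' T := fun T hT γ γ' x x' y y' =>
    sub_eq_zero.1 (mem_of_mem_minTensor
      (c (γ * x) (γ' * x') (γ * y) (γ' * y') - c x x' y y').ker
      (ContinuousLinearMap.isClosed_ker _) (fun a ha b hb => sub_eq_zero.2 (by
        change c _ _ _ _ _ = c _ _ _ _ _
        rw [hc, hc, coef_mul_left h ha, coef_mul_left h hb])) hT)
  have h2 : ∀ T ∈ minTensor (alg h) (alg h), ∀ x x' y y', ¬ (x⁻¹ * y ∈ Γ ∧ x'⁻¹ * y' ∈ Γ) →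
      c x x' y y' T = 0 := fun T hT x x' y y' hn =>
    mem_of_mem_minTensor (c x x' y y').ker
      (ContinuousLinearMap.isClosed_ker _) (fun a ha b hb => by
        change c _ _ _ _ _ = 0
        rw [hc]
        by_cases hxy : x⁻¹ * y ∈ Γ
        · rw [coef_eq_zero h hb fun h' => hn ⟨hxy, h'⟩, mul_zero]
        · rw [coef_eq_zero h ha hxy, zero_mul]) hT
  refine HTensor.clm_ext_delta fun y y' => (HTensor.toL2 G G).injective (L2.ext fun p => ?_)
  obtain ⟨x, x'⟩ := p
  have h3 : ∀ ζ : HTensor (L2 G) (L2 G), HTensor.toL2 G G ζ (x, x') =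
      inner ℂ (HTensor.tmul (delta x) (delta x')) ζ := fun ζ => by
    rw [← L2.inner_delta, ← HTensor.toL2_delta, LinearIsometryEquiv.inner_map_map]
  rw [h3, h3]
  change c x x' y y' S = c x x' y y' T
  by_cases hn : x⁻¹ * y ∈ Γ ∧ x'⁻¹ * y' ∈ Γ
  · have e1 : ∀ x y : G, ∀ hxy : x⁻¹ * y ∈ Γ,
        y = gam h x * (kap h x * ((⟨_, hxy⟩ : Γ) : G)) := fun x y hxy => by
      rw [← mul_assoc, gam_mul_kap, mul_inv_cancel_left]
    have h4 : ∀ T ∈ minTensor (alg h) (alg h), c x x' y y' T =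
        c (kap h x) (kap h x') (kap h x * ((⟨_, hn.1⟩ : Γ) : G))
          (kap h x' * ((⟨_, hn.2⟩ : Γ) : G)) T := fun T hT => by
      rw [← h1 T hT (gam h x) (gam h x') (kap h x), ← e1 x y hn.1, ← e1 x' y' hn.2, gam_mul_kap,
        gam_mul_kap]
    rw [h4 S hS, h4 T hT]
    exact e _ _ _ _
  · rw [h2 S hS _ _ _ _ hn, h2 T hT _ _ _ _ hn]

open Classical in
lemma inner_comulOp_ev [T2Space K] (a : (quantumGroup h).A) (k k' : K) (s s' : Γ) :
    inner ℂ (HTensor.tmul (delta (k : G)) (delta (k' : G)))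
      (comulOp h (a : L2 G →L[ℂ] L2 G)
        (HTensor.tmul (delta ((k : G) * s)) (delta ((k' : G) * s')))) =
      if s = gam h ((k' : G) * s') then ev h (k * k') s' a else 0 := by
  rw [inner_comulOp, gam_coeK, OneMemClass.coe_one, inv_one, mul_one, kap_coeK]
  have e : (k : G) = k * s * (gam h ((k' : G) * s') : G)⁻¹ ↔ s = gam h ((k' : G) * s') := by
    rw [eq_mul_inv_iff_mul_eq, mul_right_inj, SetLike.coe_eq_coe, eq_comm]
  simp only [e]
  split_ifs with hs
  · rw [one_mul, hs, mul_assoc, gam_mul_kap, ev_apply, Subgroup.coe_mul, mul_assoc]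
  · rw [zero_mul]

open Classical in
/-- The condition `Δ(u_ij) = ∑_l u_il ⊗ u_lj` in terms of coefficients. -/
lemma comul_eq_iff [T2Space K] {n : Type*} [Fintype n] (w : Matrix n n (quantumGroup h).A)
    (i j : n) :
    (quantumGroup h).Δ (w i j) = ∑ l, minTmul (w i l) (w l j) ↔
      ∀ (k k' : K) (s s' : Γ), (w.map (ev h k s) * w.map (ev h k' s')) i j =
        if s = gam h ((k' : G) * s') then w.map (ev h (k * k') s') i j else 0 := by
  have e1 : ∀ (k k' : K) (s s' : Γ),
      inner ℂ (HTensor.tmul (delta (k : G)) (delta (k' : G)))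
        (((∑ l, minTmul (w i l) (w l j) : minTensor (quantumGroup h).A (quantumGroup h).A) :
          HTensor (L2 G) (L2 G) →L[ℂ] HTensor (L2 G) (L2 G))
          (HTensor.tmul (delta ((k : G) * s)) (delta ((k' : G) * s')))) =
      (w.map (ev h k s) * w.map (ev h k' s')) i j := fun k k' s s' => by
    rw [AddSubmonoidClass.coe_finsetSum, sum_apply, inner_sum, Matrix.mul_apply]
    refine Finset.sum_congr rfl fun l _ => ?_
    change inner ℂ _ (HTensor.map _ _ _) = _
    rw [HTensor.map_tmul, HTensor.inner_tmul]
    rfl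
  constructor
  · intro e k k' s s'
    rw [← e1, ← e]
    exact inner_comulOp_ev h (w i j) k k' s s'
  · intro e
    refine Subtype.ext (minTensor_ext_coef h (SetLike.coe_mem _) (SetLike.coe_mem _)
      fun k k' s s' => ?_)
    exact (inner_comulOp_ev h (w i j) k k' s s').trans
      ((e k k' s s').symm.trans (e1 k k' s s').symm)

end Comul

end Bicrossed

/-! ### Coefficients of representations of the bicrossed product -/

namespace Bicrossed

variable {G : Type u} [Group G] [TopologicalSpace G] [IsTopologicalGroup G]
  {K : OpenSubgroup G} {Γ : Subgroup G} {h : Γ.IsComplement' (K : Subgroup G)} [CompactSpace K]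
  [T2Space K] {n l r : Type*}

/-- The coefficient matrices of a matrix over the bicrossed product. -/
def evM (h : Γ.IsComplement' (K : Subgroup G)) (k : K) (s : Γ)
    (w : Matrix n r (quantumGroup h).A) : Matrix n r ℂ := w.map (ev h k s)

lemma evM_apply (k : K) (s : Γ) (w : Matrix n r (quantumGroup h).A) (i : n) (j : r) :
    evM h k s w i j = ev h k s (w i j) := rfl

lemma ext_evM {w w' : Matrix n r (quantumGroup h).A} (e : ∀ k s, evM h k s w = evM h k s w') :
    w = w' := by
  ext i j : 1
  exact ext_ev h fun k s => congrFun (congrFun (e k s) i) j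

lemma continuous_evM (s : Γ) (w : Matrix n r (quantumGroup h).A) :
    Continuous fun k => evM h k s w :=
  continuous_matrix fun i j => continuous_ev h s (w i j)

open Classical in
lemma evM_one [DecidableEq n] (k : K) (s : Γ) :
    evM h k s (1 : Matrix n n (quantumGroup h).A) = if s = 1 then 1 else 0 := by
  ext i j
  rw [evM_apply, Matrix.one_apply]
  by_cases hij : i = j
  · subst hij
    rw [if_pos rfl, ev_one]
    split_ifs
    · exact (Matrix.one_apply_eq i).symm
    · rfl
  · rw [if_neg hij, map_zero]
    split_ifs
    · exact (Matrix.one_apply_ne hij).symm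
    · rfl

lemma evM_star (k : K) (s : Γ) (w : Matrix n n (quantumGroup h).A) :
    evM h k s (star w) = star (evM h (kap h ((k : G) * s)) s⁻¹ w) := by
  ext i j
  exact ev_star h k s (w j i)

lemma evM_mul [Fintype r] (k : K) (s : Γ) (a : Matrix n r (quantumGroup h).A)
    (b : Matrix r l (quantumGroup h).A) (S : Finset Γ) (hS : ∀ k, ∀ t ∉ S, evM h k t b = 0) :
    evM h k s (a * b) =
      ∑ t ∈ S, evM h k (s * t⁻¹) a * evM h (kap h ((k : G) * s * (t : G)⁻¹)) t b := by
  ext i j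
  rw [evM_apply, Matrix.mul_apply, map_sum, Matrix.sum_apply]
  simp only [Matrix.mul_apply]
  rw [Finset.sum_comm]
  exact Finset.sum_congr rfl fun p _ => ev_mul h k s _ _ S fun k t ht =>
    congrFun (congrFun (hS k t ht) p) j

lemma evM_mul_scalar [Fintype r] (k : K) (s : Γ) (a : Matrix n r (quantumGroup h).A)
    (M : Matrix r l ℂ) : evM h k s (a * M.map (algebraMap ℂ (quantumGroup h).A)) =
      evM h k s a * M := by
  ext i j
  rw [evM_apply, Matrix.mul_apply, map_sum, Matrix.mul_apply]
  refine Finset.sum_congr rfl fun p _ => ?_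
  rw [Matrix.map_apply, Algebra.algebraMap_eq_smul_one, mul_smul_comm, mul_one, map_smul,
    smul_eq_mul, mul_comm]
  rfl

lemma evM_scalar_mul [Fintype r] (k : K) (s : Γ) (M : Matrix n r ℂ)
    (b : Matrix r l (quantumGroup h).A) :
    evM h k s (M.map (algebraMap ℂ (quantumGroup h).A) * b) = M * evM h k s b := by
  ext i j
  rw [evM_apply, Matrix.mul_apply, map_sum, Matrix.mul_apply]
  refine Finset.sum_congr rfl fun p _ => ?_
  rw [Matrix.map_apply, Algebra.algebraMap_eq_smul_one, smul_mul_assoc, one_mul, map_smul,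
    smul_eq_mul]
  rfl

open Classical in
lemma comul_iff [Fintype n] (w : Matrix n n (quantumGroup h).A) :
    (∀ i j, (quantumGroup h).Δ (w i j) = ∑ l, minTmul (w i l) (w l j)) ↔
      ∀ (k k' : K) (s s' : Γ), evM h k s w * evM h k' s' w =
        if s = gam h ((k' : G) * s') then evM h (k * k') s' w else 0 := by
  simp only [comul_eq_iff]
  constructor
  · intro e k k' s s'
    ext i j
    refine (e i j k k' s s').trans ?_
    split_ifs <;> rfl
  · intro e i j k k' s s'
    refine (congrFun (congrFun (e k k' s s') i) j).trans ?_
    split_ifs <;> rfl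

/-- A matrix `w` over the bicrossed product whose coefficients vanish outside a finite subset of
`Γ` has, in `w w^*`, the coefficients `∑_r w_{sr}(k) w_r(k')^*`, where `k'` is the `K`-component
of `k s`. -/
lemma evM_mul_star [Fintype n] (w : Matrix n n (quantumGroup h).A) (S : Finset Γ)
    (hS : ∀ k, ∀ t ∉ S, evM h k t w = 0) (k : K) (s : Γ) : evM h k s (w * star w) =
      ∑ r ∈ S, evM h k (s * r) w * star (evM h (kap h ((k : G) * s)) r w) := by
  classical
  rw [evM_mul k s w (star w) (S.map (Equiv.inv Γ).toEmbedding) fun k t ht => ?_, Finset.sum_map]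
  · refine Finset.sum_congr rfl fun r _ => ?_
    rw [evM_star, kap_kap_mul]
    simp only [Equiv.coe_toEmbedding, Equiv.inv_apply, inv_inv, inv_mul_cancel_right]
  · rw [evM_star, hS, star_zero]
    exact fun hn => ht (Finset.mem_map.2 ⟨t⁻¹, hn, inv_inv t⟩)

variable [Fintype n] [DecidableEq n]

/-- The unitary representation `∑_γ π(·) p_γ v_γ` of the bicrossed product. -/
def rep (D : MatchedRep h n) : Matrix n n (quantumGroup h).A := fun i j =>
  ∑ γ ∈ D.supp, m h ⟨fun k => (D.π k * D.p γ) i j,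
    (D.continuous_π.matrix_mul continuous_const).matrix_elem i j⟩ * v h γ

lemma evM_rep (D : MatchedRep h n) (k : K) (s : Γ) : evM h k s (rep D) = D.π k * D.p s := by
  classical
  ext i j
  rw [evM_apply, rep, map_sum]
  simp only [ev_m_mul_v]
  rw [Finset.sum_ite_eq']
  split_ifs with hs
  · rfl
  · rw [D.p_eq_zero s hs, mul_zero, Matrix.zero_apply]

lemma evM_rep_eq_zero (D : MatchedRep h n) (k : K) (s : Γ) (hs : s ∉ D.supp) :
    evM h k s (rep D) = 0 := by
  rw [evM_rep, D.p_eq_zero s hs, mul_zero]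

/-- The unitarity follows from the unitarity of `π` and `∑_s p_s = 1`, the condition on the
comultiplication from `π(k) p_s π(k') p_t = π(k k') p_t` if `k' t ∈ s K`, and `0` otherwise. -/
lemma isRep_rep (D : MatchedRep h n) : (quantumGroup h).IsRep (rep D) where
  unitary := by
    classical
    constructor
    · refine ext_evM fun k s => ?_
      rw [evM_mul k s _ _ D.supp (evM_rep_eq_zero D), evM_one]
      have e : ∀ t : Γ, evM h k (s * t⁻¹) (star (rep D)) *
          evM h (kap h ((k : G) * s * (t : G)⁻¹)) t (rep D) = if s = 1 then D.p t else 0 := by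
        intro t
        rw [evM_star, mul_inv_rev, inv_inv, Subgroup.coe_mul, InvMemClass.coe_inv, ← mul_assoc,
          evM_rep, evM_rep, star_mul, D.star_p, mul_assoc, ← mul_assoc (star _), D.star_mul_π,
          one_mul, D.p_mul_p]
        simp only [mul_eq_left, inv_eq_one]
        split_ifs with hs
        · rw [hs, inv_one, mul_one]
        · rfl
      rw [Finset.sum_congr rfl fun t _ => e t]
      split_ifs
      · exact D.sum_p
      · exact Finset.sum_const_zero
    · refine ext_evM fun k s => ?_
      rw [evM_mul_star _ D.supp (evM_rep_eq_zero D), evM_one]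
      have e : ∀ r : Γ, evM h k (s * r) (rep D) * star (evM h (kap h ((k : G) * s)) r (rep D)) =
          if s = 1 then D.π k * D.p r * star (D.π k) else 0 := by
        intro r
        rw [evM_rep, evM_rep, star_mul, D.star_p, mul_assoc, ← mul_assoc (D.p _), D.p_mul_p,
          ← mul_assoc]
        simp only [mul_eq_right]
        split_ifs with hs
        · rw [hs, OneMemClass.coe_one, mul_one, kap_coeK, one_mul]
        · rw [mul_zero, zero_mul]
      rw [Finset.sum_congr rfl fun t _ => e t]
      split_ifs
      · rw [← Finset.sum_mul, ← Finset.mul_sum, D.sum_p, mul_one, D.π_mul_star]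
      · exact Finset.sum_const_zero
  comul := by
    classical
    refine (comul_iff _).2 fun k k' s s' => ?_
    rw [evM_rep, evM_rep, evM_rep, D.π_mul_p k', mul_assoc, ← mul_assoc (D.p s), D.p_mul_p,
      ← mul_assoc]
    split_ifs with hs
    · rw [hs, mul_assoc, ← D.π_mul_p, ← mul_assoc, ← map_mul]
    · rw [mul_zero, zero_mul]

/-- The conjugate data give the entrywise adjoint of the representation. The passage from `s` to
`s⁻¹` in the adjoint of `f v_s` is why the grading is inverted in `D.conj`. -/
lemma rep_conj (D : MatchedRep h n) : rep D.conj = (rep D).map star := by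
  refine ext_evM fun k s => ?_
  have e : evM h k s ((rep D).map star) =
      MatchedRep.cj (evM h (kap h ((k : G) * s)) s⁻¹ (rep D)) := by
    ext i j
    exact ev_star h k s _
  rw [e, evM_rep, evM_rep, D.conj_π_mul_p]

/-- A matrix intertwines the representations if and only if it intertwines the representations of
`K` and respects the gradings. One recovers `p_s` from `w_s(k) = π(k) p_s` at `k = 1`, and `π(k)` by
summing over `s`. -/
lemma rep_intertwines_iff [Fintype l] [DecidableEq l] (D : MatchedRep h n) (E : MatchedRep h l)
    (M : Matrix l n ℂ) :
    rep E * M.map (algebraMap ℂ (quantumGroup h).A) =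
      M.map (algebraMap ℂ (quantumGroup h).A) * rep D ↔ D.Intertwines E M := by
  have key : rep E * M.map (algebraMap ℂ (quantumGroup h).A) =
      M.map (algebraMap ℂ (quantumGroup h).A) * rep D ↔
      ∀ k s, E.π k * E.p s * M = M * (D.π k * D.p s) := by
    constructor
    · intro e k s
      rw [← evM_rep, ← evM_rep, ← evM_mul_scalar, ← evM_scalar_mul, e]
    · intro e
      refine ext_evM fun k s => ?_
      rw [evM_mul_scalar, evM_scalar_mul, evM_rep, evM_rep, e]
  rw [key]
  constructor
  · intro e
    have hp : ∀ γ, M * D.p γ = E.p γ * M := fun γ => by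
      have := e 1 γ
      rw [map_one, map_one, one_mul, one_mul] at this
      exact this.symm
    refine ⟨fun k => ?_, hp⟩
    have hM : M = ∑ γ ∈ D.supp, E.p γ * M := by
      simp only [← hp]
      rw [← Matrix.mul_sum, D.sum_p, Matrix.mul_one]
    rw [← mul_one (D.π k), ← D.sum_p, Finset.mul_sum, Matrix.mul_sum]
    conv_rhs => rw [hM]
    rw [Matrix.mul_sum]
    exact Finset.sum_congr rfl fun γ _ => by rw [← e, Matrix.mul_assoc]
  · rintro ⟨hπ, hp⟩ k s
    rw [← Matrix.mul_assoc, hπ, Matrix.mul_assoc, ← hp, ← Matrix.mul_assoc, Matrix.mul_assoc]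

end Bicrossed

/-! ### The classification of the representations of the bicrossed product -/

/-- A family of mutually orthogonal idempotent matrices has finite support. -/
lemma Matrix.finite_support_of_orthogonal_idempotents {ι n : Type*} [Fintype n] [DecidableEq n]
    (p : ι → Matrix n n ℂ) (hp : ∀ i, p i * p i = p i) (hpp : ∀ i j, i ≠ j → p i * p j = 0) :
    {i | p i ≠ 0}.Finite := by
  have hli : LinearIndependent ℂ fun i : {i | p i ≠ 0} => p i := by
    classical
    rw [linearIndependent_iff']
    intro s g hg i hi
    have h1 := congrArg (p i * ·) hg
    simp only [Finset.mul_sum, mul_zero, mul_smul_comm] at h1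
    rw [Finset.sum_eq_single i (fun j _ hj => by
      rw [hpp _ _ fun e => hj (Subtype.ext e.symm), smul_zero]) (fun hn => absurd hi hn), hp] at h1
    exact (smul_eq_zero.1 h1).resolve_right i.2
  exact Set.finite_coe_iff.1 hli.finite

namespace Bicrossed

variable {G : Type u} [Group G] [TopologicalSpace G] [IsTopologicalGroup G]
  {K : OpenSubgroup G} {Γ : Subgroup G} {h : Γ.IsComplement' (K : Subgroup G)} [CompactSpace K]
  [T2Space K] {n : Type*} [Fintype n] [DecidableEq n]

/-- Every finite-dimensional unitary representation `w` of the bicrossed product is of the form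
`rep D`. The coefficients satisfy `w_s(k) w_t(k') = w_t(k k')` if `k' t ∈ s K`, and
`w_s(k) w_t(k') = 0` otherwise. Thus the matrices `p_s = w_s(1)` are mutually orthogonal idempotents
with `w_s(k) = w_s(k) p_s`, and `π(k) = ∑_s w_s(k)` is multiplicative. The unitarity of `w` implies
that `p_s = p_s p_s^*`, that the `p_s` sum up to `1`, and that the `π(k)` are unitary. -/
lemma exists_rep_eq {w : Matrix n n (quantumGroup h).A} (hw : (quantumGroup h).IsRep w) :
    ∃ D : MatchedRep h n, rep D = w := by
  classical
  have hc := (comul_iff w).1 hw.comul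
  set p : Γ → Matrix n n ℂ := fun s => evM h 1 s w with hp
  have hwp : ∀ k s t, evM h k s w * p t = if s = t then evM h k t w else 0 := fun k s t => by
    rw [hp, hc, Subgroup.coe_one, one_mul, gam_coe, mul_one]
  have hpp : ∀ s t, p s * p t = if s = t then p t else 0 := fun s t => hwp 1 s t
  have hfin := Matrix.finite_support_of_orthogonal_idempotents p
    (fun s => by rw [hpp, if_pos rfl]) (fun s t e => by rw [hpp, if_neg e])
  set S : Finset Γ := hfin.toFinset with hS
  have hp0 : ∀ s ∉ S, p s = 0 := fun s hs => by
    by_contra hn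
    exact hs (hfin.mem_toFinset.2 hn)
  have hw0 : ∀ k, ∀ s ∉ S, evM h k s w = 0 := fun k s hs => by
    have := hwp k s s
    rw [if_pos rfl, hp0 s hs, mul_zero] at this
    exact this.symm
  have hu : ∀ k s, ∑ r ∈ S, evM h k (s * r) w * star (evM h (kap h ((k : G) * s)) r w) =
      if s = 1 then 1 else 0 := fun k s => by
    rw [← evM_mul_star w S hw0, hw.unitary.2, evM_one]
  have hu1 : ∀ k, ∑ r ∈ S, evM h k r w * star (evM h k r w) = 1 := fun k => by
    have := hu k 1
    rw [if_pos rfl] at this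
    simpa using this
  -- Multiplying `∑_r p_r p_r^* = 1` by `p_s` gives `p_s p_s^* = p_s`, so `p_s` is self-adjoint.
  have hps : ∀ s, star (p s) = p s := by
    have h1 : ∀ s, p s * star (p s) = p s := fun s => by
      by_cases hs : s ∈ S
      · have := congrArg (p s * ·) (hu1 1)
        simp only [Finset.mul_sum, ← mul_assoc, mul_one] at this
        rw [Finset.sum_eq_single s (fun r _ hr => by
          change p s * p r * _ = 0
          rw [hpp, if_neg hr.symm, zero_mul]) (fun hn => absurd hs hn)] at this
        change p s * p s * star (p s) = p s at this
        rwa [hpp, if_pos rfl] at this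
      · rw [hp0 s hs, zero_mul]
    intro s
    rw [← h1 s, star_mul, star_star]
  have hsum : ∑ s ∈ S, p s = 1 := by
    rw [← hu1 1]
    refine Finset.sum_congr rfl fun s _ => ?_
    change p s = p s * star (p s)
    rw [hps, hpp, if_pos rfl]
  have hππ : ∀ k k' s, (∑ t ∈ S, evM h k t w) * evM h k' s w = evM h (k * k') s w := by
    intro k k' s
    have e := hc k k' (gam h ((k' : G) * s)) s
    rw [if_pos rfl] at e
    rw [Finset.sum_mul, Finset.sum_eq_single (gam h ((k' : G) * s)), e]
    · intro t _ ht
      rw [hc, if_neg ht]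
    · intro hn
      rw [hw0 _ _ hn, zero_mul]
  have hπp : ∀ k s, (∑ t ∈ S, evM h k t w) * p s = evM h k s w := fun k s => by
    rw [hp, hππ, mul_one]
  have hpπ : ∀ (k : K) (s : Γ), p (gam h ((k : G) * s)) * (∑ t ∈ S, evM h k t w) = evM h k s w := by
    intro k s
    rw [Finset.mul_sum, Finset.sum_eq_single s]
    · rw [hp, hc, if_pos rfl, one_mul]
    · intro t _ ht
      rw [hp, hc, if_neg]
      exact fun e => ht ((gam_mul_inj h _).1 e.symm)
    · intro hn
      rw [hw0 _ _ hn, mul_zero]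
  have hone : ∑ t ∈ S, evM h 1 t w = 1 := hsum
  refine ⟨{
    π := ⟨⟨fun k => ∑ t ∈ S, evM h k t w, hone⟩, fun k k' => ?_⟩
    star_mul_π := fun k => ?_
    continuous_π := continuous_finsetSum _ fun s _ => continuous_evM s w
    p := p
    star_p := hps
    p_mul_self := fun s => by rw [hpp, if_pos rfl]
    p_mul_of_ne := fun s t e => by rw [hpp, if_neg e]
    π_mul_p := fun k s => (hπp k s).trans (hpπ k s).symm
    supp := S
    p_eq_zero := hp0
    sum_p := hsum }, ext_evM fun k s => (evM_rep _ k s).trans (hπp k s)⟩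
  · rw [Finset.mul_sum]
    exact Finset.sum_congr rfl fun s _ => (hππ k k' s).symm
  -- The mixed terms `w_s(k) w_t(k)^* = w_s(k) p_s p_t w_t(k)^*` vanish, and the others sum up to `1`.
  · refine mul_eq_one_comm.1 ?_
    change (∑ t ∈ S, evM h k t w) * star (∑ t ∈ S, evM h k t w) = 1
    rw [← hu1 k, star_sum, Finset.sum_mul]
    refine Finset.sum_congr rfl fun s hs => ?_
    rw [Finset.mul_sum, Finset.sum_eq_single s]
    · intro t _ ht
      have e1 := hwp k s s
      have e2 := hwp k t t
      rw [if_pos rfl] at e1 e2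
      rw [← e1, ← e2, star_mul, hps, mul_assoc, ← mul_assoc (p s), hpp, if_neg ht.symm, zero_mul,
        mul_zero]
    · exact fun hn => absurd hs hn

end Bicrossed

namespace CfModule

variable {G : Type u} [Group G] [TopologicalSpace G]
  {K : OpenSubgroup G} {Γ : Subgroup G} (h : Γ.IsComplement' (K : Subgroup G))

/-- The representation of `K` and the grading on the fiber of a module, as matrices with respect to
an orthonormal basis. -/
def matchedRep (X : CfModule K) {n : Type*} [Fintype n] [DecidableEq n]
    (b : OrthonormalBasis n ℂ X.fiber) : MatchedRep h n where
  π :=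
    { toFun := fun k => LinearMap.toMatrixOrthonormal b (X.kact k)
      map_one' := by
        rw [← map_one (LinearMap.toMatrixOrthonormal b)]
        exact congrArg _ (LinearMap.ext (X.kact_one))
      map_mul' := fun k k' => by
        rw [← map_mul]
        exact congrArg _ (LinearMap.ext (X.kact_mul k k')) }
  star_mul_π k := by
    change star (LinearMap.toMatrixOrthonormal b (X.kact k)) *
      LinearMap.toMatrixOrthonormal b (X.kact k) = 1
    rw [← map_star, ← map_mul, ← map_one (LinearMap.toMatrixOrthonormal b)]
    refine congrArg _ (LinearMap.ext fun v => ext_inner_left ℂ fun w => ?_)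
    rw [LinearMap.star_eq_adjoint, Module.End.mul_apply, LinearMap.adjoint_inner_right, inner_kact]
    rfl
  continuous_π := by
    refine continuous_matrix fun i j => ?_
    have e : ∀ k : K, LinearMap.toMatrixOrthonormal b (X.kact k) i j =
        inner ℂ ((b i : X.fiber) : X) (X.π k ((b j : X.fiber) : X)) := fun k => by
      rw [LinearMap.toMatrixOrthonormal_apply_apply]; rfl
    change Continuous fun k : K => LinearMap.toMatrixOrthonormal b (X.kact k) i j
    simp only [e]
    exact continuous_const.inner ((X.continuous_π _).comp continuous_subtype_val)
  p γ := LinearMap.toMatrixOrthonormal b (X.gr γ)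
  star_p γ := by
    rw [← map_star]
    refine congrArg _ (LinearMap.ext fun v => ext_inner_left ℂ fun w => ?_)
    rw [LinearMap.star_eq_adjoint, LinearMap.adjoint_inner_right, inner_gr]
  p_mul_self γ := by
    classical
    rw [← map_mul]
    exact congrArg _ (LinearMap.ext fun v => (gr_gr h X γ γ v).trans (if_pos rfl))
  p_mul_of_ne γ δ e := by
    classical
    rw [← map_mul, ← map_zero (LinearMap.toMatrixOrthonormal b)]
    exact congrArg _ (LinearMap.ext fun v => (gr_gr h X γ δ v).trans (if_neg e))
  π_mul_p k γ := by
    change LinearMap.toMatrixOrthonormal b (X.kact k) * _ =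
      _ * LinearMap.toMatrixOrthonormal b (X.kact k)
    rw [← map_mul, ← map_mul]
    exact congrArg _ (LinearMap.ext fun v => kact_gr h X k γ v)
  supp := X.grSupp h
  p_eq_zero γ hγ := by
    rw [← map_zero (LinearMap.toMatrixOrthonormal b)]
    exact congrArg _ (LinearMap.ext fun v => X.gr_eq_zero h hγ v)
  sum_p := by
    rw [← map_sum, ← map_one (LinearMap.toMatrixOrthonormal b)]
    refine congrArg _ (LinearMap.ext fun v => ?_)
    rw [LinearMap.sum_apply, X.sum_gr h v]
    rfl

end CfModule

/-! ### Tannaka-Krein duality -/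

namespace CfModule

variable {G : Type u} [Group G] [TopologicalSpace G] [IsTopologicalGroup G]
  {K : OpenSubgroup G} {Γ : Subgroup G}

lemma kact_unit (k : K) (v : (unit K).fiber) : (unit K).kact k v = v := by
  obtain ⟨c, rfl⟩ := eq_smul_unitVec v
  rw [map_smul]
  congr 1
  refine Subtype.ext ((π_unitVec (k : G)).trans ?_)
  change _ = (L2.delta ((1 : G) : G ⧸ (K : Subgroup G)) : L2 (G ⧸ (K : Subgroup G)))
  congr 1
  exact QuotientGroup.eq.2 (by simp)

lemma gr_unit_one (v : (unit K).fiber) : (unit K).gr (1 : Γ) v = v := by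
  obtain ⟨c, rfl⟩ := eq_smul_unitVec v
  rw [map_smul, gr_unitVec]

lemma gr_unit_of_ne (h : Γ.IsComplement' (K : Subgroup G)) {γ : Γ} (hγ : γ ≠ 1)
    (v : (unit K).fiber) : (unit K).gr γ v = 0 := by
  classical
  rw [← gr_unit_one (Γ := Γ) v, gr_gr h, if_neg hγ]

end CfModule

namespace Bicrossed

open CfModule

variable {G : Type u} [Group G] [TopologicalSpace G]
  {K : OpenSubgroup G} {Γ : Subgroup G} (h : Γ.IsComplement' (K : Subgroup G))

/-- The operators of a tensor product of modules on the fiber, in terms of those of the factors. -/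
lemma mu_intertwines (X Y : CfModule K) (k : K) (s : Γ) (z : X.fiber ⊗[ℂ] Y.fiber) :
    mu h X Y ((∑ t ∈ Y.grSupp h, TensorProduct.map (X.kact k ∘ₗ X.gr (s * t⁻¹))
      (Y.kact (kap h ((k : G) * s * (t : G)⁻¹)) ∘ₗ Y.gr t)) z) =
      (tensor X Y).kact k ((tensor X Y).gr s (mu h X Y z)) := by
  classical
  refine LinearMap.congr_fun (linearMap_ext_gr h
    (A := mu h X Y ∘ₗ ∑ t ∈ Y.grSupp h, TensorProduct.map (X.kact k ∘ₗ X.gr (s * t⁻¹))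
      (Y.kact (kap h ((k : G) * s * (t : G)⁻¹)) ∘ₗ Y.gr t))
    (B := (tensor X Y).kact k ∘ₗ (tensor X Y).gr s ∘ₗ mu h X Y) fun γ v w => ?_) z
  change mu h X Y (_ : X.fiber ⊗[ℂ] Y.fiber) =
    (tensor X Y).kact k ((tensor X Y).gr s (mu h X Y (X.gr γ v ⊗ₜ w)))
  rw [gr_mu, kact_mu, LinearMap.sum_apply, Finset.sum_eq_single (γ⁻¹ * s)]
  · rw [TensorProduct.map_tmul, LinearMap.comp_apply, LinearMap.comp_apply, mul_inv_rev, inv_inv,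
      mul_inv_cancel_left, gr_gr h, if_pos rfl]
    congr 5
    push_cast
    group
  · intro t _ ht
    rw [TensorProduct.map_tmul, LinearMap.comp_apply, gr_gr h, if_neg, map_zero,
      TensorProduct.zero_tmul]
    rintro rfl
    exact ht (by group)
  · intro hn
    rw [TensorProduct.map_tmul, LinearMap.comp_apply, LinearMap.comp_apply, Y.gr_eq_zero h hn,
      map_zero, TensorProduct.tmul_zero]

variable [IsTopologicalGroup G] [CompactSpace K] [T2Space K]

lemma evM_kronecker {n r : Type*} (k : K) (s : Γ) (w : Matrix n n (quantumGroup h).A)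
    (w' : Matrix r r (quantumGroup h).A) (S : Finset Γ) (hS : ∀ k, ∀ t ∉ S, evM h k t w' = 0) :
    evM h k s (Matrix.kroneckerMap (· * ·) w w') =
      ∑ t ∈ S, Matrix.kroneckerMap (· * ·) (evM h k (s * t⁻¹) w)
        (evM h (kap h ((k : G) * s * (t : G)⁻¹)) t w') := by
  ext i j
  rw [Matrix.sum_apply]
  exact ev_mul h k s _ _ S fun k t ht => congrFun (congrFun (hS k t ht) i.2) j.2

variable {n r l : Type*} [Fintype n] [DecidableEq n] [Fintype r] [DecidableEq r]
  [Fintype l] [DecidableEq l]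

/-- The unitary representation of the bicrossed product on the fiber of a module, written as a
matrix with respect to an orthonormal basis. -/
def modRep (X : CfModule K) (b : OrthonormalBasis n ℂ X.fiber) :
    Matrix n n (quantumGroup h).A := rep (X.matchedRep h b)

lemma evM_modRep (X : CfModule K) (b : OrthonormalBasis n ℂ X.fiber) (k : K) (s : Γ) :
    evM h k s (modRep h X b) = LinearMap.toMatrix b.toBasis b.toBasis (X.kact k ∘ₗ X.gr s) :=
  (evM_rep _ k s).trans (LinearMap.toMatrix_comp _ b.toBasis _ _ _).symm

lemma modRep_intertwines_iff (X Y : CfModule K) (b : OrthonormalBasis n ℂ X.fiber)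
    (c : OrthonormalBasis r ℂ Y.fiber) (T : X.fiber →ₗ[ℂ] Y.fiber) :
    ((∀ k v, T (X.kact k v) = Y.kact k (T v)) ∧ ∀ (γ : Γ) v, T (X.gr γ v) = Y.gr γ (T v)) ↔
      modRep h Y c * (quantumGroup h).scalarMatrix b c T =
        (quantumGroup h).scalarMatrix b c T * modRep h X b := by
  rw [CompactQuantumGroup.scalarMatrix, modRep, modRep, rep_intertwines_iff]
  have key : ∀ (A : X.fiber →ₗ[ℂ] X.fiber) (B : Y.fiber →ₗ[ℂ] Y.fiber),
      (∀ v, T (A v) = B (T v)) ↔ LinearMap.toMatrix b.toBasis c.toBasis T *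
        LinearMap.toMatrixOrthonormal b A = LinearMap.toMatrixOrthonormal c B *
          LinearMap.toMatrix b.toBasis c.toBasis T := by
    intro A B
    have e1 : LinearMap.toMatrix b.toBasis c.toBasis T * LinearMap.toMatrixOrthonormal b A =
        LinearMap.toMatrix b.toBasis c.toBasis (T ∘ₗ A) :=
      (LinearMap.toMatrix_comp _ b.toBasis _ _ _).symm
    have e2 : LinearMap.toMatrixOrthonormal c B * LinearMap.toMatrix b.toBasis c.toBasis T =
        LinearMap.toMatrix b.toBasis c.toBasis (B ∘ₗ T) :=
      (LinearMap.toMatrix_comp _ c.toBasis _ _ _).symm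
    rw [e1, e2, (LinearMap.toMatrix b.toBasis c.toBasis).injective.eq_iff, LinearMap.ext_iff]
    rfl
  exact and_congr (forall_congr' fun k => key (X.kact k) (Y.kact k))
    (forall_congr' fun γ => key (X.gr γ) (Y.gr γ))

/-- The structure maps of the fiber functor intertwine the tensor products of representations: in
`Γ` the degrees multiply, as in the formula for `Δ(v_s)`. -/
lemma kronecker_modRep (X Y : CfModule K) (b : OrthonormalBasis n ℂ X.fiber)
    (c : OrthonormalBasis r ℂ Y.fiber) (d : OrthonormalBasis l ℂ (tensor X Y).fiber) :
    Matrix.kroneckerMap (· * ·) (modRep h X b) (modRep h Y c) *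
        (quantumGroup h).scalarMatrix d (b.tensorProduct c)
          (muEquiv h X Y).symm.toLinearEquiv.toLinearMap =
      (quantumGroup h).scalarMatrix d (b.tensorProduct c)
          (muEquiv h X Y).symm.toLinearEquiv.toLinearMap * modRep h (tensor X Y) d := by
  refine ext_evM fun k s => ?_
  rw [CompactQuantumGroup.scalarMatrix, evM_mul_scalar, evM_scalar_mul,
    evM_kronecker h k s _ _ (Y.grSupp h) (show ∀ k, ∀ t ∉ Y.grSupp h,
      evM h k t (modRep h Y c) = 0 from evM_rep_eq_zero (Y.matchedRep h c)), evM_modRep]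
  simp only [evM_modRep]
  have e : ∀ t : Γ, Matrix.kroneckerMap (· * ·)
      (LinearMap.toMatrix b.toBasis b.toBasis (X.kact k ∘ₗ X.gr (s * t⁻¹)))
      (LinearMap.toMatrix c.toBasis c.toBasis
        (Y.kact (kap h ((k : G) * s * (t : G)⁻¹)) ∘ₗ Y.gr t)) =
      LinearMap.toMatrix (b.tensorProduct c).toBasis (b.tensorProduct c).toBasis
        (TensorProduct.map (X.kact k ∘ₗ X.gr (s * t⁻¹))
          (Y.kact (kap h ((k : G) * s * (t : G)⁻¹)) ∘ₗ Y.gr t)) := fun t => by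
    rw [OrthonormalBasis.toBasis_tensorProduct]
    exact (TensorProduct.toMatrix_map _ _ _ _ _ _).symm
  rw [Finset.sum_congr rfl fun t _ => e t, ← map_sum, ← LinearMap.toMatrix_comp,
    ← LinearMap.toMatrix_comp]
  congr 1
  refine LinearMap.ext fun ζ => (muEquiv h X Y).injective ?_
  refine (mu_intertwines h X Y k s _).trans ?_
  change _ = muEquiv h X Y ((muEquiv h X Y).symm _)
  rw [LinearIsometryEquiv.apply_symm_apply]
  change (tensor X Y).kact k ((tensor X Y).gr s (muEquiv h X Y ((muEquiv h X Y).symm ζ))) = _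
  rw [LinearIsometryEquiv.apply_symm_apply]
  rfl

lemma modRep_unit (b : OrthonormalBasis n ℂ (unit K).fiber) : modRep h (unit K) b = 1 := by
  classical
  refine ext_evM fun k s => ?_
  rw [evM_modRep, evM_one]
  split_ifs with hs
  · rw [hs, ← LinearMap.toMatrix_id b.toBasis]
    congr 1
    exact LinearMap.ext fun v => (kact_unit k _).trans (gr_unit_one v)
  · rw [← map_zero (LinearMap.toMatrix b.toBasis b.toBasis)]
    congr 1
    exact LinearMap.ext fun v => (kact_unit k _).trans (gr_unit_of_ne h hs v)

/-- Every finite-dimensional unitary representation comes from a module. -/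
lemma exists_modRep {N : ℕ} {w : Matrix (Fin N) (Fin N) (quantumGroup h).A}
    (hw : (quantumGroup h).IsRep w) :
    ∃ (X : CfModule K) (W : EuclideanSpace ℂ (Fin N) ≃ₗᵢ[ℂ] X.fiber),
      ∀ {n : Type} [Fintype n] [DecidableEq n] (b : OrthonormalBasis n ℂ X.fiber),
        modRep h X b * (quantumGroup h).scalarMatrix (EuclideanSpace.basisFun (Fin N) ℂ) b
            W.toLinearEquiv.toLinearMap =
          (quantumGroup h).scalarMatrix (EuclideanSpace.basisFun (Fin N) ℂ) b
            W.toLinearEquiv.toLinearMap * w := by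
  classical
  obtain ⟨D, rfl⟩ := exists_rep_eq hw
  refine ⟨D.toModule, D.toFiberEquiv, fun b => ext_evM fun k s => ?_⟩
  rw [CompactQuantumGroup.scalarMatrix, evM_mul_scalar, evM_scalar_mul, evM_modRep, evM_rep,
    ← LinearMap.toMatrix_comp]
  have e : D.π k * D.p s = LinearMap.toMatrix (EuclideanSpace.basisFun (Fin N) ℂ).toBasis
      (EuclideanSpace.basisFun (Fin N) ℂ).toBasis
      (Matrix.toEuclideanCLM (n := Fin N) (𝕜 := ℂ) (D.π k * D.p s)).toLinearMap :=
    ((LinearMap.toMatrixOrthonormal (EuclideanSpace.basisFun (Fin N) ℂ)).apply_symm_apply _).symm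
  rw [e, ← LinearMap.toMatrix_comp]
  congr 1
  refine LinearMap.ext fun v => ?_
  change D.toModule.kact k (D.toModule.gr s (D.toFiberEquiv v)) = D.toFiberEquiv _
  rw [D.gr_toFiberEquiv, D.kact_toFiberEquiv]
  congr 1
  change _ = Matrix.toEuclideanCLM (n := Fin N) (𝕜 := ℂ) (D.π k * D.p s) v
  rw [map_mul]
  rfl

lemma isTannakaKreinDual : letI := fiberMonoidal h
    IsTannakaKreinDual (fiberFunctor K) (quantumGroup h) := by
  let := fiberMonoidal h
  refine ⟨fun X => modRep h X (stdOrthonormalBasis ℂ ((fiberFunctor K).obj X)),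
    fun X => isRep_rep _, fun X Y T => ?_, fun X Y => ?_, ?_, fun N w hw => ?_⟩
  · exact (exists_map_iff h T).trans (modRep_intertwines_iff h X Y _ _ T)
  · exact kronecker_modRep h X Y _ _ _
  · exact modRep_unit h _
  · obtain ⟨X, W, e⟩ := exists_modRep h hw
    exact ⟨X, W, e _⟩

end Bicrossed

/-! ### The conjugate equations on the fiber -/

section ConjugateEquations

open Functor.Monoidal Functor.LaxMonoidal Functor.OplaxMonoidal in
/-- The image of a conjugate equation under a monoidal functor. -/
lemma map_conjugate_equation {C D : Type*} [Category C] [Category D] [MonoidalCategory C]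
    [MonoidalCategory D] (F : C ⥤ D) [F.Monoidal] {X X' : C} (t : 𝟙_ C ⟶ X' ⊗ X)
    (r : X ⊗ X' ⟶ 𝟙_ C) :
    F.map ((ρ_ X).inv ≫ X ◁ t ≫ (α_ X X' X).inv ≫ r ▷ X ≫ (λ_ X).hom) =
      (ρ_ (F.obj X)).inv ≫ F.obj X ◁ (ε F ≫ F.map t ≫ δ F X' X) ≫
        (α_ (F.obj X) (F.obj X') (F.obj X)).inv ≫
          (μ F X X' ≫ F.map r ≫ η F) ▷ F.obj X ≫ (λ_ (F.obj X)).hom := by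
  simp only [Functor.map_comp, map_whiskerLeft, map_whiskerRight, map_associator_inv,
    map_leftUnitor, map_rightUnitor_inv, Category.assoc, μ_δ_assoc,
    MonoidalCategory.whiskerLeft_comp, MonoidalCategory.comp_whiskerRight]

/-- The map `v ↦ (⟨σ, ·⟩ ⊗ 1) (v ⊗ τ)`. -/
def contraction {V V' : Type*} [NormedAddCommGroup V] [InnerProductSpace ℂ V]
    [NormedAddCommGroup V'] [InnerProductSpace ℂ V'] (σ : V ⊗[ℂ] V') (τ : V' ⊗[ℂ] V) : V →ₗ[ℂ] V :=
  (TensorProduct.lid ℂ V).toLinearMap ∘ₗ (innerₛₗ ℂ σ).rTensor V ∘ₗ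
    (TensorProduct.assoc ℂ V V' V).symm.toLinearMap ∘ₗ (TensorProduct.mk ℂ V (V' ⊗[ℂ] V)).flip τ

/-- The coefficients of a tensor with respect to a pair of orthonormal bases. -/
def coords {n r V V' : Type*} [NormedAddCommGroup V] [InnerProductSpace ℂ V]
    [NormedAddCommGroup V'] [InnerProductSpace ℂ V'] [Fintype n] [Fintype r]
    (b : OrthonormalBasis n ℂ V) (c : OrthonormalBasis r ℂ V') :
    V ⊗[ℂ] V' ≃ₗ[ℂ] Matrix n r ℂ :=
  (b.tensorProduct c).toBasis.equivFun.trans (LinearEquiv.curry ℂ ℂ n r)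

section Coords

variable {n r V V' : Type*} [NormedAddCommGroup V] [InnerProductSpace ℂ V]
    [NormedAddCommGroup V'] [InnerProductSpace ℂ V'] [Fintype n] [Fintype r]
    (b : OrthonormalBasis n ℂ V) (c : OrthonormalBasis r ℂ V')

lemma coords_apply (z : V ⊗[ℂ] V') (i : n) (j : r) :
    coords b c z i j = inner ℂ (b i ⊗ₜ[ℂ] c j) z := by
  change (b.tensorProduct c).repr z (i, j) = _
  rw [OrthonormalBasis.repr_apply_apply, OrthonormalBasis.tensorProduct_apply]

lemma inner_eq_trace_coords (z z' : V ⊗[ℂ] V') :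
    inner ℂ z z' = ((coords b c z).conjTranspose * coords b c z').trace := by
  refine ((b.tensorProduct c).sum_inner_mul_inner z z').symm.trans ?_
  rw [Matrix.trace, Fintype.sum_prod_type, Finset.sum_comm]
  refine Finset.sum_congr rfl fun j _ => ?_
  rw [Matrix.diag_apply, Matrix.mul_apply]
  refine Finset.sum_congr rfl fun i _ => ?_
  rw [Matrix.conjTranspose_apply, coords_apply, coords_apply, OrthonormalBasis.tensorProduct_apply]
  refine congrArg₂ (fun x y : ℂ => x * y) ?_ rfl
  exact (inner_conj_symm (𝕜 := ℂ) (E := V ⊗[ℂ] V') z (b i ⊗ₜ[ℂ] c j)).symm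

lemma coords_tmul (v : V) (w : V') :
    coords b c (v ⊗ₜ w) = Matrix.vecMulVec (b.repr v).ofLp (c.repr w).ofLp := by
  ext i j
  rw [coords_apply, Matrix.vecMulVec_apply, b.repr_apply_apply, c.repr_apply_apply]
  exact TensorProduct.inner_tmul ℂ (b i) v (c j) w

/-- In coordinates, `A ⊗ B` acts on a tensor `Z` by `A Z Bᵀ`. -/
lemma coords_map [DecidableEq n] [DecidableEq r] (A : V →ₗ[ℂ] V) (B : V' →ₗ[ℂ] V')
    (z : V ⊗[ℂ] V') : coords b c (TensorProduct.map A B z) =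
      LinearMap.toMatrix b.toBasis b.toBasis A * coords b c z *
        (LinearMap.toMatrix c.toBasis c.toBasis B).transpose := by
  induction z with
  | zero => simp
  | add z z' hz hz' => rw [map_add, map_add, hz, hz', map_add, Matrix.mul_add, Matrix.add_mul]
  | tmul v w =>
    have e1 : (b.repr (A v)).ofLp =
        Matrix.mulVec (LinearMap.toMatrix b.toBasis b.toBasis A) (b.repr v).ofLp :=
      (LinearMap.toMatrix_mulVec_repr b.toBasis b.toBasis A v).symm
    have e2 : (c.repr (B w)).ofLp =
        Matrix.mulVec (LinearMap.toMatrix c.toBasis c.toBasis B) (c.repr w).ofLp :=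
      (LinearMap.toMatrix_mulVec_repr c.toBasis c.toBasis B w).symm
    rw [TensorProduct.map_tmul, coords_tmul, coords_tmul, Matrix.mul_vecMulVec,
      Matrix.vecMulVec_mul, Matrix.vecMul_transpose, e1, e2]

/-- In coordinates, the contraction of two tensors is the product of their matrices, with the first
one conjugated. -/
lemma inner_contraction (σ : V ⊗[ℂ] V') (τ : V' ⊗[ℂ] V) (i k : n) :
    inner ℂ (b k) (contraction σ τ (b i)) = ((coords b c σ).map star * coords c b τ) i k := by
  induction τ with
  | zero =>
    have e : contraction σ (0 : V' ⊗[ℂ] V) (b i) = 0 := by simp [contraction]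
    rw [e, map_zero, Matrix.mul_zero, inner_zero_right, Matrix.zero_apply]
  | add τ τ' hτ hτ' =>
    have e : contraction σ (τ + τ') (b i) = contraction σ τ (b i) + contraction σ τ' (b i) := by
      simp [contraction]
    rw [e, inner_add_right, hτ, hτ', map_add, Matrix.mul_add, Matrix.add_apply]
  | tmul w v =>
    have e : contraction σ (w ⊗ₜ v) (b i) = inner ℂ σ (b i ⊗ₜ[ℂ] w) • v := rfl
    have e2 : inner ℂ σ (b i ⊗ₜ[ℂ] w) = ∑ j, star (coords b c σ i j) * (c.repr w).ofLp j := by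
      conv_lhs => rw [← c.sum_repr w, TensorProduct.tmul_sum]
      refine (inner_sum _ _ _).trans (Finset.sum_congr rfl fun j _ => ?_)
      rw [TensorProduct.tmul_smul, coords_apply, mul_comm]
      exact (inner_smul_right (𝕜 := ℂ) σ (b i ⊗ₜ[ℂ] c j) _).trans
        (congrArg ((c.repr w).ofLp j * ·) (inner_conj_symm σ (b i ⊗ₜ[ℂ] c j)).symm)
    rw [e, inner_smul_right, e2, Finset.sum_mul, Matrix.mul_apply]
    refine Finset.sum_congr rfl fun j _ => ?_
    rw [coords_tmul, Matrix.vecMulVec_apply, b.repr_apply_apply, mul_assoc]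
    rfl

lemma contraction_eq_id_iff [DecidableEq n] (σ : V ⊗[ℂ] V') (τ : V' ⊗[ℂ] V) :
    contraction σ τ = LinearMap.id ↔ (coords b c σ).map star * coords c b τ = 1 := by
  constructor
  · intro e
    ext i k
    rw [← inner_contraction, e, LinearMap.id_apply, b.inner_eq_ite, Matrix.one_apply]
    simp only [eq_comm]
  · intro e
    refine b.toBasis.ext fun i => InnerProductSpace.ext_inner_left_basis b.toBasis fun k => ?_
    rw [b.coe_toBasis, inner_contraction b c, e, LinearMap.id_apply, b.inner_eq_ite,
      Matrix.one_apply]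
    simp only [eq_comm]

end Coords

end ConjugateEquations

namespace CfModule

variable {G : Type u} [Group G] [TopologicalSpace G] [IsTopologicalGroup G]
  {K : OpenSubgroup G} {Γ : Subgroup G} (h : Γ.IsComplement' (K : Subgroup G))

/-- The vector of `(χ_K · X) ⊗ (χ_K · Y)` that corresponds to a morphism from the unit. -/
def unitHomVec {X Y : CfModule K} (s : 𝟙_ (CfModule K) ⟶ X ⊗ Y) : X.fiber ⊗[ℂ] Y.fiber :=
  (muEquiv h X Y).symm (HilbF.lin ((fiberFunctor K).map s) (unitVec K))

lemma mu_unitHomVec {X Y : CfModule K} (s : 𝟙_ (CfModule K) ⟶ X ⊗ Y) :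
    mu h X Y (unitHomVec h s) = HilbF.lin ((fiberFunctor K).map s) (unitVec K) :=
  (muEquiv h X Y).apply_symm_apply _

/-- A morphism from the unit is determined by its value at the unit vector. -/
lemma unit_hom_ext (h : Γ.IsComplement' (K : Subgroup G)) {X : CfModule K}
    {f g : 𝟙_ (CfModule K) ⟶ X} (e : HilbF.lin ((fiberFunctor K).map f) (unitVec K) =
      HilbF.lin ((fiberFunctor K).map g) (unitVec K)) : f = g := by
  let := fiberMonoidal h
  have := (isFiberFunctor h).faithful
  refine (fiberFunctor K).map_injective (HilbF.hom_ext (LinearMap.ext fun v => ?_))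
  obtain ⟨c, rfl⟩ := eq_smul_unitVec v
  exact (map_smul (HilbF.lin ((fiberFunctor K).map f)) c _).trans
    ((congrArg (c • ·) e).trans (map_smul (HilbF.lin ((fiberFunctor K).map g)) c _).symm)

lemma inner_unitHomVec {X Y : CfModule K} (r s : 𝟙_ (CfModule K) ⟶ X ⊗ Y) :
    inner ℂ (unitVec K) (HilbF.lin ((fiberFunctor K).map (r ≫ HasDagger.dagger s)) (unitVec K)) =
      inner ℂ (unitHomVec h s) (unitHomVec h r) := by
  rw [Functor.map_comp, map_dagger]
  refine Eq.trans ?_ (inner_mu h X Y (unitHomVec h s) (unitHomVec h r))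
  rw [mu_unitHomVec, mu_unitHomVec]
  exact LinearMap.adjoint_inner_right (HilbF.lin ((fiberFunctor K).map s)) _ _

/-- An endomorphism of the unit is determined by its matrix coefficient on the fiber. -/
lemma unit_end_ext (h : Γ.IsComplement' (K : Subgroup G)) {f g : 𝟙_ (CfModule K) ⟶ 𝟙_ (CfModule K)}
    (e : inner ℂ (unitVec K) (HilbF.lin ((fiberFunctor K).map f) (unitVec K)) =
      inner ℂ (unitVec K) (HilbF.lin ((fiberFunctor K).map g) (unitVec K))) : f = g := by
  refine unit_hom_ext h ?_
  obtain ⟨c, hc⟩ := eq_smul_unitVec (HilbF.lin ((fiberFunctor K).map f) (unitVec K))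
  obtain ⟨d, hd⟩ := eq_smul_unitVec (HilbF.lin ((fiberFunctor K).map g) (unitVec K))
  have h1 : inner ℂ (unitVec K) (unitVec K) = (1 : ℂ) := by
    rw [inner_self_eq_norm_sq_to_K, norm_unitVec]; simp
  rw [hc, hd, inner_smul_right, inner_smul_right, h1, mul_one, mul_one] at e
  rw [hc, hd, e]

lemma unitHomVec_comp_whiskerRight {X X' Y : CfModule K} (s : 𝟙_ (CfModule K) ⟶ X ⊗ Y)
    (T : X ⟶ X') : unitHomVec h (s ≫ T ▷ Y) =
      (HilbF.lin ((fiberFunctor K).map T)).rTensor _ (unitHomVec h s) := by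
  let := fiberMonoidal h
  have e := Functor.OplaxMonoidal.δ_natural_left (fiberFunctor K) T Y
  have e1 := LinearMap.congr_fun (congrArg HilbF.lin e)
    (HilbF.lin ((fiberFunctor K).map s) (unitVec K))
  exact e1.symm

lemma unitHomVec_comp_whiskerLeft {X Y Y' : CfModule K} (s : 𝟙_ (CfModule K) ⟶ X ⊗ Y)
    (T : Y ⟶ Y') : unitHomVec h (s ≫ X ◁ T) =
      (HilbF.lin ((fiberFunctor K).map T)).lTensor _ (unitHomVec h s) := by
  let := fiberMonoidal h
  have e := Functor.OplaxMonoidal.δ_natural_right (fiberFunctor K) X T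
  have e1 := LinearMap.congr_fun (congrArg HilbF.lin e)
    (HilbF.lin ((fiberFunctor K).map s) (unitVec K))
  exact e1.symm

/-- The conjugate equations on the fiber. -/
lemma conjugate_equation_iff {X X' : CfModule K} (s : 𝟙_ (CfModule K) ⟶ X ⊗ X')
    (t : 𝟙_ (CfModule K) ⟶ X' ⊗ X) :
    (ρ_ X).inv ≫ X ◁ t ≫ (α_ X X' X).inv ≫ HasDagger.dagger s ▷ X ≫ (λ_ X).hom = 𝟙 X ↔
      contraction (unitHomVec h s) (unitHomVec h t) = LinearMap.id := by
  let := fiberMonoidal h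
  have := (isFiberFunctor h).faithful
  rw [← (fiberFunctor K).map_injective.eq_iff, map_conjugate_equation, map_dagger]
  have e1 : ∀ z : X.fiber ⊗[ℂ] X'.fiber,
      (HilbF.lin (Functor.LaxMonoidal.μ (fiberFunctor K) X X' ≫
        HasDagger.dagger ((fiberFunctor K).map s) ≫
          Functor.OplaxMonoidal.η (fiberFunctor K)) z).down =
      inner ℂ (unitHomVec h s) z := by
    intro z
    have u1 : HilbF.lin (Functor.LaxMonoidal.ε (fiberFunctor K)) (ULift.up 1) = unitVec K :=
      one_smul ℂ (unitVec K)
    have u2 : ∀ v : (unit K).fiber, (HilbF.lin (Functor.OplaxMonoidal.η (fiberFunctor K)) v).down =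
        inner ℂ (unitVec K) v := fun v => by
      rw [← u1, ← unit_unitary h]
      refine Eq.trans ?_ (LinearMap.adjoint_inner_left
        (HilbF.lin (Functor.OplaxMonoidal.η (fiberFunctor K))) v (ULift.up (1 : ℂ))).symm
      exact (mul_one _).symm.trans (congrArg _ (map_one (starRingEnd ℂ)).symm)
    refine (u2 _).trans ((LinearMap.adjoint_inner_right (HilbF.lin ((fiberFunctor K).map s))
      (unitVec K) (mu h X X' z)).trans ?_)
    rw [← mu_unitHomVec h s]
    exact inner_mu h X X' _ _
  have e2 : HilbF.lin (Functor.LaxMonoidal.ε (fiberFunctor K) ≫ (fiberFunctor K).map t ≫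
      Functor.OplaxMonoidal.δ (fiberFunctor K) X' X) (ULift.up 1) = unitHomVec h t :=
    congrArg (fun v => (muEquiv h X' X).symm (HilbF.lin ((fiberFunctor K).map t) v))
      (one_smul ℂ (unitVec K))
  have key : HilbF.lin ((ρ_ ((fiberFunctor K).obj X)).inv ≫
      (fiberFunctor K).obj X ◁ (Functor.LaxMonoidal.ε (fiberFunctor K) ≫ (fiberFunctor K).map t ≫
        Functor.OplaxMonoidal.δ (fiberFunctor K) X' X) ≫
      (α_ ((fiberFunctor K).obj X) ((fiberFunctor K).obj X') ((fiberFunctor K).obj X)).inv ≫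
      (Functor.LaxMonoidal.μ (fiberFunctor K) X X' ≫
        HasDagger.dagger ((fiberFunctor K).map s) ≫ Functor.OplaxMonoidal.η (fiberFunctor K)) ▷
          (fiberFunctor K).obj X ≫ (λ_ ((fiberFunctor K).obj X)).hom) =
      contraction (unitHomVec h s) (unitHomVec h t) := by
    refine LinearMap.ext fun v => ?_
    generalize (Functor.LaxMonoidal.μ (fiberFunctor K) X X' ≫
        HasDagger.dagger ((fiberFunctor K).map s) ≫ Functor.OplaxMonoidal.η (fiberFunctor K)) = φ
      at e1 ⊢
    generalize (Functor.LaxMonoidal.ε (fiberFunctor K) ≫ (fiberFunctor K).map t ≫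
        Functor.OplaxMonoidal.δ (fiberFunctor K) X' X) = τ at e2 ⊢
    have e3 : (show (X.fiber ⊗[ℂ] X'.fiber) ⊗[ℂ] X.fiber →ₗ[ℂ] X.fiber from
        HilbF.lin (φ ▷ (fiberFunctor K).obj X ≫ (λ_ ((fiberFunctor K).obj X)).hom)) =
          (TensorProduct.lid ℂ X.fiber).toLinearMap ∘ₗ
            (innerₛₗ ℂ (unitHomVec h s)).rTensor X.fiber :=
      TensorProduct.ext' fun a w => congrArg (· • w) (e1 a)
    refine (LinearMap.congr_fun e3 _).trans ?_
    rw [← e2]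
    rfl
  rw [← key]
  exact ⟨fun e => (congrArg HilbF.lin e).trans rfl, fun e => HilbF.hom_ext (e.trans rfl)⟩

end CfModule

/-! ### Morphisms from the unit as invariant matrices -/

open scoped ComplexOrder in
/-- A positive semidefinite matrix with square `1` is the identity. -/
lemma Matrix.PosSemidef.eq_one_of_mul_self {n : Type*} [Fintype n] [DecidableEq n]
    {A : Matrix n n ℂ} (hA : A.PosSemidef) (e : A * A = 1) : A = 1 := by
  have h1 : IsUnit (A + 1) := (Matrix.PosDef.posSemidef_add hA Matrix.PosDef.one).isUnit
  have h2 : (A + 1) * (A - 1) = 0 := by noncomm_ring; simp [e]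
  exact sub_eq_zero.1 (h1.mul_right_eq_zero.1 h2)

section

variable {n r : Type*} [Fintype r] [DecidableEq n]

lemma Matrix.map_star_mul_iff {S : Matrix n r ℂ} {R : Matrix r n ℂ} :
    S.map star * R = 1 ↔ S * R.map star = 1 := by
  have e : ∀ M N : Matrix n n ℂ, M.map star = N.map star ↔ M = N := fun M N =>
    (Matrix.map_injective star_injective).eq_iff
  rw [← e]
  have e1 : (S.map star * R).map star = S * R.map star := by
    ext i j; simp [Matrix.mul_apply]
  have e2 : (1 : Matrix n n ℂ).map star = 1 := by
    ext i j; simp [Matrix.one_apply, apply_ite]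
  rw [e1, e2]

end

namespace Bicrossed

open CfModule

variable {G : Type u} [Group G] [TopologicalSpace G] [IsTopologicalGroup G]
  {K : OpenSubgroup G} {Γ : Subgroup G} (h : Γ.IsComplement' (K : Subgroup G))

open Classical in
/-- The vectors of the fiber of `X ⊗ Y` that come from a morphism from the unit. -/
lemma exists_unitHomVec_eq_iff {X Y : CfModule K} (σ : X.fiber ⊗[ℂ] Y.fiber) :
    (∃ s : 𝟙_ (CfModule K) ⟶ X ⊗ Y, unitHomVec h s = σ) ↔ ∀ (k : K) (s : Γ),
      (tensor X Y).kact k ((tensor X Y).gr s (mu h X Y σ)) =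
        if s = 1 then mu h X Y σ else 0 := by
  let T : (unit K).fiber →ₗ[ℂ] (tensor X Y).fiber :=
    (innerₛₗ ℂ (unitVec K)).smulRight (mu h X Y σ)
  have hT : T (unitVec K) = mu h X Y σ := by
    change inner ℂ (unitVec K) (unitVec K) • mu h X Y σ = _
    rw [inner_self_eq_norm_sq_to_K, norm_unitVec]
    simp
  have e1 : (∃ s : 𝟙_ (CfModule K) ⟶ X ⊗ Y, unitHomVec h s = σ) ↔
      ∃ f : unit K ⟶ tensor X Y, (fiberFunctor K).map f =
        HilbF.ofLin (X := (fiberFunctor K).obj (unit K)) (Y := (fiberFunctor K).obj (tensor X Y))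
          T := by
    refine exists_congr fun f => ⟨fun e => HilbF.hom_ext (LinearMap.ext fun v => ?_), fun e => ?_⟩
    · obtain ⟨c, rfl⟩ := eq_smul_unitVec v
      refine (map_smul (HilbF.lin ((fiberFunctor K).map f)) c (unitVec K)).trans
        (Eq.trans (congrArg (c • ·) ?_) (map_smul T c (unitVec K)).symm)
      rw [hT, ← e]
      exact (mu_unitHomVec h f).symm
    · refine (muEquiv h X Y).injective ((mu_unitHomVec h f).trans ?_)
      exact (LinearMap.congr_fun (congrArg HilbF.lin e) (unitVec K)).trans hT
  rw [e1, exists_map_iff h]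
  constructor
  · rintro ⟨hk, hg⟩ k s
    rw [← hT, ← hg, ← hk, kact_unit]
    split_ifs with hs
    · rw [hs, gr_unit_one]
    · rw [gr_unit_of_ne h hs, map_zero]
  · intro e
    have hg : ∀ s : Γ, (tensor X Y).gr s (mu h X Y σ) = if s = 1 then mu h X Y σ else 0 :=
      fun s => by rw [← e 1 s, kact_one]
    have hk : ∀ k : K, (tensor X Y).kact k (mu h X Y σ) = mu h X Y σ := fun k => by
      have := e k 1
      rwa [hg, if_pos rfl] at this
    refine ⟨fun k v => ?_, fun s v => ?_⟩ <;> obtain ⟨c, rfl⟩ := eq_smul_unitVec v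
    · rw [kact_unit, map_smul, map_smul, hT, hk]
    · rw [map_smul, map_smul, map_smul, map_smul, hT, hg]
      split_ifs with hs
      · rw [hs, gr_unit_one, hT]
      · rw [gr_unit_of_ne h hs, map_zero]

section Coefficients

/-- The restriction of a morphism to the fibers. -/
def fiberMap {X Y : CfModule K} (T : X ⟶ Y) : X.fiber →ₗ[ℂ] Y.fiber :=
  HilbF.lin ((fiberFunctor K).map T)

variable {n r : Type*} [Fintype n] [Fintype r] {X Y : CfModule K}
  (b : OrthonormalBasis n ℂ X.fiber) (c : OrthonormalBasis r ℂ Y.fiber)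

/-- The number `s^* (T ⊗ 1) s`. -/
lemma inner_comp_whiskerRight [DecidableEq n] [DecidableEq r] (s : 𝟙_ (CfModule K) ⟶ X ⊗ Y)
    (T : X ⟶ X) :
    inner ℂ (unitVec K) (HilbF.lin ((fiberFunctor K).map (s ≫ T ▷ Y ≫ HasDagger.dagger s))
      (unitVec K)) = ((coords b c (unitHomVec h s)).conjTranspose *
        (LinearMap.toMatrix b.toBasis b.toBasis (fiberMap T) *
          coords b c (unitHomVec h s))).trace := by
  have e : unitHomVec h (s ≫ T ▷ Y) =
      TensorProduct.map (fiberMap T) LinearMap.id (unitHomVec h s) :=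
    unitHomVec_comp_whiskerRight h s T
  rw [← Category.assoc, inner_unitHomVec h, inner_eq_trace_coords b c, e, coords_map,
    LinearMap.toMatrix_id, Matrix.transpose_one, Matrix.mul_one]

/-- The number `s^* (1 ⊗ T) s`. -/
lemma inner_comp_whiskerLeft [DecidableEq n] [DecidableEq r] (s : 𝟙_ (CfModule K) ⟶ X ⊗ Y)
    (T : Y ⟶ Y) :
    inner ℂ (unitVec K) (HilbF.lin ((fiberFunctor K).map (s ≫ X ◁ T ≫ HasDagger.dagger s))
      (unitVec K)) = ((coords b c (unitHomVec h s)).conjTranspose * (coords b c (unitHomVec h s) *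
        (LinearMap.toMatrix c.toBasis c.toBasis (fiberMap T)).transpose)).trace := by
  have e : unitHomVec h (s ≫ X ◁ T) =
      TensorProduct.map LinearMap.id (fiberMap T) (unitHomVec h s) :=
    unitHomVec_comp_whiskerLeft h s T
  rw [← Category.assoc, inner_unitHomVec h, inner_eq_trace_coords b c, e, coords_map,
    LinearMap.toMatrix_id, Matrix.one_mul]

lemma comp_dagger_eq_smul_iff (s : 𝟙_ (CfModule K) ⟶ X ⊗ Y) (d : ℂ) :
    s ≫ HasDagger.dagger s = d • 𝟙 (𝟙_ (CfModule K)) ↔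
      ((coords b c (unitHomVec h s)).conjTranspose * coords b c (unitHomVec h s)).trace = d := by
  have e : inner ℂ (unitVec K) (HilbF.lin ((fiberFunctor K).map (d • 𝟙 (𝟙_ (CfModule K))))
      (unitVec K)) = d := by
    change inner ℂ (unitVec K) (d • unitVec K) = d
    rw [inner_smul_right, inner_self_eq_norm_sq_to_K, norm_unitVec]
    simp
  rw [← inner_eq_trace_coords b c, ← inner_unitHomVec h]
  exact ⟨fun e' => by rw [e', e], fun e' => unit_end_ext h (e'.trans e.symm)⟩

end Coefficients

variable [CompactSpace K] [T2Space K] {n r : Type*} [Fintype n] [DecidableEq n] [Fintype r]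
  [DecidableEq r]

open Classical in
lemma evM_scalar {l m : Type*} [Fintype m] [DecidableEq m] (M : Matrix l m ℂ) (k : K) (s : Γ) :
    evM h k s (M.map (algebraMap ℂ (quantumGroup h).A)) = if s = 1 then M else 0 := by
  rw [← Matrix.mul_one (M.map _), evM_scalar_mul, evM_one]
  split_ifs
  · rw [Matrix.mul_one]
  · rw [Matrix.mul_zero]

/-- The tensors that come from a morphism from the unit, in terms of their coefficients. -/
lemma exists_unitHomVec_eq_iff_coords {X Y : CfModule K} (b : OrthonormalBasis n ℂ X.fiber)
    (c : OrthonormalBasis r ℂ Y.fiber) (σ : X.fiber ⊗[ℂ] Y.fiber) :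
    (∃ s : 𝟙_ (CfModule K) ⟶ X ⊗ Y, unitHomVec h s = σ) ↔
      modRep h X b * (coords b c σ).map (algebraMap ℂ (quantumGroup h).A) *
        (modRep h Y c).transpose = (coords b c σ).map (algebraMap ℂ (quantumGroup h).A) := by
  classical
  rw [exists_unitHomVec_eq_iff]
  have hY : ∀ k, ∀ t ∉ Y.grSupp h, evM h k t (modRep h Y c).transpose = 0 := fun k t ht =>
    congrArg Matrix.transpose (evM_rep_eq_zero (Y.matchedRep h c) k t ht)
  have key : ∀ (k : K) (s : Γ), evM h k s (modRep h X b *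
      (coords b c σ).map (algebraMap ℂ (quantumGroup h).A) * (modRep h Y c).transpose) =
      coords b c ((muEquiv h X Y).symm
        ((tensor X Y).kact k ((tensor X Y).gr s (mu h X Y σ)))) := fun k s => by
    rw [evM_mul k s _ _ (Y.grSupp h) hY, ← mu_intertwines, ← muEquiv_apply,
      LinearIsometryEquiv.symm_apply_apply, LinearMap.sum_apply, map_sum]
    refine Finset.sum_congr rfl fun t _ => ?_
    rw [coords_map, evM_mul_scalar, evM_modRep]
    congr 1
    exact congrArg Matrix.transpose (evM_modRep h Y c _ t)
  constructor
  · intro e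
    refine ext_evM fun k s => ?_
    rw [key, e, evM_scalar]
    split_ifs
    · rw [← muEquiv_apply, LinearIsometryEquiv.symm_apply_apply]
    · rw [LinearIsometryEquiv.map_zero, map_zero]
  · intro e k s
    have e1 := key k s
    rw [e, evM_scalar] at e1
    rw [← (muEquiv h X Y).symm.injective.eq_iff, ← (coords b c).injective.eq_iff, ← e1]
    split_ifs
    · rw [← muEquiv_apply, LinearIsometryEquiv.symm_apply_apply]
    · rw [LinearIsometryEquiv.map_zero, map_zero]

end Bicrossed

/-! ### The categorical dimension -/

section

variable {n r : Type*} [Fintype n] [DecidableEq n] [Fintype r] [DecidableEq r]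

/-- If `u S v = S` with `u` and `v` unitary, then `u` commutes with `S S^*`, since `S v^* = u S`. -/
lemma Matrix.mul_conjTranspose_comm_of_mul_mul_eq {A : Type*} [Ring A] [StarRing A]
    {u : Matrix n n A} {v : Matrix r r A} {S : Matrix n r A} (hu : u.conjTranspose * u = 1)
    (hv : v * v.conjTranspose = 1) (e : u * S * v = S) :
    u * (S * S.conjTranspose) = S * S.conjTranspose * u := by
  have e' : v.conjTranspose * S.conjTranspose * u.conjTranspose = S.conjTranspose := by
    conv_rhs => rw [← e]
    rw [Matrix.conjTranspose_mul, Matrix.conjTranspose_mul, Matrix.mul_assoc]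
  have e1 : u * S = S * v.conjTranspose := by
    conv_rhs => rw [← e]
    rw [Matrix.mul_assoc (u * S), hv, Matrix.mul_one]
  have e2 : S.conjTranspose * u = v.conjTranspose * S.conjTranspose := by
    conv_lhs => rw [← e']
    rw [Matrix.mul_assoc _ _ u, hu, Matrix.mul_one]
  rw [← Matrix.mul_assoc, e1, Matrix.mul_assoc, Matrix.mul_assoc, e2]

lemma Matrix.mul_eq_one_of_conjugate_equations {S : Matrix n r ℂ} {R : Matrix r n ℂ}
    (h1 : S.map star * R = 1) (h2 : R.map star * S = 1) :
    S * S.conjTranspose * (R.transpose * R.map star) = 1 := by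
  have e1 : S.conjTranspose * R.transpose = 1 := by
    rw [← Matrix.conjTranspose_one, ← h2, Matrix.conjTranspose_mul]
    congr 1
    ext i j
    simp
  rw [Matrix.mul_assoc, ← Matrix.mul_assoc _ R.transpose, e1, Matrix.one_mul]
  exact Matrix.map_star_mul_iff.1 h1

open scoped ComplexOrder in
/-- The coefficients `S` and `R` of a standard solution of the conjugate equations satisfy
`Tr(S^* S) = n`. For an arbitrary solution, `S S^*` and `Rᵀ R̄` are inverse to each other; if it is
standard, then their difference `B` satisfies `Tr(B²) = 0`, and hence both are equal to `1`. -/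
lemma Matrix.trace_conjTranspose_mul_self_of_standard {S : Matrix n r ℂ} {R : Matrix r n ℂ}
    (h1 : S.map star * R = 1) (h2 : R.map star * S = 1)
    (e : (S.conjTranspose * ((S * S.conjTranspose - R.transpose * R.map star) * S)).trace =
      (R.conjTranspose *
        (R * (S * S.conjTranspose - R.transpose * R.map star).transpose)).trace) :
    (S.conjTranspose * S).trace = Fintype.card n := by
  set A := S * S.conjTranspose with hA
  set A' := R.transpose * R.map star with hA'
  have hRt : R.transpose = (R.map star).conjTranspose := by ext i j; simp
  have hAA' : A * A' = 1 := Matrix.mul_eq_one_of_conjugate_equations h1 h2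
  have hAh : A.IsHermitian := Matrix.isHermitian_mul_conjTranspose_self S
  have hAh' : A'.IsHermitian := by
    rw [hA', hRt]
    exact Matrix.isHermitian_conjTranspose_mul_self _
  have e1 : (S.conjTranspose * ((A - A') * S)).trace = ((A - A') * A).trace := by
    rw [Matrix.trace_mul_comm, Matrix.mul_assoc]
  have e2 : (R.conjTranspose * (R * (A - A').transpose)).trace = ((A - A') * A').trace := by
    rw [← Matrix.mul_assoc, ← Matrix.trace_transpose, Matrix.transpose_mul,
      Matrix.transpose_transpose, Matrix.transpose_mul]
    rfl
  have hB : A - A' = 0 := by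
    rw [← Matrix.trace_conjTranspose_mul_self_eq_zero_iff, (hAh.sub hAh').eq, Matrix.mul_sub,
      Matrix.trace_sub, ← e1, ← e2, e, sub_self]
  have hA1 : A = 1 := (Matrix.posSemidef_self_mul_conjTranspose S).eq_one_of_mul_self (by
    rwa [← sub_eq_zero.1 hB] at hAA')
  rw [Matrix.trace_mul_comm]
  change A.trace = _
  rw [hA1, Matrix.trace_one]

end

namespace Bicrossed

open CfModule

variable {G : Type u} [Group G] [TopologicalSpace G] [IsTopologicalGroup G]
  {K : OpenSubgroup G} {Γ : Subgroup G} (h : Γ.IsComplement' (K : Subgroup G))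
  [CompactSpace K] [T2Space K]
  {n r : Type*} [Fintype n] [DecidableEq n] [Fintype r] [DecidableEq r]

/-- A scalar matrix that commutes with the representation of the bicrossed product comes from an
endomorphism. -/
lemma exists_fiberMap_eq {X : CfModule K} (b : OrthonormalBasis n ℂ X.fiber) {B : Matrix n n ℂ}
    (e : modRep h X b * B.map (algebraMap ℂ (quantumGroup h).A) =
      B.map (algebraMap ℂ (quantumGroup h).A) * modRep h X b) :
    ∃ T : X ⟶ X, LinearMap.toMatrix b.toBasis b.toBasis (fiberMap T) = B := by
  have e1 : LinearMap.toMatrix b.toBasis b.toBasis (Matrix.toLin b.toBasis b.toBasis B) = B :=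
    LinearMap.toMatrix_toLin _ _ B
  obtain ⟨T, hT⟩ := (exists_map_iff h (Matrix.toLin b.toBasis b.toBasis B)).2
    ((modRep_intertwines_iff h X X b b _).2 (by
      rw [CompactQuantumGroup.scalarMatrix, e1]
      exact e))
  refine ⟨T, ?_⟩
  conv_rhs => rw [← e1]
  exact congrArg (LinearMap.toMatrix b.toBasis b.toBasis) hT

lemma star_modRep_mul (X : CfModule K) (b : OrthonormalBasis n ℂ X.fiber) :
    star (modRep h X b) * modRep h X b = 1 := (isRep_rep (X.matchedRep h b)).unitary.1

lemma modRep_mul_star (X : CfModule K) (b : OrthonormalBasis n ℂ X.fiber) :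
    modRep h X b * star (modRep h X b) = 1 := (isRep_rep (X.matchedRep h b)).unitary.2

/-- The complex conjugate of the representation of the bicrossed product on a fiber is unitary. -/
lemma transpose_modRep_mul (X : CfModule K) (b : OrthonormalBasis n ℂ X.fiber) :
    (modRep h X b).transpose * (modRep h X b).map star = 1 := by
  have e := (isRep_rep (X.matchedRep h b).conj).unitary.1
  rw [rep_conj] at e
  refine Eq.trans (congrArg (· * _) ?_) e
  ext i j : 1
  exact (star_star (modRep h X b j i)).symm

lemma map_star_modRep_mul (X : CfModule K) (b : OrthonormalBasis n ℂ X.fiber) :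
    (modRep h X b).map star * (modRep h X b).transpose = 1 := by
  have e := (isRep_rep (X.matchedRep h b).conj).unitary.2
  rw [rep_conj] at e
  refine Eq.trans (congrArg (fun M => (modRep h X b).map star * M) ?_) e
  ext i j : 1
  exact (star_star (modRep h X b j i)).symm

/-- The categorical dimension is unique. -/
lemma eq_finrank_of_hasCategoricalDimension {X : CfModule K} {d : ℂ}
    (hX : HasCategoricalDimension X d) (h : Γ.IsComplement' (K : Subgroup G)) :
    d = Module.finrank ℂ X.fiber := by
  obtain ⟨X', s, t, h1, h2, h3, h4⟩ := hX
  let b := stdOrthonormalBasis ℂ X.fiber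
  let c := stdOrthonormalBasis ℂ X'.fiber
  rw [conjugate_equation_iff h, contraction_eq_id_iff c b] at h1
  rw [conjugate_equation_iff h, contraction_eq_id_iff b c] at h2
  rw [comp_dagger_eq_smul_iff h b c] at h4
  set S := coords b c (unitHomVec h s) with hS
  set R := coords c b (unitHomVec h t) with hR
  have hs := (exists_unitHomVec_eq_iff_coords h b c (unitHomVec h s)).1 ⟨s, rfl⟩
  set u := modRep h X b
  have hstar : (S.map (algebraMap ℂ (quantumGroup h).A)) *
      (S.map (algebraMap ℂ (quantumGroup h).A)).conjTranspose =
      (S * S.conjTranspose).map (algebraMap ℂ (quantumGroup h).A) := by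
    rw [Matrix.map_mul]
    congr 1
    ext i j : 1
    exact (algebraMap_star_comm (S j i)).symm
  -- The scalar matrix `S S^*` commutes with `u`, so it is an endomorphism of the fiber of `X` that
  -- comes from a morphism.
  have hc : u * (S * S.conjTranspose).map (algebraMap ℂ (quantumGroup h).A) =
      (S * S.conjTranspose).map (algebraMap ℂ (quantumGroup h).A) * u := by
    rw [← hstar]
    exact Matrix.mul_conjTranspose_comm_of_mul_mul_eq (star_modRep_mul h X b)
      (by
        refine Eq.trans (congrArg (fun M => (modRep h X' c).transpose * M) ?_)
          (transpose_modRep_mul h X' c)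
        rfl) hs
  set P := S * S.conjTranspose
  set Q := R.transpose * R.map star
  have hPQ : P * Q = 1 := Matrix.mul_eq_one_of_conjugate_equations h2 h1
  have hone : (1 : Matrix _ _ ℂ).map (algebraMap ℂ (quantumGroup h).A) =
      (1 : Matrix (Fin (Module.finrank ℂ X.fiber)) (Fin (Module.finrank ℂ X.fiber)) _) :=
    Matrix.map_one _ (map_zero _) (map_one _)
  have hPQ1 : P.map (algebraMap ℂ (quantumGroup h).A) *
      Q.map (algebraMap ℂ (quantumGroup h).A) = 1 := by
    rw [← Matrix.map_mul, hPQ, hone]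
  have hQP1 : Q.map (algebraMap ℂ (quantumGroup h).A) *
      P.map (algebraMap ℂ (quantumGroup h).A) = 1 := by
    rw [← Matrix.map_mul, mul_eq_one_comm.1 hPQ, hone]
  have hc' : u * Q.map (algebraMap ℂ (quantumGroup h).A) =
      Q.map (algebraMap ℂ (quantumGroup h).A) * u := by
    calc u * Q.map (algebraMap ℂ (quantumGroup h).A)
        = Q.map (algebraMap ℂ (quantumGroup h).A) * (P.map (algebraMap ℂ (quantumGroup h).A) * u) *
            Q.map (algebraMap ℂ (quantumGroup h).A) := by
          rw [← Matrix.mul_assoc (Q.map _), hQP1, Matrix.one_mul]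
      _ = _ := by rw [← hc, Matrix.mul_assoc, Matrix.mul_assoc, hPQ1, Matrix.mul_one]
  obtain ⟨T, hT⟩ := exists_fiberMap_eq h b (B := P - Q) (by
    rw [Matrix.map_sub _ (map_sub _), Matrix.mul_sub, Matrix.sub_mul, hc, hc'])
  -- Standardness for this `T` says that the traces of `(P - Q) P` and `(P - Q) Q` agree.
  have e := congrArg (fun f => inner ℂ (unitVec K)
    (HilbF.lin ((fiberFunctor K).map f) (unitVec K))) (h3 T)
  beta_reduce at e
  rw [inner_comp_whiskerRight h b c, inner_comp_whiskerLeft h c b, hT] at e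
  rw [← h4, Matrix.trace_conjTranspose_mul_self_of_standard h2 h1 e, Fintype.card_fin]

/-- Every module has a conjugate, on which the bicrossed product acts by the conjugate
representation. -/
lemma exists_modRep_eq_map_star {N : ℕ} (X : CfModule K)
    (b : OrthonormalBasis (Fin N) ℂ X.fiber) :
    ∃ (X' : CfModule K) (c : OrthonormalBasis (Fin N) ℂ X'.fiber),
      modRep h X' c = (modRep h X b).map star := by
  obtain ⟨X', W, e⟩ := exists_modRep h (isRep_rep (X.matchedRep h b).conj)
  refine ⟨X', (EuclideanSpace.basisFun (Fin N) ℂ).map W, ?_⟩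
  have e1 : (quantumGroup h).scalarMatrix (EuclideanSpace.basisFun (Fin N) ℂ)
      ((EuclideanSpace.basisFun (Fin N) ℂ).map W) W.toLinearEquiv.toLinearMap = 1 := by
    have e0 : LinearMap.toMatrix (EuclideanSpace.basisFun (Fin N) ℂ).toBasis
        ((EuclideanSpace.basisFun (Fin N) ℂ).map W).toBasis W.toLinearEquiv.toLinearMap = 1 := by
      ext i j
      rw [LinearMap.toMatrix_apply, OrthonormalBasis.coe_toBasis_repr_apply,
        OrthonormalBasis.coe_toBasis, OrthonormalBasis.repr_apply_apply,
        OrthonormalBasis.map_apply]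
      refine (W.inner_map_map _ _).trans ?_
      rw [OrthonormalBasis.inner_eq_ite, Matrix.one_apply]
    rw [CompactQuantumGroup.scalarMatrix, e0]
    exact Matrix.map_one _ (map_zero _) (map_one _)
  have e2 := e ((EuclideanSpace.basisFun (Fin N) ℂ).map W)
  rw [e1, Matrix.mul_one, Matrix.one_mul] at e2
  exact e2.trans (rep_conj _)

/-- The conjugate module carries the conjugate representation, and the morphisms given by the
identity matrices are a standard solution of the conjugate equations. -/
lemma hasCategoricalDimension_finrank (h : Γ.IsComplement' (K : Subgroup G)) (X : CfModule K) :
    HasCategoricalDimension X (Module.finrank ℂ X.fiber : ℂ) := by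
  let b := stdOrthonormalBasis ℂ X.fiber
  obtain ⟨X', c, e⟩ := exists_modRep_eq_map_star h X b
  have hone : (1 : Matrix _ _ ℂ).map (algebraMap ℂ (quantumGroup h).A) =
      (1 : Matrix (Fin (Module.finrank ℂ X.fiber)) (Fin (Module.finrank ℂ X.fiber)) _) :=
    Matrix.map_one _ (map_zero _) (map_one _)
  obtain ⟨s, hs⟩ := (exists_unitHomVec_eq_iff_coords h b c ((coords b c).symm 1)).2 (by
    rw [LinearEquiv.apply_symm_apply, hone, Matrix.mul_one, e]
    exact modRep_mul_star h X b)
  obtain ⟨t, ht⟩ := (exists_unitHomVec_eq_iff_coords h c b ((coords c b).symm 1)).2 (by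
    rw [LinearEquiv.apply_symm_apply, hone, Matrix.mul_one, e]
    exact map_star_modRep_mul h X b)
  have hs' : coords b c (unitHomVec h s) = 1 := by rw [hs, LinearEquiv.apply_symm_apply]
  have ht' : coords c b (unitHomVec h t) = 1 := by rw [ht, LinearEquiv.apply_symm_apply]
  have h1 : (1 : Matrix (Fin (Module.finrank ℂ X.fiber)) (Fin (Module.finrank ℂ X.fiber)) ℂ).map
      star = 1 := Matrix.map_one _ (star_zero ℂ) (star_one ℂ)
  refine ⟨X', s, t, ?_, ?_, fun T => ?_, ?_⟩
  · rw [conjugate_equation_iff h, contraction_eq_id_iff c b, hs', ht', h1, Matrix.mul_one]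
  · rw [conjugate_equation_iff h, contraction_eq_id_iff b c, hs', ht', h1, Matrix.mul_one]
  · refine unit_end_ext h ?_
    rw [inner_comp_whiskerRight h b c, inner_comp_whiskerLeft h c b, hs', ht', Matrix.one_mul,
      Matrix.mul_one,
      Matrix.conjTranspose_one, Matrix.one_mul, Matrix.one_mul,
      Matrix.trace_transpose]
  · rw [comp_dagger_eq_smul_iff h b c, hs', Matrix.conjTranspose_one, Matrix.one_mul,
      Matrix.trace_one, Fintype.card_fin]

lemma isDimensionPreserving (h : Γ.IsComplement' (K : Subgroup G)) :
    IsDimensionPreserving (fiberFunctor K) :=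
  fun X => ⟨hasCategoricalDimension_finrank h X,
    fun _ hd => eq_finrank_of_hasCategoricalDimension hd h⟩

end Bicrossed

theorem proposition6p1 {G : Type u} [Group G] [TopologicalSpace G] [IsTopologicalGroup G]
    [LocallyCompactSpace G] [T2Space G] (K : OpenSubgroup G) (hK : IsCompact (K : Set G))
    (Γ : Subgroup G) (hΓK : ∀ g : G, ∃ γ ∈ Γ, ∃ k ∈ K, g = γ * k)
    (hd : ∀ g : G, g ∈ Γ → g ∈ K → g = 1) :
    ∃ _M : (fiberFunctor K).Monoidal,
      (∀ (X Y : CfModule K) (ξ : (fiberFunctor K).obj (X ⊗ Y)),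
        HasSum (fun γ : Γ => HTensor.map (1 : X →L[ℂ] X)
            ((Y.π (γ : G)).adjoint ∘L Y.left (LInf.chi ((γ : G) : G ⧸ (K : Subgroup G))))
            (CfModule.toHTensor (ξ : CfModule.fiber (X ⊗ Y)).1))
          (CfModule.fiberIncl X Y
            (HilbF.lin (Functor.OplaxMonoidal.δ (fiberFunctor K) X Y) ξ))) ∧
      IsFiberFunctor (fiberFunctor K) ∧
      IsDimensionPreserving (fiberFunctor K) ∧
      ∃ 𝔾 : CompactQuantumGroup (L2 G),
        IsBicrossedProduct K Γ 𝔾 ∧ 𝔾.IsKac ∧ IsTannakaKreinDual (fiberFunctor K) 𝔾 := by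
  have h : Γ.IsComplement' (K : Subgroup G) := by
    refine Subgroup.isComplement'_of_disjoint_and_mul_eq_univ ?_ ?_
    · exact Subgroup.disjoint_def.2 fun {g} h1 h2 => hd g h1 h2
    · refine Set.eq_univ_of_forall fun g => ?_
      obtain ⟨γ, hγ, k, hk, rfl⟩ := hΓK g
      exact Set.mul_mem_mul hγ hk
  have : CompactSpace K := isCompact_iff_compactSpace.1 hK
  let : MeasurableSpace G := borel G
  have : BorelSpace G := ⟨rfl⟩
  refine ⟨fiberMonoidal h, fun X Y (ξ : (X.tensor Y).fiber) => ?_, isFiberFunctor h,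
    Bicrossed.isDimensionPreserving h,
    Bicrossed.quantumGroup h, Bicrossed.isBicrossedProduct h, Bicrossed.isKac h,
    Bicrossed.isTannakaKreinDual h⟩
  have e := hasSum_structure_map h X Y ((CfModule.muEquiv h X Y).symm ξ)
  rw [← CfModule.muEquiv_apply, LinearIsometryEquiv.apply_symm_apply] at e
  exact e

end
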